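/- **Setting.** Let $I$ be a finite or countably infinite set and $A=(a_{ij})_{i,j\in I}$ an integer matrix with $a_{ii}\in\{2,0,-2,-4,\dots\}$, $a_{ij}\le 0$ for $i\ne j$, and $s_ia_{ij}=s_ja_{ji}$ for some positive integers $s_i$. An index $i$ is real if $a_{ii}=2$ and imaginary otherwise. Put $I^\infty=\{(i,1): i \text{ real}\}\cup\{(i,l): i\text{ imaginary},\ l\ge 1\}$, $P^\vee=\bigoplus_i\mathbb Z h_i\oplus\bigoplus_i\mathbb Z d_i$, $P=\mathrm{Hom}(P^\vee,\mathbb Z)$, and let $\alpha_j\in P$ be given by $\alpha_j(h_i)=a_{ij}$, $\alpha_j(d_i)=\delta_{ij}$. For real $i$ let $r_i(h)=h-\alpha_i(h)h_i$ on $P^\vee$ and $r_i(\mu)=\mu-\mu(h_i)\alpha_i$ on $P$. Put $(\alpha_i,\alpha_j)=s_ia_{ij}$, $q_i=q^{s_i}$, $q_{(i)}=q^{s_ia_{ii}/2}$, $[n]_i=\frac{q_i^n-q_i^{-n}}{q_i-q_i^{-1}}$; for an element $x$ attached to a real index $i$ write $x^{(n)}=x^n/[n]_i!$. Fix $\nu_{il}\in\mathbb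 Q(q)$, $(i,l)\in I^\infty$, whose expansions in $q^{-1}$ lie in $1+q^{-1}\mathbb Z_{\ge0}[[q^{-1}]]$, and put $\nu_{i0}=1$. The quantum Borcherds–Bozec algebra $U$ is the $\mathbb Q(q)$-algebra with generators $q^h$ $(h\in P^\vee)$, $e_{il},f_{il}$ $((i,l)\in I^\infty)$ (with $e_{i0}=f_{i0}=1$, $K_i=q^{s_ih_i}$, and $e_i=e_{i1}$, $f_i=f_{i1}$ for real $i$) and relations: $q^0=1$, $q^hq^{h'}=q^{h+h'}$; $q^he_{jl}q^{-h}=q^{l\alpha_j(h)}e_{jl}$, $q^hf_{jl}q^{-h}=q^{-l\alpha_j(h)}f_{jl}$; $\sum_{r+s=1-la_{ij}}(-1)^re_i^{(r)}e_{jl}e_i^{(s)}=0=\sum_{r+s=1-la_{ij}}(-1)^rf_i^{(r)}f_{jl}f_i^{(s)}$ for $i$ real, $j\neq i$; $e_{ik}e_{jl}=e_{jl}e_{ik}$ and $f_{ik}f_{jl}=f_{jl}f_{ik}$ if $a_{ij}=0$; $e_{ik}f_{jl}=f_{jl}e_{ik}$ if $i\ne j$; and $$\sum_{m+n=k,\ n+s=l}q_{(i)}^{n(m-s)}\nu_{in}K_i^{-n}f_{is}e_{im}=\sum_{m+n=k,\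 n+s=l}q_{(i)}^{n(s-m)}\nu_{in}K_i^{n}e_{im}f_{is}.$$ On the free algebra $\mathscr E$ on the $e_{il}$, graded by $|e_{il}|=l\alpha_i$, let $\rho:\mathscr E\to\mathscr E\otimes\mathscr E$ be the homomorphism for the product $(x_1\otimes x_2)(y_1\otimes y_2)=q^{(|x_2|,|y_1|)}x_1y_1\otimes x_2y_2$ with $\rho(e_{il})=\sum_{m+n=l}q_{(i)}^{mn}e_{im}\otimes e_{in}$. For imaginary $i$ let $\mathtt a_{il}\in U$ be the primitive generator: the image of a homogeneous element $x$ of degree $l\alpha_i$ with $x-e_{il}\in\mathbb Q(q)\langle e_{ik}\mid k<l\rangle$ and $\rho(x)=x\otimes1+1\otimes x$ (its image in $U$ is uniquely determined), and $\mathtt b_{il}$ the element obtained by replacing every $e_{ik}$ by $f_{ik}$. For real $i$ put $\mathtt a_i=\mathtt a_{i1}=e_i$, $\mathtt b_i=\mathtt b_{i1}=f_i$, $B_i=\mathtt b_i/(\nu_{i1}(q_i^{-1}-q_i))$. Let $\mathcal O$ be the category of $U$-modules $M=\bigoplus_{\mu\in P}M_\mu$, $M_\mu=\{z: q^hz=q^{\mu(h)}z\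 \forall h\}$, on which $\mathtt a_i,\mathtt b_i$ are locally nilpotent for every real $i$. Fix a real index $i$ and $e=\pm1$. For $M\in\mathcal O$ and $z\in M$ with $K_iz=q_i^nz$ put $$L'_{i,e}(z)=\sum_{a-b+c=n}(-1)^bq_i^{e(-ac+b)}B_i^{(a)}\mathtt a_i^{(b)}B_i^{(c)}z,\qquad L''_{i,e}(z)=\sum_{-a+b-c=n}(-1)^bq_i^{e(-ac+b)}\mathtt a_i^{(a)}B_i^{(b)}\mathtt a_i^{(c)}z$$ (sums over $a,b,c\ge0$), extended linearly to $M$. On the generators of $U$ put, for $(j,l)\in I^\infty$ with $j\ne i$ and $h\in P^\vee$: $$L'_{i,e}(\mathtt a_i)=-K_i^{e}B_i,\quad L'_{i,e}(B_i)=-\mathtt a_iK_i^{-e},\quad L'_{i,e}(q^h)=q^{r_i(h)},$$ $$L'_{i,e}(\mathtt a_{jl})=\sum_{r+s=-la_{ij}}(-1)^rq_i^{er}\mathtt a_i^{(r)}\mathtt a_{jl}\mathtt a_i^{(s)},\quad L'_{i,e}(\mathtt b_{jl})=\sum_{r+s=-la_{ij}}(-1)^rq_i^{-er}B_i^{(s)}\mathtt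 b_{jl}B_i^{(r)},$$ $$L''_{i,-e}(\mathtt a_i)=-B_iK_i^{-e},\quad L''_{i,-e}(B_i)=-K_i^{e}\mathtt a_i,\quad L''_{i,-e}(q^h)=q^{r_i(h)},$$ $$L''_{i,-e}(\mathtt a_{jl})=\sum_{r+s=-la_{ij}}(-1)^rq_i^{er}\mathtt a_i^{(s)}\mathtt a_{jl}\mathtt a_i^{(r)},\quad L''_{i,-e}(\mathtt b_{jl})=\sum_{r+s=-la_{ij}}(-1)^rq_i^{-er}B_i^{(r)}\mathtt b_{jl}B_i^{(s)}.$$ For $j\ne i$, $n\ge0$, $m\in\mathbb Z$ put $\beta=-a_{ij}$ and (empty sums if $m<0$) $$\mathcal F_{n,m,e}=\sum_{r+s=m}(-1)^rq_i^{er(\beta n-m+1)}\mathtt a_i^{(r)}\mathtt a_{jn}\mathtt a_i^{(s)},\quad \mathcal F'_{n,m,e}=\sum_{r+s=m}(-1)^rq_i^{er(\beta n-m+1)}\mathtt a_i^{(s)}\mathtt a_{jn}\mathtt a_i^{(r)},$$ $$\mathcal G_{n,m,e}=\sum_{r+s=m}(-1)^rq_i^{-er(\beta n-m+1)}B_i^{(s)}\mathtt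 b_{jn}B_i^{(r)},\quad \mathcal G'_{n,m,e}=\sum_{r+s=m}(-1)^rq_i^{-er(\beta n-m+1)}B_i^{(r)}\mathtt b_{jn}B_i^{(s)},$$ where in these four formulas and in (i) below $\mathtt a_{j0}=\mathtt b_{j0}=1$ and, for real $j$, $\mathtt a_{jn},\mathtt b_{jn}$ mean $\mathtt a_j^{(n)},\mathtt b_j^{(n)}$. **Proposition.** (i) For all $M\in\mathcal O$, $z\in M$, $j\neq i$, $n\ge0$: $$L''_{i,-e}(\mathcal F_{n,\beta n,e}z)=\mathtt a_{jn}L''_{i,-e}(z),\quad L'_{i,e}(\mathcal F'_{n,\beta n,e}z)=\mathtt a_{jn}L'_{i,e}(z),$$ $$L''_{i,-e}(\mathcal G_{n,\beta n,e}z)=\mathtt b_{jn}L''_{i,-e}(z),\quad L'_{i,e}(\mathcal G'_{n,\beta n,e}z)=\mathtt b_{jn}L'_{i,e}(z).$$ (ii) $L'_{i,e}$ and $L''_{i,-e}$, defined above on the generators, extend to $\mathbb Q(q)$-algebra automorphisms of $U$ that are inverse to each other. For every $\alpha$ both map the root space $U_\alpha=\{u: q^huq^{-h}=q^{\alpha(h)}u\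 \forall h\in P^\vee\}$ onto $U_{r_i(\alpha)}$. For all $M\in\mathcal O$, $u\in U$, $z\in M$: $L'_{i,e}(uz)=L'_{i,e}(u)L'_{i,e}(z)$ and $L''_{i,-e}(uz)=L''_{i,-e}(u)L''_{i,-e}(z)$; and each of the two operators on $U$ is the only map $U\to U$ with this compatibility with all $M\in\mathcal O$. (iii) For all $j\ne i$, $n\ge0$, $m\in\mathbb Z$: $L'_{i,e}(\mathcal F'_{n,m,e})=\mathcal F_{n,\beta n-m,e}$ and $L''_{i,-e}(\mathcal F_{n,m,e})=\mathcal F'_{n,\beta n-m,e}$. -/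

import Mathlib

open scoped TensorProduct

universe u v

/-- The field `ℚ(q)`. -/
abbrev Qq : Type := RatFunc ℚ

/-- The indeterminate `q` of `ℚ(q)`. -/
noncomputable abbrev qq : Qq := RatFunc.X

/-- `x ∈ 1 + q⁻¹ ℤ_{≥0}[[q⁻¹]]` for `x ∈ ℚ(q)`: the expansion of `x` in powers of `T = q⁻¹` is a power
series `g` with coefficients in `ℕ` and constant term `1`.  If `x = N(q⁻¹) / D(q⁻¹)` with polynomials
`N` and `D ≠ 0`, this says `N = D * g` in `ℚ[[T]]`. -/
def HasPositiveExpansion (x : Qq) : Prop :=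
  ∃ (g : PowerSeries ℕ) (N D : Polynomial ℚ), PowerSeries.constantCoeff g = 1 ∧ D ≠ 0 ∧
    (N : PowerSeries ℚ) = (D : PowerSeries ℚ) * PowerSeries.map (Nat.castRingHom ℚ) g ∧
    x = Polynomial.aeval (qq⁻¹) N / Polynomial.aeval (qq⁻¹) D

/-- An even symmetrizable Borcherds-Cartan matrix `(a i j)` with symmetrizing diagonal matrix
`diag (s i)`. -/
structure BorcherdsCartanMatrix (I : Type u) where
  a : I → I → ℤ
  s : I → ℤ
  diag : ∀ i, a i i = 2 ∨ (a i i ≤ 0 ∧ Even (a i i))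
  offdiag : ∀ i j, i ≠ j → a i j ≤ 0
  s_pos : ∀ i, 0 < s i
  symm : ∀ i j, s i * a i j = s j * a j i

/-- The dual weight lattice `P^∨ = (⨁ ℤ h_i) ⊕ (⨁ ℤ d_i)`. -/
abbrev DualWeightLattice (I : Type u) : Type u := (I →₀ ℤ) × (I →₀ ℤ)

/-- The weight lattice `P`: the linear forms on `ℚ ⊗ P^∨` that are integral on `P^∨`, that is, the
`ℤ`-linear forms `P^∨ → ℤ`. -/
abbrev WeightLattice (I : Type u) : Type u := DualWeightLattice I →ₗ[ℤ] ℤ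

namespace BorcherdsCartanMatrix

variable {I : Type u} (C : BorcherdsCartanMatrix I)

/-! ### The Cartan datum -/

/-- Real indices. -/
def IsReal (i : I) : Prop := C.a i i = 2

/-- `(i, l) ∈ I^∞ = (I^re × {1}) ∪ (I^im × ℤ_{>0})`. -/
def IsIndex (i : I) (l : ℕ) : Prop := (C.a i i = 2 ∧ l = 1) ∨ (C.a i i ≤ 0 ∧ 0 < l)

/-- The set `I^∞`. -/
structure Index : Type u where
  i : I
  l : ℕ
  isIndex : C.IsIndex i l

/-- The simple coroot `h_i`. -/
noncomputable def coroot (i : I) : DualWeightLattice I := (Finsupp.single i 1, 0)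

/-- The simple root `α_j`, with `α_j (h_i) = a i j` and `α_j (d_i) = δ_ij`. -/
noncomputable def root (j : I) : WeightLattice I :=
  (Finsupp.linearCombination ℤ (fun i => C.a i j)).comp
      (LinearMap.fst ℤ (I →₀ ℤ) (I →₀ ℤ)) +
    (Finsupp.lapply j).comp (LinearMap.snd ℤ (I →₀ ℤ) (I →₀ ℤ))

/-- The simple reflection on `P^∨`: `r_i (h) = h - α_i (h) h_i`. -/
noncomputable def reflCo (i : I) (h : DualWeightLattice I) : DualWeightLattice I :=
  h - C.root i h • coroot i

/-- The simple reflection on weights: `r_i (μ) = μ - μ (h_i) α_i`. -/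
noncomputable def refl (i : I) (μ : WeightLattice I) : WeightLattice I :=
  μ - μ (coroot i) • C.root i

/-- `q_i = q ^ s_i`. -/
noncomputable def qi (i : I) : Qq := qq ^ C.s i

/-- `q_(i) = q ^ ((α_i, α_i) / 2)`, where `(α_i, α_i) = s_i a_ii` is even. -/
noncomputable def qpar (i : I) : Qq := qq ^ (C.s i * C.a i i / 2)

/-- `[n]_i = (q_i ^ n - q_i ^ (-n)) / (q_i - q_i⁻¹)`. -/
noncomputable def qInt (i : I) (n : ℕ) : Qq :=
  (C.qi i ^ n - (C.qi i)⁻¹ ^ n) / (C.qi i - (C.qi i)⁻¹)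

/-- `[n]_i!`. -/
noncomputable def qFact (i : I) (n : ℕ) : Qq := ∏ k ∈ Finset.Icc 1 n, C.qInt i k

/-- The divided power `x ^ n / [n]_i!`. -/
noncomputable def divPow {A : Type*} [Ring A] [Algebra Qq A] (i : I) (x : A) (n : ℕ) : A :=
  (C.qFact i n)⁻¹ • x ^ n

/-! ### The free algebra on the `e_{il}`, its twisted coproduct and the primitive generators -/

/-- The free algebra `𝓔` on the symbols `e_{il}`, `(i, l) ∈ I^∞`. -/
abbrev FreeE : Type u := FreeAlgebra Qq C.Index

open Classical in
/-- `e_{il}` in `𝓔`, with `e_{i0} = 1` (and `0` if `l ≠ 0` and `(i, l) ∉ I^∞`). -/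
noncomputable def freeE (i : I) (l : ℕ) : C.FreeE :=
  if l = 0 then 1
  else if h : C.IsIndex i l then FreeAlgebra.ι Qq (⟨i, l, h⟩ : C.Index) else 0

/-- The algebra endomorphism `y ↦ q ^ (n α_i, |y|) y` of `𝓔` (`y` homogeneous of degree `|y|`). -/
noncomputable def degTwist (i : I) (n : ℕ) : C.FreeE →ₐ[Qq] C.FreeE :=
  FreeAlgebra.lift Qq fun x : C.Index =>
    qq ^ ((n : ℤ) * (x.l : ℤ) * (C.s i * C.a i x.i)) • FreeAlgebra.ι Qq x

/-- Left multiplication by `e_{im} ⊗ e_{in}` in `𝓔 ⊗ 𝓔` for the twisted product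
`(x₁ ⊗ x₂) (y₁ ⊗ y₂) = q ^ (|x₂|, |y₁|) x₁ y₁ ⊗ x₂ y₂`. -/
noncomputable def twistedLeftMul (i : I) (m n : ℕ) :
    Module.End Qq (C.FreeE ⊗[Qq] C.FreeE) :=
  TensorProduct.map
    ((LinearMap.mulLeft Qq (C.freeE i m)).comp (C.degTwist i n).toLinearMap)
    (LinearMap.mulLeft Qq (C.freeE i n))

/-- The coproduct `ρ : 𝓔 → 𝓔 ⊗ 𝓔`: the homomorphism for the twisted product with
`ρ (e_{il}) = ∑_{m+n=l} q_(i) ^ (m n) e_{im} ⊗ e_{in}`.  It is given as `ρ (x) = Θ (x) (1 ⊗ 1)`, where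
`Θ (x)` is the twisted left multiplication by `ρ (x)`. -/
noncomputable def rho (x : C.FreeE) : C.FreeE ⊗[Qq] C.FreeE :=
  FreeAlgebra.lift Qq (fun y : C.Index =>
    ∑ p ∈ Finset.HasAntidiagonal.antidiagonal y.l,
      C.qpar y.i ^ (p.1 * p.2) • C.twistedLeftMul y.i p.1 p.2) x (1 ⊗ₜ[Qq] 1)

/-- The homogeneous component of degree `γ ∈ Q_+` of `𝓔`, where `|e_{il}| = l α_i`. -/
noncomputable def homogeneous (γ : I →₀ ℕ) : Submodule Qq C.FreeE :=
  Submodule.span Qq {w | ∃ L : List C.Index,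
    w = (L.map (FreeAlgebra.ι Qq)).prod ∧
    (L.map fun x => Finsupp.single x.i x.l).sum = γ}

/-- `x` is a primitive generator of degree `l α_i`: it is homogeneous of degree `l α_i`, it differs from
`e_{il}` by an element of `ℚ(q)⟨e_{ik} ∣ k < l⟩`, and it is primitive for `ρ`. -/
def IsPrimitiveGenerator (i : I) (l : ℕ) (x : C.FreeE) : Prop :=
  x ∈ C.homogeneous (Finsupp.single i l) ∧
  x - C.freeE i l ∈ Algebra.adjoin Qq {y | ∃ k < l, y = C.freeE i k} ∧
  C.rho x = x ⊗ₜ[Qq] 1 + 1 ⊗ₜ[Qq] x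

open Classical in
/-- The primitive generator of degree `l α_i`, as a polynomial in the `e_{ik}`; it is `e_i` if `i` is
real.  (For `a_ii < 0` it is unique in `𝓔`; for `a_ii = 0` it is unique modulo the commutators of the
`e_{ik}`, which vanish in the quantum algebra.) -/
noncomputable def primFree (i : I) (l : ℕ) : C.FreeE :=
  if C.IsReal i then C.freeE i l
  else if h : ∃ x, C.IsPrimitiveGenerator i l x then h.choose else 0

/-! ### The quantum Borcherds-Bozec algebra -/

/-- The generators `q^h`, `e_{il}`, `f_{il}`. -/
inductive Gen : Type u
  | q (h : DualWeightLattice I) : Gen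
  | e (x : C.Index) : Gen
  | f (x : C.Index) : Gen

/-- The free algebra on the generators. -/
abbrev FreeGen : Type u := FreeAlgebra Qq C.Gen

/-- The symbol `q^h`. -/
noncomputable def gq (h : DualWeightLattice I) : C.FreeGen := FreeAlgebra.ι Qq (Gen.q h)

/-- The symbol `K_i ^ n`, where `K_i = q_i ^ h_i = q ^ (s_i h_i)`. -/
noncomputable def gK (i : I) (n : ℤ) : C.FreeGen := C.gq ((n * C.s i) • coroot i)

open Classical in
/-- The symbol `e_{il}`, with `e_{i0} = 1`. -/
noncomputable def ge (i : I) (l : ℕ) : C.FreeGen :=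
  if l = 0 then 1
  else if h : C.IsIndex i l then FreeAlgebra.ι Qq (Gen.e (⟨i, l, h⟩ : C.Index)) else 0

open Classical in
/-- The symbol `f_{il}`, with `f_{i0} = 1`. -/
noncomputable def gf (i : I) (l : ℕ) : C.FreeGen :=
  if l = 0 then 1
  else if h : C.IsIndex i l then FreeAlgebra.ι Qq (Gen.f (⟨i, l, h⟩ : C.Index)) else 0

/-- The parameters `ν_{in}`, with `ν_{i0} = 1`. -/
noncomputable def nu0 (ν : I → ℕ → Qq) (i : I) (n : ℕ) : Qq := if n = 0 then 1 else ν i n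

/-- The defining relations. -/
inductive Rel (ν : I → ℕ → Qq) : C.FreeGen → C.FreeGen → Prop
  | q_zero : Rel ν (C.gq 0) 1
  | q_add (h h' : DualWeightLattice I) : Rel ν (C.gq h * C.gq h') (C.gq (h + h'))
  | q_e (h : DualWeightLattice I) (j : I) (l : ℕ) (hj : C.IsIndex j l) :
      Rel ν (C.gq h * C.ge j l * C.gq (-h)) (qq ^ ((l : ℤ) * C.root j h) • C.ge j l)
  | q_f (h : DualWeightLattice I) (j : I) (l : ℕ) (hj : C.IsIndex j l) :
      Rel ν (C.gq h * C.gf j l * C.gq (-h)) (qq ^ (-((l : ℤ) * C.root j h)) • C.gf j l)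
  | serre_e (i j : I) (l : ℕ) (hi : C.IsReal i) (hj : C.IsIndex j l) (hij : i ≠ j) :
      Rel ν (∑ p ∈ Finset.HasAntidiagonal.antidiagonal (1 - (l : ℤ) * C.a i j).toNat,
        (-1 : Qq) ^ p.1 •
          (C.divPow i (C.ge i 1) p.1 * C.ge j l * C.divPow i (C.ge i 1) p.2)) 0
  | serre_f (i j : I) (l : ℕ) (hi : C.IsReal i) (hj : C.IsIndex j l) (hij : i ≠ j) :
      Rel ν (∑ p ∈ Finset.HasAntidiagonal.antidiagonal (1 - (l : ℤ) * C.a i j).toNat,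
        (-1 : Qq) ^ p.1 •
          (C.divPow i (C.gf i 1) p.1 * C.gf j l * C.divPow i (C.gf i 1) p.2)) 0
  | comm_e (i j : I) (k l : ℕ) (hi : C.IsIndex i k) (hj : C.IsIndex j l) (hij : C.a i j = 0) :
      Rel ν (C.ge i k * C.ge j l) (C.ge j l * C.ge i k)
  | comm_f (i j : I) (k l : ℕ) (hi : C.IsIndex i k) (hj : C.IsIndex j l) (hij : C.a i j = 0) :
      Rel ν (C.gf i k * C.gf j l) (C.gf j l * C.gf i k)
  | comm_ef (i j : I) (k l : ℕ) (hi : C.IsIndex i k) (hj : C.IsIndex j l) (hij : i ≠ j) :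
      Rel ν (C.ge i k * C.gf j l) (C.gf j l * C.ge i k)
  | ef (i : I) (k l : ℕ) (hk : C.IsIndex i k) (hl : C.IsIndex i l) :
      Rel ν
        (∑ n ∈ Finset.range (min k l + 1),
          (C.qpar i ^ ((n : ℤ) * (((k - n : ℕ) : ℤ) - ((l - n : ℕ) : ℤ))) * nu0 ν i n) •
            (C.gK i (-(n : ℤ)) * C.gf i (l - n) * C.ge i (k - n)))
        (∑ n ∈ Finset.range (min k l + 1),
          (C.qpar i ^ ((n : ℤ) * (((l - n : ℕ) : ℤ) - ((k - n : ℕ) : ℤ))) * nu0 ν i n) •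
            (C.gK i (n : ℤ) * C.ge i (k - n) * C.gf i (l - n)))

/-- The quantum Borcherds-Bozec algebra `U = U_q(𝔤)`. -/
def QAlg (ν : I → ℕ → Qq) : Type u := RingQuot (C.Rel ν)

noncomputable instance (ν : I → ℕ → Qq) : Ring (C.QAlg ν) :=
  inferInstanceAs (Ring (RingQuot (C.Rel ν)))

noncomputable instance (ν : I → ℕ → Qq) : Algebra Qq (C.QAlg ν) :=
  inferInstanceAs (Algebra Qq (RingQuot (C.Rel ν)))

variable (ν : I → ℕ → Qq)

/-- The quotient map from the free algebra on the generators onto `U`. -/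
noncomputable def toU : C.FreeGen →ₐ[Qq] C.QAlg ν := RingQuot.mkAlgHom Qq (C.Rel ν)

/-- `q^h ∈ U`. -/
noncomputable def qh (h : DualWeightLattice I) : C.QAlg ν := C.toU ν (C.gq h)

/-- `K_i ^ n ∈ U`. -/
noncomputable def Kpow (i : I) (n : ℤ) : C.QAlg ν := C.toU ν (C.gK i n)

/-- The primitive generator `𝚊_{il} ∈ U` (`𝚊_i = 𝚊_{i1} = e_i` for real `i`). -/
noncomputable def pa (i : I) (l : ℕ) : C.QAlg ν :=
  FreeAlgebra.lift Qq (fun x : C.Index => C.toU ν (C.ge x.i x.l)) (C.primFree i l)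

/-- The primitive generator `𝚋_{il} = ω (𝚊_{il}) ∈ U`, where `ω (e_{il}) = f_{il}`. -/
noncomputable def pb (i : I) (l : ℕ) : C.QAlg ν :=
  FreeAlgebra.lift Qq (fun x : C.Index => C.toU ν (C.gf x.i x.l)) (C.primFree i l)

/-- `B_i = 𝚋_i / (τ_i (q_i⁻¹ - q_i))` for real `i`, where `τ_i = ν_{i1}`. -/
noncomputable def B (i : I) : C.QAlg ν :=
  (ν i 1 * ((C.qi i)⁻¹ - C.qi i))⁻¹ • C.pb ν i 1

open Classical in
/-- The element written `𝚊_{jn}` in the Serre-type elements: `1` if `n = 0`, the divided power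
`𝚊_j ^ (n)` if `j` is real, the primitive generator if `j` is imaginary. -/
noncomputable def paS (j : I) (n : ℕ) : C.QAlg ν :=
  if n = 0 then 1 else if C.IsReal j then C.divPow j (C.pa ν j 1) n else C.pa ν j n

open Classical in
/-- The element written `𝚋_{jn}` in the Serre-type elements. -/
noncomputable def pbS (j : I) (n : ℕ) : C.QAlg ν :=
  if n = 0 then 1 else if C.IsReal j then C.divPow j (C.pb ν j 1) n else C.pb ν j n

/-- The pairs `(r, s)` of natural numbers with `r + s = m` (none if `m < 0`). -/
def pairs (m : ℤ) : Finset (ℕ × ℕ) := if 0 ≤ m then Finset.HasAntidiagonal.antidiagonal m.toNat else ∅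

/-- `𝓕_{i,j,n,m,e}`. -/
noncomputable def serF (i j : I) (n : ℕ) (m e : ℤ) : C.QAlg ν :=
  ∑ p ∈ pairs m, ((-1) ^ p.1 * C.qi i ^ (e * p.1 * (-C.a i j * n - m + 1))) •
    (C.divPow i (C.pa ν i 1) p.1 * C.paS ν j n * C.divPow i (C.pa ν i 1) p.2)

/-- `𝓕'_{i,j,n,m,e}`. -/
noncomputable def serF' (i j : I) (n : ℕ) (m e : ℤ) : C.QAlg ν :=
  ∑ p ∈ pairs m, ((-1) ^ p.1 * C.qi i ^ (e * p.1 * (-C.a i j * n - m + 1))) •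
    (C.divPow i (C.pa ν i 1) p.2 * C.paS ν j n * C.divPow i (C.pa ν i 1) p.1)

/-- `𝓖_{i,j,n,m,e}`. -/
noncomputable def serG (i j : I) (n : ℕ) (m e : ℤ) : C.QAlg ν :=
  ∑ p ∈ pairs m, ((-1) ^ p.1 * C.qi i ^ (-(e * p.1 * (-C.a i j * n - m + 1)))) •
    (C.divPow i (C.B ν i) p.2 * C.pbS ν j n * C.divPow i (C.B ν i) p.1)

/-- `𝓖'_{i,j,n,m,e}`. -/
noncomputable def serG' (i j : I) (n : ℕ) (m e : ℤ) : C.QAlg ν :=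
  ∑ p ∈ pairs m, ((-1) ^ p.1 * C.qi i ^ (-(e * p.1 * (-C.a i j * n - m + 1)))) •
    (C.divPow i (C.B ν i) p.1 * C.pbS ν j n * C.divPow i (C.B ν i) p.2)

/-- The root space `U_α = {u ∣ q^h u q^{-h} = q^{α(h)} u for all h}`. -/
def rootSpace (α : WeightLattice I) : Submodule Qq (C.QAlg ν) where
  carrier := {u | ∀ h, C.qh ν h * u * C.qh ν (-h) = qq ^ (α h) • u}
  add_mem' := by
    intro x y hx hy h
    rw [mul_add, add_mul, hx h, hy h, smul_add]
  zero_mem' := by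
    intro h
    simp
  smul_mem' := by
    intro c x hx h
    rw [mul_smul_comm, smul_mul_assoc, hx h, smul_comm]

/-- The prescribed values of `L'_{i,e}` on the generators of `U`. -/
structure ExtendsL' (i : I) (e : ℤ) (L : C.QAlg ν → C.QAlg ν) : Prop where
  a_self : L (C.pa ν i 1) = -(C.Kpow ν i e * C.B ν i)
  B_self : L (C.B ν i) = -(C.pa ν i 1 * C.Kpow ν i (-e))
  a_other : ∀ j l, C.IsIndex j l → j ≠ i → L (C.pa ν j l) =
    ∑ p ∈ pairs (-(l * C.a i j)), ((-1) ^ p.1 * C.qi i ^ (e * p.1)) •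
      (C.divPow i (C.pa ν i 1) p.1 * C.pa ν j l * C.divPow i (C.pa ν i 1) p.2)
  b_other : ∀ j l, C.IsIndex j l → j ≠ i → L (C.pb ν j l) =
    ∑ p ∈ pairs (-(l * C.a i j)), ((-1) ^ p.1 * C.qi i ^ (-(e * p.1))) •
      (C.divPow i (C.B ν i) p.2 * C.pb ν j l * C.divPow i (C.B ν i) p.1)
  q_pow : ∀ h, L (C.qh ν h) = C.qh ν (C.reflCo i h)

/-- The prescribed values of `L''_{i,-e}` (note the sign of `e`) on the generators of `U`. -/
structure ExtendsL''neg (i : I) (e : ℤ) (L : C.QAlg ν → C.QAlg ν) : Prop where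
  a_self : L (C.pa ν i 1) = -(C.B ν i * C.Kpow ν i (-e))
  B_self : L (C.B ν i) = -(C.Kpow ν i e * C.pa ν i 1)
  a_other : ∀ j l, C.IsIndex j l → j ≠ i → L (C.pa ν j l) =
    ∑ p ∈ pairs (-(l * C.a i j)), ((-1) ^ p.1 * C.qi i ^ (e * p.1)) •
      (C.divPow i (C.pa ν i 1) p.2 * C.pa ν j l * C.divPow i (C.pa ν i 1) p.1)
  b_other : ∀ j l, C.IsIndex j l → j ≠ i → L (C.pb ν j l) =
    ∑ p ∈ pairs (-(l * C.a i j)), ((-1) ^ p.1 * C.qi i ^ (-(e * p.1))) •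
      (C.divPow i (C.B ν i) p.1 * C.pb ν j l * C.divPow i (C.B ν i) p.2)
  q_pow : ∀ h, L (C.qh ν h) = C.qh ν (C.reflCo i h)

/-! ### The category `𝓞` and the symmetries of its objects -/

section Modules

variable (M : Type v) [AddCommGroup M] [Module Qq M] [Module (C.QAlg ν) M]
  [IsScalarTower Qq (C.QAlg ν) M]

/-- The weight space `M_μ = {z ∣ q^h z = q^{μ(h)} z for all h}`. -/
def weightSpace (μ : WeightLattice I) : Submodule Qq M where
  carrier := {z | ∀ h, C.qh ν h • z = qq ^ (μ h) • z}
  add_mem' := by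
    intro x y hx hy h
    rw [smul_add, hx h, hy h, smul_add]
  zero_mem' := by
    intro h
    simp
  smul_mem' := by
    intro c x hx h
    rw [smul_algebra_smul_comm, hx h, smul_comm]

open Classical in
/-- The `U`-module `M` is an object of the category `𝓞`. -/
structure IsCategoryO : Prop where
  weight : DirectSum.IsInternal (fun μ : WeightLattice I => C.weightSpace ν M μ)
  nilpotent_a : ∀ i, C.IsReal i → ∀ z : M, ∃ N : ℕ, C.pa ν i 1 ^ N • z = 0
  nilpotent_b : ∀ i, C.IsReal i → ∀ z : M, ∃ N : ℕ, C.pb ν i 1 ^ N • z = 0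

/-- `M^n = {z ∣ K_i z = q_i ^ n z}`. -/
noncomputable def kSpace (i : I) (n : ℤ) : Submodule Qq M :=
  Module.End.eigenspace (Algebra.lsmul Qq Qq M (C.Kpow ν i 1)) (C.qi i ^ n)

variable {M}
variable {C ν}

theorem qi_zpow_injective (i : I) : Function.Injective fun n : ℤ => C.qi i ^ n := by
  have hnat : ∀ k : ℕ, RatFunc.intDegree (qq ^ k) = k := by
    intro k
    rw [qq, ← RatFunc.algebraMap_X, ← map_pow, RatFunc.intDegree_polynomial,
      Polynomial.natDegree_X_pow]
  have hdeg : ∀ k : ℤ, RatFunc.intDegree (qq ^ k) = k := by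
    intro k
    obtain ⟨k, rfl | rfl⟩ := k.eq_nat_or_neg
    · rw [zpow_natCast, hnat]
    · rw [zpow_neg, zpow_natCast, RatFunc.intDegree_inv, hnat]
  intro m n h
  have h1 := congrArg RatFunc.intDegree h
  simp only [qi, ← zpow_mul, hdeg] at h1
  exact mul_left_cancel₀ (C.s_pos i).ne' h1

theorem weightSpace_le_kSpace (i : I) (μ : WeightLattice I) :
    C.weightSpace ν M μ ≤ C.kSpace ν M i (μ (coroot i)) := by
  intro z hz
  rw [kSpace, Module.End.mem_eigenspace_iff]
  have h := hz ((1 * C.s i) • coroot i)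
  rw [one_mul, map_smul, smul_eq_mul, zpow_mul] at h
  simpa [Kpow, gK, qi, qh] using h

/-- `M = ⨁ M^n`. -/
theorem IsCategoryO.kSpace_isInternal (hM : C.IsCategoryO ν M) (i : I) :
    DirectSum.IsInternal (fun n : ℤ => C.kSpace ν M i n) := by
  classical
  rw [DirectSum.isInternal_submodule_iff_iSupIndep_and_iSup_eq_top]
  refine ⟨(Module.End.eigenspaces_iSupIndep _).comp (qi_zpow_injective i), ?_⟩
  rw [eq_top_iff, ← hM.weight.submodule_iSup_eq_top]
  exact iSup_le fun μ => (weightSpace_le_kSpace i μ).trans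
    (le_iSup (fun n : ℤ => C.kSpace ν M i n) _)

theorem IsCategoryO.coe_bijective (hM : C.IsCategoryO ν M) (i : I) :
    Function.Bijective (DirectSum.coeLinearMap fun n : ℤ => C.kSpace ν M i n) :=
  hM.kSpace_isInternal i

theorem IsCategoryO.nilpotent_B (hM : C.IsCategoryO ν M) (i : I) (hi : C.IsReal i) (z : M) :
    ∃ N : ℕ, C.B ν i ^ N • z = 0 := by
  obtain ⟨N, hN⟩ := hM.nilpotent_b i hi z
  exact ⟨N, by rw [B, smul_pow, smul_assoc, hN, smul_zero]⟩

variable (C)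

/-- The term `(-1)^b q_i^{e(-ac+b)} x^(a) y^(b) x^(c) z` for `t = (a, b, c)`. -/
noncomputable def tripleTerm (i : I) (e : ℤ) (x y : C.QAlg ν) (t : ℕ × ℕ × ℕ) (z : M) : M :=
  ((-1) ^ t.2.1 * C.qi i ^ (e * (-(t.1 * t.2.2 : ℤ) + t.2.1))) •
    (C.divPow i x t.1 • C.divPow i y t.2.1 • C.divPow i x t.2.2 • z)

variable {C}

theorem divPow_smul_eq_zero (i : I) {x : C.QAlg ν} {z : M} {N n : ℕ} (h : x ^ N • z = 0)
    (hn : N ≤ n) : C.divPow i x n • z = 0 := by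
  rw [divPow, smul_assoc, ← Nat.sub_add_cancel hn, pow_add, mul_smul, h, smul_zero, smul_zero]

theorem tripleTerm_finite (i : I) (e : ℤ) {x y : C.QAlg ν} (hx : ∀ z : M, ∃ N : ℕ, x ^ N • z = 0)
    (hy : ∀ z : M, ∃ N : ℕ, y ^ N • z = 0) (n : ℤ) (z : M) :
    (Function.support fun t : ℕ × ℕ × ℕ =>
      if (t.1 : ℤ) - t.2.1 + t.2.2 = n then C.tripleTerm i e x y t z else 0).Finite := by
  choose Nx hNx using hx
  choose Ny hNy using hy
  let Bd : ℕ := (Finset.range (Nx z)).sup fun c => Ny (C.divPow i x c • z)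
  refine Set.Finite.subset (Set.Finite.prod (Set.finite_Iio (n.toNat + Bd + 1))
    (Set.Finite.prod (Set.finite_Iio Bd) (Set.finite_Iio (Nx z)))) ?_
  rintro ⟨a, b, c⟩ ht
  simp only [Function.mem_support, ne_eq, ite_eq_right_iff, not_forall] at ht
  obtain ⟨h1, h2⟩ := ht
  have hc : c < Nx z := by
    by_contra! hc
    exact h2 (by rw [tripleTerm, divPow_smul_eq_zero i (hNx z) hc]; simp)
  have hb : b < Ny (C.divPow i x c • z) := by
    by_contra! hb
    exact h2 (by rw [tripleTerm, divPow_smul_eq_zero i (hNy _) hb]; simp)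
  have hb' : b < Bd := hb.trans_le
    (Finset.le_sup (f := fun c => Ny (C.divPow i x c • z)) (Finset.mem_range.2 hc))
  refine ⟨?_, hb', hc⟩
  simp only [Set.mem_Iio]
  omega

variable (C)

/-- The map `z ↦ ∑_{a-b+c=n} (-1)^b q_i^{e(-ac+b)} x^(a) y^(b) x^(c) z`, a finite sum for each `z`. -/
noncomputable def tripleSum (i : I) (e : ℤ) (x y : C.QAlg ν) (hx : ∀ z : M, ∃ N : ℕ, x ^ N • z = 0)
    (hy : ∀ z : M, ∃ N : ℕ, y ^ N • z = 0) (n : ℤ) : M →ₗ[Qq] M where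
  toFun z := ∑ᶠ t : ℕ × ℕ × ℕ,
    if (t.1 : ℤ) - t.2.1 + t.2.2 = n then C.tripleTerm i e x y t z else 0
  map_add' z w := by
    rw [← finsum_add_distrib (tripleTerm_finite i e hx hy n z) (tripleTerm_finite i e hx hy n w)]
    refine finsum_congr fun t => ?_
    split_ifs
    · simp only [tripleTerm, smul_add]
    · rw [add_zero]
  map_smul' c z := by
    rw [RingHom.id_apply, smul_finsum' c (tripleTerm_finite i e hx hy n z)]
    refine finsum_congr fun t => ?_
    split_ifs
    · simp only [tripleTerm]
      rw [smul_algebra_smul_comm, smul_algebra_smul_comm, smul_algebra_smul_comm, smul_comm _ c]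
    · rw [smul_zero]

/-- The linear map `M → M` that is `φ n` on `M^n`. -/
noncomputable def glue (hM : C.IsCategoryO ν M) (i : I) (φ : ℤ → M →ₗ[Qq] M) : M →ₗ[Qq] M :=
  (DirectSum.toModule Qq ℤ M fun n => (φ n).comp (C.kSpace ν M i n).subtype).comp
    (LinearEquiv.ofBijective (DirectSum.coeLinearMap fun n : ℤ => C.kSpace ν M i n)
      (hM.coe_bijective i)).symm.toLinearMap

/-- The symmetry `L'_{i,e}` of `M`: for `z ∈ M^n`,
`L'_{i,e} (z) = ∑_{a-b+c=n} (-1)^b q_i^{e(-ac+b)} B_i^(a) 𝚊_i^(b) B_i^(c) z`. -/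
noncomputable def modL' (hM : C.IsCategoryO ν M) (i : I) (hi : C.IsReal i) (e : ℤ) : M →ₗ[Qq] M :=
  C.glue hM i fun n =>
    C.tripleSum i e (C.B ν i) (C.pa ν i 1) (hM.nilpotent_B i hi) (hM.nilpotent_a i hi) n

/-- The symmetry `L''_{i,e}` of `M`: for `z ∈ M^n`,
`L''_{i,e} (z) = ∑_{-a+b-c=n} (-1)^b q_i^{e(-ac+b)} 𝚊_i^(a) B_i^(b) 𝚊_i^(c) z`. -/
noncomputable def modL'' (hM : C.IsCategoryO ν M) (i : I) (hi : C.IsReal i) (e : ℤ) : M →ₗ[Qq] M :=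
  C.glue hM i fun n =>
    C.tripleSum i e (C.pa ν i 1) (C.B ν i) (hM.nilpotent_a i hi) (hM.nilpotent_B i hi) (-n)

end Modules

end BorcherdsCartanMatrix

/-!
The operators `L'_{i,e}` and `L''_{i,-e}` are the braid group operators of the copy of `U_q(𝔰𝔩₂)` attached to the
real index `i`, for the parameter `q_i^e`.

*Modules.* On the weight space of weight `n` the triple sum collapses to `∑_s (-1)^s q^s B^(s+n) E^(s)`
(`tripleSum_eq_braid`). An integrable `U_q(𝔰𝔩₂)`-module is spanned by the vectors `B^(s) η`, `η` of highest weight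
`t ≥ s` (`Sl2Module.eq_top_of_highest`), and the operator sends `B^(s) η` to `± q^{...} B^(t-s) η`; hence the two
operators are mutually inverse (`IsBraid.comp_eq`). If `x` commutes with `B` and lowers weights by `N`, the sums
`F_m = ∑_{r+s=m} (-1)^r q^{r(N-m+1)} E^(r) x E^(s)` satisfy `F_m B - B F_m = [N-m+1] K⁻¹ F_{m-1}`. So `F_{N+1}` commutes
with `B`, kills the highest weight vectors, and vanishes: the Serre relations hold automatically in integrable modules
(`Sl2Module.serreSum_eq_zero`). Therefore `F_N` commutes with `E` up to a scalar, which gives `T x = F_N T`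
(`IsBraid.apply_of_commute`). This is (i), as `𝚊_{jn}` commutes with `B_i` for `j ≠ i`.

*Faithfulness.* An element of `U` that kills all objects of `𝓞` is zero (`eq_zero_of_forall_smul_eq_zero`). Objects
are constructed as follows. The relation of `e_{ik}` and `f_{il}` can be solved for `e_{ik} f_{il}`, which defines Verma
modules on the space of words in the `f_{il}` (`verma`). The span of the Serre relators, the commutators and the vectors
`f_i^{Λ(h_i)+1} v` is stable (`vE_mem_relSub`), and the quotient `highest` is integrable. Its mirror image is a lowest
weight module, and tensor products (`PreRep.tensor`) stay integrable. `U` is spanned by the products `y x q^h` of words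
`y` in the `f_{il}` and `x` in the `e_{il}` (`range_triang`). On `ξ ⊗ η`, with `ξ` a lowest and `η` a highest weight vector,
the component of `y x q^h (ξ ⊗ η)` of greatest height in the second factor is `q^{μ(h)} x ξ ⊗ y η`. Far from the walls
nothing is lost below any given height, and the characters `μ ↦ q^{μ(h)}` are linearly independent. So the top part of
an element that kills everything is zero (`top_part_eq_zero`), and one concludes by induction on the height.

*The algebra.* The pairs `(u, u')` with `L'(u z) = u' L'(z)` for all `z` in objects of `𝓞` form a subalgebra `braidGraph`
of `U × U`. The formulas on modules put the generators into both of its projections, and faithfulness makes the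
projections injective; the subalgebra is thus the graph of an automorphism (`exists_algEquiv`). Finally (iii) follows by
induction on `m`: the recursion `[m+1] 𝓕'_{m+1} = 𝚊_i 𝓕'_m - q^{...} 𝓕'_m 𝚊_i` is turned by `L'` into the formula for
`𝓕_m B_i - B_i 𝓕_m`, and outside of `0 ≤ m ≤ βn` both sides vanish by the higher Serre relations.
-/

/-! ### Quantum integers, divided powers and weight modules -/

namespace QuantumSl2

variable {k : Type*} [Field k]

/-- The quantum integer `[n] = (q ^ n - q ^ (-n)) / (q - q⁻¹)`, for `n ∈ ℤ`. -/
def qint (q : k) (n : ℤ) : k := (q ^ n - q ^ (-n)) / (q - q⁻¹)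

/-- The quantum factorial `[n]!`. -/
def qfact (q : k) (n : ℕ) : k := ∏ j ∈ Finset.range n, qint q (j + 1)

/-- `q` is nonzero and not a root of unity. -/
structure Generic (q : k) : Prop where
  ne_zero : q ≠ 0
  pow_ne_one : ∀ n : ℕ, n ≠ 0 → q ^ n ≠ 1

namespace Generic

variable {q : k}

theorem zpow_ne_one (hq : Generic q) {n : ℤ} (hn : n ≠ 0) : q ^ n ≠ 1 := by
  obtain ⟨m, rfl | rfl⟩ := n.eq_nat_or_neg
  · rw [zpow_natCast]; exact hq.pow_ne_one m (by simpa using hn)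
  · rw [zpow_neg, zpow_natCast, ne_eq, inv_eq_one]; exact hq.pow_ne_one m (by simpa using hn)

theorem inv (hq : Generic q) : Generic q⁻¹ :=
  ⟨inv_ne_zero hq.ne_zero, fun n hn => by
    rw [inv_pow, ne_eq, inv_eq_one]; exact hq.pow_ne_one n hn⟩

theorem sub_ne_zero (hq : Generic q) : q - q⁻¹ ≠ 0 := by
  intro h
  apply hq.pow_ne_one 2 (by norm_num)
  have h0 := hq.ne_zero
  field_simp at h
  linear_combination h

theorem qint_ne_zero (hq : Generic q) {n : ℤ} (hn : n ≠ 0) : qint q n ≠ 0 := by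
  refine div_ne_zero ?_ hq.sub_ne_zero
  intro h
  apply hq.zpow_ne_one (n := n + n) (by omega)
  rw [zpow_add₀ hq.ne_zero]
  nth_rw 1 [sub_eq_zero.1 h]
  rw [← zpow_add₀ hq.ne_zero]; simp

theorem qfact_ne_zero (hq : Generic q) (n : ℕ) : qfact q n ≠ 0 :=
  Finset.prod_ne_zero_iff.2 fun _ _ => hq.qint_ne_zero (by positivity)

end Generic

@[simp] theorem qint_zero (q : k) : qint q 0 = 0 := by simp [qint]

theorem qint_neg (q : k) (n : ℤ) : qint q (-n) = -qint q n := by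
  simp only [qint, neg_neg]; ring

theorem qint_inv (q : k) (n : ℤ) : qint q⁻¹ n = qint q n := by
  simp only [qint, inv_zpow', inv_inv, neg_neg]
  rw [← neg_sub (q ^ n), ← neg_sub q, neg_div_neg_eq]

theorem qfact_succ (q : k) (n : ℕ) : qfact q (n + 1) = qfact q n * qint q (n + 1) :=
  Finset.prod_range_succ _ _

theorem qfact_inv (q : k) (n : ℕ) : qfact q⁻¹ n = qfact q n := by
  simp only [qfact, qint_inv]

section DividedPowers

variable {A : Type*} [Ring A] [Algebra k A]

/-- The divided power `x ^ (n) = x ^ n / [n]!` for an integer `n`; it is `0` for `n < 0`, so that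
`x * x ^ (n) = [n + 1] x ^ (n + 1)` holds for all `n ∈ ℤ`. -/
def dp (q : k) (x : A) (n : ℤ) : A := if 0 ≤ n then (qfact q n.toNat)⁻¹ • x ^ n.toNat else 0

theorem dp_of_neg (q : k) (x : A) {n : ℤ} (hn : n < 0) : dp q x n = 0 := if_neg (by omega)

theorem dp_natCast (q : k) (x : A) (n : ℕ) : dp q x n = (qfact q n)⁻¹ • x ^ n := by
  simp [dp]

@[simp] theorem dp_zero (q : k) (x : A) : dp q x 0 = 1 := by simp [dp, qfact]

theorem dp_inv (q : k) (x : A) (n : ℤ) : dp q⁻¹ x n = dp q x n := by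
  simp only [dp, qfact_inv]

theorem commute_dp (q : k) {x y : A} (h : Commute y x) (n : ℤ) : Commute y (dp q x n) := by
  rw [dp]; split_ifs
  · exact (h.pow_right _).smul_right _
  · exact Commute.zero_right _

theorem dp_mul_self {q : k} (hq : Generic q) (x : A) (n : ℤ) :
    dp q x n * x = qint q (n + 1) • dp q x (n + 1) := by
  rcases lt_or_ge n 0 with hn | hn
  · rcases eq_or_ne n (-1) with rfl | h
    · simp [dp]
    · rw [dp_of_neg q x hn, dp_of_neg q x (by omega)]; simp
  · obtain ⟨m, rfl⟩ := Int.eq_ofNat_of_zero_le hn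
    rw [dp_natCast, show (m : ℤ) + 1 = ((m + 1 : ℕ) : ℤ) by push_cast; rfl, dp_natCast, qfact_succ,
      smul_smul, smul_mul_assoc, ← pow_succ]
    congr 1
    have := hq.qint_ne_zero (n := ((m : ℤ) + 1)) (by positivity)
    have := hq.qfact_ne_zero m
    push_cast
    field_simp

theorem self_mul_dp {q : k} (hq : Generic q) (x : A) (n : ℤ) :
    x * dp q x n = qint q (n + 1) • dp q x (n + 1) := by
  rw [← dp_mul_self hq, (commute_dp q (Commute.refl x) n).eq]

end DividedPowers

variable {M : Type*} [AddCommGroup M] [Module k M]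

/-- A weight module of `U_q(𝔰𝔩₂)`: operators `E`, `B` on `M` and weight spaces `W n`, `n ∈ ℤ`, with
`E W n ⊆ W (n + 2)`, `B W n ⊆ W (n - 2)` and `E B - B E = [n]` on `W n`. -/
structure Sl2Weight (q : k) (E B : Module.End k M) (W : ℤ → Submodule k M) : Prop where
  generic : Generic q
  E_mem : ∀ {n : ℤ} {z : M}, z ∈ W n → E z ∈ W (n + 2)
  B_mem : ∀ {n : ℤ} {z : M}, z ∈ W n → B z ∈ W (n - 2)
  comm : ∀ {n : ℤ} {z : M}, z ∈ W n → E (B z) - B (E z) = qint q n • z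

/-- An integrable module of `U_q(𝔰𝔩₂)`: the weight spaces span `M`, and `E`, `B` are locally
nilpotent. -/
structure Sl2Module (q : k) (E B : Module.End k M) (W : ℤ → Submodule k M) : Prop
    extends Sl2Weight q E B W where
  iSup_eq_top : ⨆ n, W n = ⊤
  nilE : ∀ z, ∃ N : ℕ, (E ^ N) z = 0
  nilB : ∀ z, ∃ N : ℕ, (B ^ N) z = 0

namespace Sl2Weight

variable {q : k} {E B : Module.End k M} {W : ℤ → Submodule k M}

theorem swap (h : Sl2Weight q E B W) : Sl2Weight q B E (fun n => W (-n)) where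
  generic := h.generic
  E_mem {n z} hz := by
    have := h.B_mem hz; rwa [show -n - 2 = -(n + 2) by ring] at this
  B_mem {n z} hz := by
    have := h.E_mem hz; rwa [show -n + 2 = -(n - 2) by ring] at this
  comm {n z} hz := by
    rw [← neg_sub, h.comm hz, qint_neg, neg_smul, neg_neg]

theorem inv (h : Sl2Weight q E B W) : Sl2Weight q⁻¹ E B W :=
  ⟨h.generic.inv, h.E_mem, h.B_mem, fun hz => by rw [qint_inv]; exact h.comm hz⟩

theorem powE_mem (h : Sl2Weight q E B W) {n : ℤ} {z : M} (hz : z ∈ W n) (s : ℕ) :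
    (E ^ s) z ∈ W (n + 2 * s) := by
  induction s with
  | zero => simpa using hz
  | succ s ih =>
    rw [pow_succ', Module.End.mul_apply]
    have := h.E_mem ih
    rwa [show n + 2 * (s : ℤ) + 2 = n + 2 * ((s + 1 : ℕ) : ℤ) by push_cast; ring] at this

theorem dpE_mem (h : Sl2Weight q E B W) {n : ℤ} {z : M} (hz : z ∈ W n) (s : ℤ) :
    dp q E s z ∈ W (n + 2 * s) := by
  rcases lt_or_ge s 0 with hs | hs
  · rw [dp_of_neg q E hs]; exact zero_mem _
  · obtain ⟨m, rfl⟩ := Int.eq_ofNat_of_zero_le hs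
    rw [dp_natCast]
    exact (W _).smul_mem _ (h.powE_mem hz m)

theorem dpB_mem (h : Sl2Weight q E B W) {n : ℤ} {z : M} (hz : z ∈ W n) (s : ℤ) :
    dp q B s z ∈ W (n - 2 * s) := by
  have := h.swap.dpE_mem (n := -n) (z := z) (by simpa using hz) s
  simpa [show -(-n + 2 * s) = n - 2 * s by ring] using this

theorem E_dpE (h : Sl2Weight q E B W) (z : M) (s : ℤ) :
    E (dp q E s z) = qint q (s + 1) • dp q E (s + 1) z := by
  rw [← Module.End.mul_apply, self_mul_dp h.generic]; rfl

theorem dpE_E (h : Sl2Weight q E B W) (z : M) (s : ℤ) :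
    dp q E s (E z) = qint q (s + 1) • dp q E (s + 1) z := by
  rw [← Module.End.mul_apply, dp_mul_self h.generic]; rfl

theorem B_dpB (h : Sl2Weight q E B W) (z : M) (s : ℤ) :
    B (dp q B s z) = qint q (s + 1) • dp q B (s + 1) z := h.swap.E_dpE z s

theorem dpB_B (h : Sl2Weight q E B W) (z : M) (s : ℤ) :
    dp q B s (B z) = qint q (s + 1) • dp q B (s + 1) z := h.swap.dpE_E z s

/-- `E^(s) B - B E^(s) = [n + s - 1] E^(s-1)` on the weight space of weight `n`. -/
theorem dpE_B (h : Sl2Weight q E B W) {n : ℤ} {z : M} (hz : z ∈ W n) (s : ℤ) :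
    dp q E s (B z) = B (dp q E s z) + qint q (n + s - 1) • dp q E (s - 1) z := by
  rcases lt_or_ge s 0 with hs | hs
  · rw [dp_of_neg q E hs, dp_of_neg q E (by omega)]; simp
  obtain ⟨m, rfl⟩ := Int.eq_ofNat_of_zero_le hs
  clear hs
  induction m with
  | zero => simp [dp_of_neg q E (show (-1 : ℤ) < 0 by norm_num)]
  | succ m ih =>
    have hne := h.generic.qint_ne_zero (n := (m : ℤ) + 1) (by positivity)
    have h1 := h.E_dpE (B z) m
    rw [ih, map_add, map_smul, h.E_dpE] at h1
    have h2 := h.comm (h.dpE_mem hz m)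
    rw [h.E_dpE, map_smul, sub_eq_iff_eq_add] at h2
    rw [h2, sub_add_cancel] at h1
    push_cast
    rw [add_sub_cancel_right]
    apply smul_right_injective M hne
    simp only
    rw [← h1, smul_add, add_assoc, add_comm, add_assoc, smul_smul, smul_smul, add_right_inj, ← add_smul]
    congr 1
    have h0 := h.generic.ne_zero
    have h3 := h.generic.sub_ne_zero
    simp only [qint]
    rw [div_mul_div_comm, div_mul_div_comm, div_add_div _ _ (mul_ne_zero h3 h3) h3,
      div_eq_div_iff (mul_ne_zero (mul_ne_zero h3 h3) h3) (mul_ne_zero h3 h3)]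
    simp only [zpow_add₀ h0, zpow_sub₀ h0, neg_add, neg_sub, zpow_neg, zpow_one, mul_comm (2:ℤ), zpow_mul]
    have hm : q ^ (m:ℤ) ≠ 0 := zpow_ne_zero _ h0
    have hn : q ^ n ≠ 0 := zpow_ne_zero _ h0
    field_simp
    ring

theorem E_dpB (h : Sl2Weight q E B W) {n : ℤ} {z : M} (hz : z ∈ W n) (s : ℤ) :
    E (dp q B s z) = dp q B s (E z) + qint q (n - s + 1) • dp q B (s - 1) z := by
  have := h.swap.dpE_B (n := -n) (z := z) (by simpa using hz) s
  rw [this, show -n + s - 1 = -(n - s + 1) by ring, qint_neg]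
  simp

end Sl2Weight
end QuantumSl2

namespace QuantumSl2

variable {k : Type*} [Field k] {M : Type*} [AddCommGroup M] [Module k M]

/-! ### The braid group operator of a weight module -/

theorem support_smul_finite (c : ℤ → k) {X : ℤ → M} (hX : (Function.support X).Finite) :
    (Function.support fun a => c a • X a).Finite :=
  hX.subset (Function.support_smul_subset_right _ _)

theorem support_shift_finite (t : ℤ) (c : ℤ → k) {X : ℤ → M} (hX : (Function.support X).Finite) :
    (Function.support fun a => c a • X (a + t)).Finite :=
  support_smul_finite c (hX.preimage (Function.Injective.injOn (Equiv.addRight t).injective))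

theorem finsum_shift_add (t : ℤ) {c d : ℤ → k} {X : ℤ → M} (hX : (Function.support X).Finite) :
    ∑ᶠ a, (c a • X (a + t) + d a • X a) = ∑ᶠ a, (c (a - t) + d a) • X a := by
  simp only [add_smul]
  rw [finsum_add_distrib (support_shift_finite t c hX) (support_smul_finite d hX),
    finsum_add_distrib (support_smul_finite _ hX) (support_smul_finite d hX),
    ← finsum_comp_equiv (Equiv.addRight t) (f := fun a => c (a - t) • X a)]
  simp

theorem finsum_linear {c d : ℤ → k} {X : ℤ → M} (hX : (Function.support X).Finite) (α β : k) :
    ∑ᶠ a, (α * c a + β * d a) • X a = α • ∑ᶠ a, c a • X a + β • ∑ᶠ a, d a • X a := by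
  have h1 : (Function.support fun a => c a • X a).Finite :=
    hX.subset (Function.support_smul_subset_right _ _)
  have h2 : (Function.support fun a => d a • X a).Finite :=
    hX.subset (Function.support_smul_subset_right _ _)
  rw [smul_finsum' _ h1, smul_finsum' _ h2, ← finsum_add_distrib]
  · simp only [add_smul, mul_smul]
  · exact h1.subset (Function.support_const_smul_subset _ _)
  · exact h2.subset (Function.support_const_smul_subset _ _)

theorem dp_eq_zero_of_pow {q : k} {E : Module.End k M} {z : M} {N : ℕ} (h : (E ^ N) z = 0) {s : ℤ}
    (hs : (N : ℤ) ≤ s) : dp q E s z = 0 := by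
  obtain ⟨m, rfl⟩ := Int.eq_ofNat_of_zero_le (show 0 ≤ s by omega)
  have hm : m = (m - N) + N := by omega
  rw [dp_natCast, hm, pow_add, LinearMap.smul_apply, Module.End.mul_apply, h, map_zero, smul_zero]

theorem support_dp_finite (q : k) {E : Module.End k M} (B : Module.End k M) {z : M}
    (hz : ∃ N : ℕ, (E ^ N) z = 0) (j : ℤ) :
    (Function.support fun a : ℤ => dp q B a (dp q E (a + j) z)).Finite := by
  obtain ⟨N, hN⟩ := hz
  refine (Set.finite_Icc (0 : ℤ) (N - j)).subset fun a ha => ?_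
  rw [Function.mem_support] at ha
  constructor
  · by_contra! h
    exact ha (by rw [dp_of_neg q B h]; rfl)
  · by_contra! h
    exact ha (by rw [dp_eq_zero_of_pow hN (by omega), map_zero])

/-- The sum `∑_a (-1)^a q ^ (u a) B^(a) E^(a + j) z`. -/
noncomputable def altSum (q : k) (E B : Module.End k M) (u j : ℤ) (z : M) : M :=
  ∑ᶠ a : ℤ, ((-1) ^ a * q ^ (u * a)) • dp q B a (dp q E (a + j) z)

theorem altSum_support_finite (q : k) {E : Module.End k M} (B : Module.End k M) {z : M}
    (hz : ∃ N : ℕ, (E ^ N) z = 0) (u j : ℤ) :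
    (Function.support fun a : ℤ => ((-1) ^ a * q ^ (u * a)) • dp q B a (dp q E (a + j) z)).Finite :=
  (support_dp_finite q B hz j).subset (Function.support_smul_subset_right _ _)

theorem altSum_smul {q : k} {E : Module.End k M} (B : Module.End k M) {z : M}
    (hz : ∃ N : ℕ, (E ^ N) z = 0) (u j : ℤ) (c : k) :
    altSum q E B u j (c • z) = c • altSum q E B u j z := by
  rw [altSum, altSum, smul_finsum' _ (altSum_support_finite q B hz u j)]
  refine finsum_congr fun a => ?_
  rw [map_smul, map_smul, smul_comm]

namespace Sl2Weight

variable {q : k} {E B : Module.End k M} {W : ℤ → Submodule k M}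

theorem altSum_mem (h : Sl2Weight q E B W) {n : ℤ} {z : M} (hz : z ∈ W n) (u j : ℤ) :
    altSum q E B u j z ∈ W (n + 2 * j) := by
  refine finsum_induction (· ∈ W (n + 2 * j)) (zero_mem _) (fun x y hx hy => add_mem hx hy) ?_
  intro a
  have := h.dpB_mem (h.dpE_mem hz (a + j)) a
  rw [show n + 2 * (a + j) - 2 * a = n + 2 * j by ring] at this
  exact (W _).smul_mem _ this

/-- On `B z`, the sum is a combination of the sums with `u ± 1` and `j - 1` on `z`; the coefficients vanish at
`u = 1 - n - j` and `u = n + j - 1`, respectively. -/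
theorem altSum_B (h : Sl2Weight q E B W) {n : ℤ} {z : M} (hz : z ∈ W n)
    (hE : ∃ N : ℕ, (E ^ N) z = 0) (u j : ℤ) :
    altSum q E B u j (B z) =
      ((q ^ (n + j - 1) - q ^ (-u)) / (q - q⁻¹)) • altSum q E B (u + 1) (j - 1) z +
      ((q ^ (-u) - q ^ (-(n + j - 1))) / (q - q⁻¹)) • altSum q E B (u - 1) (j - 1) z := by
  simp only [altSum]
  have hX := support_dp_finite q B hE (j - 1)
  rw [← finsum_linear hX]
  have h0 := h.generic.ne_zero
  trans ∑ᶠ a : ℤ, ((((-1) ^ a * q ^ (u * a)) * qint q (a + 1)) •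
      (fun a : ℤ => dp q B a (dp q E (a + (j - 1)) z)) (a + 1) +
      (((-1) ^ a * q ^ (u * a)) * qint q (n + (a + j) - 1)) •
        (fun a : ℤ => dp q B a (dp q E (a + (j - 1)) z)) a)
  · refine finsum_congr fun a => ?_
    rw [h.dpE_B hz, map_add, h.dpB_B, map_smul, smul_add, smul_smul, smul_smul]
    simp only [show a + 1 + (j - 1) = a + j by ring, show a + (j - 1) = a + j - 1 by ring]
  · rw [finsum_shift_add 1 hX]
    refine finsum_congr fun a => ?_
    congr 1
    have h3 := h.generic.sub_ne_zero
    simp only [qint]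
    rw [show u * (a - 1) = u * a - u by ring, show (u + 1) * a = u * a + a by ring,
      show (u - 1) * a = u * a - a by ring, zpow_sub_one₀ (by norm_num : (-1 : k) ≠ 0)]
    simp only [zpow_add₀ h0, zpow_sub₀ h0, neg_sub, zpow_neg, zpow_one, sub_add_cancel]
    field_simp
    ring

/-- The counterpart of `altSum_B` for `E` applied to the sum. -/
theorem E_altSum (h : Sl2Weight q E B W) {n : ℤ} {z : M} (hz : z ∈ W n)
    (hE : ∃ N : ℕ, (E ^ N) z = 0) (u j : ℤ) :
    E (altSum q E B u j z) =
      ((q ^ (j + 1) - q ^ (u + n + 2 * j + 2)) / (q - q⁻¹)) • altSum q E B (u + 1) (j + 1) z +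
      ((q ^ (u - n - 2 * j - 2) - q ^ (-(j + 1))) / (q - q⁻¹)) • altSum q E B (u - 1) (j + 1) z := by
  simp only [altSum]
  have hX := support_dp_finite q B hE (j + 1)
  rw [← finsum_linear hX, map_finsum E (altSum_support_finite q B hE u j)]
  have h0 := h.generic.ne_zero
  trans ∑ᶠ a : ℤ, ((((-1) ^ a * q ^ (u * a)) * qint q (n + 2 * j + a + 1)) •
      (fun a : ℤ => dp q B a (dp q E (a + (j + 1)) z)) (a + -1) +
      (((-1) ^ a * q ^ (u * a)) * qint q (a + j + 1)) •
        (fun a : ℤ => dp q B a (dp q E (a + (j + 1)) z)) a)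
  · refine finsum_congr fun a => ?_
    rw [map_smul, h.E_dpB (h.dpE_mem hz _), h.E_dpE, map_smul, smul_add, smul_smul, smul_smul, add_comm]
    simp only [show a + (j + 1) = a + j + 1 by ring, show a + -1 = a - 1 by ring,
      show n + 2 * (a + j) - a + 1 = n + 2 * j + a + 1 by ring, show a - 1 + (j + 1) = a + j by ring]
  · rw [finsum_shift_add (-1) hX]
    refine finsum_congr fun a => ?_
    congr 1
    have h3 := h.generic.sub_ne_zero
    simp only [qint]
    rw [show u * (a - -1) = u * a + u by ring, show (u + 1) * a = u * a + a by ring,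
      show (u - 1) * a = u * a - a by ring, show a - -1 = a + 1 by ring,
      zpow_add_one₀ (by norm_num : (-1 : k) ≠ 0),
      show n + 2 * j + (a + 1) + 1 = (n + 2 * j + 2) + a by ring,
      show u + n + 2 * j + 2 = u + (n + 2 * j + 2) by ring,
      show u - n - 2 * j - 2 = u - (n + 2 * j + 2) by ring]
    generalize n + 2 * j + 2 = r
    simp only [zpow_add₀ h0, zpow_sub₀ h0, neg_add, zpow_neg, zpow_one]
    have := zpow_ne_zero r h0
    have := zpow_ne_zero u h0
    field_simp
    ring

/-- The terms `B^(a) E^(b) B^(c)` with a fixed `c ≥ 1` in the triple sum that defines the braid group operator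
add up to zero (here `c + 1` stands for this exponent). -/
theorem altSum_pow_B_eq_zero (h : Sl2Weight q E B W) (hE : ∀ z, ∃ N : ℕ, (E ^ N) z = 0) {n : ℤ}
    {z : M} (hz : z ∈ W n) (c : ℕ) : altSum q E B (-c) (c + 1 - n) ((B ^ (c + 1)) z) = 0 := by
  induction c with
  | zero =>
    rw [zero_add, pow_one, h.altSum_B hz (hE z)]
    simp
  | succ c ih =>
    have hz' := h.swap.powE_mem (n := -n) (z := z) (by simpa using hz) (c + 1)
    rw [pow_succ', Module.End.mul_apply, h.altSum_B hz' (hE _)]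
    push_cast
    rw [show -(c + 1 : ℤ) + 1 = -c by ring, show (c : ℤ) + 1 + 1 - n - 1 = c + 1 - n by ring, ih, smul_zero,
      zero_add, show -(-(-n + 2 * (c + 1 : ℤ)) + (c + 1 + 1 - n) - 1) = - -(c + 1 : ℤ) by ring, sub_self,
      zero_div, zero_smul]

/-- The operator `z ↦ ∑_s (-1)^s q ^ s B^(s + n) E^(s) z` on the weight space of weight `n`. -/
noncomputable def _root_.QuantumSl2.braid (q : k) (E B : Module.End k M) (n : ℤ) (z : M) : M :=
  ((-1) ^ n * q ^ (-n)) • altSum q E B 1 (-n) z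

theorem braid_mem (h : Sl2Weight q E B W) {n : ℤ} {z : M} (hz : z ∈ W n) :
    braid q E B n z ∈ W (-n) := by
  have := h.altSum_mem hz 1 (-n)
  rw [show n + 2 * -n = -n by ring] at this
  exact (W _).smul_mem _ this

/-- The operator turns `B` into `E`: in `altSum_B` and `E_altSum` one of the two coefficients is zero. -/
theorem braid_B (h : Sl2Weight q E B W) (hE : ∀ z, ∃ N : ℕ, (E ^ N) z = 0) {n : ℤ} {z : M}
    (hz : z ∈ W n) : braid q E B (n - 2) (B z) = -(q ^ n • E (braid q E B n z)) := by
  have h0 := h.generic.ne_zero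
  have h3 := h.generic.sub_ne_zero
  have h1 : (-1 : k) ^ (n - 2) = (-1) ^ n := by
    rw [zpow_sub₀ (by norm_num)]; simp
  simp only [braid]
  rw [map_smul, h.altSum_B hz (hE z), h.E_altSum hz (hE z), show n + -(n - 2) - 1 = 1 by ring,
    show -(n - 2) - 1 = -n + 1 by ring, show (1 : ℤ) - n - 2 * -n - 2 = -(-n + 1) by ring, sub_self,
    show (1 : ℤ) + n + 2 * -n + 2 = (-n + 1) + 2 by ring]
  simp only [sub_self, zero_div, zero_smul, add_zero, smul_smul, ← neg_smul, h1]
  congr 1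
  simp only [zpow_add₀ h0, zpow_sub₀ h0, zpow_neg, zpow_one]
  have := zpow_ne_zero n h0
  have h2 : q ^ (2 : ℤ) = q ^ 2 := by norm_cast
  rw [h2]
  field_simp
  ring

/-- On a highest weight vector only the term `s = 0` of the braid group operator survives. -/
theorem braid_of_E_eq_zero (h : Sl2Weight q E B W) {z : M} (hz : E z = 0) (n : ℤ) :
    braid q E B n z = dp q B n z := by
  have h0 := h.generic.ne_zero
  rw [braid, altSum, finsum_eq_single _ n]
  · rw [smul_smul, add_neg_cancel, dp_zero, Module.End.one_apply, one_mul]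
    have h1 : (-1 : k) ^ n * q ^ (-n) * ((-1) ^ n * q ^ n) = 1 := by
      rw [zpow_neg]
      have h2 : (-1 : k) ^ n * (-1) ^ n = 1 := by rw [← mul_zpow]; simp
      have := zpow_ne_zero n h0
      field_simp
      linear_combination h2
    rw [h1, one_smul]
  · intro a ha
    have : dp q E (a + -n) z = 0 := by
      rcases lt_or_ge (a + -n) 0 with hs | hs
      · rw [dp_of_neg q E hs]; rfl
      · exact dp_eq_zero_of_pow (N := 1) (by simpa using hz) (by omega)
    rw [this, map_zero, smul_zero]

end Sl2Weight
end QuantumSl2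

namespace QuantumSl2

variable {k : Type*} [Field k] {M : Type*} [AddCommGroup M] [Module k M]

/-! ### Integrable modules of `U_q(𝔰𝔩₂)` -/

namespace Sl2Module

variable {q : k} {E B : Module.End k M} {W : ℤ → Submodule k M}

theorem swap (h : Sl2Module q E B W) : Sl2Module q B E (fun n => W (-n)) where
  toSl2Weight := h.toSl2Weight.swap
  iSup_eq_top := by
    rw [← h.iSup_eq_top]
    exact (Equiv.neg ℤ).iSup_comp (g := W)
  nilE := h.nilB
  nilB := h.nilE

theorem inv (h : Sl2Module q E B W) : Sl2Module q⁻¹ E B W :=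
  ⟨h.toSl2Weight.inv, h.iSup_eq_top, h.nilE, h.nilB⟩

theorem E_dpB_highest (h : Sl2Module q E B W) {t : ℤ} {η : M} (hη : η ∈ W t) (hE : E η = 0) (s : ℤ) :
    E (dp q B s η) = qint q (t - s + 1) • dp q B (s - 1) η := by
  rw [h.E_dpB hη, hE, map_zero, zero_add]

/-- If `B^(s) η` were nonzero for some `s > t`, so would be all later ones, as `E B^(s+1) η = [t - s] B^(s) η`
with `[t - s] ≠ 0`; but `B` is locally nilpotent. -/
theorem dpB_highest_eq_zero (h : Sl2Module q E B W) {t : ℤ} {η : M} (hη : η ∈ W t) (hE : E η = 0)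
    {s : ℤ} (hs : 0 ≤ s) (hst : t < s) : dp q B s η = 0 := by
  obtain ⟨N, hN⟩ := h.nilB η
  have key : ∀ m : ℕ, ∀ s : ℤ, 0 ≤ s → t < s → (N : ℤ) ≤ s + m → dp q B s η = 0 := by
    intro m
    induction m with
    | zero => exact fun s _ _ h3 => dp_eq_zero_of_pow hN (by simpa using h3)
    | succ m ih =>
      intro s h1 h2 h3
      have h4 := h.E_dpB_highest hη hE (s + 1)
      rw [ih (s + 1) (by omega) (by omega) (by push_cast at h3; omega), map_zero, add_sub_cancel_right] at h4
      exact (smul_eq_zero.1 h4.symm).resolve_left (h.generic.qint_ne_zero (by omega))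
  exact key N s hs hst (by omega)

theorem dpE_dpB_highest (h : Sl2Module q E B W) {t : ℕ} {η : M} (hη : η ∈ W t) (hE : E η = 0) (a : ℤ) :
    dp q E a (dp q B t η) = dp q B (t - a) η := by
  rcases lt_or_ge a 0 with ha | ha
  · rw [dp_of_neg q E ha, h.dpB_highest_eq_zero hη hE (s := t - a) (by omega) (by omega)]; rfl
  obtain ⟨m, rfl⟩ := Int.eq_ofNat_of_zero_le ha
  clear ha
  induction m with
  | zero => simp
  | succ m ih =>
    have h1 := h.E_dpE (dp q B t η) m
    rw [ih, h.E_dpB_highest hη hE, show (t : ℤ) - (t - m) + 1 = m + 1 by ring] at h1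
    have := smul_right_injective M (h.generic.qint_ne_zero (n := (m : ℤ) + 1) (by positivity)) h1
    push_cast
    rw [← this, show (t : ℤ) - (m + 1) = t - m - 1 by ring]

theorem exists_pow_E_dpB (h : Sl2Module q E B W) {t : ℕ} {η : M} (hη : η ∈ W t) (hE : E η = 0) (s : ℕ)
    (hs : s ≤ t) : ∃ c : k, c ≠ 0 ∧ (E ^ s) (dp q B s η) = c • η := by
  induction s with
  | zero => exact ⟨1, one_ne_zero, by simp⟩
  | succ s ih =>
    obtain ⟨c, hc, h1⟩ := ih (by omega)
    refine ⟨qint q (t - (s + 1 : ℕ) + 1) * c, mul_ne_zero (h.generic.qint_ne_zero (by omega)) hc, ?_⟩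
    rw [pow_succ, Module.End.mul_apply, h.E_dpB_highest hη hE, map_smul,
      show ((s + 1 : ℕ) : ℤ) - 1 = s by push_cast; ring, h1, smul_smul]

/-- The weight spaces of weight `n ≥ 0`, by induction on the nilpotency order `N` of `E` on `z`: a multiple of
`B^(N) E^N z` can be subtracted from `z` to lower it. -/
theorem mem_of_highest (h : Sl2Module q E B W) (n : ℕ) (p : Submodule k M)
    (hp : ∀ (t : ℕ) (η : M), η ∈ W t → E η = 0 → ∀ s : ℕ, s ≤ t → (t : ℤ) - 2 * s = n → dp q B s η ∈ p)
    (N : ℕ) (z : M) (hz : z ∈ W n) (hN : (E ^ N) z = 0) : z ∈ p := by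
  induction N generalizing z with
  | zero => rw [pow_zero, Module.End.one_apply] at hN; rw [hN]; exact zero_mem _
  | succ N ih =>
    have hη : (E ^ N) z ∈ W ((n + 2 * N : ℕ) : ℤ) := by
      have := h.powE_mem hz N
      push_cast; exact this
    have hEη : E ((E ^ N) z) = 0 := by rw [← Module.End.mul_apply, ← pow_succ', hN]
    obtain ⟨c, hc, h1⟩ := h.exists_pow_E_dpB hη hEη N (by omega)
    have hv := hp _ _ hη hEη N (by omega) (by push_cast; ring)
    have hvW : dp q B N ((E ^ N) z) ∈ W n := by
      have := h.dpB_mem hη N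
      rwa [show ((n + 2 * N : ℕ) : ℤ) - 2 * N = n by push_cast; ring] at this
    have h2 := ih (z - c⁻¹ • dp q B N ((E ^ N) z)) (sub_mem hz ((W _).smul_mem _ hvW)) (by
      rw [map_sub, map_smul, h1, smul_smul, inv_mul_cancel₀ hc, one_smul, sub_self])
    have h3 := add_mem h2 (p.smul_mem c⁻¹ hv)
    rwa [sub_add_cancel] at h3

/-- The weight space of weight `n` of an integrable module is spanned by the vectors `B^(s) η` for
highest weight vectors `η` of weight `t = n + 2 s ≥ s`. -/
theorem weight_le_of_highest (h : Sl2Module q E B W) (n : ℤ) (p : Submodule k M)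
    (hp : ∀ (t : ℕ) (η : M), η ∈ W t → E η = 0 → ∀ s : ℕ, s ≤ t → (t : ℤ) - 2 * s = n →
      dp q B s η ∈ p) : W n ≤ p := by
  intro z hz
  obtain ⟨m, rfl | rfl⟩ := n.eq_nat_or_neg
  · obtain ⟨N, hN⟩ := h.nilE z
    exact h.mem_of_highest m p hp N z hz hN
  · obtain ⟨N, hN⟩ := h.nilB z
    -- For `n ≤ 0` the roles of `E` and `B` are exchanged; a vector killed by `B` is `B^(t)` of a highest
    -- weight vector.
    refine h.swap.mem_of_highest m p ?_ N z hz hN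
    intro t ζ hζ hB s hs hm
    have h1 : dp q E t ζ ∈ W t := by
      have := h.swap.dpB_mem hζ t
      rwa [show -((t : ℤ) - 2 * t) = t by ring] at this
    have h2 : E (dp q E t ζ) = 0 := by
      rw [h.E_dpE, h.swap.dpB_highest_eq_zero hζ hB (by omega) (by omega), smul_zero]
    have h3 := hp t _ h1 h2 (t - s) (by omega) (by omega)
    rw [h.swap.dpE_dpB_highest hζ hB, Nat.cast_sub hs, sub_sub_cancel] at h3
    exact h3

/-- An integrable module is spanned by the vectors `B^(s) η` for highest weight vectors `η` of weight
`t ≥ s`. -/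
theorem eq_top_of_highest (h : Sl2Module q E B W) (p : Submodule k M)
    (hp : ∀ (t : ℕ) (η : M), η ∈ W t → E η = 0 → ∀ s : ℕ, s ≤ t → dp q B s η ∈ p) : p = ⊤ := by
  rw [eq_top_iff, ← h.iSup_eq_top]
  exact iSup_le fun n => h.weight_le_of_highest n p fun t η hη hE s hs _ => hp t η hη hE s hs

end Sl2Module

/-- `T` is the braid group operator `∑_s (-1)^s q ^ s B^(s + n) E^(s)` on the weight space of weight
`n`, for all `n`. -/
def IsBraid (q : k) (E B : Module.End k M) (W : ℤ → Submodule k M) (T : M →ₗ[k] M) : Prop :=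
  ∀ n : ℤ, ∀ z ∈ W n, T z = braid q E B n z

/-- The scalar `(-1)^s q ^ (s (t - s) + s)`, the matrix coefficient of the braid group operator on
the irreducible module of highest weight `t`. -/
def braidCoeff (q : k) (t s : ℤ) : k := (-1) ^ s * q ^ (s * (t - s) + s)

theorem braidCoeff_mul_inv {q : k} (hq : q ≠ 0) (t s : ℤ) :
    braidCoeff q t s * braidCoeff q⁻¹ t s = 1 := by
  rw [braidCoeff, braidCoeff, mul_mul_mul_comm, ← mul_zpow, inv_zpow, mul_inv_cancel₀ (zpow_ne_zero _ hq)]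
  simp

namespace IsBraid

variable {q : k} {E B : Module.End k M} {W : ℤ → Submodule k M} {T T' : M →ₗ[k] M}

theorem mem (hT : IsBraid q E B W T) (h : Sl2Module q E B W) {n : ℤ} {z : M} (hz : z ∈ W n) :
    T z ∈ W (-n) := by
  rw [hT n z hz]; exact h.braid_mem hz

theorem apply_B (hT : IsBraid q E B W T) (h : Sl2Module q E B W) {n : ℤ} {z : M} (hz : z ∈ W n) :
    T (B z) = -(q ^ n • E (T z)) := by
  rw [hT n z hz, hT (n - 2) _ (h.B_mem hz), h.braid_B h.nilE hz]

/-- The operator on the irreducible module generated by the highest weight vector `η`. -/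
theorem highest (hT : IsBraid q E B W T) (h : Sl2Module q E B W) {t : ℕ} {η : M} (hη : η ∈ W t)
    (hE : E η = 0) (s : ℕ) : T (dp q B s η) = braidCoeff q t s • dp q B (t - s) η := by
  have h0 := h.generic.ne_zero
  induction s with
  | zero =>
    simp only [Nat.cast_zero, dp_zero, Module.End.one_apply, braidCoeff, sub_zero]
    rw [hT _ _ hη, h.braid_of_E_eq_zero hE]
    simp
  | succ s ih =>
    have h1 := congrArg T (h.B_dpB η s)
    rw [hT.apply_B h (h.dpB_mem hη s), ih, map_smul, map_smul, h.E_dpB_highest hη hE,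
      show (t : ℤ) - (t - s) + 1 = s + 1 by ring] at h1
    apply smul_right_injective M (h.generic.qint_ne_zero (n := (s : ℤ) + 1) (by positivity))
    simp only
    push_cast
    rw [← h1, smul_smul, smul_smul, smul_smul, ← neg_smul, show (t : ℤ) - s - 1 = t - (s + 1) by ring]
    congr 1
    simp only [braidCoeff]
    rw [zpow_add_one₀ (by norm_num : (-1 : k) ≠ 0),
      show ((s : ℤ) + 1) * (t - (s + 1)) + (s + 1) = (t - 2 * s) + (s * (t - s) + s) by ring]
    generalize (s : ℤ) * (t - s) + s = r
    rw [zpow_add₀ h0 _ r]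
    ring

/-- The operator of the pair `(B, E)` in terms of `η`; the highest weight vector for this pair is `B^(t) η`. -/
theorem swap_highest (hT' : IsBraid q B E (fun n => W (-n)) T') (h : Sl2Module q E B W) {t : ℕ} {η : M}
    (hη : η ∈ W t) (hE : E η = 0) {s : ℕ} (hs : s ≤ t) :
    T' (dp q B s η) = braidCoeff q t (t - s) • dp q B (t - s) η := by
  have h1 : dp q B t η ∈ W (-t) := by
    have := h.dpB_mem hη t
    rwa [show (t : ℤ) - 2 * t = -t by ring] at this
  have h2 : B (dp q B t η) = 0 := by
    rw [h.B_dpB, h.dpB_highest_eq_zero hη hE (by omega) (by omega), smul_zero]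
  have h3 := hT'.highest h.swap h1 h2 (t - s)
  rwa [h.dpE_dpB_highest hη hE, h.dpE_dpB_highest hη hE, Nat.cast_sub hs, sub_sub_cancel] at h3

/-- The operators attached to `(E, B)` and to `(B, E)` agree up to a scalar on each weight space. -/
theorem eq_swap (hT : IsBraid q E B W T) (hT' : IsBraid q B E (fun n => W (-n)) T')
    (h : Sl2Module q E B W) {n : ℤ} {z : M} (hz : z ∈ W n) :
    T' z = ((-1) ^ n * q ^ n) • T z := by
  refine h.weight_le_of_highest n (LinearMap.eqLocus T' (((-1) ^ n * q ^ n) • T)) ?_ hz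
  intro t η hη hE s hs hn
  rw [LinearMap.mem_eqLocus, LinearMap.smul_apply, hT.highest h hη hE, hT'.swap_highest h hη hE hs, smul_smul]
  congr 1
  subst hn
  have h1 : (-1 : k) ^ (2 * (s : ℤ)) = 1 := by rw [zpow_mul]; norm_num
  have h2 : (-1 : k) ^ (s : ℤ) * (-1 : k) ^ (s : ℤ) = 1 := by rw [← mul_zpow]; norm_num
  have h3 := zpow_ne_zero (s : ℤ) (by norm_num : (-1 : k) ≠ 0)
  simp only [braidCoeff]
  rw [show ((t : ℤ) - s) * (t - (t - s)) + (t - s) = (t - 2 * s) + (s * (t - s) + s) by ring,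
    zpow_sub₀ (by norm_num), zpow_sub₀ (by norm_num), h1, zpow_add₀ h.generic.ne_zero (t - 2 * s)]
  field_simp
  linear_combination (-(q ^ ((t : ℤ) - 2 * s) * q ^ ((s : ℤ) * (t - s) + s))) * h2

/-- The operator attached to `(B, E)` and `q⁻¹` inverts the one attached to `(E, B)` and `q`. -/
theorem comp_eq (hT : IsBraid q E B W T) (hT' : IsBraid q⁻¹ B E (fun n => W (-n)) T')
    (h : Sl2Module q E B W) (z : M) : T (T' z) = z := by
  have key : LinearMap.eqLocus (T ∘ₗ T') LinearMap.id = ⊤ := by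
    refine h.eq_top_of_highest _ ?_
    intro t η hη hE s hs
    rw [LinearMap.mem_eqLocus, LinearMap.comp_apply, LinearMap.id_apply]
    have h1 := hT'.swap_highest h.inv hη hE hs
    simp only [dp_inv] at h1
    have h2 := hT.highest h hη hE (t - s)
    rw [Nat.cast_sub hs, sub_sub_cancel] at h2
    rw [h1, map_smul, h2, smul_smul, mul_comm, braidCoeff_mul_inv h.generic.ne_zero, one_smul]
  exact LinearMap.mem_eqLocus.1 (key ▸ Submodule.mem_top)

theorem comp_eq' (hT : IsBraid q E B W T) (hT' : IsBraid q⁻¹ B E (fun n => W (-n)) T')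
    (h : Sl2Module q E B W) (z : M) : T' (T z) = z := by
  refine comp_eq (W := fun n => W (-n)) hT' ?_ h.inv.swap z
  simpa using hT

theorem apply_E (hT : IsBraid q E B W T) (hT' : IsBraid q B E (fun n => W (-n)) T')
    (h : Sl2Module q E B W) {n : ℤ} {z : M} (hz : z ∈ W n) :
    T (E z) = -(q ^ (-n - 2) • B (T z)) := by
  have h0 := h.generic.ne_zero
  have h1 := hT'.apply_B (n := -n) h.swap (z := z) (by simpa using hz)
  rw [hT.eq_swap hT' h hz, hT.eq_swap hT' h (h.E_mem hz), map_smul] at h1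
  have h2 : ((-1) ^ (n + 2) * q ^ (n + 2) : k) ≠ 0 :=
    mul_ne_zero (zpow_ne_zero _ (by norm_num)) (zpow_ne_zero _ h0)
  apply smul_right_injective M h2
  simp only
  rw [h1, smul_neg, smul_smul, smul_smul]
  congr 2
  rw [zpow_add₀ (by norm_num : (-1 : k) ≠ 0), zpow_add₀ h0, zpow_sub₀ h0, zpow_neg]
  have := zpow_ne_zero n h0
  have := zpow_ne_zero 2 h0
  have h3 : (-1 : k) ^ (2 : ℤ) = 1 := by norm_num
  rw [h3]
  field_simp

/-- The braid group operator with the divided powers in the opposite order: `∑_r (-1)^r q ^ r E^(r) B^(r + n)`. -/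
theorem eq_altSum (hT : IsBraid q E B W T) (hT' : IsBraid q B E (fun n => W (-n)) T')
    (h : Sl2Module q E B W) {n : ℤ} {z : M} (hz : z ∈ W n) :
    T z = altSum q B E 1 n z := by
  have h0 := h.generic.ne_zero
  have h1 := hT' (-n) z (by simpa using hz)
  rw [hT.eq_swap hT' h hz, braid, neg_neg, zpow_neg, ← inv_zpow, inv_neg, inv_one] at h1
  exact smul_right_injective M (mul_ne_zero (zpow_ne_zero _ (by norm_num)) (zpow_ne_zero _ h0)) h1

end IsBraid

end QuantumSl2

namespace QuantumSl2

variable {k : Type*} [Field k]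

/-! ### Serre type sums -/

section Algebra

variable {A : Type*} [Ring A] [Algebra k A]

/-- The Serre type sum `∑_{r + s = m} (-1)^r q ^ (u r) E^(r) x E^(s)`. -/
noncomputable def serreSum (q : k) (E x : A) (m u : ℤ) : A :=
  ∑ r ∈ Finset.Icc (0 : ℤ) m, ((-1) ^ r * q ^ (u * r)) • (dp q E r * x * dp q E (m - r))

theorem dp_mul_dp_eq_zero (q : k) (E x : A) {m r : ℤ} (h : r ∉ Finset.Icc (0 : ℤ) m) :
    dp q E r * x * dp q E (m - r) = 0 := by
  rw [Finset.mem_Icc, not_and_or, not_le, not_le] at h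
  rcases h with h | h
  · rw [dp_of_neg q E h, zero_mul, zero_mul]
  · rw [dp_of_neg q E (by omega : m - r < 0), mul_zero]

theorem support_dp_mul_dp_finite (q : k) (E x : A) (m : ℤ) :
    (Function.support fun r : ℤ => dp q E r * x * dp q E (m - r)).Finite :=
  (Finset.Icc (0 : ℤ) m).finite_toSet.subset fun r hr => by
    by_contra h
    exact hr (dp_mul_dp_eq_zero q E x h)

theorem serreSum_eq_finsum (q : k) (E x : A) (m u : ℤ) :
    serreSum q E x m u =
      ∑ᶠ r : ℤ, ((-1) ^ r * q ^ (u * r)) • (dp q E r * x * dp q E (m - r)) := by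
  rw [finsum_eq_sum_of_support_subset]
  · rfl
  · intro r hr
    by_contra h
    exact hr (by simp only; rw [dp_mul_dp_eq_zero q E x h, smul_zero])

theorem serreSum_of_neg (q : k) (E x : A) {m : ℤ} (hm : m < 0) (u : ℤ) : serreSum q E x m u = 0 := by
  rw [serreSum, Finset.Icc_eq_empty (by omega), Finset.sum_empty]

@[simp] theorem serreSum_zero (q : k) (E x : A) (u : ℤ) : serreSum q E x 0 u = x := by
  simp [serreSum]

theorem serreSum_inv (q : k) (E x : A) (m u : ℤ) : serreSum q⁻¹ E x m u = serreSum q E x m (-u) := by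
  simp only [serreSum, dp_inv, inv_zpow', neg_mul]

theorem sum_antidiagonal_eq_serreSum {q : k} (E x : A) {m : ℤ} (hm : 0 ≤ m) (u : ℤ) :
    ∑ p ∈ Finset.HasAntidiagonal.antidiagonal m.toNat, ((-1) ^ p.1 * q ^ (u * p.1)) •
      (dp q E p.1 * x * dp q E p.2) = serreSum q E x m u := by
  obtain ⟨m, rfl⟩ := Int.eq_ofNat_of_zero_le hm
  rw [Int.toNat_natCast, serreSum]
  refine Finset.sum_bij (fun p _ => (p.1 : ℤ)) ?_ ?_ ?_ ?_
  · intro p hp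
    rw [Finset.HasAntidiagonal.mem_antidiagonal] at hp
    rw [Finset.mem_Icc]; omega
  · intro p hp p' hp' h
    rw [Finset.HasAntidiagonal.mem_antidiagonal] at hp hp'
    ext <;> omega
  · intro r hr
    rw [Finset.mem_Icc] at hr
    exact ⟨(r.toNat, (m - r).toNat), by rw [Finset.HasAntidiagonal.mem_antidiagonal]; omega, by simp [hr.1]⟩
  · intro p hp
    rw [Finset.HasAntidiagonal.mem_antidiagonal] at hp
    rw [zpow_natCast, show (m : ℤ) - p.1 = p.2 by omega]

theorem sum_antidiagonal_swap_eq_serreSum {q : k} (hq : q ≠ 0) (E x : A) {m : ℤ} (hm : 0 ≤ m) (u : ℤ) :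
    ∑ p ∈ Finset.HasAntidiagonal.antidiagonal m.toNat, ((-1) ^ p.1 * q ^ (u * p.1)) •
      (dp q E p.2 * x * dp q E p.1) = ((-1) ^ m * q ^ (u * m)) • serreSum q E x m (-u) := by
  rw [← sum_antidiagonal_eq_serreSum E x hm, Finset.smul_sum, ← Finset.Nat.sum_antidiagonal_swap]
  refine Finset.sum_congr rfl fun p hp => ?_
  rw [Finset.HasAntidiagonal.mem_antidiagonal] at hp
  rw [smul_smul]
  congr 1
  have h1 : m = p.1 + p.2 := by omega
  rw [h1, zpow_add₀ (by norm_num), mul_add, zpow_add₀ hq, Prod.fst_swap, neg_mul, zpow_neg, zpow_natCast,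
    zpow_natCast]
  have h2 : (-1 : k) ^ p.1 * (-1) ^ p.1 = 1 := by rw [← mul_pow]; simp
  have h3 := zpow_ne_zero (u * (p.1 : ℤ)) hq
  field_simp
  linear_combination (-1 : k) * h2

theorem serreSum_mul (q : k) (hq : Generic q) (E x : A) (m u : ℤ) :
    serreSum q E x m u * E = ∑ᶠ r : ℤ, ((-1) ^ r * q ^ (u * r) * qint q (m + 1 - r)) •
      (dp q E r * x * dp q E (m + 1 - r)) := by
  rw [serreSum_eq_finsum, finsum_mul']
  · refine finsum_congr fun r => ?_
    rw [smul_mul_assoc, mul_assoc, dp_mul_self hq, mul_smul_comm, smul_smul,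
      show m - r + 1 = m + 1 - r by ring]
  · exact support_smul_finite (fun r : ℤ => (-1 : k) ^ r * q ^ (u * r)) (support_dp_mul_dp_finite q E x m)

theorem mul_serreSum (q : k) (hq : Generic q) (E x : A) (m u : ℤ) :
    E * serreSum q E x m u = ∑ᶠ r : ℤ, (-((-1) ^ r * q ^ (u * (r - 1)) * qint q r)) •
      (dp q E r * x * dp q E (m + 1 - r)) := by
  rw [serreSum_eq_finsum, mul_finsum', ← finsum_comp_equiv (Equiv.addRight (1 : ℤ))
    (f := fun r => (-((-1) ^ r * q ^ (u * (r - 1)) * qint q r)) • (dp q E r * x * dp q E (m + 1 - r)))]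
  · refine finsum_congr fun r => ?_
    simp only [Equiv.coe_addRight]
    rw [mul_smul_comm, ← mul_assoc, ← mul_assoc, self_mul_dp hq, smul_mul_assoc, smul_mul_assoc, smul_smul,
      show m + 1 - (r + 1) = m - r by ring, add_sub_cancel_right,
      zpow_add_one₀ (by norm_num : (-1 : k) ≠ 0)]
    congr 1
    ring
  · exact support_smul_finite (fun r : ℤ => (-1 : k) ^ r * q ^ (u * r)) (support_dp_mul_dp_finite q E x m)

/-- The `q`-commutator of a Serre type sum with `E`; the exponent of `q` is chosen such that the result is again
a Serre type sum. -/
theorem serreSum_recursion_sub {q : k} (hq : Generic q) (E x : A) (m u : ℤ) :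
    serreSum q E x m u * E - q ^ (u - m - 1) • (E * serreSum q E x m u) =
      qint q (m + 1) • serreSum q E x (m + 1) (u - 1) := by
  have hX := support_dp_mul_dp_finite q E x (m + 1)
  have h0 := hq.ne_zero
  have h3 := hq.sub_ne_zero
  rw [serreSum_mul q hq, mul_serreSum q hq, sub_eq_add_neg, ← neg_smul,
    ← one_smul k (finsum fun r : ℤ => ((-1) ^ r * q ^ (u * r) * qint q (m + 1 - r)) •
      (dp q E r * x * dp q E (m + 1 - r)))]
  refine (finsum_linear (k := k) hX _ _).symm.trans ?_
  rw [serreSum_eq_finsum]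
  refine Eq.trans ?_ (smul_finsum' _
    (support_smul_finite (fun r : ℤ => (-1 : k) ^ r * q ^ ((u - 1) * r)) hX)).symm
  refine finsum_congr fun r => ?_
  rw [smul_smul]
  congr 1
  simp only [qint, show u * (r - 1) = u * r - u by ring, show (u - 1) * r = u * r - r by ring]
  generalize u * r = w
  simp only [zpow_add₀ h0, zpow_sub₀ h0, zpow_neg, zpow_one]
  have := zpow_ne_zero m h0
  have := zpow_ne_zero u h0
  have := zpow_ne_zero r h0
  field_simp
  ring

theorem serreSum_recursion_add {q : k} (hq : Generic q) (E x : A) (m u : ℤ) :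
    serreSum q E x m u * E - q ^ (u + m + 1) • (E * serreSum q E x m u) =
      qint q (m + 1) • serreSum q E x (m + 1) (u + 1) := by
  have h := serreSum_recursion_sub hq.inv E x m (-u)
  rw [serreSum_inv, serreSum_inv, qint_inv, neg_neg, inv_zpow', show -(-u - m - 1) = u + m + 1 by ring,
    show -(-u - 1) = u + 1 by ring] at h
  exact h

/-- The higher Serre relations, modulo a subspace `J` stable under left and right multiplication by
`E`. -/
theorem serreSum_mem {q : k} (hq : Generic q) {E x : A} {J : Submodule k A}
    (hl : ∀ y ∈ J, E * y ∈ J) (hr : ∀ y ∈ J, y * E ∈ J) {N : ℤ} (hN : 0 ≤ N)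
    (h : serreSum q E x (N + 1) 0 ∈ J) (d i : ℕ) (hi : i ≤ d) :
    serreSum q E x (N + 1 + d) (d - 2 * i) ∈ J := by
  induction d generalizing i with
  | zero =>
    obtain rfl : i = 0 := by omega
    simpa using h
  | succ d ih =>
    have hne := hq.qint_ne_zero (n := N + 1 + d + 1) (by omega)
    have key : ∀ y : A, qint q (N + 1 + d + 1) • y ∈ J → y ∈ J := fun y hy =>
      (J.smul_mem_iff hne).1 hy
    rcases Nat.lt_or_ge d i with h1 | h1
    · obtain rfl : i = d + 1 := by omega
      have h2 := ih d le_rfl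
      have h3 := J.sub_mem (hr _ h2) (J.smul_mem (q ^ ((d : ℤ) - 2 * d - (N + 1 + d) - 1)) (hl _ h2))
      rw [serreSum_recursion_sub hq] at h3
      convert key _ h3 using 2 <;> push_cast <;> ring
    · have h2 := ih i h1
      have h3 := J.sub_mem (hr _ h2) (J.smul_mem (q ^ ((d : ℤ) - 2 * i + (N + 1 + d) + 1)) (hl _ h2))
      rw [serreSum_recursion_add hq] at h3
      convert key _ h3 using 2 <;> push_cast <;> ring

end Algebra

variable {M : Type*} [AddCommGroup M] [Module k M]

namespace Sl2Weight

variable {q : k} {E B : Module.End k M} {W : ℤ → Submodule k M}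

theorem serreSum_apply (q : k) (E x : Module.End k M) (m u : ℤ) (z : M) :
    serreSum q E x m u z =
      ∑ᶠ r : ℤ, ((-1) ^ r * q ^ (u * r)) • (dp q E r (x (dp q E (m - r) z))) := by
  rw [serreSum_eq_finsum, ← LinearMap.applyₗ_apply_apply (R := k), map_finsum]
  · rfl
  · exact support_smul_finite (fun r : ℤ => (-1 : k) ^ r * q ^ (u * r)) (support_dp_mul_dp_finite q E x m)

theorem support_dp_apply_finite (q : k) (E x : Module.End k M) (m : ℤ) (z : M) :
    (Function.support fun r : ℤ => dp q E r (x (dp q E (m - r) z))).Finite :=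
  (support_dp_mul_dp_finite q E x m).subset fun r hr h => hr (by
    have := congrArg (fun f : Module.End k M => f z) h
    simpa using this)

theorem serreSum_mem_weight (h : Sl2Weight q E B W) {x : Module.End k M} {N : ℤ}
    (hx : ∀ n, ∀ z ∈ W n, x z ∈ W (n - N)) {n : ℤ} {z : M} (hz : z ∈ W n) (m u : ℤ) :
    serreSum q E x m u z ∈ W (n - N + 2 * m) := by
  rw [serreSum, LinearMap.sum_apply]
  refine Submodule.sum_mem _ fun r _ => ?_
  have := h.dpE_mem (hx _ _ (h.dpE_mem hz (m - r))) r
  rw [show n + 2 * (m - r) - N + 2 * r = n - N + 2 * m by ring] at this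
  exact (W _).smul_mem _ this

/-- The commutator of a Serre type sum with `B`, for `x` commuting with `B` and lowering the weights
by `N`. -/
theorem serreSum_B (h : Sl2Weight q E B W) {x : Module.End k M} (hxB : Commute x B) {N : ℤ}
    (hx : ∀ n, ∀ z ∈ W n, x z ∈ W (n - N)) {n : ℤ} {z : M} (hz : z ∈ W n) (m : ℤ) :
    serreSum q E x m (N - m + 1) (B z) - B (serreSum q E x m (N - m + 1) z) =
      (qint q (N - m + 1) * q ^ (-(n - N + 2 * (m - 1)))) •
        serreSum q E x (m - 1) (N - (m - 1) + 1) z := by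
  have h0 := h.generic.ne_zero
  have h3 := h.generic.sub_ne_zero
  have hX := support_dp_apply_finite q E x (m - 1) z
  have hxB' : ∀ y, x (B y) = B (x y) := fun y => congrArg (fun f : Module.End k M => f y) hxB.eq
  rw [sub_eq_iff_eq_add, serreSum_apply, serreSum_apply, serreSum_apply,
    map_finsum B (support_smul_finite _ (support_dp_apply_finite q E x m z)),
    smul_finsum' _ (support_smul_finite _ hX)]
  have hc := finsum_shift_add (-1) (c := fun r => ((-1) ^ r * q ^ ((N - m + 1) * r)) *
    qint q (n - N + 2 * m - r - 1)) (d := fun r => ((-1) ^ r * q ^ ((N - m + 1) * r)) *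
    qint q (n + m - r - 1)) hX
  trans ∑ᶠ r : ℤ, ((((-1) ^ r * q ^ ((N - m + 1) * r)) * qint q (n - N + 2 * m - r - 1)) •
        (fun r : ℤ => dp q E r (x (dp q E (m - 1 - r) z))) (r + -1) +
      (((-1) ^ r * q ^ ((N - m + 1) * r)) * qint q (n + m - r - 1)) •
        (fun r : ℤ => dp q E r (x (dp q E (m - 1 - r) z))) r) +
      ∑ᶠ r : ℤ, B (((-1) ^ r * q ^ ((N - m + 1) * r)) • dp q E r (x (dp q E (m - r) z)))
  · rw [← finsum_add_distrib]
    · refine finsum_congr fun r => ?_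
      rw [h.dpE_B hz, map_add, map_add, hxB', h.dpE_B (hx _ _ (h.dpE_mem hz _)), map_smul, map_smul,
        map_smul, smul_add, smul_add, smul_smul, smul_smul]
      simp only [show n + 2 * (m - r) - N + r - 1 = n - N + 2 * m - r - 1 by ring,
        show n + (m - r) - 1 = n + m - r - 1 by ring, show m - 1 - (r - 1) = m - r by ring,
        show m - 1 - r = m - r - 1 by ring, show r + -1 = r - 1 by ring]
      abel
    · exact ((support_shift_finite (-1) _ hX).union (support_smul_finite _ hX)).subset
        (Function.support_add _ _)
    · refine (support_smul_finite (fun r => (-1 : k) ^ r * q ^ ((N - m + 1) * r))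
        (support_dp_apply_finite q E x m z)).subset fun r hr h => hr ?_
      simp only at h ⊢
      rw [h, map_zero]
  · rw [hc]
    congr 1
    refine finsum_congr fun r => ?_
    rw [smul_smul]
    congr 1
    simp only [qint]
    rw [show (N - m + 1) * (r - -1) = (N - m + 1) * r + (N - m + 1) by ring,
      show (N - (m - 1) + 1) * r = (N - m + 1) * r + r by ring, show r - -1 = r + 1 by ring,
      zpow_add_one₀ (by norm_num : (-1 : k) ≠ 0)]
    generalize (N - m + 1) * r = w
    rw [show n - N + 2 * m - (r + 1) - 1 = (n + m - r - 1) - (N - m + 1) by ring,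
      show -(n - N + 2 * (m - 1)) = (N - m + 1) - (n + m - 1) by ring,
      show n + m - r - 1 = (n + m - 1) - r by ring]
    generalize N - m + 1 = a
    generalize n + m - 1 = b
    simp only [zpow_add₀ h0, zpow_sub₀ h0, zpow_neg]
    have := zpow_ne_zero a h0
    have := zpow_ne_zero b h0
    have := zpow_ne_zero r h0
    field_simp
    ring

end Sl2Weight

namespace Sl2Module

variable {q : k} {E B : Module.End k M} {W : ℤ → Submodule k M}

theorem ext_of_weight (h : Sl2Module q E B W) {f g : M →ₗ[k] M} (hfg : ∀ n, ∀ z ∈ W n, f z = g z) :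
    f = g := by
  have : LinearMap.eqLocus f g = ⊤ := by
    rw [eq_top_iff, ← h.iSup_eq_top]
    exact iSup_le fun n z hz => hfg n z hz
  ext z
  exact LinearMap.mem_eqLocus.1 (this ▸ Submodule.mem_top)

/-- `B^s` is injective on the weight space of weight `p ≥ s`. -/
theorem powB_injective (h : Sl2Module q E B W) (N : ℕ) (p : ℤ) (w : M) (hw : w ∈ W p)
    (hN : (E ^ N) w = 0) (s : ℕ) (hs : s ≤ p) (hB : (B ^ s) w = 0) : w = 0 := by
  induction N generalizing p w s with
  | zero => simpa using hN
  | succ N ih =>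
    have hdp : dp q B s w = 0 := dp_eq_zero_of_pow hB le_rfl
    have hdp1 : dp q B (s + 1) w = 0 := dp_eq_zero_of_pow hB (by omega)
    have h1 : dp q B (s + 1 : ℕ) (E w) = 0 := by
      have := h.E_dpB hw (s + 1)
      rw [hdp1, add_sub_cancel_right, hdp, map_zero, smul_zero, add_zero] at this
      push_cast; exact this.symm
    have h2 : (B ^ (s + 1)) (E w) = 0 := by
      rw [dp_natCast, LinearMap.smul_apply] at h1
      exact (smul_eq_zero.1 h1).resolve_left (inv_ne_zero (h.generic.qfact_ne_zero _))
    have hE : E w = 0 := ih (p + 2) (E w) (h.E_mem hw)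
      (by rw [← Module.End.mul_apply, ← pow_succ, hN]) (s + 1) (by push_cast; omega) h2
    obtain ⟨t, rfl⟩ := Int.eq_ofNat_of_zero_le (show 0 ≤ p by omega)
    obtain ⟨c, hc, h3⟩ := h.exists_pow_E_dpB hw hE s (by omega)
    rw [hdp, map_zero] at h3
    exact (smul_eq_zero.1 h3.symm).resolve_left hc

/-- The quantum Serre relation holds automatically on an integrable module: the sum commutes with `B`
and raises the weights by `N + 2`, hence kills the highest weight vectors. -/
theorem serreSum_eq_zero (h : Sl2Module q E B W) {x : Module.End k M} (hxB : Commute x B) {N : ℤ}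
    (hx : ∀ n, ∀ z ∈ W n, x z ∈ W (n - N)) (hN : 0 ≤ N) : serreSum q E x (N + 1) 0 = 0 := by
  have hc : ∀ z, serreSum q E x (N + 1) 0 (B z) = B (serreSum q E x (N + 1) 0 z) := by
    intro z
    have : serreSum q E x (N + 1) 0 ∘ₗ B = B ∘ₗ serreSum q E x (N + 1) 0 := by
      refine h.ext_of_weight fun n z hz => ?_
      have h1 := h.serreSum_B hxB hx hz (N + 1)
      rw [show N - (N + 1) + 1 = 0 by ring, qint_zero, zero_mul, zero_smul, sub_eq_zero] at h1
      exact h1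
    exact congrArg (fun f : Module.End k M => f z) this
  have hpow : ∀ (s : ℕ) z, serreSum q E x (N + 1) 0 ((B ^ s) z) = (B ^ s) (serreSum q E x (N + 1) 0 z) := by
    intro s z
    induction s with
    | zero => simp
    | succ s ih => rw [pow_succ', Module.End.mul_apply, hc, ih]; rfl
  have key : LinearMap.ker (serreSum q E x (N + 1) 0) = ⊤ := by
    refine h.eq_top_of_highest _ fun t η hη hE s _ => ?_
    rw [LinearMap.mem_ker, dp_natCast, LinearMap.smul_apply, map_smul, hpow]
    have h1 := h.serreSum_mem_weight hx hη (N + 1) 0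
    obtain ⟨K, hK⟩ := h.nilE (serreSum q E x (N + 1) 0 η)
    have h2 : (B ^ (t + 1)) η = 0 := by
      have := h.dpB_highest_eq_zero hη hE (s := ((t + 1 : ℕ) : ℤ)) (by omega) (by push_cast; omega)
      rw [dp_natCast, LinearMap.smul_apply] at this
      exact (smul_eq_zero.1 this).resolve_left (inv_ne_zero (h.generic.qfact_ne_zero _))
    rw [h.powB_injective K _ _ h1 hK (t + 1) (by push_cast; omega) (by rw [← hpow, h2, map_zero]),
      map_zero, smul_zero]
  exact LinearMap.ker_eq_top.1 key

/-- The higher Serre relations on an integrable module. -/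
theorem serreSum_eq_zero_of_lt (h : Sl2Module q E B W) {x : Module.End k M} (hxB : Commute x B) {N : ℤ}
    (hx : ∀ n, ∀ z ∈ W n, x z ∈ W (n - N)) (hN : 0 ≤ N) {m : ℤ} (hm : N < m) :
    serreSum q E x m (N - m + 1) = 0 := by
  obtain ⟨d, hd⟩ := Int.eq_ofNat_of_zero_le (show 0 ≤ m - (N + 1) by omega)
  have := serreSum_mem h.generic (E := E) (x := x) (J := ⊥) (by simp) (by simp) hN
    (by rw [Submodule.mem_bot]; exact h.serreSum_eq_zero hxB hx hN) d d le_rfl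
  rw [Submodule.mem_bot] at this
  rwa [show N + 1 + (d : ℤ) = m by omega, show (d : ℤ) - 2 * d = N - m + 1 by omega] at this

end Sl2Module

namespace IsBraid

variable {q : k} {E B : Module.End k M} {W : ℤ → Submodule k M} {T T' : M →ₗ[k] M}

/-- The braid group operator intertwines an operator `x` which commutes with `B` and lowers the weights
by `N` with the top Serre type sum `∑_{r + s = N} (-1)^r q ^ r E^(r) x E^(s)`.  The latter commutes with
`E` up to a scalar, which reduces the statement to highest weight vectors. -/
theorem apply_of_commute (hT : IsBraid q E B W T) (hT' : IsBraid q B E (fun n => W (-n)) T')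
    (h : Sl2Module q E B W) {x : Module.End k M} (hxB : Commute x B) {N : ℤ}
    (hx : ∀ n, ∀ z ∈ W n, x z ∈ W (n - N)) (hN : 0 ≤ N) (z : M) :
    T (x z) = serreSum q E x N 1 (T z) := by
  have h0 := h.generic.ne_zero
  have hxB' : ∀ y, x (B y) = B (x y) := fun y => congrArg (fun f : Module.End k M => f y) hxB.eq
  have hFE : ∀ y, serreSum q E x N 1 (E y) = q ^ (-N) • E (serreSum q E x N 1 y) := by
    intro y
    have h1 := serreSum_recursion_sub h.generic E x N 1
    rw [show (1 : ℤ) - 1 = 0 by rfl, h.serreSum_eq_zero hxB hx hN, smul_zero, sub_eq_zero,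
      show 1 - N - 1 = -N by ring] at h1
    exact congrArg (fun f : Module.End k M => f y) h1
  have key : LinearMap.eqLocus (T ∘ₗ x) (serreSum q E x N 1 ∘ₗ T) = ⊤ := by
    refine h.eq_top_of_highest _ ?_
    intro t η hη hE s _
    rw [LinearMap.mem_eqLocus, LinearMap.comp_apply, LinearMap.comp_apply]
    induction s with
    | zero =>
      simp only [Nat.cast_zero, dp_zero, Module.End.one_apply]
      -- On `η` both sides are `∑_r (-1)^r q^r E^(r) x B^(t - N + r) η`.
      have h2 : T η = dp q B t η := by rw [hT _ _ hη, h.braid_of_E_eq_zero hE]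
      rw [hT.eq_altSum hT' h (hx _ _ hη), altSum, Sl2Weight.serreSum_apply, h2]
      refine finsum_congr fun r => ?_
      have h3 : x (dp q B (r + (t - N)) η) = dp q B (r + (t - N)) (x η) :=
        congrArg (fun f : Module.End k M => f η) (commute_dp q hxB _).eq
      rw [← h3, h.dpE_dpB_highest hη hE, show r + ((t : ℤ) - N) = t - (N - r) by ring]
    | succ s ih =>
      have h2 := h.B_dpB η s
      have h3 := h.dpB_mem hη s
      apply smul_right_injective M (h.generic.qint_ne_zero (n := (s : ℤ) + 1) (by positivity))
      simp only
      push_cast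
      have h4 : qint q ((s : ℤ) + 1) • T (x (dp q B (s + 1) η)) = T (x (B (dp q B s η))) := by
        rw [h2, map_smul, map_smul]
      have h5 : qint q ((s : ℤ) + 1) • serreSum q E x N 1 (T (dp q B (s + 1) η)) =
          serreSum q E x N 1 (T (B (dp q B s η))) := by rw [h2, map_smul, map_smul]
      -- Both sides pass from `z` to `B z` in the same way, `x` by `hxB` and the Serre type sum by `hFE`.
      rw [h4, h5, hxB', hT.apply_B h (hx _ _ h3), ih (by omega),
        hT.apply_B h h3, map_neg, map_smul, hFE, smul_smul, ← zpow_add₀ h0]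
      rfl
  exact LinearMap.mem_eqLocus.1 (key ▸ Submodule.mem_top : z ∈ _)

/-- The analogue of `IsBraid.apply_of_commute` for an operator commuting with `E`. -/
theorem apply_of_commute' (hT : IsBraid q E B W T) (hT' : IsBraid q B E (fun n => W (-n)) T')
    (h : Sl2Module q E B W) {y : Module.End k M} (hyE : Commute y E) {N : ℤ}
    (hy : ∀ n, ∀ z ∈ W n, y z ∈ W (n + N)) (hN : 0 ≤ N) (z : M) :
    T (y z) = ((-1) ^ N * q ^ N)⁻¹ • serreSum q B y N 1 (T z) := by
  have h0 := h.generic.ne_zero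
  have key : T ∘ₗ y = (((-1) ^ N * q ^ N : k)⁻¹ • serreSum q B y N 1) ∘ₗ T := by
    refine h.ext_of_weight fun n z hz => ?_
    have h1 := apply_of_commute (W := fun n => W (-n)) hT' (by simpa using hT) h.swap hyE (N := N)
      (fun n z hz => by have := hy _ z hz; rwa [show -n + N = -(n - N) by ring] at this) hN z
    rw [hT.eq_swap hT' h hz, hT.eq_swap hT' h (hy _ _ hz), map_smul] at h1
    have h2 : ((-1) ^ n * q ^ n : k) ≠ 0 := mul_ne_zero (zpow_ne_zero _ (by norm_num)) (zpow_ne_zero _ h0)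
    have h3 : ((-1) ^ N * q ^ N : k) ≠ 0 := mul_ne_zero (zpow_ne_zero _ (by norm_num)) (zpow_ne_zero _ h0)
    apply smul_right_injective M (mul_ne_zero h2 h3)
    simp only [LinearMap.comp_apply, LinearMap.smul_apply]
    rw [smul_smul, mul_inv_cancel_right₀ h3, ← h1, zpow_add₀ (by norm_num : (-1 : k) ≠ 0),
      zpow_add₀ h0]
    congr 1
    ring
  exact congrArg (fun f : Module.End k M => f z) key

end IsBraid
end QuantumSl2

namespace BorcherdsCartanMatrix

open QuantumSl2

variable {I : Type u} {C : BorcherdsCartanMatrix I} {ν : I → ℕ → Qq}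

/-! ### Relations in the quantum Borcherds-Bozec algebra -/

theorem qq_ne_zero : qq ≠ 0 := RatFunc.X_ne_zero

theorem qi_ne_zero (i : I) : C.qi i ≠ 0 := zpow_ne_zero _ qq_ne_zero

theorem generic_qi (i : I) : Generic (C.qi i) where
  ne_zero := qi_ne_zero i
  pow_ne_one n hn h := hn (by
    have := qi_zpow_injective (C := C) i (a₁ := n) (a₂ := 0) (by simpa using h)
    simpa using this)

theorem qq_zpow_injective : Function.Injective fun n : ℤ => qq ^ n := by
  let D : BorcherdsCartanMatrix Unit :=
    { a := fun _ _ => 2, s := fun _ => 1, diag := by simp, offdiag := by simp, s_pos := by simp,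
      symm := by simp }
  have := qi_zpow_injective (C := D) ()
  simpa [qi, D] using this

theorem HasPositiveExpansion.ne_zero {x : Qq} (hx : HasPositiveExpansion x) : x ≠ 0 := by
  obtain ⟨g, N, D, hg, hD, hN, rfl⟩ := hx
  have hinj : Function.Injective (Polynomial.aeval (R := ℚ) (qq⁻¹)) := by
    rw [← transcendental_iff_injective]
    intro h
    refine RatFunc.transcendental_X (K := ℚ) ?_
    have := h.inv
    rw [inv_inv] at this
    convert this
    exact Subsingleton.elim _ _
  have hN0 : N ≠ 0 := by
    rintro rfl
    have h1 : PowerSeries.map (Nat.castRingHom ℚ) g ≠ 0 := by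
      intro h
      have := congrArg PowerSeries.constantCoeff h
      rw [← PowerSeries.coeff_zero_eq_constantCoeff_apply, PowerSeries.coeff_map,
        PowerSeries.coeff_zero_eq_constantCoeff_apply, hg] at this
      simp at this
    have h2 : (D : PowerSeries ℚ) ≠ 0 := by
      rw [ne_eq, Polynomial.coe_eq_zero_iff]; exact hD
    exact mul_ne_zero h2 h1 (by rw [← hN]; simp)
  exact div_ne_zero ((map_ne_zero_iff _ hinj).2 hN0) ((map_ne_zero_iff _ hinj).2 hD)

@[simp] theorem root_coroot (i j : I) : C.root j (coroot i) = C.a i j := by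
  simp [root, coroot]

theorem coroot_eq_of_smul (i : I) (μ : WeightLattice I) (n : ℤ) : μ (n • coroot i) = n * μ (coroot i) := by
  rw [map_smul, smul_eq_mul]

variable (C ν)

/-- The generator `e_{il}` of `U`. -/
noncomputable def ue (i : I) (l : ℕ) : C.QAlg ν := C.toU ν (C.ge i l)

/-- The generator `f_{il}` of `U`. -/
noncomputable def uf (i : I) (l : ℕ) : C.QAlg ν := C.toU ν (C.gf i l)

variable {C ν}

theorem toU_gq (h : DualWeightLattice I) : C.toU ν (C.gq h) = C.qh ν h := rfl

theorem toU_gK (i : I) (n : ℤ) : C.toU ν (C.gK i n) = C.Kpow ν i n := rfl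

theorem toU_ge (i : I) (l : ℕ) : C.toU ν (C.ge i l) = C.ue ν i l := rfl

theorem toU_gf (i : I) (l : ℕ) : C.toU ν (C.gf i l) = C.uf ν i l := rfl

theorem toU_rel {x y : C.FreeGen} (h : C.Rel ν x y) : C.toU ν x = C.toU ν y :=
  RingQuot.mkAlgHom_rel Qq h

@[simp] theorem ue_zero (i : I) : C.ue ν i 0 = 1 := by simp [ue, ge]

@[simp] theorem uf_zero (i : I) : C.uf ν i 0 = 1 := by simp [uf, gf]

theorem qh_zero : C.qh ν 0 = 1 := by rw [qh, toU_rel .q_zero, map_one]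

theorem qh_add (h h' : DualWeightLattice I) : C.qh ν (h + h') = C.qh ν h * C.qh ν h' := by
  rw [qh, qh, qh, ← map_mul, toU_rel (.q_add h h')]

theorem qh_mul_neg (h : DualWeightLattice I) : C.qh ν h * C.qh ν (-h) = 1 := by
  rw [← qh_add, add_neg_cancel, qh_zero]

theorem qh_neg_mul (h : DualWeightLattice I) : C.qh ν (-h) * C.qh ν h = 1 := by
  rw [← qh_add, neg_add_cancel, qh_zero]

theorem Kpow_eq (i : I) (n : ℤ) : C.Kpow ν i n = C.qh ν ((n * C.s i) • coroot i) := rfl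

theorem qh_mul_of_mem {α : WeightLattice I} {u : C.QAlg ν} (hu : u ∈ C.rootSpace ν α)
    (h : DualWeightLattice I) : C.qh ν h * u = qq ^ (α h) • (u * C.qh ν h) := by
  have h1 := congrArg (· * C.qh ν h) (hu h)
  simp only [mul_assoc, qh_neg_mul, mul_one, smul_mul_assoc] at h1
  exact h1

theorem mem_rootSpace_iff {α : WeightLattice I} {u : C.QAlg ν} :
    u ∈ C.rootSpace ν α ↔ ∀ h, C.qh ν h * u * C.qh ν (-h) = qq ^ (α h) • u := Iff.rfl

theorem mul_mem_rootSpace {α β : WeightLattice I} {u w : C.QAlg ν} (hu : u ∈ C.rootSpace ν α)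
    (hw : w ∈ C.rootSpace ν β) : u * w ∈ C.rootSpace ν (α + β) := by
  rw [mem_rootSpace_iff]
  intro h
  rw [← mul_assoc, qh_mul_of_mem hu, smul_mul_assoc, smul_mul_assoc, mul_assoc, mul_assoc,
    ← mul_assoc (C.qh ν h), mem_rootSpace_iff.1 hw h, mul_smul_comm, smul_smul, LinearMap.add_apply,
    zpow_add₀ qq_ne_zero]

theorem one_mem_rootSpace : (1 : C.QAlg ν) ∈ C.rootSpace ν 0 := by
  rw [mem_rootSpace_iff]
  intro h
  simp [qh_mul_neg]

theorem ue_mem_rootSpace {j : I} {l : ℕ} (hj : C.IsIndex j l) :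
    C.ue ν j l ∈ C.rootSpace ν (l • C.root j) := by
  rw [mem_rootSpace_iff]
  intro h
  have := toU_rel (ν := ν) (.q_e h j l hj)
  rw [map_mul, map_mul, map_smul] at this
  simpa [LinearMap.smul_apply, toU_gq, toU_ge, toU_gf] using this

theorem uf_mem_rootSpace {j : I} {l : ℕ} (hj : C.IsIndex j l) :
    C.uf ν j l ∈ C.rootSpace ν (-(l • C.root j)) := by
  rw [mem_rootSpace_iff]
  intro h
  have := toU_rel (ν := ν) (.q_f h j l hj)
  rw [map_mul, map_mul, map_smul] at this
  simpa [LinearMap.smul_apply, toU_gq, toU_ge, toU_gf] using this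

theorem commute_ue_uf {i j : I} {k l : ℕ} (hi : C.IsIndex i k) (hj : C.IsIndex j l) (hij : i ≠ j) :
    Commute (C.ue ν i k) (C.uf ν j l) := by
  have := toU_rel (ν := ν) (.comm_ef i j k l hi hj hij)
  rwa [map_mul, map_mul] at this

theorem IsReal.isIndex {i : I} (hi : C.IsReal i) : C.IsIndex i 1 := Or.inl ⟨hi, rfl⟩

theorem ue_uf_relation {i : I} {k l : ℕ} (hk : C.IsIndex i k) (hl : C.IsIndex i l) :
    ∑ n ∈ Finset.range (min k l + 1),
      (C.qpar i ^ ((n : ℤ) * (((k - n : ℕ) : ℤ) - ((l - n : ℕ) : ℤ))) * nu0 ν i n) •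
        (C.Kpow ν i (-(n : ℤ)) * C.uf ν i (l - n) * C.ue ν i (k - n)) =
    ∑ n ∈ Finset.range (min k l + 1),
      (C.qpar i ^ ((n : ℤ) * (((l - n : ℕ) : ℤ) - ((k - n : ℕ) : ℤ))) * nu0 ν i n) •
        (C.Kpow ν i (n : ℤ) * C.ue ν i (k - n) * C.uf ν i (l - n)) := by
  have := toU_rel (ν := ν) (.ef i k l hk hl)
  simpa only [map_sum, map_smul, map_mul, toU_gK, toU_ge, toU_gf] using this

theorem ue_uf_sub {i : I} (hi : C.IsReal i) :
    C.ue ν i 1 * C.uf ν i 1 - C.uf ν i 1 * C.ue ν i 1 =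
      ν i 1 • (C.Kpow ν i (-1) - C.Kpow ν i 1) := by
  have := ue_uf_relation hi.isIndex hi.isIndex (ν := ν)
  simp only [Finset.sum_range_succ, min_self, Finset.sum_range_zero, nu0] at this
  have h0 : C.Kpow ν i 0 = 1 := by rw [Kpow_eq, zero_mul, zero_smul, qh_zero]
  simp [h0] at this
  rw [smul_sub, sub_eq_iff_eq_add, add_comm, ← add_sub_assoc, this, add_sub_cancel_right]

theorem index_word {L : List C.Index} {j : I} {l : ℕ}
    (h : (L.map fun x => Finsupp.single x.i x.l).sum = Finsupp.single j l) :
    (∀ x ∈ L, x.i = j) ∧ (L.map fun x => x.l).sum = l := by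
  classical
  have key : ∀ (L : List C.Index) (a : I),
      (L.map fun x => Finsupp.single x.i x.l).sum a = (L.map fun x => if x.i = a then x.l else 0).sum := by
    intro L a
    induction L with
    | nil => simp
    | cons x L ih => simp [ih, Finsupp.single_apply]
  have h1 : ∀ x ∈ L, x.i = j := by
    intro x hx
    by_contra hne
    have h2 := key L x.i
    rw [h, Finsupp.single_apply, if_neg (Ne.symm hne)] at h2
    have h3 : (if x.i = x.i then x.l else 0) ∈ L.map fun y => if y.i = x.i then y.l else 0 :=
      List.mem_map_of_mem (f := fun y : C.Index => if y.i = x.i then y.l else 0) hx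
    have h4 := List.sum_eq_zero_iff.1 h2.symm _ h3
    rw [if_pos rfl] at h4
    rcases x.isIndex with h5 | h5 <;> omega
  refine ⟨h1, ?_⟩
  have h2 := key L j
  rw [h, Finsupp.single_eq_same] at h2
  rw [h2]
  congr 1
  exact List.map_congr_left fun x hx => by rw [if_pos (h1 x hx)]

theorem freeE_mem_homogeneous {j : I} {l : ℕ} (hj : C.IsIndex j l) :
    C.freeE j l ∈ C.homogeneous (Finsupp.single j l) := by
  have hl : l ≠ 0 := by rcases hj with h | h <;> omega
  rw [freeE, if_neg hl, dif_pos hj]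
  exact Submodule.subset_span ⟨[⟨j, l, hj⟩], by simp, by simp⟩

/-- Only the homogeneity of the primitive generators matters for their behaviour under the braid group
operators. -/
theorem primFree_mem_homogeneous {j : I} {l : ℕ} (hj : C.IsIndex j l) :
    C.primFree j l ∈ C.homogeneous (Finsupp.single j l) := by
  rw [primFree]
  split_ifs with h1 h2
  · exact freeE_mem_homogeneous hj
  · exact h2.choose_spec.1
  · exact zero_mem _

theorem lift_primFree_induction {A : Type*} [Ring A] [Algebra Qq A] (g : C.Index → A) {j : I} {l : ℕ}
    (hj : C.IsIndex j l) (p : Submodule Qq A)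
    (hp : ∀ L : List C.Index, (∀ x ∈ L, x.i = j) → (L.map fun x => x.l).sum = l → (L.map g).prod ∈ p) :
    FreeAlgebra.lift Qq g (C.primFree j l) ∈ p := by
  have h := primFree_mem_homogeneous hj
  rw [homogeneous] at h
  refine Submodule.span_induction (p := fun x _ => FreeAlgebra.lift Qq g x ∈ p) ?_ ?_ ?_ ?_ h
  · rintro w ⟨L, rfl, hL⟩
    obtain ⟨h1, h2⟩ := index_word hL
    rw [map_list_prod, List.map_map]
    have : (⇑(FreeAlgebra.lift Qq g) ∘ FreeAlgebra.ι Qq) = g := by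
      ext x; simp
    rw [this]
    exact hp L h1 h2
  · simp
  · intro x y _ _ hx hy; rw [map_add]; exact p.add_mem hx hy
  · intro c x _ hx; rw [map_smul]; exact p.smul_mem c hx

theorem pa_mem_rootSpace {j : I} {l : ℕ} (hj : C.IsIndex j l) :
    C.pa ν j l ∈ C.rootSpace ν (l • C.root j) := by
  refine lift_primFree_induction _ hj (C.rootSpace ν (l • C.root j)) fun L hL hl => ?_
  subst hl
  clear hj
  induction L with
  | nil => simpa using one_mem_rootSpace
  | cons x L ih =>
    rw [List.map_cons, List.map_cons, List.prod_cons, List.sum_cons, add_smul]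
    refine mul_mem_rootSpace ?_ (ih fun y hy => hL y (List.mem_cons_of_mem _ hy))
    rw [← hL x List.mem_cons_self]
    exact ue_mem_rootSpace x.isIndex

theorem pb_mem_rootSpace {j : I} {l : ℕ} (hj : C.IsIndex j l) :
    C.pb ν j l ∈ C.rootSpace ν (-(l • C.root j)) := by
  refine lift_primFree_induction _ hj (C.rootSpace ν (-(l • C.root j))) fun L hL hl => ?_
  subst hl
  clear hj
  induction L with
  | nil => simpa using one_mem_rootSpace
  | cons x L ih =>
    rw [List.map_cons, List.map_cons, List.prod_cons, List.sum_cons, add_smul, neg_add]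
    refine mul_mem_rootSpace ?_ (ih fun y hy => hL y (List.mem_cons_of_mem _ hy))
    rw [← hL x List.mem_cons_self]
    exact uf_mem_rootSpace x.isIndex

theorem pa_real {i : I} (hi : C.IsReal i) : C.pa ν i 1 = C.ue ν i 1 := by
  have h : C.IsIndex i 1 := hi.isIndex
  rw [pa, primFree, if_pos hi, freeE, if_neg one_ne_zero, dif_pos h, FreeAlgebra.lift_ι_apply]
  rfl

theorem pb_real {i : I} (hi : C.IsReal i) : C.pb ν i 1 = C.uf ν i 1 := by
  have h : C.IsIndex i 1 := hi.isIndex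
  rw [pb, primFree, if_pos hi, freeE, if_neg one_ne_zero, dif_pos h, FreeAlgebra.lift_ι_apply]
  rfl

theorem commute_pa_uf {i j : I} {k l : ℕ} (hi : C.IsIndex i k) (hj : C.IsIndex j l) (hij : j ≠ i) :
    Commute (C.pa ν j l) (C.uf ν i k) := by
  refine lift_primFree_induction _ hj
    (Subalgebra.toSubmodule (Subalgebra.centralizer Qq {C.uf ν i k})) (fun L hL _ => ?_) _ rfl |>.symm
  refine Subalgebra.list_prod_mem _ fun y hy => ?_
  obtain ⟨x, hx, rfl⟩ := List.mem_map.1 hy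
  rw [Subalgebra.mem_centralizer_iff]
  rintro _ rfl
  exact (commute_ue_uf x.isIndex hi (by rw [hL x hx]; exact hij)).symm.eq

theorem commute_pb_ue {i j : I} {k l : ℕ} (hi : C.IsIndex i k) (hj : C.IsIndex j l) (hij : j ≠ i) :
    Commute (C.pb ν j l) (C.ue ν i k) := by
  refine lift_primFree_induction _ hj
    (Subalgebra.toSubmodule (Subalgebra.centralizer Qq {C.ue ν i k})) (fun L hL _ => ?_) _ rfl |>.symm
  refine Subalgebra.list_prod_mem _ fun y hy => ?_
  obtain ⟨x, hx, rfl⟩ := List.mem_map.1 hy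
  rw [Subalgebra.mem_centralizer_iff]
  rintro _ rfl
  exact (commute_ue_uf hi x.isIndex (by rw [hL x hx]; exact hij.symm)).eq

end BorcherdsCartanMatrix

namespace QuantumSl2

/-- A sum over pairs `(a, a + j)` of natural numbers as a sum over integers. -/
theorem finsum_pair {M : Type*} [AddCommMonoid M] (f : ℤ → M) (j : ℤ)
    (h0 : ∀ a, a < 0 ∨ a + j < 0 → f a = 0) :
    ∑ᶠ p : ℕ × ℕ, (if (p.2 : ℤ) = p.1 + j then f p.1 else 0) = ∑ᶠ a, f a := by
  classical
  have hinj : Set.InjOn (fun p : ℕ × ℕ => (p.1 : ℤ)) {p : ℕ × ℕ | (p.2 : ℤ) = p.1 + j} := by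
    intro p hp p' hp' h
    simp only [Set.mem_ofPred_eq] at hp hp' h
    ext <;> omega
  have h1 := finsum_mem_image (f := f) hinj
  rw [finsum_mem_def, finsum_mem_def] at h1
  have h2 : (fun p : ℕ × ℕ => if (p.2 : ℤ) = p.1 + j then f p.1 else 0) =
      Set.indicator {p : ℕ × ℕ | (p.2 : ℤ) = p.1 + j} (fun p => f p.1) := by
    ext p; simp [Set.indicator_apply]
  rw [h2, ← h1]
  refine finsum_congr fun a => ?_
  rw [Set.indicator_apply]
  split_ifs with h
  · rfl
  · symm
    apply h0
    by_contra! h3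
    exact h ⟨(a.toNat, (a + j).toNat), by simp [h3.1, h3.2], by simp [h3.1]⟩

end QuantumSl2

namespace BorcherdsCartanMatrix

open QuantumSl2

variable {I : Type u} {C : BorcherdsCartanMatrix I} {ν : I → ℕ → Qq}

/-! ### The symmetries of the objects of the category `𝓞` -/

theorem qInt_eq (i : I) (n : ℕ) : C.qInt i n = qint (C.qi i) n := by
  rw [qInt, qint, zpow_neg, zpow_natCast, inv_pow]

theorem qFact_eq (i : I) (n : ℕ) : C.qFact i n = qfact (C.qi i) n := by
  rw [qFact, qfact]
  induction n with
  | zero => simp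
  | succ n ih =>
    rw [Finset.prod_Icc_succ_top (by omega), ih, Finset.prod_range_succ, qInt_eq]
    push_cast; rfl

theorem qFact_eq_zpow (i : I) {e : ℤ} (he : e = 1 ∨ e = -1) (n : ℕ) :
    C.qFact i n = qfact (C.qi i ^ e) n := by
  rcases he with rfl | rfl
  · rw [zpow_one, qFact_eq]
  · rw [zpow_neg_one, qfact_inv, qFact_eq]

theorem qint_zpow (q : Qq) {e : ℤ} (he : e = 1 ∨ e = -1) (n : ℤ) : qint (q ^ e) n = qint q n := by
  rcases he with rfl | rfl
  · rw [zpow_one]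
  · rw [zpow_neg_one, qint_inv]

theorem generic_zpow (i : I) {e : ℤ} (he : e = 1 ∨ e = -1) : Generic (C.qi i ^ e) := by
  rcases he with rfl | rfl
  · rw [zpow_one]; exact generic_qi i
  · rw [zpow_neg_one]; exact (generic_qi i).inv

theorem divPow_eq_dp {A : Type*} [Ring A] [Algebra Qq A] (i : I) {e : ℤ} (he : e = 1 ∨ e = -1) (x : A)
    (n : ℕ) : C.divPow i x n = dp (C.qi i ^ e) x n := by
  rw [divPow, dp_natCast, qFact_eq_zpow i he]

theorem map_dp {A A' : Type*} [Ring A] [Algebra Qq A] [Ring A'] [Algebra Qq A'] (g : A →ₐ[Qq] A') (q : Qq)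
    (x : A) (n : ℤ) : g (dp q x n) = dp q (g x) n := by
  rw [dp, dp]; split_ifs
  · rw [map_smul, map_pow]
  · exact map_zero g

theorem map_serreSum {A A' : Type*} [Ring A] [Algebra Qq A] [Ring A'] [Algebra Qq A'] (g : A →ₐ[Qq] A')
    (q : Qq) (E x : A) (m u : ℤ) : g (serreSum q E x m u) = serreSum q (g E) (g x) m u := by
  simp only [serreSum, map_sum, map_smul, map_mul, map_dp]

section Modules

variable {M : Type v} [AddCommGroup M] [Module Qq M] [Module (C.QAlg ν) M]
  [IsScalarTower Qq (C.QAlg ν) M]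

variable (M) in
/-- The action of `U` on a module. -/
noncomputable abbrev act : C.QAlg ν →ₐ[Qq] Module.End Qq M := Algebra.lsmul Qq Qq M

theorem mem_kSpace_iff {i : I} {n : ℤ} {z : M} :
    z ∈ C.kSpace ν M i n ↔ C.Kpow ν i 1 • z = C.qi i ^ n • z := by
  rw [kSpace, Module.End.mem_eigenspace_iff]; rfl

theorem smul_mem_kSpace {α : WeightLattice I} {u : C.QAlg ν} (hu : u ∈ C.rootSpace ν α) (i : I) {n : ℤ}
    {z : M} (hz : z ∈ C.kSpace ν M i n) : u • z ∈ C.kSpace ν M i (n + α (coroot i)) := by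
  rw [mem_kSpace_iff] at hz ⊢
  rw [Kpow_eq] at hz ⊢
  rw [← mul_smul (C.qh ν _) u z, qh_mul_of_mem hu, smul_assoc, mul_smul u, hz, smul_algebra_smul_comm, smul_smul,
    map_smul, smul_eq_mul, one_mul, zpow_mul, ← qi, ← zpow_add₀ (qi_ne_zero i), add_comm n]

theorem smul_mem_weightSpace {α μ : WeightLattice I} {u : C.QAlg ν} (hu : u ∈ C.rootSpace ν α)
    {z : M} (hz : z ∈ C.weightSpace ν M μ) : u • z ∈ C.weightSpace ν M (μ + α) := by
  intro h
  rw [← mul_smul, qh_mul_of_mem hu, smul_assoc, mul_smul, hz h, smul_algebra_smul_comm, smul_smul,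
    ← zpow_add₀ qq_ne_zero, LinearMap.add_apply, add_comm]

theorem Kpow_smul {i : I} {n : ℤ} {z : M} (hz : z ∈ C.kSpace ν M i n) (m : ℤ) :
    C.Kpow ν i m • z = C.qi i ^ (m * n) • z := by
  have hK : ∀ a b : ℤ, C.Kpow ν i (a + b) = C.Kpow ν i a * C.Kpow ν i b := by
    intro a b
    rw [Kpow_eq, Kpow_eq, Kpow_eq, ← qh_add, ← add_smul, add_mul]
  have hK0 : C.Kpow ν i 0 = 1 := by rw [Kpow_eq, zero_mul, zero_smul, qh_zero]
  have h0 := qi_ne_zero (C := C) i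
  rw [mem_kSpace_iff] at hz
  have hinv : C.Kpow ν i (-1) • z = C.qi i ^ (-n) • z := by
    have h1 := congrArg (C.Kpow ν i (-1) • ·) hz
    simp only [← mul_smul, ← hK] at h1
    rw [show (-1 : ℤ) + 1 = 0 by rfl, hK0, one_smul, smul_algebra_smul_comm] at h1
    rw [h1, smul_smul, ← zpow_add₀ h0, neg_add_cancel, zpow_zero, one_smul, ← h1]
  induction m with
  | zero => simp [hK0]
  | succ m ih =>
    rw [hK, mul_smul, hz, smul_algebra_smul_comm, ih, smul_smul (C.qi i ^ _), ← zpow_add₀ h0]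
    congr 2; ring
  | pred m ih =>
    rw [sub_eq_add_neg, hK, mul_smul, hinv, smul_algebra_smul_comm, ih, smul_smul (C.qi i ^ _), ← zpow_add₀ h0]
    congr 2; ring

theorem B_mem_rootSpace {i : I} (hi : C.IsReal i) : C.B ν i ∈ C.rootSpace ν (-C.root i) := by
  rw [B]
  have := pb_mem_rootSpace (ν := ν) hi.isIndex
  rw [one_smul] at this
  exact (C.rootSpace ν _).smul_mem _ this

theorem pa_real_mem_rootSpace {i : I} (hi : C.IsReal i) : C.pa ν i 1 ∈ C.rootSpace ν (C.root i) := by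
  have := pa_mem_rootSpace (ν := ν) hi.isIndex
  rwa [one_smul] at this

theorem qi_inv_sub_ne_zero (i : I) : (C.qi i)⁻¹ - C.qi i ≠ 0 := by
  rw [← neg_sub]; exact neg_ne_zero.2 (generic_qi i).sub_ne_zero

theorem pa_B_sub {i : I} (hi : C.IsReal i) (hν : ν i 1 ≠ 0) :
    C.pa ν i 1 * C.B ν i - C.B ν i * C.pa ν i 1 =
      (C.qi i - (C.qi i)⁻¹)⁻¹ • (C.Kpow ν i 1 - C.Kpow ν i (-1)) := by
  rw [B, mul_smul_comm, smul_mul_assoc, ← smul_sub, pa_real hi, pb_real hi, ue_uf_sub hi, smul_smul,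
    mul_inv, mul_right_comm, inv_mul_cancel₀ hν, one_mul, ← neg_sub (C.qi i), inv_neg, neg_smul, ← smul_neg,
    neg_sub]

/-- An object of `𝓞` is an integrable module of `U_q(𝔰𝔩₂)` under `𝚊_i` and `B_i`, for both `q_i` and `q_i⁻¹`. -/
theorem sl2Module (hM : C.IsCategoryO ν M) {i : I} (hi : C.IsReal i) (hν : ν i 1 ≠ 0) {e : ℤ}
    (he : e = 1 ∨ e = -1) :
    Sl2Module (C.qi i ^ e) (act M (C.pa ν i 1)) (act M (C.B ν i)) (C.kSpace ν M i) where
  generic := generic_zpow i he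
  E_mem {n z} hz := by
    have := smul_mem_kSpace (pa_real_mem_rootSpace (ν := ν) hi) i hz
    rwa [root_coroot, show C.a i i = 2 from hi] at this
  B_mem {n z} hz := by
    have := smul_mem_kSpace (B_mem_rootSpace (ν := ν) hi) i hz
    rwa [LinearMap.neg_apply, root_coroot, show C.a i i = 2 from hi] at this
  comm {n z} hz := by
    rw [qint_zpow _ he]
    change C.pa ν i 1 • C.B ν i • z - C.B ν i • C.pa ν i 1 • z = _
    rw [← mul_smul, ← mul_smul, ← sub_smul, pa_B_sub hi hν, smul_assoc, sub_smul, Kpow_smul hz, Kpow_smul hz,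
      ← sub_smul, smul_smul, qint, one_mul, neg_one_mul, div_eq_inv_mul]
  iSup_eq_top := (hM.kSpace_isInternal i).submodule_iSup_eq_top
  nilE z := by
    obtain ⟨N, hN⟩ := hM.nilpotent_a i hi z
    exact ⟨N, by rw [← map_pow]; exact hN⟩
  nilB z := by
    obtain ⟨N, hN⟩ := hM.nilpotent_B i hi z
    exact ⟨N, by rw [← map_pow]; exact hN⟩

theorem glue_apply (hM : C.IsCategoryO ν M) (i : I) (φ : ℤ → M →ₗ[Qq] M) {n : ℤ} {z : M}
    (hz : z ∈ C.kSpace ν M i n) : C.glue hM i φ z = φ n z := by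
  have h1 : (LinearEquiv.ofBijective (DirectSum.coeLinearMap fun n : ℤ => C.kSpace ν M i n)
      (hM.coe_bijective i)).symm z = DirectSum.lof Qq ℤ (fun n : ℤ => C.kSpace ν M i n) n ⟨z, hz⟩ := by
    rw [LinearEquiv.symm_apply_eq, LinearEquiv.ofBijective_apply, DirectSum.coeLinearMap_lof]
  rw [glue, LinearMap.comp_apply, LinearEquiv.coe_coe, h1, DirectSum.toModule_lof]
  rfl

/-- The terms with `c ≥ 1` of the triple sum cancel. -/
theorem tripleSum_eq_braid {i : I} {e : ℤ} (he : e = 1 ∨ e = -1) {x y : C.QAlg ν}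
    {W : ℤ → Submodule Qq M} (h : Sl2Module (C.qi i ^ e) (act M y) (act M x) W)
    (hx : ∀ z : M, ∃ N : ℕ, x ^ N • z = 0) (hy : ∀ z : M, ∃ N : ℕ, y ^ N • z = 0) {n : ℤ} {z : M}
    (hz : z ∈ W n) : C.tripleSum i e x y hx hy n z = braid (C.qi i ^ e) (act M y) (act M x) n z := by
  set q := C.qi i ^ e with hq
  have h0 := h.generic.ne_zero
  let F : ℕ × ℕ × ℕ → M := fun t =>
    if (t.2.1 : ℤ) - t.2.2 + t.1 = n then C.tripleTerm i e x y (t.2.1, t.2.2, t.1) z else 0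
  let σ : ℕ × ℕ × ℕ ≃ ℕ × ℕ × ℕ :=
    ⟨fun t => (t.2.2, t.1, t.2.1), fun t => (t.2.1, t.2.2, t.1), fun _ => rfl, fun _ => rfl⟩
  have hF : ∑ᶠ t, F t = C.tripleSum i e x y hx hy n z := by
    change _ = ∑ᶠ t : ℕ × ℕ × ℕ, _
    rw [← finsum_comp_equiv σ]
    rfl
  have hfin : (Function.support F).Finite :=
    (tripleTerm_finite i e hx hy n z).preimage σ.symm.injective.injOn
  rw [← hF, finsum_curry F hfin]
  have hc : ∀ c : ℕ, ∑ᶠ p : ℕ × ℕ, F (c, p) = ((-1) ^ ((c : ℤ) - n) * q ^ ((c : ℤ) - n)) •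
      altSum q (act M y) (act M x) (1 - c) (c - n) (dp q (act M x) c z) := by
    intro c
    rw [altSum, smul_finsum' _ (altSum_support_finite q (act M x) (h.nilE _) _ _), ← finsum_pair _ ((c : ℤ) - n)]
    · refine finsum_congr fun p => ?_
      simp only [F]
      have : ((p.1 : ℤ) - p.2 + c = n) ↔ ((p.2 : ℤ) = p.1 + (c - n)) := by omega
      rw [if_congr this rfl rfl]
      refine if_ctx_congr Iff.rfl (fun hp => ?_) fun _ => rfl
      rw [tripleTerm, smul_smul ((-1 : Qq) ^ ((c : ℤ) - n) * _)]
      congr 1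
      · simp only
        rw [zpow_mul, ← hq, ← zpow_natCast (-1 : Qq), hp, zpow_add₀ (by norm_num : (-1 : Qq) ≠ 0)]
        rw [show -((p.1 : ℤ) * c) + (p.1 + (c - n)) = (c - n) + (1 - c) * p.1 by ring, zpow_add₀ h0]
        ring
      · rw [← hp, divPow_eq_dp i he, divPow_eq_dp i he, divPow_eq_dp i he, ← map_dp, ← map_dp, ← map_dp]
        rfl
    · rintro a (ha | ha)
      · rw [dp_of_neg _ _ ha]; simp
      · rw [dp_of_neg _ _ ha]; simp
  simp_rw [hc]
  rw [finsum_eq_single _ 0]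
  · simp only [Nat.cast_zero, zero_sub, sub_zero, dp_zero, Module.End.one_apply, braid]
    congr 2
    rw [zpow_neg, ← inv_zpow, inv_neg, inv_one]
  · intro c hc0
    obtain ⟨c, rfl⟩ := Nat.exists_eq_succ_of_ne_zero hc0
    have h1 := h.altSum_pow_B_eq_zero h.nilE hz c
    have h2 := altSum_smul (q := q) (E := act M y) (act M x) (h.nilE ((act M x ^ (c + 1)) z)) (-c) (c + 1 - n)
      (qfact q (c + 1))⁻¹
    rw [dp_natCast, LinearMap.smul_apply]
    push_cast
    rw [show (1 : ℤ) - (c + 1) = -c by ring, h2, h1, smul_zero, smul_zero]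

theorem modL'_isBraid (hM : C.IsCategoryO ν M) {i : I} (hi : C.IsReal i) (hν : ν i 1 ≠ 0) {e : ℤ}
    (he : e = 1 ∨ e = -1) :
    IsBraid (C.qi i ^ e) (act M (C.pa ν i 1)) (act M (C.B ν i)) (C.kSpace ν M i) (C.modL' hM i hi e) := by
  intro n z hz
  rw [modL', glue_apply hM i _ hz]
  exact tripleSum_eq_braid he (sl2Module hM hi hν he) _ _ hz

theorem modL''_isBraid (hM : C.IsCategoryO ν M) {i : I} (hi : C.IsReal i) (hν : ν i 1 ≠ 0) {e : ℤ}
    (he : e = 1 ∨ e = -1) :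
    IsBraid (C.qi i ^ e) (act M (C.B ν i)) (act M (C.pa ν i 1)) (fun n => C.kSpace ν M i (-n))
      (C.modL'' hM i hi e) := by
  intro n z hz
  rw [modL'', glue_apply hM i _ hz, neg_neg]
  exact tripleSum_eq_braid he (sl2Module hM hi hν he).swap _ _ hz

end Modules

end BorcherdsCartanMatrix

namespace BorcherdsCartanMatrix

open QuantumSl2

variable {I : Type u} {C : BorcherdsCartanMatrix I} {ν : I → ℕ → Qq}

/-! ### The symmetries and the action of `U` -/

theorem pow_mem_rootSpace {α : WeightLattice I} {x : C.QAlg ν} (hx : x ∈ C.rootSpace ν α) (n : ℕ) :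
    x ^ n ∈ C.rootSpace ν (n • α) := by
  induction n with
  | zero => simpa using one_mem_rootSpace
  | succ n ih => rw [pow_succ, succ_nsmul]; exact mul_mem_rootSpace ih hx

theorem dp_mem_rootSpace {α : WeightLattice I} {x : C.QAlg ν} (hx : x ∈ C.rootSpace ν α) (q : Qq) (n : ℤ) :
    dp q x n ∈ C.rootSpace ν (n • α) := by
  rcases lt_or_ge n 0 with hn | hn
  · rw [dp_of_neg q x hn]; exact zero_mem _
  · obtain ⟨n, rfl⟩ := Int.eq_ofNat_of_zero_le hn
    rw [dp_natCast, natCast_zsmul]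
    exact (C.rootSpace ν _).smul_mem _ (pow_mem_rootSpace hx n)

theorem divPow_mem_rootSpace {α : WeightLattice I} {x : C.QAlg ν} (hx : x ∈ C.rootSpace ν α) (i : I) (n : ℕ) :
    C.divPow i x n ∈ C.rootSpace ν (n • α) := (C.rootSpace ν _).smul_mem _ (pow_mem_rootSpace hx n)

theorem commute_pa_B {i j : I} {l : ℕ} (hi : C.IsReal i) (hj : C.IsIndex j l) (hij : j ≠ i) :
    Commute (C.pa ν j l) (C.B ν i) := by
  rw [B, pb_real hi]; exact (commute_pa_uf hi.isIndex hj hij).smul_right _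

theorem commute_pb_pa {i j : I} {l : ℕ} (hi : C.IsReal i) (hj : C.IsIndex j l) (hij : j ≠ i) :
    Commute (C.pb ν j l) (C.pa ν i 1) := by
  rw [pa_real hi]; exact commute_pb_ue hi.isIndex hj hij

theorem isIndex_of_not_isReal {j : I} (hj : ¬ C.IsReal j) {n : ℕ} (hn : n ≠ 0) : C.IsIndex j n :=
  Or.inr ⟨((C.diag j).resolve_left hj).1, Nat.pos_of_ne_zero hn⟩

theorem paS_mem_rootSpace (j : I) (n : ℕ) : C.paS ν j n ∈ C.rootSpace ν (n • C.root j) := by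
  rw [paS]
  split_ifs with h1 h2
  · subst h1; simpa using one_mem_rootSpace
  · exact divPow_mem_rootSpace (pa_real_mem_rootSpace h2) j n
  · exact pa_mem_rootSpace (isIndex_of_not_isReal h2 h1)

theorem pbS_mem_rootSpace (j : I) (n : ℕ) : C.pbS ν j n ∈ C.rootSpace ν (-(n • C.root j)) := by
  rw [pbS]
  split_ifs with h1 h2
  · subst h1; simpa using one_mem_rootSpace
  · rw [← smul_neg]
    refine divPow_mem_rootSpace ?_ j n
    simpa using pb_mem_rootSpace (ν := ν) h2.isIndex
  · exact pb_mem_rootSpace (isIndex_of_not_isReal h2 h1)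

theorem commute_paS_B {i j : I} (hi : C.IsReal i) (hij : j ≠ i) (n : ℕ) :
    Commute (C.paS ν j n) (C.B ν i) := by
  rw [paS]
  split_ifs with h1 h2
  · exact Commute.one_left _
  · exact ((commute_pa_B hi h2.isIndex hij).pow_left _).smul_left _
  · exact commute_pa_B hi (isIndex_of_not_isReal h2 h1) hij

theorem commute_pbS_pa {i j : I} (hi : C.IsReal i) (hij : j ≠ i) (n : ℕ) :
    Commute (C.pbS ν j n) (C.pa ν i 1) := by
  rw [pbS]
  split_ifs with h1 h2
  · exact Commute.one_left _
  · exact ((commute_pb_pa hi h2.isIndex hij).pow_left _).smul_left _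
  · exact commute_pb_pa hi (isIndex_of_not_isReal h2 h1) hij

theorem offdiag_mul_nonneg {i j : I} (hij : j ≠ i) (n : ℕ) : 0 ≤ -C.a i j * n :=
  mul_nonneg (neg_nonneg.2 (C.offdiag i j hij.symm)) (Int.natCast_nonneg n)

theorem root_nsmul_coroot (i j : I) (n : ℕ) : (n • C.root j) (coroot i) = -(-C.a i j * n) := by
  rw [LinearMap.smul_apply, root_coroot, nsmul_eq_mul]; ring

section SerreElements

variable {A : Type*} [Ring A] [Algebra Qq A]

/-- The sums over pairs of natural numbers in the definitions of `𝓕` and `𝓖` as Serre type sums. -/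
theorem sum_pairs_eq_serreSum (i : I) {e : ℤ} (he : e = 1 ∨ e = -1) (E x : A) (m u : ℤ) :
    ∑ p ∈ pairs m, ((-1) ^ p.1 * C.qi i ^ (e * p.1 * u)) • (C.divPow i E p.1 * x * C.divPow i E p.2) =
      serreSum (C.qi i ^ e) E x m u := by
  rw [pairs]
  split_ifs with hm
  · rw [← sum_antidiagonal_eq_serreSum E x hm]
    refine Finset.sum_congr rfl fun p _ => ?_
    rw [divPow_eq_dp i he, divPow_eq_dp i he, ← zpow_mul, mul_assoc, mul_comm u]
  · rw [Finset.sum_empty, serreSum_of_neg _ _ _ (by omega)]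

/-- The sums with the two divided powers exchanged, up to a scalar, as Serre type sums. -/
theorem sum_pairs_swap_eq_serreSum (i : I) {e : ℤ} (he : e = 1 ∨ e = -1) (E x : A) (m u : ℤ) :
    ∑ p ∈ pairs m, ((-1) ^ p.1 * C.qi i ^ (e * p.1 * u)) • (C.divPow i E p.2 * x * C.divPow i E p.1) =
      ((-1) ^ m * (C.qi i ^ e) ^ (u * m)) • serreSum (C.qi i ^ e) E x m (-u) := by
  rw [pairs]
  split_ifs with hm
  · rw [← sum_antidiagonal_swap_eq_serreSum (generic_zpow i he).ne_zero E x hm]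
    refine Finset.sum_congr rfl fun p _ => ?_
    rw [divPow_eq_dp i he, divPow_eq_dp i he, ← zpow_mul, mul_assoc, mul_comm u]
  · rw [Finset.sum_empty, serreSum_of_neg _ _ _ (by omega), smul_zero]

end SerreElements

theorem serF_eq (i j : I) {e : ℤ} (he : e = 1 ∨ e = -1) (n : ℕ) (m : ℤ) :
    C.serF ν i j n m e =
      serreSum (C.qi i ^ e) (C.pa ν i 1) (C.paS ν j n) m (-C.a i j * n - m + 1) :=
  sum_pairs_eq_serreSum i he _ _ _ _

theorem serF'_eq (i j : I) {e : ℤ} (he : e = 1 ∨ e = -1) (n : ℕ) (m : ℤ) :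
    C.serF' ν i j n m e = ((-1) ^ m * (C.qi i ^ e) ^ ((-C.a i j * n - m + 1) * m)) •
      serreSum (C.qi i ^ e) (C.pa ν i 1) (C.paS ν j n) m (-(-C.a i j * n - m + 1)) :=
  sum_pairs_swap_eq_serreSum i he _ _ _ _

theorem neg_sign {e : ℤ} (he : e = 1 ∨ e = -1) : -e = 1 ∨ -e = -1 := by omega

theorem serG_eq (i j : I) {e : ℤ} (he : e = 1 ∨ e = -1) (n : ℕ) (m : ℤ) :
    C.serG ν i j n m e = ((-1) ^ m * (C.qi i ^ (-e)) ^ ((-C.a i j * n - m + 1) * m)) •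
      serreSum (C.qi i ^ (-e)) (C.B ν i) (C.pbS ν j n) m (-(-C.a i j * n - m + 1)) := by
  rw [← sum_pairs_swap_eq_serreSum i (neg_sign he), serG]
  simp only [neg_mul]

theorem serG'_eq (i j : I) {e : ℤ} (he : e = 1 ∨ e = -1) (n : ℕ) (m : ℤ) :
    C.serG' ν i j n m e =
      serreSum (C.qi i ^ (-e)) (C.B ν i) (C.pbS ν j n) m (-C.a i j * n - m + 1) := by
  rw [← sum_pairs_eq_serreSum i (neg_sign he), serG']
  simp only [neg_mul]

theorem refl_apply_reflCo {i : I} (hi : C.IsReal i) (μ : WeightLattice I) (h : DualWeightLattice I) :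
    C.refl i μ (C.reflCo i h) = μ h := by
  rw [refl, reflCo, LinearMap.sub_apply, LinearMap.smul_apply, map_sub, map_sub, map_smul, map_smul,
    root_coroot, show C.a i i = 2 from hi]
  simp only [smul_eq_mul]; ring

theorem refl_apply (i : I) (μ : WeightLattice I) (h : DualWeightLattice I) :
    C.refl i μ h = μ (C.reflCo i h) := by
  rw [refl, reflCo, LinearMap.sub_apply, LinearMap.smul_apply, map_sub, map_smul]
  simp only [smul_eq_mul]; ring

section Modules

variable {M : Type v} [AddCommGroup M] [Module Qq M] [Module (C.QAlg ν) M]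
  [IsScalarTower Qq (C.QAlg ν) M]
variable (hM : C.IsCategoryO ν M) {i : I} (hi : C.IsReal i) (hν : ν i 1 ≠ 0) {e : ℤ}
  (he : e = 1 ∨ e = -1)
include hM hi hν he

theorem modL''_neg_isBraid :
    IsBraid (C.qi i ^ e)⁻¹ (act M (C.B ν i)) (act M (C.pa ν i 1)) (fun n => C.kSpace ν M i (-n))
      (C.modL'' hM i hi (-e)) := by
  rw [← zpow_neg]; exact modL''_isBraid hM hi hν (neg_sign he)

/-- The operators `L'_{i,e}` and `L''_{i,-e}` on the objects of `𝓞` are mutually inverse. -/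
theorem modL'_modL'' (z : M) : C.modL' hM i hi e (C.modL'' hM i hi (-e) z) = z :=
  (modL'_isBraid hM hi hν he).comp_eq (modL''_neg_isBraid hM hi hν he) (sl2Module hM hi hν he) z

theorem modL''_modL' (z : M) : C.modL'' hM i hi (-e) (C.modL' hM i hi e z) = z :=
  (modL'_isBraid hM hi hν he).comp_eq' (modL''_neg_isBraid hM hi hν he) (sl2Module hM hi hν he) z

/-- `L'` intertwines an element that commutes with `B_i` with a Serre type sum in `𝚊_i`. -/
theorem modL'_of_commute_B {α : WeightLattice I} {x : C.QAlg ν} (hx : x ∈ C.rootSpace ν α)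
    (hxB : Commute x (C.B ν i)) {N : ℤ} (hα : α (coroot i) = -N) (hN : 0 ≤ N) (z : M) :
    C.modL' hM i hi e (x • z) =
      serreSum (C.qi i ^ e) (C.pa ν i 1) x N 1 • C.modL' hM i hi e z := by
  have := (modL'_isBraid hM hi hν he).apply_of_commute (modL''_isBraid hM hi hν he)
    (sl2Module hM hi hν he) (x := act M x) (hxB.map (act M)) (N := N)
    (fun n z hz => by have := smul_mem_kSpace hx i hz; rwa [hα] at this) hN z
  rw [← map_serreSum] at this
  exact this

/-- `L'` intertwines an element that commutes with `𝚊_i` with a Serre type sum in `B_i`. -/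
theorem modL'_of_commute_pa {α : WeightLattice I} {y : C.QAlg ν} (hy : y ∈ C.rootSpace ν α)
    (hyE : Commute y (C.pa ν i 1)) {N : ℤ} (hα : α (coroot i) = N) (hN : 0 ≤ N) (z : M) :
    C.modL' hM i hi e (y • z) =
      (((-1) ^ N * (C.qi i ^ e) ^ N)⁻¹ • serreSum (C.qi i ^ e) (C.B ν i) y N 1) •
        C.modL' hM i hi e z := by
  have := (modL'_isBraid hM hi hν he).apply_of_commute' (modL''_isBraid hM hi hν he)
    (sl2Module hM hi hν he) (y := act M y) (hyE.map (act M)) (N := N)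
    (fun n z hz => by have := smul_mem_kSpace hy i hz; rwa [hα] at this) hN z
  rw [← map_serreSum] at this
  rw [smul_assoc]
  exact this

theorem modL''_of_commute_pa {α : WeightLattice I} {y : C.QAlg ν} (hy : y ∈ C.rootSpace ν α)
    (hyE : Commute y (C.pa ν i 1)) {N : ℤ} (hα : α (coroot i) = N) (hN : 0 ≤ N) (z : M) :
    C.modL'' hM i hi (-e) (y • z) =
      serreSum (C.qi i ^ (-e)) (C.B ν i) y N 1 • C.modL'' hM i hi (-e) z := by
  have hT' := modL'_isBraid hM hi hν (neg_sign he)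
  have := (modL''_isBraid hM hi hν (neg_sign he)).apply_of_commute (by simpa using hT')
    (sl2Module hM hi hν (neg_sign he)).swap (x := act M y) (hyE.map (act M)) (N := N)
    (fun n z hz => by have := smul_mem_kSpace hy i hz; rw [hα] at this; rwa [show -n + N = -(n - N) by ring] at this) hN z
  rw [← map_serreSum] at this
  exact this

theorem modL''_of_commute_B {α : WeightLattice I} {x : C.QAlg ν} (hx : x ∈ C.rootSpace ν α)
    (hxB : Commute x (C.B ν i)) {N : ℤ} (hα : α (coroot i) = -N) (hN : 0 ≤ N) (z : M) :
    C.modL'' hM i hi (-e) (x • z) =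
      (((-1) ^ N * (C.qi i ^ (-e)) ^ N)⁻¹ • serreSum (C.qi i ^ (-e)) (C.pa ν i 1) x N 1) •
        C.modL'' hM i hi (-e) z := by
  have hT' := modL'_isBraid hM hi hν (neg_sign he)
  have := (modL''_isBraid hM hi hν (neg_sign he)).apply_of_commute' (by simpa using hT')
    (sl2Module hM hi hν (neg_sign he)).swap (y := act M x) (hxB.map (act M)) (N := N)
    (fun n z hz => by have := smul_mem_kSpace hx i hz; rw [hα] at this; rwa [show -n + -N = -(n + N) by ring] at this) hN z
  rw [← map_serreSum] at this
  rw [smul_assoc]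
  exact this

theorem modL'_paS {j : I} (hj : j ≠ i) (n : ℕ) (z : M) :
    C.modL' hM i hi e (C.paS ν j n • z) = C.serF ν i j n (-C.a i j * n) e • C.modL' hM i hi e z := by
  rw [modL'_of_commute_B hM hi hν he (paS_mem_rootSpace j n) (commute_paS_B hi hj n)
    (root_nsmul_coroot i j n) (offdiag_mul_nonneg hj n), serF_eq i j he, sub_self, zero_add]

theorem modL'_pbS {j : I} (hj : j ≠ i) (n : ℕ) (z : M) :
    C.modL' hM i hi e (C.pbS ν j n • z) = C.serG ν i j n (-C.a i j * n) e • C.modL' hM i hi e z := by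
  rw [modL'_of_commute_pa hM hi hν he (pbS_mem_rootSpace j n) (commute_pbS_pa hi hj n)
    (N := -C.a i j * n) (by rw [LinearMap.neg_apply, root_nsmul_coroot, neg_neg]) (offdiag_mul_nonneg hj n),
    serG_eq i j he, sub_self, zero_add, zpow_neg, serreSum_inv, neg_neg, one_mul, mul_inv, ← inv_zpow (-1 : Qq),
    inv_neg, inv_one, ← inv_zpow]

theorem modL''_paS {j : I} (hj : j ≠ i) (n : ℕ) (z : M) :
    C.modL'' hM i hi (-e) (C.paS ν j n • z) =
      C.serF' ν i j n (-C.a i j * n) e • C.modL'' hM i hi (-e) z := by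
  rw [modL''_of_commute_B hM hi hν he (paS_mem_rootSpace j n) (commute_paS_B hi hj n)
    (root_nsmul_coroot i j n) (offdiag_mul_nonneg hj n), serF'_eq i j he, sub_self, zero_add, zpow_neg,
    serreSum_inv, one_mul, mul_inv, ← inv_zpow (-1 : Qq), inv_neg, inv_one, ← inv_zpow, inv_inv]

theorem modL''_pbS {j : I} (hj : j ≠ i) (n : ℕ) (z : M) :
    C.modL'' hM i hi (-e) (C.pbS ν j n • z) =
      C.serG' ν i j n (-C.a i j * n) e • C.modL'' hM i hi (-e) z := by
  rw [modL''_of_commute_pa hM hi hν he (pbS_mem_rootSpace j n) (commute_pbS_pa hi hj n)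
    (N := -C.a i j * n) (by rw [LinearMap.neg_apply, root_nsmul_coroot, neg_neg]) (offdiag_mul_nonneg hj n),
    serG'_eq i j he, sub_self, zero_add]

theorem modL'_pa (z : M) : C.modL' hM i hi e (C.pa ν i 1 • z) =
    -(C.Kpow ν i e * C.B ν i) • C.modL' hM i hi e z := by
  have hT := modL'_isBraid hM hi hν he
  have h := sl2Module hM hi hν he
  have key : C.modL' hM i hi e ∘ₗ act M (C.pa ν i 1) =
      act M (-(C.Kpow ν i e * C.B ν i)) ∘ₗ C.modL' hM i hi e := by
    refine h.ext_of_weight fun n z hz => ?_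
    rw [LinearMap.comp_apply, LinearMap.comp_apply, hT.apply_E (modL''_isBraid hM hi hν he) h hz]
    have h2 := h.B_mem (hT.mem h hz)
    change _ = (-(C.Kpow ν i e * C.B ν i)) • C.modL' hM i hi e z
    rw [neg_smul, mul_smul]
    congr 1
    refine Eq.trans ?_ (Kpow_smul h2 e).symm
    rw [← zpow_mul]
  exact LinearMap.congr_fun key z

theorem modL'_B (z : M) : C.modL' hM i hi e (C.B ν i • z) =
    -(C.pa ν i 1 * C.Kpow ν i (-e)) • C.modL' hM i hi e z := by
  have hT := modL'_isBraid hM hi hν he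
  have h := sl2Module hM hi hν he
  have key : C.modL' hM i hi e ∘ₗ act M (C.B ν i) =
      act M (-(C.pa ν i 1 * C.Kpow ν i (-e))) ∘ₗ C.modL' hM i hi e := by
    refine h.ext_of_weight fun n z hz => ?_
    rw [LinearMap.comp_apply, LinearMap.comp_apply, hT.apply_B h hz]
    have h2 := hT.mem h hz
    change _ = (-(C.pa ν i 1 * C.Kpow ν i (-e))) • C.modL' hM i hi e z
    rw [neg_smul, mul_smul, Kpow_smul h2, neg_mul_neg, smul_algebra_smul_comm, zpow_mul]
    rfl
  exact LinearMap.congr_fun key z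

theorem modL'_mem_weightSpace {μ : WeightLattice I} {z : M} (hz : z ∈ C.weightSpace ν M μ) :
    C.modL' hM i hi e z ∈ C.weightSpace ν M (C.refl i μ) := by
  rw [modL'_isBraid hM hi hν he _ z (weightSpace_le_kSpace i μ hz), braid, altSum]
  refine (C.weightSpace ν M _).smul_mem _ (finsum_induction (· ∈ C.weightSpace ν M (C.refl i μ))
    (zero_mem _) (fun _ _ => add_mem) fun a => (C.weightSpace ν M _).smul_mem _ ?_)
  rw [← map_dp, ← map_dp]
  have h1 := smul_mem_weightSpace (dp_mem_rootSpace (B_mem_rootSpace (ν := ν) hi) (C.qi i ^ e) a)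
    (smul_mem_weightSpace (dp_mem_rootSpace (pa_real_mem_rootSpace (ν := ν) hi) (C.qi i ^ e)
      (a + -μ (coroot i))) hz)
  have h2 : μ + (a + -μ (coroot i)) • C.root i + a • -C.root i = C.refl i μ := by
    rw [refl]; module
  rw [h2] at h1
  exact h1

theorem modL'_qh (h : DualWeightLattice I) (z : M) : C.modL' hM i hi e (C.qh ν h • z) =
    C.qh ν (C.reflCo i h) • C.modL' hM i hi e z := by
  classical
  have hz : z ∈ ⨆ μ, C.weightSpace ν M μ := by
    rw [hM.weight.submodule_iSup_eq_top]; trivial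
  refine Submodule.iSup_induction _ (motive := fun z => C.modL' hM i hi e (C.qh ν h • z) =
    C.qh ν (C.reflCo i h) • C.modL' hM i hi e z) hz ?_ ?_ ?_
  · intro μ z hz
    rw [hz h, modL'_mem_weightSpace hM hi hν he hz (C.reflCo i h), refl_apply_reflCo hi, map_smul]
  · simp
  · intro x y hx hy
    rw [smul_add, map_add, hx, hy, map_add, smul_add]

end Modules

end BorcherdsCartanMatrix

namespace BorcherdsCartanMatrix

open QuantumSl2

variable {I : Type u} {V : Type v} [AddCommGroup V] [Module Qq V]

/-! ### Representations before the Serre relations are imposed -/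

/-- The simultaneous eigenspace of the operators `T h` (standing for `q^h`) of weight `μ`. -/
noncomputable def wtSpace (T : DualWeightLattice I → Module.End Qq V) (μ : WeightLattice I) : Submodule Qq V :=
  ⨅ h, Module.End.eigenspace (T h) (qq ^ μ h)

/-- The operators of degree `α`: those `A` with `T h * A = q ^ α(h) A * T h` for all `h`. -/
def degSpace (T : DualWeightLattice I → Module.End Qq V) (α : WeightLattice I) :
    Submodule Qq (Module.End Qq V) where
  carrier := {A | ∀ h, T h * A = qq ^ α h • (A * T h)}
  add_mem' {A B} hA hB h := by rw [mul_add, hA h, hB h, add_mul, smul_add]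
  zero_mem' h := by simp
  smul_mem' c A hA h := by rw [mul_smul_comm, hA h, smul_mul_assoc, smul_comm]

variable {T : DualWeightLattice I → Module.End Qq V}

theorem mem_wtSpace {μ : WeightLattice I} {z : V} : z ∈ wtSpace T μ ↔ ∀ h, T h z = qq ^ μ h • z := by
  simp [wtSpace, Submodule.mem_iInf]

theorem apply_mem_wtSpace {α μ : WeightLattice I} {A : Module.End Qq V} (hA : A ∈ degSpace T α) {z : V}
    (hz : z ∈ wtSpace T μ) : A z ∈ wtSpace T (μ + α) := by
  rw [mem_wtSpace] at hz ⊢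
  intro h
  have := LinearMap.congr_fun (hA h) z
  rw [LinearMap.smul_apply, Module.End.mul_apply, Module.End.mul_apply, hz h, map_smul, smul_smul] at this
  rw [this, LinearMap.add_apply, zpow_add₀ qq_ne_zero, mul_comm]

theorem ext_of_wtSpace {V' : Type*} [AddCommGroup V'] [Module Qq V'] (hT : ⨆ μ, wtSpace T μ = ⊤)
    {A B : V →ₗ[Qq] V'} (h : ∀ μ, ∀ z ∈ wtSpace T μ, A z = B z) : A = B := by
  have : LinearMap.eqLocus A B = ⊤ := by
    rw [eq_top_iff, ← hT]
    exact iSup_le fun μ z hz => h μ z hz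
  ext z
  have hz : z ∈ LinearMap.eqLocus A B := by rw [this]; trivial
  exact hz

theorem mul_mem_degSpace {α β : WeightLattice I} {A B : Module.End Qq V} (hA : A ∈ degSpace T α)
    (hB : B ∈ degSpace T β) : A * B ∈ degSpace T (α + β) := by
  intro h
  rw [← mul_assoc, hA h, smul_mul_assoc, mul_assoc, hB h, mul_smul_comm, smul_smul, mul_assoc,
    LinearMap.add_apply, zpow_add₀ qq_ne_zero]

theorem one_mem_degSpace : (1 : Module.End Qq V) ∈ degSpace T 0 := by
  intro h; simp

theorem pow_mem_degSpace {α : WeightLattice I} {A : Module.End Qq V} (hA : A ∈ degSpace T α) (n : ℕ) :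
    A ^ n ∈ degSpace T (n • α) := by
  induction n with
  | zero => simpa using one_mem_degSpace
  | succ n ih => rw [pow_succ, succ_nsmul]; exact mul_mem_degSpace ih hA

theorem dp_mem_degSpace {α : WeightLattice I} {A : Module.End Qq V} (hA : A ∈ degSpace T α) (q : Qq)
    (n : ℤ) : dp q A n ∈ degSpace T (n • α) := by
  rcases lt_or_ge n 0 with hn | hn
  · rw [dp_of_neg q A hn]; exact zero_mem _
  · obtain ⟨n, rfl⟩ := Int.eq_ofNat_of_zero_le hn
    rw [dp_natCast, natCast_zsmul]
    exact (degSpace T _).smul_mem _ (pow_mem_degSpace hA n)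

theorem serreSum_mem_degSpace {α β : WeightLattice I} {A B : Module.End Qq V} (hA : A ∈ degSpace T α)
    (hB : B ∈ degSpace T β) (q : Qq) (m t : ℤ) : serreSum q A B m t ∈ degSpace T (m • α + β) := by
  rw [serreSum]
  refine Submodule.sum_mem _ fun r _ => Submodule.smul_mem _ _ ?_
  have h1 := mul_mem_degSpace (mul_mem_degSpace (dp_mem_degSpace hA q r) hB) (dp_mem_degSpace hA q (m - r))
  have h2 : r • α + β + (m - r) • α = m • α + β := by rw [sub_smul]; abel
  rw [h2] at h1
  exact h1

theorem wtSpace_iSupIndep (hT : ⨆ μ, wtSpace T μ = ⊤) : iSupIndep fun μ => wtSpace T μ := by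
  have hcomm : ∀ h h', Commute (T h) (T h') := by
    intro h h'
    refine ext_of_wtSpace hT fun μ z hz => ?_
    rw [Module.End.mul_apply, Module.End.mul_apply, mem_wtSpace.1 hz h, mem_wtSpace.1 hz h', map_smul,
      map_smul, mem_wtSpace.1 hz h, mem_wtSpace.1 hz h', smul_comm]
  have h1 := Module.End.independent_iInf_maxGenEigenspace_of_forall_mapsTo T fun h h' φ =>
    Module.End.mapsTo_maxGenEigenspace_of_comm (hcomm h' h) φ
  have hinj : Function.Injective fun (μ : WeightLattice I) (h : DualWeightLattice I) => qq ^ μ h := by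
    intro μ μ' h
    exact LinearMap.ext fun x => qq_zpow_injective (congrFun h x)
  refine (h1.comp hinj).mono fun μ => ?_
  exact iInf_mono fun h => (Module.End.genEigenspace (T h) _).mono le_top

theorem wtSpace_neg (μ : WeightLattice I) : wtSpace (fun h => T (-h)) μ = wtSpace T (-μ) := by
  ext z
  rw [mem_wtSpace, mem_wtSpace]
  refine ⟨fun h x => ?_, fun h x => ?_⟩
  · have := h (-x); simpa using this
  · have := h (-x); simpa using this

theorem mem_degSpace_neg {α : WeightLattice I} {A : Module.End Qq V} (hA : A ∈ degSpace T (-α)) :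
    A ∈ degSpace (fun h => T (-h)) α := by
  intro h
  have := hA (-h); simpa using this

variable (C : BorcherdsCartanMatrix I) (ν : I → ℕ → Qq)

/-- The coefficient `q_(i)^d q_i^{-μ(h_i)}` of the commutation relation of `e_{ik}` and `f_{il}`, `d = l - k`,
on vectors of weight `μ`. -/
noncomputable def cpar (i : I) (μ : WeightLattice I) (d : ℤ) : Qq := C.qpar i ^ d * qq ^ (-(C.s i * μ (coroot i)))

/-- Representations of the algebra with the generators of `U` and all its relations except the Serre
relations and the commutation relations among the `e_{il}` and among the `f_{il}`. -/
structure PreRep (V : Type v) [AddCommGroup V] [Module Qq V] where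
  T : DualWeightLattice I → Module.End Qq V
  e : I → ℕ → Module.End Qq V
  f : I → ℕ → Module.End Qq V
  e_zero : ∀ i, e i 0 = 1
  f_zero : ∀ i, f i 0 = 1
  iSup_wt : ⨆ μ, wtSpace T μ = ⊤
  e_mem : ∀ i l, C.IsIndex i l → e i l ∈ degSpace T (l • C.root i)
  f_mem : ∀ i l, C.IsIndex i l → f i l ∈ degSpace T (-(l • C.root i))
  comm_ef : ∀ i j k l, C.IsIndex i k → C.IsIndex j l → i ≠ j → Commute (e i k) (f j l)
  ef : ∀ i k l, C.IsIndex i k → C.IsIndex i l → ∀ μ, ∀ z ∈ wtSpace T μ,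
    ∑ n ∈ Finset.range (min k l + 1), (nu0 ν i n * C.cpar i μ (l - k) ^ n) • f i (l - n) (e i (k - n) z) =
    ∑ n ∈ Finset.range (min k l + 1),
      (nu0 ν i n * (C.cpar i μ (l - k))⁻¹ ^ n) • e i (k - n) (f i (l - n) z)

variable {C ν}

theorem IsIndex.of_le {i : I} {k m : ℕ} (hk : C.IsIndex i k) (hm : m ≤ k) : m = 0 ∨ C.IsIndex i m := by
  rcases hk with ⟨h, rfl⟩ | ⟨h, _⟩
  · rcases Nat.le_one_iff_eq_zero_or_eq_one.1 hm with rfl | rfl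
    · exact Or.inl rfl
    · exact Or.inr (Or.inl ⟨h, rfl⟩)
  · rcases Nat.eq_zero_or_pos m with rfl | hm
    · exact Or.inl rfl
    · exact Or.inr (Or.inr ⟨h, hm⟩)

theorem IsIndex.sub_left {i : I} {k : ℕ} (hk : C.IsIndex i k) (n : ℕ) : k - n = 0 ∨ C.IsIndex i (k - n) :=
  hk.of_le (Nat.sub_le _ _)

theorem qpar_sq (i : I) : C.qpar i * C.qpar i = qq ^ (C.s i * C.a i i) := by
  have h2 : Even (C.s i * C.a i i) := by
    refine Even.mul_left ?_ _
    rcases C.diag i with h | h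
    · rw [h]; exact even_two
    · exact h.2
  rw [qpar, ← zpow_add₀ qq_ne_zero, ← two_mul, Int.two_mul_ediv_two_of_even h2]

theorem qpar_ne_zero (i : I) : C.qpar i ≠ 0 := zpow_ne_zero _ qq_ne_zero

theorem cpar_ne_zero (i : I) (μ : WeightLattice I) (d : ℤ) : C.cpar i μ d ≠ 0 :=
  mul_ne_zero (zpow_ne_zero _ (qpar_ne_zero i)) (zpow_ne_zero _ qq_ne_zero)

theorem qpar_zpow_two_mul (i : I) (d : ℤ) : qq ^ (d * (C.s i * C.a i i)) = C.qpar i ^ d * C.qpar i ^ d := by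
  rw [mul_comm d, zpow_mul, ← qpar_sq, mul_zpow]

/-- The two exponents of `q` combine, on a vector of weight `μ`, into a power of `cpar`. -/
theorem ef_term_left {i : I} {A B : Module.End Qq V} {a b : ℕ} (hA : A ∈ degSpace T (a • C.root i))
    (hB : B ∈ degSpace T (-(b • C.root i))) {μ : WeightLattice I} {z : V} (hz : z ∈ wtSpace T μ) (n : ℕ)
    (x : Qq) :
    ((C.qpar i ^ ((n : ℤ) * ((a : ℤ) - b)) * x) • (T ((-(n : ℤ) * C.s i) • coroot i) * B * A)) z =
      (x * C.cpar i μ ((b : ℤ) - a) ^ n) • B (A z) := by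
  have h1 := mem_wtSpace.1 (apply_mem_wtSpace hB (apply_mem_wtSpace hA hz)) ((-(n : ℤ) * C.s i) • coroot i)
  rw [LinearMap.smul_apply, Module.End.mul_apply, Module.End.mul_apply, h1, smul_smul]
  congr 1
  rw [cpar, mul_pow, ← zpow_natCast, ← zpow_natCast, ← zpow_mul, ← zpow_mul, coroot_eq_of_smul, LinearMap.add_apply,
    LinearMap.add_apply, LinearMap.neg_apply, LinearMap.smul_apply, LinearMap.smul_apply, root_coroot,
    nsmul_eq_mul, nsmul_eq_mul,
    show (-(n : ℤ) * C.s i * (μ (coroot i) + (a : ℤ) * C.a i i + -((b : ℤ) * C.a i i))) =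
      (n * (b - a)) * (C.s i * C.a i i) + -(C.s i * μ (coroot i)) * n by ring, zpow_add₀ qq_ne_zero,
    qpar_zpow_two_mul, show (n : ℤ) * ((a : ℤ) - b) = -(n * (b - a)) by ring, zpow_neg,
    mul_comm (n : ℤ) ((b : ℤ) - a)]
  have := zpow_ne_zero (((b : ℤ) - a) * n) (qpar_ne_zero (C := C) i)
  field_simp

theorem ef_term_right {i : I} {A B : Module.End Qq V} {a b : ℕ} (hA : A ∈ degSpace T (a • C.root i))
    (hB : B ∈ degSpace T (-(b • C.root i))) {μ : WeightLattice I} {z : V} (hz : z ∈ wtSpace T μ) (n : ℕ)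
    (x : Qq) :
    ((C.qpar i ^ ((n : ℤ) * ((b : ℤ) - a)) * x) • (T (((n : ℤ) * C.s i) • coroot i) * A * B)) z =
      (x * (C.cpar i μ ((b : ℤ) - a))⁻¹ ^ n) • A (B z) := by
  have h1 := mem_wtSpace.1 (apply_mem_wtSpace hA (apply_mem_wtSpace hB hz)) (((n : ℤ) * C.s i) • coroot i)
  rw [LinearMap.smul_apply, Module.End.mul_apply, Module.End.mul_apply, h1, smul_smul]
  congr 1
  rw [cpar, inv_pow, mul_pow, ← zpow_natCast, ← zpow_natCast, ← zpow_mul, ← zpow_mul, coroot_eq_of_smul,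
    LinearMap.add_apply,
    LinearMap.add_apply, LinearMap.neg_apply, LinearMap.smul_apply, LinearMap.smul_apply, root_coroot,
    nsmul_eq_mul, nsmul_eq_mul,
    show ((n : ℤ) * C.s i * (μ (coroot i) + -((b : ℤ) * C.a i i) + (a : ℤ) * C.a i i)) =
      (-((b - a) * n)) * (C.s i * C.a i i) + -(-(C.s i * μ (coroot i)) * n) by ring, zpow_add₀ qq_ne_zero,
    qpar_zpow_two_mul, show (n : ℤ) * ((b : ℤ) - a) = (b - a) * n by ring, zpow_neg, zpow_neg]
  have := zpow_ne_zero (((b : ℤ) - a) * n) (qpar_ne_zero (C := C) i)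
  field_simp

/-- The operator form and the weight form of the commutation relation of `e_{ik}` and `f_{il}`. -/
theorem ef_apply_iff {i : I} {e f : ℕ → Module.End Qq V}
    (he : ∀ l, l = 0 ∨ C.IsIndex i l → e l ∈ degSpace T (l • C.root i))
    (hf : ∀ l, l = 0 ∨ C.IsIndex i l → f l ∈ degSpace T (-(l • C.root i))) {k l : ℕ} (hk : C.IsIndex i k)
    (hl : C.IsIndex i l) {μ : WeightLattice I} {z : V} (hz : z ∈ wtSpace T μ) :
    (∑ n ∈ Finset.range (min k l + 1),
      (C.qpar i ^ ((n : ℤ) * (((k - n : ℕ) : ℤ) - ((l - n : ℕ) : ℤ))) * nu0 ν i n) •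
        (T ((-(n : ℤ) * C.s i) • coroot i) * f (l - n) * e (k - n))) z =
    (∑ n ∈ Finset.range (min k l + 1),
      (C.qpar i ^ ((n : ℤ) * (((l - n : ℕ) : ℤ) - ((k - n : ℕ) : ℤ))) * nu0 ν i n) •
        (T (((n : ℤ) * C.s i) • coroot i) * e (k - n) * f (l - n))) z ↔
    ∑ n ∈ Finset.range (min k l + 1), (nu0 ν i n * C.cpar i μ (l - k) ^ n) • f (l - n) (e (k - n) z) =
    ∑ n ∈ Finset.range (min k l + 1),
      (nu0 ν i n * (C.cpar i μ (l - k))⁻¹ ^ n) • e (k - n) (f (l - n) z) := by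
  rw [LinearMap.sum_apply, LinearMap.sum_apply]
  refine iff_of_eq (congrArg₂ _ (Finset.sum_congr rfl fun n hn => ?_) (Finset.sum_congr rfl fun n hn => ?_))
  · rw [Finset.mem_range] at hn
    rw [ef_term_left (he _ (hk.sub_left n)) (hf _ (hl.sub_left n)) hz]
    congr 4; omega
  · rw [Finset.mem_range] at hn
    rw [ef_term_right (he _ (hk.sub_left n)) (hf _ (hl.sub_left n)) hz]
    congr 5; omega

namespace PreRep

variable (R : C.PreRep ν V)

theorem e_mem' {i : I} {l : ℕ} (hl : l = 0 ∨ C.IsIndex i l) : R.e i l ∈ degSpace R.T (l • C.root i) := by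
  rcases hl with rfl | hl
  · rw [R.e_zero, zero_smul]; exact one_mem_degSpace
  · exact R.e_mem i l hl

theorem f_mem' {i : I} {l : ℕ} (hl : l = 0 ∨ C.IsIndex i l) : R.f i l ∈ degSpace R.T (-(l • C.root i)) := by
  rcases hl with rfl | hl
  · rw [R.f_zero, zero_smul, neg_zero]; exact one_mem_degSpace
  · exact R.f_mem i l hl

theorem ef' {i : I} {k l : ℕ} (hk : k = 0 ∨ C.IsIndex i k) (hl : l = 0 ∨ C.IsIndex i l)
    {μ : WeightLattice I} {z : V} (hz : z ∈ wtSpace R.T μ) :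
    ∑ n ∈ Finset.range (min k l + 1),
      (nu0 ν i n * C.cpar i μ (l - k) ^ n) • R.f i (l - n) (R.e i (k - n) z) =
    ∑ n ∈ Finset.range (min k l + 1),
      (nu0 ν i n * (C.cpar i μ (l - k))⁻¹ ^ n) • R.e i (k - n) (R.f i (l - n) z) := by
  rcases hk with rfl | hk
  · simp [R.e_zero]
  rcases hl with rfl | hl
  · simp [R.f_zero]
  exact R.ef i k l hk hl μ z hz

theorem comm_ef' {i j : I} {k l : ℕ} (hk : k = 0 ∨ C.IsIndex i k) (hl : l = 0 ∨ C.IsIndex j l) (hij : i ≠ j) :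
    Commute (R.e i k) (R.f j l) := by
  rcases hk with rfl | hk
  · rw [R.e_zero]; exact Commute.one_left _
  rcases hl with rfl | hl
  · rw [R.f_zero]; exact Commute.one_right _
  exact R.comm_ef i j k l hk hl hij

theorem T_add (h h' : DualWeightLattice I) : R.T (h + h') = R.T h * R.T h' :=
  ext_of_wtSpace R.iSup_wt fun μ z hz => by
    rw [mem_wtSpace] at hz
    rw [Module.End.mul_apply, hz, hz, map_smul, hz, smul_smul, map_add, zpow_add₀ qq_ne_zero, mul_comm]

theorem T_zero : R.T 0 = 1 :=
  ext_of_wtSpace R.iSup_wt fun μ z hz => by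
    rw [mem_wtSpace] at hz
    rw [hz, map_zero, zpow_zero, one_smul]; rfl

theorem T_mul_mul {α : WeightLattice I} {A : Module.End Qq V} (hA : A ∈ degSpace R.T α)
    (h : DualWeightLattice I) : R.T h * A * R.T (-h) = qq ^ α h • A := by
  rw [hA h, smul_mul_assoc, mul_assoc, ← R.T_add, add_neg_cancel, R.T_zero, mul_one]

/-- Exchange of the roles of the `e_{il}` and the `f_{il}`, with `q^h` replaced by `q^{-h}`. -/
noncomputable def swap : C.PreRep ν V where
  T h := R.T (-h)
  e := R.f
  f := R.e
  e_zero := R.f_zero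
  f_zero := R.e_zero
  iSup_wt := by
    rw [eq_top_iff, ← R.iSup_wt]
    refine iSup_le fun μ => ?_
    have := le_iSup (fun μ => wtSpace (fun h => R.T (-h)) μ) (-μ)
    rwa [wtSpace_neg, neg_neg] at this
  e_mem i l hl := mem_degSpace_neg (R.f_mem i l hl)
  f_mem i l hl := mem_degSpace_neg (by rw [neg_neg]; exact R.e_mem i l hl)
  comm_ef i j k l hk hl hij := (R.comm_ef j i l k hl hk hij.symm).symm
  ef i k l hk hl μ z hz := by
    rw [wtSpace_neg] at hz
    have h1 := R.ef i l k hl hk _ z hz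
    have h2 : C.cpar i (-μ) (k - l) = (C.cpar i μ (l - k))⁻¹ := by
      rw [cpar, cpar, mul_inv, ← zpow_neg, ← zpow_neg, LinearMap.neg_apply, neg_sub]
      congr 2; ring
    rw [h2, inv_inv, min_comm] at h1
    exact h1.symm

end PreRep

end BorcherdsCartanMatrix

namespace BorcherdsCartanMatrix

open QuantumSl2

variable {I : Type u} {C : BorcherdsCartanMatrix I} {ν : I → ℕ → Qq}

namespace PreRep

variable {V : Type v} [AddCommGroup V] [Module Qq V] (R : C.PreRep ν V)

/-! ### Integrable representations -/

/-- The defining commutation relation of `e_{ik}` and `f_{il}` as an identity of operators. -/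
theorem ef_op {i : I} {k l : ℕ} (hk : C.IsIndex i k) (hl : C.IsIndex i l) :
    ∑ n ∈ Finset.range (min k l + 1),
      (C.qpar i ^ ((n : ℤ) * (((k - n : ℕ) : ℤ) - ((l - n : ℕ) : ℤ))) * nu0 ν i n) •
        (R.T ((-(n : ℤ) * C.s i) • coroot i) * R.f i (l - n) * R.e i (k - n)) =
    ∑ n ∈ Finset.range (min k l + 1),
      (C.qpar i ^ ((n : ℤ) * (((l - n : ℕ) : ℤ) - ((k - n : ℕ) : ℤ))) * nu0 ν i n) •
        (R.T (((n : ℤ) * C.s i) • coroot i) * R.e i (k - n) * R.f i (l - n)) := by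
  exact ext_of_wtSpace R.iSup_wt fun μ z hz => (ef_apply_iff (fun l hl => R.e_mem' hl)
    (fun l hl => R.f_mem' hl) hk hl hz).2 (R.ef i k l hk hl μ z hz)

/-- The operators by which the elements `B_i` of `U` act. -/
noncomputable def opB (i : I) : Module.End Qq V := (ν i 1 * ((C.qi i)⁻¹ - C.qi i))⁻¹ • R.f i 1

/-- The eigenspaces of `K_i`. -/
noncomputable def kWt (i : I) (n : ℤ) : Submodule Qq V :=
  Module.End.eigenspace (R.T (C.s i • coroot i)) (C.qi i ^ n)

theorem wtSpace_le_kWt (i : I) (μ : WeightLattice I) : wtSpace R.T μ ≤ R.kWt i (μ (coroot i)) := by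
  intro z hz
  rw [kWt, Module.End.mem_eigenspace_iff, mem_wtSpace.1 hz, coroot_eq_of_smul, zpow_mul]
  rfl

theorem apply_mem_kWt {α : WeightLattice I} {A : Module.End Qq V} (hA : A ∈ degSpace R.T α) {i : I} {n : ℤ}
    {z : V} (hz : z ∈ R.kWt i n) : A z ∈ R.kWt i (n + α (coroot i)) := by
  rw [kWt, Module.End.mem_eigenspace_iff] at hz ⊢
  have := LinearMap.congr_fun (hA (C.s i • coroot i)) z
  rw [LinearMap.smul_apply, Module.End.mul_apply, Module.End.mul_apply, hz, map_smul A, smul_smul,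
    coroot_eq_of_smul, zpow_mul, ← qi, ← zpow_add₀ (qi_ne_zero i), add_comm] at this
  exact this

theorem iSup_kWt (i : I) : ⨆ n, R.kWt i n = ⊤ := by
  rw [eq_top_iff, ← R.iSup_wt]
  exact iSup_le fun μ => (R.wtSpace_le_kWt i μ).trans (le_iSup (fun n => R.kWt i n) _)

/-- For real `i` the relation of `e_i` and `f_i` is that of `U_q(𝔰𝔩₂)`. -/
theorem e_f_sub {i : I} (hi : C.IsReal i) : R.e i 1 * R.f i 1 - R.f i 1 * R.e i 1 =
    ν i 1 • (R.T (-(C.s i • coroot i)) - R.T (C.s i • coroot i)) := by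
  refine ext_of_wtSpace R.iSup_wt fun μ z hz => ?_
  have h1 := R.ef i 1 1 hi.isIndex hi.isIndex μ z hz
  simp only [min_self, Finset.sum_range_succ, Finset.sum_range_zero, nu0, pow_zero, mul_one, if_pos,
    one_smul, zero_add, Nat.sub_zero, Nat.sub_self, R.e_zero, R.f_zero, one_ne_zero, if_false, pow_one,
    Nat.cast_one, sub_self, Module.End.one_apply] at h1
  simp only [LinearMap.sub_apply, LinearMap.smul_apply, Module.End.mul_apply]
  rw [mem_wtSpace.1 hz, mem_wtSpace.1 hz, map_neg, coroot_eq_of_smul]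
  rw [cpar, zpow_zero, one_mul, zpow_neg, inv_inv] at h1
  rw [zpow_neg, ← sub_smul, smul_smul, mul_sub, sub_smul, sub_eq_sub_iff_add_eq_add, ← h1, add_comm]

theorem sl2Weight {i : I} (hi : C.IsReal i) (hν : ν i 1 ≠ 0) :
    Sl2Weight (C.qi i) (R.e i 1) (R.opB i) (R.kWt i) where
  generic := generic_qi i
  E_mem {n z} hz := by
    have := R.apply_mem_kWt (R.e_mem i 1 hi.isIndex) hz
    rwa [one_smul, root_coroot, show C.a i i = 2 from hi] at this
  B_mem {n z} hz := by
    have := R.apply_mem_kWt (R.f_mem i 1 hi.isIndex) hz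
    rw [one_smul, LinearMap.neg_apply, root_coroot, show C.a i i = 2 from hi] at this
    exact (R.kWt i _).smul_mem _ this
  comm {n z} hz := by
    have h1 := LinearMap.congr_fun (R.e_f_sub hi) z
    rw [kWt, Module.End.mem_eigenspace_iff] at hz
    have h2 : R.T (-(C.s i • coroot i)) z = C.qi i ^ (-n) • z := by
      have h3 : R.T (-(C.s i • coroot i)) (R.T (C.s i • coroot i) z) = z := by
        rw [← Module.End.mul_apply, ← R.T_add, neg_add_cancel, R.T_zero]; rfl
      rw [hz, map_smul] at h3
      rw [zpow_neg, eq_inv_smul_iff₀ (zpow_ne_zero _ (qi_ne_zero i)), h3]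
    simp only [LinearMap.sub_apply, LinearMap.smul_apply, Module.End.mul_apply] at h1
    rw [hz, h2] at h1
    rw [opB, LinearMap.smul_apply, LinearMap.smul_apply, map_smul, ← smul_sub, h1, ← sub_smul, smul_smul,
      smul_smul]
    congr 1
    have h3 := qi_inv_sub_ne_zero (C := C) i
    rw [qint, ← neg_sub (C.qi i)⁻¹, ← neg_sub (C.qi i ^ (-n)), neg_div_neg_eq]
    field_simp

/-- The representations that are integrable (all `e_i`, `f_i` with `i` real are locally nilpotent) and in
which the `e_{il}`, and the `f_{il}`, satisfy the commutation relations. -/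
structure Integrable : Prop where
  comm_e : ∀ i j k l, C.IsIndex i k → C.IsIndex j l → C.a i j = 0 → Commute (R.e i k) (R.e j l)
  comm_f : ∀ i j k l, C.IsIndex i k → C.IsIndex j l → C.a i j = 0 → Commute (R.f i k) (R.f j l)
  nil_e : ∀ i, C.IsReal i → ∀ z, ∃ N : ℕ, (R.e i 1 ^ N) z = 0
  nil_f : ∀ i, C.IsReal i → ∀ z, ∃ N : ℕ, (R.f i 1 ^ N) z = 0

theorem Integrable.swap {R : C.PreRep ν V} (hR : R.Integrable) : R.swap.Integrable :=
  ⟨hR.comm_f, hR.comm_e, hR.nil_f, hR.nil_e⟩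

theorem Integrable.sl2Module {R : C.PreRep ν V} (hR : R.Integrable) {i : I} (hi : C.IsReal i)
    (hν : ν i 1 ≠ 0) : Sl2Module (C.qi i) (R.e i 1) (R.opB i) (R.kWt i) where
  toSl2Weight := R.sl2Weight hi hν
  iSup_eq_top := R.iSup_kWt i
  nilE := hR.nil_e i hi
  nilB z := by
    obtain ⟨N, hN⟩ := hR.nil_f i hi z
    exact ⟨N, by rw [opB, smul_pow, LinearMap.smul_apply, hN, smul_zero]⟩

/-- The Serre relations hold in every integrable representation. -/
theorem Integrable.serre_e {R : C.PreRep ν V} (hR : R.Integrable) {i j : I} {l : ℕ} (hi : C.IsReal i)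
    (hν : ν i 1 ≠ 0) (hj : C.IsIndex j l) (hij : i ≠ j) :
    serreSum (C.qi i) (R.e i 1) (R.e j l) (-(l * C.a i j) + 1) 0 = 0 := by
  refine (hR.sl2Module hi hν).serreSum_eq_zero ((R.comm_ef j i l 1 hj hi.isIndex hij.symm).smul_right _)
    (fun n z hz => ?_) (neg_nonneg.2 (mul_nonpos_of_nonneg_of_nonpos (Int.natCast_nonneg l)
      (C.offdiag i j hij)))
  have := R.apply_mem_kWt (R.e_mem j l hj) hz
  rwa [LinearMap.smul_apply, root_coroot, nsmul_eq_mul,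
    show n + (l : ℤ) * C.a i j = n - -(l * C.a i j) by ring] at this

end PreRep

theorem serre_relator_eq {A : Type*} [Ring A] [Algebra Qq A] {i j : I} (l : ℕ) (hij : i ≠ j) (E x : A) :
    ∑ p ∈ Finset.HasAntidiagonal.antidiagonal (1 - (l : ℤ) * C.a i j).toNat,
      (-1 : Qq) ^ p.1 • (C.divPow i E p.1 * x * C.divPow i E p.2) =
    serreSum (C.qi i) E x (-(l * C.a i j) + 1) 0 := by
  have h0 := mul_nonpos_of_nonneg_of_nonpos (Int.natCast_nonneg l) (C.offdiag i j hij)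
  rw [show (1 : ℤ) - l * C.a i j = -(l * C.a i j) + 1 by ring,
    ← sum_antidiagonal_eq_serreSum E x (by omega)]
  refine Finset.sum_congr rfl fun p _ => ?_
  rw [divPow_eq_dp i (Or.inl rfl), divPow_eq_dp i (Or.inl rfl), zpow_one, zero_mul, zpow_zero, mul_one]

theorem map_divPow {A A' : Type*} [Ring A] [Algebra Qq A] [Ring A'] [Algebra Qq A'] (g : A →ₐ[Qq] A')
    (i : I) (x : A) (n : ℕ) : g (C.divPow i x n) = C.divPow i (g x) n := by
  rw [divPow, divPow, map_smul, map_pow]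

namespace PreRep

variable {V : Type v} [AddCommGroup V] [Module Qq V] (R : C.PreRep ν V)

/-- The action of the free algebra on the generators of `U`. -/
noncomputable def freeAction : C.FreeGen →ₐ[Qq] Module.End Qq V :=
  FreeAlgebra.lift Qq fun
    | .q h => R.T h
    | .e x => R.e x.i x.l
    | .f x => R.f x.i x.l

theorem freeAction_gq (h : DualWeightLattice I) : R.freeAction (C.gq h) = R.T h := by
  rw [freeAction, gq, FreeAlgebra.lift_ι_apply]

theorem freeAction_ge {i : I} {l : ℕ} (hl : l = 0 ∨ C.IsIndex i l) : R.freeAction (C.ge i l) = R.e i l := by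
  rw [ge]
  split_ifs with h0 h1
  · rw [map_one, h0, R.e_zero]
  · rw [freeAction, FreeAlgebra.lift_ι_apply]
  · exact absurd hl (by tauto)

theorem freeAction_gf {i : I} {l : ℕ} (hl : l = 0 ∨ C.IsIndex i l) : R.freeAction (C.gf i l) = R.f i l := by
  rw [gf]
  split_ifs with h0 h1
  · rw [map_one, h0, R.f_zero]
  · rw [freeAction, FreeAlgebra.lift_ι_apply]
  · exact absurd hl (by tauto)

theorem Integrable.freeAction_rel {R : C.PreRep ν V} (hR : R.Integrable)
    (hν : ∀ i, C.IsReal i → ν i 1 ≠ 0) {x y : C.FreeGen} (h : C.Rel ν x y) :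
    R.freeAction x = R.freeAction y := by
  induction h with
  | q_zero => rw [freeAction_gq, R.T_zero, map_one]
  | q_add h h' => rw [map_mul, freeAction_gq, freeAction_gq, freeAction_gq, R.T_add]
  | q_e h j l hj =>
    rw [map_mul, map_mul, map_smul, freeAction_gq, freeAction_gq, freeAction_ge _ (Or.inr hj),
      R.T_mul_mul (R.e_mem j l hj), LinearMap.smul_apply, nsmul_eq_mul]
  | q_f h j l hj =>
    rw [map_mul, map_mul, map_smul, freeAction_gq, freeAction_gq, freeAction_gf _ (Or.inr hj),
      R.T_mul_mul (R.f_mem j l hj), LinearMap.neg_apply, LinearMap.smul_apply, nsmul_eq_mul]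
  | serre_e i j l hi hj hij =>
    simp only [map_sum, map_smul, map_mul, map_divPow, map_zero]
    rw [freeAction_ge _ (Or.inr hi.isIndex), freeAction_ge _ (Or.inr hj), serre_relator_eq l hij,
      hR.serre_e hi (hν i hi) hj hij]
  | serre_f i j l hi hj hij =>
    simp only [map_sum, map_smul, map_mul, map_divPow, map_zero]
    rw [freeAction_gf _ (Or.inr hi.isIndex), freeAction_gf _ (Or.inr hj), serre_relator_eq l hij]
    exact hR.swap.serre_e hi (hν i hi) hj hij
  | comm_e i j k l hi hj hij =>
    rw [map_mul, map_mul, freeAction_ge _ (Or.inr hi), freeAction_ge _ (Or.inr hj)]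
    exact hR.comm_e i j k l hi hj hij
  | comm_f i j k l hi hj hij =>
    rw [map_mul, map_mul, freeAction_gf _ (Or.inr hi), freeAction_gf _ (Or.inr hj)]
    exact hR.comm_f i j k l hi hj hij
  | comm_ef i j k l hi hj hij =>
    rw [map_mul, map_mul, freeAction_ge _ (Or.inr hi), freeAction_gf _ (Or.inr hj)]
    exact R.comm_ef i j k l hi hj hij
  | ef i k l hk hl =>
    simp only [map_sum, map_smul, map_mul, gK, freeAction_gq, freeAction_ge _ (hk.sub_left _),
      freeAction_gf _ (hl.sub_left _)]
    exact R.ef_op hk hl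

/-- The action of `U` on an integrable representation. -/
noncomputable def Integrable.toEnd {R : C.PreRep ν V} (hR : R.Integrable)
    (hν : ∀ i, C.IsReal i → ν i 1 ≠ 0) : C.QAlg ν →ₐ[Qq] Module.End Qq V :=
  RingQuot.liftAlgHom Qq ⟨R.freeAction, fun _ _ h => hR.freeAction_rel hν h⟩

theorem Integrable.toEnd_toU {R : C.PreRep ν V} (hR : R.Integrable)
    (hν : ∀ i, C.IsReal i → ν i 1 ≠ 0) (x : C.FreeGen) : hR.toEnd hν (C.toU ν x) = R.freeAction x :=
  RingQuot.liftAlgHom_mkAlgHom_apply Qq R.freeAction (fun _ _ h => hR.freeAction_rel hν h) x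

theorem Integrable.toEnd_qh {R : C.PreRep ν V} (hR : R.Integrable) (hν : ∀ i, C.IsReal i → ν i 1 ≠ 0)
    (h : DualWeightLattice I) : hR.toEnd hν (C.qh ν h) = R.T h := by
  rw [qh, hR.toEnd_toU, freeAction_gq]

theorem Integrable.toEnd_ue {R : C.PreRep ν V} (hR : R.Integrable) (hν : ∀ i, C.IsReal i → ν i 1 ≠ 0)
    {i : I} {l : ℕ} (hl : C.IsIndex i l) : hR.toEnd hν (C.ue ν i l) = R.e i l := by
  rw [ue, hR.toEnd_toU, R.freeAction_ge (Or.inr hl)]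

theorem Integrable.toEnd_uf {R : C.PreRep ν V} (hR : R.Integrable) (hν : ∀ i, C.IsReal i → ν i 1 ≠ 0)
    {i : I} {l : ℕ} (hl : C.IsIndex i l) : hR.toEnd hν (C.uf ν i l) = R.f i l := by
  rw [uf, hR.toEnd_toU, R.freeAction_gf (Or.inr hl)]

/-- An element of `U` that acts by zero on all objects of `𝓞` acts by zero on all integrable
representations. -/
theorem Integrable.toEnd_eq_zero {R : C.PreRep ν V} (hR : R.Integrable)
    (hν : ∀ i, C.IsReal i → ν i 1 ≠ 0) {x : C.QAlg ν}
    (hx : ∀ (M : Type v) [AddCommGroup M] [Module Qq M] [Module (C.QAlg ν) M]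
      [IsScalarTower Qq (C.QAlg ν) M] (_ : C.IsCategoryO ν M) (z : M), x • z = 0) :
    hR.toEnd hν x = 0 := by
  classical
  let : Module (C.QAlg ν) V := Module.compHom V (hR.toEnd hν).toRingHom
  have hsmul : ∀ (y : C.QAlg ν) (z : V), y • z = hR.toEnd hν y z := fun _ _ => rfl
  have : IsScalarTower Qq (C.QAlg ν) V := ⟨fun c y z => by
    rw [hsmul, hsmul, map_smul, LinearMap.smul_apply]⟩
  have hw : ∀ μ, C.weightSpace ν V μ = wtSpace R.T μ := by
    intro μ
    ext z
    rw [mem_wtSpace]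
    refine forall_congr' fun h => ?_
    rw [hsmul, hR.toEnd_qh]
  have hO : C.IsCategoryO ν V := by
    refine ⟨?_, fun i hi z => ?_, fun i hi z => ?_⟩
    · rw [DirectSum.isInternal_submodule_iff_iSupIndep_and_iSup_eq_top]
      simp only [hw]
      exact ⟨wtSpace_iSupIndep R.iSup_wt, R.iSup_wt⟩
    · obtain ⟨N, hN⟩ := hR.nil_e i hi z
      exact ⟨N, by rw [hsmul, map_pow, pa_real hi, hR.toEnd_ue hν hi.isIndex, hN]⟩
    · obtain ⟨N, hN⟩ := hR.nil_f i hi z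
      exact ⟨N, by rw [hsmul, map_pow, pb_real hi, hR.toEnd_uf hν hi.isIndex, hN]⟩
  ext z
  rw [← hsmul, hx V hO z]
  rfl

/-- The quotient of a representation by a stable subspace. -/
noncomputable def quot (N : Submodule Qq V) (hT : ∀ h, N ≤ N.comap (R.T h)) (he : ∀ i k, N ≤ N.comap (R.e i k))
    (hf : ∀ i k, N ≤ N.comap (R.f i k)) : C.PreRep ν (V ⧸ N) where
  T h := N.mapQ N (R.T h) (hT h)
  e i k := N.mapQ N (R.e i k) (he i k)
  f i k := N.mapQ N (R.f i k) (hf i k)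
  e_zero i := by ext z; simp [R.e_zero]
  f_zero i := by ext z; simp [R.f_zero]
  iSup_wt := by
    rw [eq_top_iff, ← N.range_mkQ, ← Submodule.map_top, ← R.iSup_wt, Submodule.map_iSup]
    refine iSup_mono fun μ => ?_
    rintro _ ⟨z, hz, rfl⟩
    rw [mem_wtSpace]
    intro h
    rw [Submodule.mkQ_apply, Submodule.mapQ_apply, mem_wtSpace.1 hz h]
    rfl
  e_mem i l hl h := by
    ext z
    exact congrArg N.mkQ (LinearMap.congr_fun (R.e_mem i l hl h) z)
  f_mem i l hl h := by
    ext z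
    exact congrArg N.mkQ (LinearMap.congr_fun (R.f_mem i l hl h) z)
  comm_ef i j k l hk hl hij := by
    ext z
    exact congrArg N.mkQ (LinearMap.congr_fun (R.comm_ef i j k l hk hl hij) z)
  ef i k l hk hl μ z hz := by
    have hT' : ∀ i l, (l = 0 ∨ C.IsIndex i l) →
        N.mapQ N (R.e i l) (he i l) ∈ degSpace (fun h => N.mapQ N (R.T h) (hT h)) (l • C.root i) := by
      intro i l hl h
      ext z
      exact congrArg N.mkQ (LinearMap.congr_fun (R.e_mem' hl h) z)
    have hT'' : ∀ i l, (l = 0 ∨ C.IsIndex i l) →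
        N.mapQ N (R.f i l) (hf i l) ∈ degSpace (fun h => N.mapQ N (R.T h) (hT h)) (-(l • C.root i)) := by
      intro i l hl h
      ext z
      exact congrArg N.mkQ (LinearMap.congr_fun (R.f_mem' hl h) z)
    obtain ⟨w, rfl⟩ := N.mkQ_surjective z
    refine (ef_apply_iff (hT' i) (hT'' i) hk hl hz).1 ?_
    have h1 := congrArg N.mkQ (LinearMap.congr_fun (R.ef_op hk hl) w)
    simp only [LinearMap.sum_apply, map_sum] at h1 ⊢
    exact h1

end PreRep

end BorcherdsCartanMatrix

namespace BorcherdsCartanMatrix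

open QuantumSl2

variable {I : Type u} (C : BorcherdsCartanMatrix I) (ν : I → ℕ → Qq)

/-! ### Verma modules over the free algebra -/

/-- The free algebra on the `f_{il}`, as the vector space with basis the words in the symbols `(i, l)`. -/
abbrev Fock : Type u := List C.Index →₀ Qq

variable {C} in
/-- The operator that multiplies each word `w` by the scalar `g w`. -/
noncomputable def wordDiag (g : List C.Index → Qq) : Module.End Qq C.Fock :=
  Finsupp.linearCombination Qq fun w => Finsupp.single w (g w)

/-- The weight of the word `w` in the Verma module of highest weight `Λ`. -/
noncomputable def wordWt (Λ : WeightLattice I) (w : List C.Index) : WeightLattice I :=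
  Λ - (w.map fun x => x.l • C.root x.i).sum

/-- The action of `q^h` on the Verma module of highest weight `Λ`. -/
noncomputable def vT (Λ : WeightLattice I) (h : DualWeightLattice I) : Module.End Qq C.Fock :=
  wordDiag fun w => qq ^ C.wordWt Λ w h

open Classical in
/-- The action of `f_{il}`: left multiplication. -/
noncomputable def vf (i : I) (l : ℕ) : Module.End Qq C.Fock :=
  if l = 0 then 1
  else if h : C.IsIndex i l then Finsupp.lmapDomain Qq Qq (List.cons ⟨i, l, h⟩) else 0

/-- The power series `∑ ν_{in} c^n X^n`. -/
noncomputable def nuSeries (i : I) (c : Qq) : PowerSeries Qq := PowerSeries.mk fun n => nu0 ν i n * c ^ n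

/-- The coefficients of `(∑ ν_{in} c^n X^n) / (∑ ν_{in} c^{-n} X^n)`. -/
noncomputable def gcoef (i : I) (c : Qq) (n : ℕ) : Qq :=
  PowerSeries.coeff n (nuSeries ν i c * (nuSeries ν i c⁻¹)⁻¹)

open Classical in
/-- The vector `e_{ik} w` of the Verma module of highest weight `Λ` (zero for `k < 0`). The relation of
`e_{ik}` and `f_{il}` is solved for `e_{ik} f_{il}`. -/
noncomputable def eWord (Λ : WeightLattice I) (i : I) : List C.Index → ℤ → C.Fock
  | [], k => if k = 0 then Finsupp.single [] 1 else 0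
  | x :: w, k =>
    if x.i = i then
      ∑ n ∈ Finset.range (x.l + 1), gcoef ν i (C.cpar i (C.wordWt Λ w) (x.l - k)) n •
        C.vf i (x.l - n) (eWord Λ i w (k - n))
    else C.vf x.i x.l (eWord Λ i w k)

/-- The action of `e_{ik}` on the Verma module of highest weight `Λ`. -/
noncomputable def vE (Λ : WeightLattice I) (i : I) (k : ℤ) : Module.End Qq C.Fock :=
  Finsupp.linearCombination Qq fun w => C.eWord ν Λ i w k

variable {C ν}

theorem fock_ext {V : Type*} [AddCommGroup V] [Module Qq V] {A B : C.Fock →ₗ[Qq] V}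
    (h : ∀ w, A (Finsupp.single w 1) = B (Finsupp.single w 1)) : A = B := by
  ext w; exact h w

theorem wordDiag_single (g : List C.Index → Qq) (w : List C.Index) :
    wordDiag g (Finsupp.single w 1) = g w • Finsupp.single w 1 := by
  rw [wordDiag, Finsupp.linearCombination_single, one_smul, Finsupp.smul_single, smul_eq_mul, mul_one]

theorem wordDiag_apply (g : List C.Index → Qq) (z : C.Fock) (w : List C.Index) : wordDiag g z w = g w * z w := by
  have : Finsupp.lapply w ∘ₗ wordDiag g = g w • (Finsupp.lapply w : C.Fock →ₗ[Qq] Qq) := by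
    refine fock_ext fun w' => ?_
    rw [LinearMap.comp_apply, wordDiag_single, LinearMap.smul_apply, Finsupp.lapply_apply, Finsupp.lapply_apply,
      Finsupp.smul_apply]
    by_cases h : w' = w
    · rw [h]
    · rw [Finsupp.single_eq_of_ne (Ne.symm h), smul_zero, smul_zero]
  exact LinearMap.congr_fun this z

theorem vT_single (Λ : WeightLattice I) (h : DualWeightLattice I) (w : List C.Index) :
    C.vT Λ h (Finsupp.single w 1) = qq ^ C.wordWt Λ w h • Finsupp.single w 1 := wordDiag_single _ w

theorem single_mem_wtSpace (Λ : WeightLattice I) (w : List C.Index) :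
    Finsupp.single w 1 ∈ wtSpace (C.vT Λ) (C.wordWt Λ w) :=
  mem_wtSpace.2 fun h => vT_single Λ h w

theorem wordWt_of_mem {Λ μ : WeightLattice I} {z : C.Fock} (hz : z ∈ wtSpace (C.vT Λ) μ) {w : List C.Index}
    (hw : z w ≠ 0) : C.wordWt Λ w = μ := by
  refine LinearMap.ext fun h => ?_
  have h1 := DFunLike.congr_fun (mem_wtSpace.1 hz h) w
  rw [vT, wordDiag_apply, Finsupp.smul_apply, smul_eq_mul] at h1
  exact qq_zpow_injective (mul_right_cancel₀ hw h1)

theorem wordDiag_of_mem {Λ μ : WeightLattice I} {z : C.Fock} (hz : z ∈ wtSpace (C.vT Λ) μ)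
    (g : WeightLattice I → Qq) : wordDiag (fun w => g (C.wordWt Λ w)) z = g μ • z := by
  ext w
  rw [wordDiag_apply, Finsupp.smul_apply, smul_eq_mul]
  by_cases hw : z w = 0
  · rw [hw, mul_zero, mul_zero]
  · rw [wordWt_of_mem hz hw]

theorem iSup_wtSpace_vT (Λ : WeightLattice I) : ⨆ μ, wtSpace (C.vT Λ) μ = ⊤ := by
  rw [eq_top_iff]
  rintro z -
  induction z using Finsupp.induction_linear with
  | zero => exact zero_mem _
  | add x y hx hy => exact add_mem hx hy
  | single w c =>
    rw [← mul_one c, ← smul_eq_mul, ← Finsupp.smul_single]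
    exact Submodule.smul_mem _ _ (Submodule.mem_iSup_of_mem _ (single_mem_wtSpace Λ w))

theorem mem_degSpace_of_single {Λ α : WeightLattice I} {A : Module.End Qq C.Fock}
    (hA : ∀ w, A (Finsupp.single w 1) ∈ wtSpace (C.vT Λ) (C.wordWt Λ w + α)) : A ∈ degSpace (C.vT Λ) α := by
  intro h
  refine fock_ext fun w => ?_
  rw [LinearMap.smul_apply, Module.End.mul_apply, Module.End.mul_apply, mem_wtSpace.1 (hA w) h, vT_single,
    map_smul, smul_smul, ← zpow_add₀ qq_ne_zero, LinearMap.add_apply, add_comm]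

@[simp] theorem vf_zero (i : I) : C.vf i 0 = 1 := by simp [vf]

theorem vf_index (x : C.Index) (w : List C.Index) :
    C.vf x.i x.l (Finsupp.single w 1) = Finsupp.single (x :: w) 1 := by
  have : x.l ≠ 0 := by rcases x.isIndex with h | h <;> omega
  rw [vf, if_neg this, dif_pos x.isIndex, Finsupp.lmapDomain_apply, Finsupp.mapDomain_single]

theorem vf_single {i : I} {l : ℕ} (h : C.IsIndex i l) (w : List C.Index) :
    C.vf i l (Finsupp.single w 1) = Finsupp.single (⟨i, l, h⟩ :: w) 1 := vf_index ⟨i, l, h⟩ w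

theorem wordWt_cons (Λ : WeightLattice I) (x : C.Index) (w : List C.Index) :
    C.wordWt Λ (x :: w) = C.wordWt Λ w + -(x.l • C.root x.i) := by
  rw [wordWt, wordWt, List.map_cons, List.sum_cons]; abel

theorem vf_mem_degSpace (Λ : WeightLattice I) (i : I) (l : ℕ) : C.vf i l ∈ degSpace (C.vT Λ) (-(l • C.root i)) := by
  by_cases h0 : l = 0
  · rw [h0, vf_zero, zero_smul, neg_zero]; exact one_mem_degSpace
  by_cases h : C.IsIndex i l
  · refine mem_degSpace_of_single fun w => ?_
    rw [vf_single h]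
    have := single_mem_wtSpace Λ (⟨i, l, h⟩ :: w)
    rwa [wordWt_cons] at this
  · rw [vf, if_neg h0, dif_neg h]; exact zero_mem _

theorem constantCoeff_nuSeries (i : I) (c : Qq) : PowerSeries.constantCoeff (nuSeries ν i c) = 1 := by
  rw [← PowerSeries.coeff_zero_eq_constantCoeff_apply, nuSeries, PowerSeries.coeff_mk, nu0, if_pos rfl,
    pow_zero, mul_one]

theorem gcoef_zero (i : I) (c : Qq) : gcoef ν i c 0 = 1 := by
  rw [gcoef, PowerSeries.coeff_zero_eq_constantCoeff_apply, map_mul, PowerSeries.constantCoeff_inv,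
    constantCoeff_nuSeries, constantCoeff_nuSeries, inv_one, mul_one]

/-- The equation `(∑ ν_{in} c^{-n} X^n) (∑ g_n X^n) = ∑ ν_{in} c^n X^n` which the `g_n = gcoef` solve. -/
theorem sum_gcoef (i : I) (c : Qq) (p : ℕ) :
    ∑ m ∈ Finset.range (p + 1), nu0 ν i m * c⁻¹ ^ m * gcoef ν i c (p - m) = nu0 ν i p * c ^ p := by
  have h0 : PowerSeries.constantCoeff (nuSeries ν i c⁻¹) ≠ 0 := by
    rw [constantCoeff_nuSeries]; exact one_ne_zero
  have h1 : nuSeries ν i c⁻¹ * (nuSeries ν i c * (nuSeries ν i c⁻¹)⁻¹) = nuSeries ν i c := by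
    rw [mul_left_comm, PowerSeries.mul_inv_cancel _ h0, mul_one]
  have h2 := congrArg (PowerSeries.coeff p) h1
  rw [PowerSeries.coeff_mul, Finset.Nat.sum_antidiagonal_eq_sum_range_succ_mk] at h2
  simpa only [nuSeries, PowerSeries.coeff_mk, gcoef] using h2

/-- The coefficients of `e_{ik} f_{il}` are Laurent polynomials in `c` with exponents `n - 2 b`,
`0 ≤ b ≤ n`. -/
theorem gcoef_eq (i : I) {c : Qq} (hc : c ≠ 0) (n : ℕ) :
    gcoef ν i c n = ∑ b ∈ Finset.range (n + 1),
      nu0 ν i (n - b) * PowerSeries.coeff b (nuSeries ν i 1)⁻¹ * c ^ ((n : ℤ) - 2 * b) := by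
  have h0 : ∀ c : Qq, PowerSeries.constantCoeff (nuSeries ν i c) ≠ 0 := fun c => by
    rw [constantCoeff_nuSeries]; exact one_ne_zero
  have h1 : (nuSeries ν i c⁻¹)⁻¹ = PowerSeries.rescale c⁻¹ (nuSeries ν i 1)⁻¹ := by
    have h2 : nuSeries ν i c⁻¹ = PowerSeries.rescale c⁻¹ (nuSeries ν i 1) := by
      ext m
      rw [PowerSeries.coeff_rescale, nuSeries, nuSeries, PowerSeries.coeff_mk, PowerSeries.coeff_mk, one_pow,
        mul_one, mul_comm]
    have h3 : nuSeries ν i c⁻¹ * PowerSeries.rescale c⁻¹ (nuSeries ν i 1)⁻¹ = 1 := by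
      rw [h2, ← map_mul, PowerSeries.mul_inv_cancel _ (h0 1), map_one]
    rw [PowerSeries.inv_eq_iff_mul_eq_one (h0 _), mul_comm]
    exact h3
  rw [gcoef, mul_comm, PowerSeries.coeff_mul, Finset.Nat.sum_antidiagonal_eq_sum_range_succ_mk]
  refine Finset.sum_congr rfl fun b hb => ?_
  rw [Finset.mem_range] at hb
  have h2 : PowerSeries.coeff (n - b) (nuSeries ν i c) = nu0 ν i (n - b) * c ^ (n - b) :=
    PowerSeries.coeff_mk _ _
  rw [h1, PowerSeries.coeff_rescale, h2,
    show ((n : ℤ) - 2 * b) = ((n - b : ℕ) : ℤ) + -(b : ℤ) by omega, zpow_add₀ hc, zpow_neg, zpow_natCast,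
    zpow_natCast, inv_pow]
  ring

theorem vE_single (Λ : WeightLattice I) (i : I) (k : ℤ) (w : List C.Index) :
    C.vE ν Λ i k (Finsupp.single w 1) = C.eWord ν Λ i w k := by
  rw [vE, Finsupp.linearCombination_single, one_smul]

theorem eWord_of_neg (Λ : WeightLattice I) (i : I) (w : List C.Index) :
    ∀ {k : ℤ}, k < 0 → C.eWord ν Λ i w k = 0 := by
  induction w with
  | nil => intro k hk; rw [eWord, if_neg hk.ne]
  | cons x w ih =>
    intro k hk
    rw [eWord]
    split_ifs
    · refine Finset.sum_eq_zero fun n _ => ?_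
      rw [ih (by omega), map_zero, smul_zero]
    · rw [ih hk, map_zero]

theorem eWord_zero (Λ : WeightLattice I) (i : I) (w : List C.Index) :
    C.eWord ν Λ i w 0 = Finsupp.single w 1 := by
  induction w with
  | nil => rw [eWord, if_pos rfl]
  | cons x w ih =>
    rw [eWord]
    split_ifs with h
    · rw [Finset.sum_eq_single 0]
      · subst h
        rw [gcoef_zero, one_smul, Nat.sub_zero, Nat.cast_zero, sub_zero, ih, vf_index]
      · intro n _ hn
        rw [eWord_of_neg _ _ _ (by omega), map_zero, smul_zero]
      · simp
    · rw [ih, vf_index]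

theorem vE_of_neg (Λ : WeightLattice I) (i : I) {k : ℤ} (hk : k < 0) : C.vE ν Λ i k = 0 :=
  fock_ext fun w => by rw [vE_single, eWord_of_neg _ _ _ hk]; rfl

theorem vE_zero (Λ : WeightLattice I) (i : I) : C.vE ν Λ i 0 = 1 :=
  fock_ext fun w => by rw [vE_single, eWord_zero]; rfl

theorem vE_mem_degSpace (Λ : WeightLattice I) (i : I) (k : ℤ) :
    C.vE ν Λ i k ∈ degSpace (C.vT Λ) (k • C.root i) := by
  refine mem_degSpace_of_single fun w => ?_
  rw [vE_single]
  induction w generalizing k with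
  | nil =>
    rw [eWord]
    split_ifs with h
    · rw [h, zero_smul, add_zero]; exact single_mem_wtSpace Λ _
    · exact zero_mem _
  | cons x w ih =>
    rw [eWord]
    split_ifs with h
    · refine Submodule.sum_mem _ fun n hn => Submodule.smul_mem _ _ ?_
      rw [Finset.mem_range] at hn
      have h1 := apply_mem_wtSpace (vf_mem_degSpace Λ i (x.l - n)) (ih (k - n))
      have h2 : C.wordWt Λ w + (k - (n : ℤ)) • C.root i + -((x.l - n) • C.root i) =
          C.wordWt Λ (x :: w) + k • C.root i := by
        rw [wordWt_cons, h, ← natCast_zsmul, ← natCast_zsmul, Nat.cast_sub (by omega), sub_smul, sub_smul]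
        abel
      rwa [h2] at h1
    · have h1 := apply_mem_wtSpace (vf_mem_degSpace Λ x.i x.l) (ih k)
      have h2 : C.wordWt Λ w + k • C.root i + -(x.l • C.root x.i) =
          C.wordWt Λ (x :: w) + k • C.root i := by
        rw [wordWt_cons]; abel
      rwa [h2] at h1

theorem commute_vE_vf (Λ : WeightLattice I) {i j : I} (hij : i ≠ j) (k : ℤ) (l : ℕ) :
    Commute (C.vE ν Λ i k) (C.vf j l) := by
  by_cases h0 : l = 0
  · rw [h0, vf_zero]; exact Commute.one_right _
  by_cases h : C.IsIndex j l
  · refine fock_ext fun w => ?_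
    rw [Module.End.mul_apply, Module.End.mul_apply, vf_single h, vE_single, vE_single, eWord,
      if_neg hij.symm]
  · rw [vf, if_neg h0, dif_neg h]; exact Commute.zero_right _

/-- The recursion that defines `e_{ik}` on words, extended to vectors of weight `μ`. -/
theorem vE_vf {Λ : WeightLattice I} {i : I} {l : ℕ} (hl : l = 0 ∨ C.IsIndex i l) (k : ℤ)
    {μ : WeightLattice I} {z : C.Fock} (hz : z ∈ wtSpace (C.vT Λ) μ) :
    C.vE ν Λ i k (C.vf i l z) = ∑ n ∈ Finset.range (l + 1),
      gcoef ν i (C.cpar i μ (l - k)) n • C.vf i (l - n) (C.vE ν Λ i (k - n) z) := by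
  rcases hl with rfl | hl
  · simp [gcoef_zero]
  have h1 : C.vE ν Λ i k * C.vf i l = ∑ n ∈ Finset.range (l + 1),
      C.vf i (l - n) * C.vE ν Λ i (k - n) *
        wordDiag (fun w => gcoef ν i (C.cpar i (C.wordWt Λ w) (l - k)) n) := by
    refine fock_ext fun w => ?_
    rw [Module.End.mul_apply, vf_single hl, vE_single, eWord, if_pos rfl, LinearMap.sum_apply]
    refine Finset.sum_congr rfl fun n _ => ?_
    rw [Module.End.mul_apply, wordDiag_single, map_smul, Module.End.mul_apply, vE_single]
  have h2 := LinearMap.congr_fun h1 z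
  rw [Module.End.mul_apply, LinearMap.sum_apply] at h2
  rw [h2]
  refine Finset.sum_congr rfl fun n _ => ?_
  rw [Module.End.mul_apply, wordDiag_of_mem hz (fun μ => gcoef ν i (C.cpar i μ (l - k)) n), map_smul,
    Module.End.mul_apply]

theorem vE_nil {Λ : WeightLattice I} {i : I} {k : ℤ} (hk : k ≠ 0) :
    C.vE ν Λ i k (Finsupp.single [] 1) = 0 := by
  rw [vE_single, eWord, if_neg hk]

/-- The Verma module satisfies the commutation relation of `e_{ik}` and `f_{il}`: both sides are expanded in
`f_{i,l-p} e_{i,k-p}` and compared by `sum_gcoef`. -/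
theorem vE_vf_relation {Λ : WeightLattice I} {i : I} {k l : ℕ} (hl : C.IsIndex i l)
    {μ : WeightLattice I} {z : C.Fock} (hz : z ∈ wtSpace (C.vT Λ) μ) :
    ∑ n ∈ Finset.range (min k l + 1),
      (nu0 ν i n * C.cpar i μ (l - k) ^ n) • C.vf i (l - n) (C.vE ν Λ i (k - n : ℕ) z) =
    ∑ n ∈ Finset.range (min k l + 1),
      (nu0 ν i n * (C.cpar i μ (l - k))⁻¹ ^ n) • C.vE ν Λ i (k - n : ℕ) (C.vf i (l - n) z) := by
  set c := C.cpar i μ (l - k) with hc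
  -- As `e_{i,k-n}` is zero for `n > k`, the sums may be extended to all `n ≤ l`.
  have hext : ∀ F : ℕ → C.Fock, (∀ n, k < n → F n = 0) →
      ∑ n ∈ Finset.range (min k l + 1), F n = ∑ n ∈ Finset.range (l + 1), F n := by
    intro F hF
    refine Finset.sum_subset (fun n hn => ?_) fun n hn hn' => hF n ?_
    · rw [Finset.mem_range] at hn ⊢; omega
    · rw [Finset.mem_range] at hn hn'; omega
  have hl1 : ∑ n ∈ Finset.range (min k l + 1),
      (nu0 ν i n * c ^ n) • C.vf i (l - n) (C.vE ν Λ i (k - n : ℕ) z) =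
      ∑ n ∈ Finset.range (l + 1), (nu0 ν i n * c ^ n) • C.vf i (l - n) (C.vE ν Λ i (k - n) z) := by
    rw [← hext _ fun n hn => by rw [vE_of_neg Λ i (by omega : (k : ℤ) - n < 0)]; simp]
    refine Finset.sum_congr rfl fun n hn => ?_
    rw [Finset.mem_range] at hn
    rw [Nat.cast_sub (by omega)]
  have hr1 : ∑ n ∈ Finset.range (min k l + 1),
      (nu0 ν i n * c⁻¹ ^ n) • C.vE ν Λ i (k - n : ℕ) (C.vf i (l - n) z) =
      ∑ n ∈ Finset.range (l + 1), (nu0 ν i n * c⁻¹ ^ n) • C.vE ν Λ i (k - n) (C.vf i (l - n) z) := by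
    rw [← hext _ fun n hn => by rw [vE_of_neg Λ i (by omega : (k : ℤ) - n < 0)]; simp]
    refine Finset.sum_congr rfl fun n hn => ?_
    rw [Finset.mem_range] at hn
    rw [Nat.cast_sub (by omega)]
  rw [hl1, hr1]
  have h2 : ∀ n ∈ Finset.range (l + 1), (nu0 ν i n * c⁻¹ ^ n) • C.vE ν Λ i (k - n) (C.vf i (l - n) z) =
      ∑ m ∈ Finset.range (l + 1 - n), (nu0 ν i n * c⁻¹ ^ n * gcoef ν i c m) •
        C.vf i (l - (n + m)) (C.vE ν Λ i (k - (n + m : ℕ)) z) := by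
    intro n hn
    rw [Finset.mem_range] at hn
    rw [vE_vf (hl.sub_left n) _ hz, Finset.smul_sum, show l - n + 1 = l + 1 - n by omega]
    refine Finset.sum_congr rfl fun m _ => ?_
    rw [smul_smul, show (((l - n : ℕ) : ℤ) - (k - n)) = (l : ℤ) - k by omega, ← hc, Nat.sub_sub, Nat.cast_add,
      sub_sub]
  rw [Finset.sum_congr rfl h2, ← Finset.sum_range_diag_flip (l + 1) fun n m =>
    (nu0 ν i n * c⁻¹ ^ n * gcoef ν i c m) • C.vf i (l - (n + m)) (C.vE ν Λ i (k - (n + m : ℕ)) z)]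
  refine Finset.sum_congr rfl fun p _ => ?_
  rw [← sum_gcoef, Finset.sum_smul]
  refine Finset.sum_congr rfl fun n hn => ?_
  rw [Finset.mem_range] at hn
  rw [Nat.add_sub_cancel' (by omega)]

open Classical in
variable (C ν) in
/-- The Verma module of highest weight `Λ`. -/
noncomputable def verma (Λ : WeightLattice I) : C.PreRep ν C.Fock where
  T := C.vT Λ
  e i k := if k = 0 ∨ C.IsIndex i k then C.vE ν Λ i k else 0
  f := C.vf
  e_zero i := by rw [if_pos (Or.inl rfl), Nat.cast_zero, vE_zero]
  f_zero := vf_zero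
  iSup_wt := iSup_wtSpace_vT Λ
  e_mem i l hl := by
    rw [if_pos (Or.inr hl), ← natCast_zsmul]; exact vE_mem_degSpace Λ i l
  f_mem i l _ := vf_mem_degSpace Λ i l
  comm_ef i j k l hk hl hij := by
    rw [if_pos (Or.inr hk)]; exact commute_vE_vf Λ hij k l
  ef i k l hk hl μ z hz := by
    have := vE_vf_relation (ν := ν) (k := k) hl hz
    simpa only [if_pos (hk.sub_left _)] using this

theorem verma_e {Λ : WeightLattice I} {i : I} {k : ℕ} (hk : k = 0 ∨ C.IsIndex i k) :
    (C.verma ν Λ).e i k = C.vE ν Λ i k := if_pos hk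

/-- The operators `e_{ik}` and `e_{jl}` with `a_ij = 0` commute on Verma modules. -/
theorem commute_vE_vE (Λ : WeightLattice I) {i j : I} (hij : C.a i j = 0) (k l : ℤ) :
    Commute (C.vE ν Λ i k) (C.vE ν Λ j l) := by
  refine fock_ext fun w => ?_
  rw [Module.End.mul_apply, Module.End.mul_apply]
  induction w generalizing k l with
  | nil =>
    rcases eq_or_ne k 0 with rfl | hk
    · rw [vE_zero]; rfl
    rcases eq_or_ne l 0 with rfl | hl
    · rw [vE_zero]; rfl
    rw [vE_nil hk, vE_nil hl, map_zero, map_zero]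
  | cons x w ih =>
    have hcpar : ∀ {i' j' : I}, C.a i' j' = 0 → ∀ (m d : ℤ), C.cpar i' (C.wordWt Λ w + m • C.root j') d =
        C.cpar i' (C.wordWt Λ w) d := by
      intro i' j' h m d
      rw [cpar, cpar, LinearMap.add_apply, LinearMap.smul_apply, root_coroot, h, smul_zero, add_zero]
    have hji : C.a j i = 0 := by
      have h := C.symm i j
      rw [hij, mul_zero] at h
      exact (mul_eq_zero.1 h.symm).resolve_left (C.s_pos j).ne'
    have hw := single_mem_wtSpace (C := C) Λ w
    have hmem : ∀ (j' : I) (m : ℤ), _ := fun j' m =>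
      apply_mem_wtSpace (vE_mem_degSpace (ν := ν) Λ j' m) hw
    -- one of the two indices equals the index of the first letter, the other does not
    have key : ∀ {i' j' : I} (_ : C.a i' j' = 0) (_ : x.i = i') (_ : j' ≠ i') (k' l' : ℤ)
        (_ : ∀ k' l' : ℤ, C.vE ν Λ i' k' (C.vE ν Λ j' l' (Finsupp.single w 1)) =
          C.vE ν Λ j' l' (C.vE ν Λ i' k' (Finsupp.single w 1))),
        C.vE ν Λ i' k' (C.vE ν Λ j' l' (Finsupp.single (x :: w) 1)) =
          C.vE ν Λ j' l' (C.vE ν Λ i' k' (Finsupp.single (x :: w) 1)) := by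
      intro i' j' ha hx hne k' l' IH
      subst hx
      have hc := fun (k : ℤ) (m : ℕ) (z : C.Fock) => LinearMap.congr_fun (commute_vE_vf (ν := ν) Λ hne k m) z
      simp only [Module.End.mul_apply] at hc
      rw [← vf_index, hc, vE_vf (Or.inr x.isIndex) _ (hmem _ _), vE_vf (Or.inr x.isIndex) _ hw, map_sum]
      refine Finset.sum_congr rfl fun n _ => ?_
      rw [map_smul, hc, hcpar ha, IH]
    by_cases hxi : x.i = i
    · by_cases hji' : j = i
      · subst hji'
        have hd : ∀ d, C.cpar j (C.wordWt Λ w) d = C.cpar j (C.wordWt Λ w) 0 := by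
          intro d
          rw [cpar, cpar, qpar, hij, mul_zero, Int.zero_ediv, zpow_zero, one_zpow, one_zpow]
        have hs : ∀ k l : ℤ, C.vE ν Λ j k (C.vE ν Λ j l (Finsupp.single (x :: w) 1)) =
            ∑ n ∈ Finset.range (x.l + 1), ∑ m ∈ Finset.range (x.l + 1 - n),
              (gcoef ν j (C.cpar j (C.wordWt Λ w) 0) n * gcoef ν j (C.cpar j (C.wordWt Λ w) 0) m) •
                C.vf j (x.l - (n + m))
                  (C.vE ν Λ j (k - m) (C.vE ν Λ j (l - n) (Finsupp.single w 1))) := by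
          intro k l
          have hx := x.isIndex
          rw [← vf_index]
          rw [hxi] at hx ⊢
          rw [vE_vf (Or.inr hx) _ hw, map_sum]
          refine Finset.sum_congr rfl fun n hn => ?_
          rw [Finset.mem_range] at hn
          rw [map_smul, vE_vf (hx.sub_left n) _ (hmem _ _), Finset.smul_sum,
            show x.l - n + 1 = x.l + 1 - n by omega]
          refine Finset.sum_congr rfl fun m _ => ?_
          rw [smul_smul, hcpar hij, hd, hd ((x.l - n : ℕ) - k), Nat.sub_sub]
        rw [hs, hs, ← Finset.sum_range_diag_flip (x.l + 1) fun n m =>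
            (gcoef ν j (C.cpar j (C.wordWt Λ w) 0) n * gcoef ν j (C.cpar j (C.wordWt Λ w) 0) m) •
                C.vf j (x.l - (n + m))
                  (C.vE ν Λ j (k - m) (C.vE ν Λ j (l - n) (Finsupp.single w 1))),
          ← Finset.sum_range_diag_flip (x.l + 1) fun n m =>
            (gcoef ν j (C.cpar j (C.wordWt Λ w) 0) n * gcoef ν j (C.cpar j (C.wordWt Λ w) 0) m) •
                C.vf j (x.l - (n + m))
                  (C.vE ν Λ j (l - m) (C.vE ν Λ j (k - n) (Finsupp.single w 1)))]
        refine Finset.sum_congr rfl fun p _ => ?_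
        rw [← Finset.sum_range_reflect]
        refine Finset.sum_congr rfl fun n hn => ?_
        rw [Finset.mem_range] at hn
        rw [show p + 1 - 1 - n = p - n by omega, show p - (p - n) = n by omega, ih,
          mul_comm (gcoef ν j _ (p - n)), Nat.add_comm (p - n) n]
      · exact key hij hxi hji' k l fun k l => ih k l
    · by_cases hxj : x.i = j
      · exact (key hji hxj (fun h => hxi (hxj.trans h.symm)) l k fun l k => (ih k l).symm).symm
      · have hc := fun (i' : I) (h : i' ≠ x.i) (k : ℤ) (m : ℕ) (z : C.Fock) =>
          LinearMap.congr_fun (commute_vE_vf (ν := ν) Λ h k m) z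
        simp only [Module.End.mul_apply] at hc
        rw [← vf_index, hc j (Ne.symm hxj), hc i (Ne.symm hxi), hc i (Ne.symm hxi), hc j (Ne.symm hxj), ih]

end BorcherdsCartanMatrix

namespace QuantumSl2

variable {k : Type*} [Field k]

/-! ### The ideal of the Serre relators and commutators -/

theorem serreSum_one_one {A : Type*} [Ring A] [Algebra k A] (q : k) (E : A) : serreSum q E 1 1 0 = 0 := by
  have h : Finset.Icc (0 : ℤ) 1 = {0, 1} := by decide
  rw [serreSum, h, Finset.sum_pair (by norm_num)]
  simp

variable {M : Type*} [AddCommGroup M] [Module k M] {q : k} {E B : Module.End k M}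

theorem Sl2Weight.smul_left {W : ℤ → Submodule k M} {c : k} (hc : c ≠ 0) (h : Sl2Weight q E (c • B) W) :
    Sl2Weight q (c • E) B W where
  generic := h.generic
  E_mem hz := (W _).smul_mem _ (h.E_mem hz)
  B_mem hz := by
    have := (W _).smul_mem c⁻¹ (h.B_mem hz)
    rwa [LinearMap.smul_apply, inv_smul_smul₀ hc] at this
  comm hz := by
    rw [← h.comm hz]
    simp only [LinearMap.smul_apply, map_smul]

/-- The higher Serre relations on vectors, modulo a subspace stable under `E`. -/
theorem serreSum_apply_mem (hq : Generic q) {x : Module.End k M} {K : Submodule k M}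
    (hE : ∀ z ∈ K, E z ∈ K) {N : ℤ} (hN : 0 ≤ N) (h : ∀ z, serreSum q E x (N + 1) 0 z ∈ K) (d i : ℕ)
    (hi : i ≤ d) (z : M) : serreSum q E x (N + 1 + d) (d - 2 * i) z ∈ K :=
  serreSum_mem hq (E := E) (x := x) (J :=
    { carrier := {A | ∀ z, A z ∈ K}
      add_mem' := fun hA hB z => add_mem (hA z) (hB z)
      zero_mem' := fun _ => zero_mem _
      smul_mem' := fun c _ hA z => Submodule.smul_mem _ c (hA z) })
    (fun _ hA z => hE _ (hA z)) (fun _ hA _ => hA _) hN h d i hi z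

theorem dp_apply_mem {J : Submodule k M} (hE : ∀ z ∈ J, E z ∈ J) (r : ℤ) {z : M} (hz : z ∈ J) :
    dp q E r z ∈ J := by
  rw [dp]
  split_ifs
  · refine J.smul_mem _ ?_
    generalize r.toNat = n
    induction n with
    | zero => exact hz
    | succ n ih => rw [pow_succ']; exact hE _ ih
  · exact zero_mem _

theorem pow_apply_mem_of_le {J : Submodule k M} (hE : ∀ z ∈ J, E z ∈ J) {p p' : ℕ} (hp : p ≤ p') {z : M}
    (hz : (E ^ p) z ∈ J) : (E ^ p') z ∈ J := by
  obtain ⟨d, rfl⟩ := Nat.exists_eq_add_of_le' hp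
  clear hp
  induction d with
  | zero => simpa using hz
  | succ d ih => rw [add_right_comm, pow_succ']; exact hE _ ih

/-- Modulo a stable subspace in which the Serre relation holds, `x` preserves the vectors on which `E` is
nilpotent. -/
theorem pow_apply_mem_of_serre (hq : Generic q) {x : Module.End k M} {J : Submodule k M}
    (hE : ∀ z ∈ J, E z ∈ J) (hx : ∀ z ∈ J, x z ∈ J) {N : ℕ}
    (hS : ∀ z, serreSum q E x (N + 1) 0 z ∈ J) (p : ℕ) :
    ∀ z, (E ^ p) z ∈ J → (E ^ (p * (N + 1))) (x z) ∈ J := by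
  induction p with
  | zero => intro z hz; rw [zero_mul]; exact hx z hz
  | succ p ih =>
    intro z hz
    have hE' : ∀ z ∈ J, ∀ n : ℕ, (E ^ n) z ∈ J := fun z hz n =>
      pow_apply_mem_of_le hE (Nat.zero_le n) (by simpa using hz)
    have hmem : ((N : ℤ) + 1) ∈ Finset.Icc (0 : ℤ) (N + 1) := by rw [Finset.mem_Icc]; omega
    have h1 := hE' _ (hS z) (p * (N + 1))
    -- The Serre relation expresses `E^(N+1) x z` by terms `E^(r) x E^(s) z` with `s ≥ 1`, to which the
    -- induction hypothesis applies.
    rw [serreSum, ← Finset.add_sum_erase _ _ hmem, LinearMap.add_apply, map_add, LinearMap.sum_apply,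
      map_sum] at h1
    have h2 := (J.add_mem_iff_left (J.sum_mem fun r hr => ?_)).1 h1
    · rw [LinearMap.smul_apply, map_smul, J.smul_mem_iff (mul_ne_zero (zpow_ne_zero _ (by norm_num))
        (zpow_ne_zero _ hq.ne_zero)), sub_self, dp_zero, mul_one, Module.End.mul_apply,
        show (N : ℤ) + 1 = ((N + 1 : ℕ) : ℤ) by push_cast; rfl, dp_natCast, LinearMap.smul_apply, map_smul,
        J.smul_mem_iff (inv_ne_zero (hq.qfact_ne_zero _)), ← Module.End.mul_apply, ← pow_add] at h2
      rwa [add_mul, one_mul]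
    · rw [Finset.mem_erase, Finset.mem_Icc] at hr
      rw [LinearMap.smul_apply, map_smul]
      refine J.smul_mem _ ?_
      rw [Module.End.mul_apply, Module.End.mul_apply, ← Module.End.mul_apply,
        (commute_dp q ((Commute.refl E).pow_left _) r).eq, Module.End.mul_apply]
      refine dp_apply_mem hE _ (ih _ ?_)
      obtain ⟨s, hs⟩ := Int.eq_ofNat_of_zero_le (show 0 ≤ (N : ℤ) + 1 - r - 1 by omega)
      rw [show (N : ℤ) + 1 - r = ((s + 1 : ℕ) : ℤ) by push_cast; omega, dp_natCast, LinearMap.smul_apply, map_smul,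
        ← Module.End.mul_apply, ← pow_add, show p + (s + 1) = s + (p + 1) by ring, pow_add, Module.End.mul_apply]
      exact J.smul_mem _ (hE' _ hz s)

theorem Sl2Weight.pow_E_B_eq_zero {W : ℤ → Submodule k M} (h : Sl2Weight q E B W) (p : ℕ) :
    ∀ {n : ℤ} {z : M}, z ∈ W n → (E ^ p) z = 0 → (E ^ (p + 1)) (B z) = 0 := by
  induction p with
  | zero => intro n z _ h0; rw [pow_zero, Module.End.one_apply] at h0; rw [h0]; simp
  | succ p ih =>
    intro n z hz h0
    rw [pow_succ, Module.End.mul_apply, sub_eq_iff_eq_add.1 (h.comm hz), map_add, map_smul, h0, smul_zero,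
      zero_add]
    exact ih (h.E_mem hz) (by rwa [← Module.End.mul_apply, ← pow_succ])

end QuantumSl2

namespace BorcherdsCartanMatrix

open QuantumSl2

variable {I : Type u} {C : BorcherdsCartanMatrix I} {ν : I → ℕ → Qq}

/-- The images of the vectors of `S`, of the Serre relators and of the commutators under words in the
`f_{il}`. -/
inductive RelVec (S : Set C.Fock) : C.Fock → Prop
  | base (g : C.Fock) (hg : g ∈ S) : RelVec S g
  | serre (i j : I) (l : ℕ) (hi : C.IsReal i) (hj : C.IsIndex j l) (hij : i ≠ j) (w : List C.Index) :
      RelVec S (serreSum (C.qi i) (C.vf i 1) (C.vf j l) (-(l * C.a i j) + 1) 0 (Finsupp.single w 1))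
  | comm (i j : I) (k l : ℕ) (hi : C.IsIndex i k) (hj : C.IsIndex j l) (hij : C.a i j = 0)
      (w : List C.Index) :
      RelVec S (C.vf i k (C.vf j l (Finsupp.single w 1)) - C.vf j l (C.vf i k (Finsupp.single w 1)))
  | cons (x : C.Index) (g : C.Fock) (hg : RelVec S g) : RelVec S (C.vf x.i x.l g)

/-- The two-sided ideal of the Serre relators and commutators, plus the left ideal generated by `S`. -/
noncomputable def relSub (S : Set C.Fock) : Submodule Qq C.Fock := Submodule.span Qq {g | RelVec S g}

section RelSub

variable {S : Set C.Fock}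

theorem RelVec.mem {g : C.Fock} (hg : RelVec S g) : g ∈ relSub S := Submodule.subset_span hg

theorem relSub_induction {p : C.Fock → Prop} (hz : p 0) (ha : ∀ x y, p x → p y → p (x + y))
    (hs : ∀ (c : Qq) x, p x → p (c • x)) (hg : ∀ g, RelVec S g → p g) {z : C.Fock} (h : z ∈ relSub S) : p z :=
  Submodule.span_induction (p := fun x _ => p x) (fun g h => hg g h) hz (fun x y _ _ => ha x y)
    (fun c x _ => hs c x) h

theorem vf_mem_relSub (i : I) (l : ℕ) {z : C.Fock} (hz : z ∈ relSub S) : C.vf i l z ∈ relSub S := by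
  by_cases h0 : l = 0
  · rw [h0, vf_zero]; exact hz
  by_cases h : C.IsIndex i l
  · exact relSub_induction (p := fun z => C.vf i l z ∈ relSub S) (by simp)
      (fun a b ha hb => by rw [map_add]; exact add_mem ha hb)
      (fun c a ha => by rw [map_smul]; exact Submodule.smul_mem _ _ ha)
      (fun g hg => RelVec.mem (.cons ⟨i, l, h⟩ g hg)) hz
  · rw [vf, if_neg h0, dif_neg h]; exact zero_mem _

theorem apply_mem_of_single {V : Type*} [AddCommGroup V] [Module Qq V] {A : C.Fock →ₗ[Qq] V} {J : Submodule Qq V}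
    (h : ∀ w, A (Finsupp.single w 1) ∈ J) (z : C.Fock) : A z ∈ J := by
  induction z using Finsupp.induction_linear with
  | zero => rw [map_zero]; exact zero_mem _
  | add x y hx hy => rw [map_add]; exact add_mem hx hy
  | single w c =>
    rw [← mul_one c, ← smul_eq_mul, ← Finsupp.smul_single, map_smul]
    exact Submodule.smul_mem _ _ (h w)

theorem serre_mem_relSub {i j : I} {l : ℕ} (hi : C.IsReal i) (hj : l = 0 ∨ C.IsIndex j l) (hij : i ≠ j)
    (z : C.Fock) : serreSum (C.qi i) (C.vf i 1) (C.vf j l) (-(l * C.a i j) + 1) 0 z ∈ relSub S := by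
  rcases hj with rfl | hj
  · rw [vf_zero, Nat.cast_zero, zero_mul, neg_zero, zero_add, serreSum_one_one]; exact zero_mem _
  · exact apply_mem_of_single (fun w => RelVec.mem (.serre i j l hi hj hij w)) z

theorem comm_mem_relSub {i j : I} {k l : ℕ} (hi : k = 0 ∨ C.IsIndex i k) (hj : l = 0 ∨ C.IsIndex j l)
    (hij : C.a i j = 0) (z : C.Fock) : C.vf i k (C.vf j l z) - C.vf j l (C.vf i k z) ∈ relSub S := by
  rcases hi with rfl | hi
  · rw [vf_zero, Module.End.one_apply, Module.End.one_apply, sub_self]; exact zero_mem _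
  rcases hj with rfl | hj
  · rw [vf_zero, Module.End.one_apply, Module.End.one_apply, sub_self]; exact zero_mem _
  induction z using Finsupp.induction_linear with
  | zero => simp
  | add x y hx hy => simp only [map_add, add_sub_add_comm]; exact add_mem hx hy
  | single w c =>
    rw [← mul_one c, ← smul_eq_mul, ← Finsupp.smul_single]
    simp only [map_smul, ← smul_sub]
    exact Submodule.smul_mem _ _ (RelVec.mem (.comm i j k l hi hj hij w))

theorem RelVec.mem_wtSpace {Λ : WeightLattice I} (hS : ∀ g ∈ S, ∃ μ, g ∈ wtSpace (C.vT Λ) μ) {g : C.Fock}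
    (hg : RelVec S g) : ∃ μ, g ∈ wtSpace (C.vT Λ) μ := by
  induction hg with
  | base g hg => exact hS g hg
  | serre i j l hi hj hij w =>
    exact ⟨_, apply_mem_wtSpace (serreSum_mem_degSpace (vf_mem_degSpace Λ i 1) (vf_mem_degSpace Λ j l) _ _ _)
      (single_mem_wtSpace Λ w)⟩
  | comm i j k l hi hj hij w =>
    have hw := single_mem_wtSpace Λ w
    refine ⟨_, sub_mem (apply_mem_wtSpace (vf_mem_degSpace Λ i k) (apply_mem_wtSpace (vf_mem_degSpace Λ j l) hw)) ?_⟩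
    rw [add_right_comm]
    exact apply_mem_wtSpace (vf_mem_degSpace Λ j l) (apply_mem_wtSpace (vf_mem_degSpace Λ i k) hw)
  | cons x g _ ih =>
    obtain ⟨μ, hμ⟩ := ih
    exact ⟨_, apply_mem_wtSpace (vf_mem_degSpace Λ x.i x.l) hμ⟩

theorem vT_mem_relSub {Λ : WeightLattice I} (hS : ∀ g ∈ S, ∃ μ, g ∈ wtSpace (C.vT Λ) μ)
    (h : DualWeightLattice I) {z : C.Fock} (hz : z ∈ relSub S) : C.vT Λ h z ∈ relSub S := by
  refine relSub_induction (p := fun z => C.vT Λ h z ∈ relSub S) (by simp)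
      (fun a b ha hb => by rw [map_add]; exact add_mem ha hb)
      (fun c a ha => by rw [map_smul]; exact Submodule.smul_mem _ _ ha) (fun g hg => ?_) hz
  obtain ⟨μ, hμ⟩ := hg.mem_wtSpace hS
  rw [BorcherdsCartanMatrix.mem_wtSpace.1 hμ]
  exact Submodule.smul_mem _ _ hg.mem

/-- The higher Serre relations among the `f_{il}`. -/
theorem higher_serre_mem_relSub {i j : I} {l n b : ℕ} (hi : C.IsReal i) (hj : C.IsIndex j l) (hij : i ≠ j)
    (hn : n ≤ l) (hb : b ≤ n) (z : C.Fock) :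
    serreSum (C.qi i) (C.vf i 1) (C.vf j (l - n)) (-(l * C.a i j) + 1) (-C.a i j * (n - 2 * b)) z ∈
      relSub S := by
  obtain ⟨β, hβ⟩ := Int.eq_ofNat_of_zero_le (neg_nonneg.2 (C.offdiag i j hij))
  have h1 := serreSum_apply_mem (generic_qi i) (fun z hz => vf_mem_relSub i 1 hz) (neg_nonneg.2
    (mul_nonpos_of_nonneg_of_nonpos (Int.natCast_nonneg (l - n)) (C.offdiag i j hij)))
    (fun z => serre_mem_relSub (S := S) hi (hj.sub_left n) hij z) (β * n) (β * b) (Nat.mul_le_mul_left _ hb) z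
  have ha : C.a i j = -(β : ℤ) := by rw [← neg_eq_iff_eq_neg]; exact hβ
  have h2 : -(((l - n : ℕ) : ℤ) * C.a i j) + 1 + ((β * n : ℕ) : ℤ) = -(l * C.a i j) + 1 := by
    rw [ha, Nat.cast_sub hn]; push_cast; ring
  have h3 : ((β * n : ℕ) : ℤ) - 2 * ((β * b : ℕ) : ℤ) = -C.a i j * (n - 2 * b) := by
    rw [ha]; push_cast; ring
  rwa [h2, h3] at h1

theorem cpar_add_smul {i j : I} (μ : WeightLattice I) (d m : ℤ) :
    C.cpar j (μ + m • -C.root i) d = C.cpar j μ d * C.qi i ^ (C.a i j * m) := by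
  rw [cpar, cpar, mul_assoc, qi, ← zpow_mul, ← zpow_add₀ qq_ne_zero, LinearMap.add_apply, LinearMap.smul_apply,
    LinearMap.neg_apply, root_coroot]
  congr 2
  have := C.symm i j
  rw [smul_eq_mul]
  linear_combination (-m) * this

theorem cpar_add_of_eq_zero {i j : I} (h : C.a i j = 0) (μ : WeightLattice I) (m d : ℤ) :
    C.cpar i (μ + m • C.root j) d = C.cpar i μ d := by
  rw [cpar, cpar, LinearMap.add_apply, LinearMap.smul_apply, root_coroot, h, smul_zero, add_zero]

/-- `e_{jk}` maps the Serre relator of `f_i` and `f_{jl}` into the relations: moved to the right, it leaves the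
sums of the higher Serre relations of `f_i` and `f_{j,l-n}`, since the weight of `f_i^(s) z` enters through
powers `q_i^{a_ij s (n - 2b)}`. -/
theorem vE_serre_of_other {Λ μ : WeightLattice I} {i j : I} {l : ℕ} (k : ℕ) (hi : C.IsReal i) (hj : C.IsIndex j l)
    (hij : i ≠ j) {z : C.Fock} (hz : z ∈ wtSpace (C.vT Λ) μ) :
    C.vE ν Λ j k (serreSum (C.qi i) (C.vf i 1) (C.vf j l) (-(l * C.a i j) + 1) 0 z) ∈ relSub S := by
  set q := C.qi i with hq
  set m := -(l * C.a i j) + 1 with hm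
  have hq0 : q ≠ 0 := qi_ne_zero i
  have hc : ∀ (k r : ℤ) (z : C.Fock), C.vE ν Λ j k (dp q (C.vf i 1) r z) = dp q (C.vf i 1) r (C.vE ν Λ j k z) :=
    fun k r z => by
      have h : Commute (C.vE ν Λ j k) (dp q (C.vf i 1) r) := commute_dp q (commute_vE_vf Λ hij.symm k 1) r
      exact LinearMap.congr_fun h z
  -- the contribution of the exponent `n - 2 b` of `q_i`
  have key : C.vE ν Λ j k (serreSum q (C.vf i 1) (C.vf j l) m 0 z) =
      ∑ n ∈ Finset.range (l + 1), ∑ b ∈ Finset.range (n + 1),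
        (nu0 ν j (n - b) * PowerSeries.coeff b (nuSeries ν j 1)⁻¹ *
          (C.cpar j μ (l - k) * q ^ (C.a i j * m)) ^ ((n : ℤ) - 2 * b)) •
        serreSum q (C.vf i 1) (C.vf j (l - n)) m (-C.a i j * (n - 2 * b)) (C.vE ν Λ j (k - n) z) := by
    simp only [serreSum, LinearMap.sum_apply, LinearMap.smul_apply, Module.End.mul_apply, map_sum, map_smul,
      Finset.smul_sum]
    have hterm : ∀ r ∈ Finset.Icc 0 m, ((-1 : Qq) ^ r * q ^ (0 * r)) •
        C.vE ν Λ j k (dp q (C.vf i 1) r (C.vf j l (dp q (C.vf i 1) (m - r) z))) =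
        ∑ n ∈ Finset.range (l + 1), ∑ b ∈ Finset.range (n + 1),
          (nu0 ν j (n - b) * PowerSeries.coeff b (nuSeries ν j 1)⁻¹ *
            (C.cpar j μ (l - k) * q ^ (C.a i j * m)) ^ ((n : ℤ) - 2 * b)) •
          ((-1 : Qq) ^ r * q ^ (-C.a i j * (n - 2 * b) * r)) •
            dp q (C.vf i 1) r (C.vf j (l - n) (dp q (C.vf i 1) (m - r) (C.vE ν Λ j (k - n) z))) := by
      intro r _
      have hz' := apply_mem_wtSpace (dp_mem_degSpace (vf_mem_degSpace Λ i 1) q (m - r)) hz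
      rw [one_smul] at hz'
      rw [hc, vE_vf (Or.inr hj) _ hz', map_sum, Finset.smul_sum]
      refine Finset.sum_congr rfl fun n _ => ?_
      rw [map_smul, cpar_add_smul, ← hq, gcoef_eq _ (mul_ne_zero (cpar_ne_zero _ _ _) (zpow_ne_zero _ hq0)),
        Finset.sum_smul, Finset.smul_sum, hc]
      refine Finset.sum_congr rfl fun b _ => ?_
      rw [smul_smul, smul_smul]
      congr 1
      rw [zero_mul, zpow_zero, mul_one, mul_zpow, mul_zpow, ← zpow_mul, ← zpow_mul,
        show C.a i j * (m - r) * ((n : ℤ) - 2 * b) =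
          C.a i j * m * ((n : ℤ) - 2 * b) + -C.a i j * (n - 2 * b) * r by ring, zpow_add₀ hq0]
      ring
    rw [Finset.sum_congr rfl hterm, Finset.sum_comm]
    refine Finset.sum_congr rfl fun n _ => ?_
    rw [Finset.sum_comm]
  rw [key]
  refine Submodule.sum_mem _ fun n hn => Submodule.sum_mem _ fun b hb => Submodule.smul_mem _ _ ?_
  rw [Finset.mem_range] at hn hb
  exact higher_serre_mem_relSub hi hj hij (by omega) (by omega) _

/-- `e_i` commutes with the Serre relator of `f_i` and `f_{jl}`, by `serreSum_B` with the roles of `e_i` and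
`f_i` exchanged. -/
theorem vE_serre_of_self {Λ μ : WeightLattice I} {i j : I} {l : ℕ} (hν : ν i 1 ≠ 0) (hi : C.IsReal i)
    (hij : i ≠ j) {z : C.Fock} (hz : z ∈ wtSpace (C.vT Λ) μ) :
    C.vE ν Λ i 1 (serreSum (C.qi i) (C.vf i 1) (C.vf j l) (-(l * C.a i j) + 1) 0 z) =
      serreSum (C.qi i) (C.vf i 1) (C.vf j l) (-(l * C.a i j) + 1) 0 (C.vE ν Λ i 1 z) := by
  set R := C.verma ν Λ with hR
  have hc0 : (ν i 1 * ((C.qi i)⁻¹ - C.qi i))⁻¹ ≠ 0 := inv_ne_zero (mul_ne_zero hν (qi_inv_sub_ne_zero i))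
  have he : R.e i 1 = C.vE ν Λ i 1 := verma_e (Or.inr hi.isIndex)
  have hsl : Sl2Weight (C.qi i) (C.vf i 1) ((ν i 1 * ((C.qi i)⁻¹ - C.qi i))⁻¹ • R.e i 1)
    (fun n => R.kWt i (-n)) := ((R.sl2Weight hi hν).smul_left hc0).swap
  have h1 := hsl.serreSum_B (x := C.vf j l) (N := -(l * C.a i j))
    ((he ▸ (commute_vE_vf Λ hij 1 l).symm : Commute (C.vf j l) (R.e i 1)).smul_right _) (fun n z hz => by
      have := R.apply_mem_kWt (vf_mem_degSpace Λ j l) hz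
      rwa [LinearMap.neg_apply, LinearMap.smul_apply, root_coroot, nsmul_eq_mul,
        show -n + -((l : ℤ) * C.a i j) = -(n - -(l * C.a i j)) by ring] at this)
    (n := -μ (coroot i)) (z := z) (by rw [neg_neg]; exact R.wtSpace_le_kWt i μ hz) (-(l * C.a i j) + 1)
  rw [show -((l : ℤ) * C.a i j) - (-(l * C.a i j) + 1) + 1 = 0 by ring, qint_zero, zero_mul, zero_smul,
    sub_eq_zero, LinearMap.smul_apply, LinearMap.smul_apply, map_smul, he] at h1
  exact (smul_right_injective _ hc0 h1).symm

/-- `e_{it}` maps the commutator of `f_{ik}` and `f_{jl}` to commutators: as `a_ij = 0`, the operator `f_{jl}`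
does not change the coefficients. -/
theorem vE_comm_of_ne {Λ μ : WeightLattice I} {i j : I} {k l : ℕ} (t : ℤ) (hi : C.IsIndex i k) (hj : C.IsIndex j l)
    (hij : C.a i j = 0) (hne : i ≠ j) {z : C.Fock} (hz : z ∈ wtSpace (C.vT Λ) μ) :
    C.vE ν Λ i t (C.vf i k (C.vf j l z) - C.vf j l (C.vf i k z)) ∈ relSub S := by
  have hc : ∀ (k : ℤ) (z : C.Fock), C.vE ν Λ i k (C.vf j l z) = C.vf j l (C.vE ν Λ i k z) :=
    fun k z => LinearMap.congr_fun (commute_vE_vf (ν := ν) Λ hne k l) z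
  have hz' := apply_mem_wtSpace (vf_mem_degSpace Λ j l) hz
  rw [← natCast_zsmul, ← neg_smul] at hz'
  rw [map_sub, hc, vE_vf (Or.inr hi) _ hz',
    vE_vf (Or.inr hi) _ hz, map_sum, ← Finset.sum_sub_distrib]
  refine Submodule.sum_mem _ fun n _ => ?_
  rw [cpar_add_of_eq_zero hij, map_smul, ← smul_sub, hc]
  exact Submodule.smul_mem _ _ (comm_mem_relSub (hi.sub_left n) (Or.inr hj) hij _)

/-- The case `i = j` of the commutators, where `a_ii = 0`. -/
theorem vE_comm_of_eq {Λ μ : WeightLattice I} {i : I} {k l : ℕ} (t : ℤ) (hk : C.IsIndex i k) (hl : C.IsIndex i l)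
    (hi : C.a i i = 0) {z : C.Fock} (hz : z ∈ wtSpace (C.vT Λ) μ) :
    C.vE ν Λ i t (C.vf i k (C.vf i l z) - C.vf i l (C.vf i k z)) ∈ relSub S := by
  have hd : ∀ d, C.cpar i μ d = C.cpar i μ 0 := by
    intro d
    rw [cpar, cpar, qpar, hi, mul_zero, Int.zero_ediv, zpow_zero, one_zpow, one_zpow]
  have key : ∀ k l : ℕ, C.IsIndex i k → C.IsIndex i l → C.vE ν Λ i t (C.vf i k (C.vf i l z)) =
      ∑ n ∈ Finset.range (k + 1), ∑ m ∈ Finset.range (l + 1),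
        (gcoef ν i (C.cpar i μ 0) n * gcoef ν i (C.cpar i μ 0) m) •
          C.vf i (k - n) (C.vf i (l - m) (C.vE ν Λ i (t - n - m) z)) := by
    intro k l hk hl
    have hz' := apply_mem_wtSpace (vf_mem_degSpace Λ i l) hz
    rw [← natCast_zsmul, ← neg_smul] at hz'
    rw [vE_vf (Or.inr hk) _ hz']
    refine Finset.sum_congr rfl fun n _ => ?_
    rw [vE_vf (Or.inr hl) _ hz, map_sum, Finset.smul_sum, cpar_add_of_eq_zero hi, hd]
    refine Finset.sum_congr rfl fun m _ => ?_
    rw [map_smul, smul_smul, hd (l - (t - n))]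
  rw [map_sub, key k l hk hl, key l k hl hk,
    Finset.sum_comm (s := Finset.range (l + 1)), ← Finset.sum_sub_distrib]
  refine Submodule.sum_mem _ fun n _ => ?_
  rw [← Finset.sum_sub_distrib]
  refine Submodule.sum_mem _ fun m _ => ?_
  rw [mul_comm (gcoef ν i _ m), ← smul_sub, sub_right_comm t]
  exact Submodule.smul_mem _ _ (comm_mem_relSub (hk.sub_left n) (hl.sub_left m) hi _)

/-- The `e_{ik}` preserve the relations if they map the vectors of `S` into them. Hence a Verma module modulo the
relations is again a representation. -/
theorem vE_mem_relSub {Λ : WeightLattice I} (hν : ∀ i, C.IsReal i → ν i 1 ≠ 0)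
    (hS : ∀ g ∈ S, ∃ μ, g ∈ wtSpace (C.vT Λ) μ)
    (hSe : ∀ g ∈ S, ∀ i k, C.IsIndex i k → C.vE ν Λ i k g ∈ relSub S) {i : I} {k : ℕ}
    (hk : k = 0 ∨ C.IsIndex i k) {z : C.Fock} (hz : z ∈ relSub S) : C.vE ν Λ i k z ∈ relSub S := by
  refine relSub_induction (p := fun z => ∀ k : ℕ, k = 0 ∨ C.IsIndex i k → C.vE ν Λ i k z ∈ relSub S)
      (fun k hk => by simp)
      (fun a b ha hb k hk => by rw [map_add]; exact add_mem (ha k hk) (hb k hk))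
      (fun c a ha k hk => by rw [map_smul]; exact Submodule.smul_mem _ _ (ha k hk)) (fun g hg => ?_) hz k hk
  clear hz z hk k
  intro k hk
  rcases hk with rfl | hk
  · rw [Nat.cast_zero, vE_zero]; exact hg.mem
  have hcomm : ∀ {j : I} (_ : i ≠ j) (k : ℤ) (l : ℕ), Commute (C.vE ν Λ i k) (C.vf j l) := fun h k l =>
    commute_vE_vf Λ h k l
  induction hg generalizing k with
  | base g hg => exact hSe g hg i k hk
  | serre i' j' l hi hj hij w =>
    have hw := single_mem_wtSpace (C := C) Λ w
    by_cases h1 : i = i'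
    · subst h1
      have : k = 1 := by
        rcases hk with h | h
        · exact h.2
        · have := hi; rw [IsReal] at this; omega
      rw [this, Nat.cast_one, vE_serre_of_self (hν i hi) hi hij hw]
      exact serre_mem_relSub hi (Or.inr hj) hij _
    by_cases h2 : i = j'
    · subst h2
      exact vE_serre_of_other k hi hj hij hw
    · have hc : Commute (C.vE ν Λ i k)
          (serreSum (C.qi i') (C.vf i' 1) (C.vf j' l) (-(l * C.a i' j') + 1) 0) :=
        Commute.sum_right _ _ _ fun r _ => (((commute_dp _ (hcomm h1 k 1) _).mul_right (hcomm h2 k l)).mul_right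
          (commute_dp _ (hcomm h1 k 1) _)).smul_right _
      rw [← Module.End.mul_apply, hc.eq]
      exact serre_mem_relSub hi (Or.inr hj) hij _
  | comm i' j' k' l' hi hj hij w =>
    have hw := single_mem_wtSpace (C := C) Λ w
    by_cases h1 : i = i'
    · subst h1
      by_cases h2 : i = j'
      · subst h2
        exact vE_comm_of_eq k hi hj hij hw
      · exact vE_comm_of_ne k hi hj hij h2 hw
    by_cases h2 : i = j'
    · subst h2
      have hji : C.a i i' = 0 := by
        have h := C.symm i' i
        rw [hij, mul_zero] at h
        exact (mul_eq_zero.1 h.symm).resolve_left (C.s_pos i).ne'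
      rw [← neg_sub, map_neg]
      exact neg_mem (vE_comm_of_ne k hj hi hji h1 hw)
    · have hc : ∀ {j : I} (_ : i ≠ j) (l : ℕ) (z : C.Fock),
          C.vE ν Λ i k (C.vf j l z) = C.vf j l (C.vE ν Λ i k z) :=
        fun h l z => LinearMap.congr_fun (hcomm h k l) z
      rw [map_sub, hc h1, hc h2, hc h2, hc h1]
      exact comm_mem_relSub (Or.inr hi) (Or.inr hj) hij _
  | cons x g hg ih =>
    by_cases h1 : i = x.i
    · subst h1
      obtain ⟨μ, hμ⟩ := hg.mem_wtSpace hS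
      rw [vE_vf (Or.inr x.isIndex) _ hμ]
      refine Submodule.sum_mem _ fun n _ => Submodule.smul_mem _ _ (vf_mem_relSub _ _ ?_)
      by_cases hn : n ≤ k
      · rw [← Nat.cast_sub hn]
        rcases hk.sub_left n with h0 | h0
        · rw [h0, Nat.cast_zero, vE_zero]; exact hg.mem
        · exact ih _ h0
      · rw [vE_of_neg _ _ (by omega)]; exact zero_mem _
    · rw [← Module.End.mul_apply, (hcomm h1 k x.l).eq]
      exact vf_mem_relSub _ _ (ih k hk)

end RelSub

end BorcherdsCartanMatrix

namespace BorcherdsCartanMatrix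

open QuantumSl2

variable {I : Type u} {C : BorcherdsCartanMatrix I} {ν : I → ℕ → Qq}

/-! ### Integrable highest weight modules -/

variable (C) in
/-- The vectors `f_i^{Λ(h_i) + 1} v` of the Verma module with highest weight vector `v`, for real `i`. -/
def singVec (Λ : WeightLattice I) : Set C.Fock :=
  {g | ∃ i, C.IsReal i ∧ g = (C.vf i 1 ^ ((Λ (coroot i)).toNat + 1)) (Finsupp.single [] 1)}

theorem wordWt_nil (Λ : WeightLattice I) : C.wordWt Λ [] = Λ := by
  rw [wordWt, List.map_nil, List.sum_nil, sub_zero]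

theorem singVec_mem_wtSpace (Λ : WeightLattice I) : ∀ g ∈ C.singVec Λ, ∃ μ, g ∈ wtSpace (C.vT Λ) μ := by
  rintro _ ⟨i, _, rfl⟩
  exact ⟨_, apply_mem_wtSpace (pow_mem_degSpace (vf_mem_degSpace Λ i 1) _) (single_mem_wtSpace Λ [])⟩

/-- The vectors `f_i^{Λ(h_i) + 1} v` are singular, by the formula for `e_i f_i^(s) v`. -/
theorem vE_singVec {Λ : WeightLattice I} (hΛ : ∀ i, C.IsReal i → 0 ≤ Λ (coroot i))
    (hν : ∀ i, C.IsReal i → ν i 1 ≠ 0) : ∀ g ∈ C.singVec Λ, ∀ i k, C.IsIndex i k → C.vE ν Λ i k g = 0 := by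
  rintro _ ⟨j, hj, rfl⟩ i k hk
  have hk0 : (k : ℤ) ≠ 0 := by rcases hk with h | h <;> omega
  by_cases hij : i = j
  · subst hij
    have hk1 : k = 1 := by
      rcases hk with h | h
      · exact h.2
      · have := hj; rw [IsReal] at this; omega
    subst hk1
    have hsl := (C.verma ν Λ).sl2Weight hj (hν i hj)
    rw [verma_e (Or.inr hj.isIndex)] at hsl
    have hw : Finsupp.single [] 1 ∈ (C.verma ν Λ).kWt i (Λ (coroot i)) :=
      (C.verma ν Λ).wtSpace_le_kWt i Λ (by
        have := single_mem_wtSpace (C := C) Λ []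
        rwa [wordWt_nil] at this)
    have h1 := hsl.E_dpB hw (((Λ (coroot i)).toNat + 1 : ℕ) : ℤ)
    have h2 : (Λ (coroot i)) - (((Λ (coroot i)).toNat + 1 : ℕ) : ℤ) + 1 = 0 := by
      have := hΛ i hj; push_cast; omega
    rw [h2, qint_zero, zero_smul, add_zero, vE_nil hk0, map_zero, dp_natCast, PreRep.opB, smul_pow,
      LinearMap.smul_apply, LinearMap.smul_apply, map_smul, map_smul] at h1
    have hc0 : ((ν i 1 * ((C.qi i)⁻¹ - C.qi i))⁻¹) ^ ((Λ (coroot i)).toNat + 1) ≠ 0 :=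
      pow_ne_zero _ (inv_ne_zero (mul_ne_zero (hν i hj) (qi_inv_sub_ne_zero i)))
    rw [smul_eq_zero_iff_right (inv_ne_zero ((generic_qi i).qfact_ne_zero _)), smul_eq_zero_iff_right hc0] at h1
    exact h1
  · have hc : Commute (C.vE ν Λ i k) (C.vf j 1 ^ ((Λ (coroot j)).toNat + 1)) :=
      (commute_vE_vf Λ hij k 1).pow_right _
    rw [← Module.End.mul_apply, hc.eq, Module.End.mul_apply, vE_nil hk0, map_zero]

section

variable {Λ : WeightLattice I} (hΛ : ∀ i, C.IsReal i → 0 ≤ Λ (coroot i)) (hν : ∀ i, C.IsReal i → ν i 1 ≠ 0)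

variable (ν) in
/-- The integrable module with highest weight `Λ`. -/
noncomputable def highest : C.PreRep ν (C.Fock ⧸ relSub (C.singVec Λ)) :=
  (C.verma ν Λ).quot (relSub (C.singVec Λ)) (fun h _ hz => vT_mem_relSub (singVec_mem_wtSpace Λ) h hz)
    (fun i k z hz => by
      by_cases hk : k = 0 ∨ C.IsIndex i k
      · rw [verma_e hk]
        exact vE_mem_relSub hν (singVec_mem_wtSpace Λ)
          (fun g hg i k hk => by rw [vE_singVec hΛ hν g hg i k hk]; exact zero_mem _) hk hz
      · have h0 : (C.verma ν Λ).e i k = 0 := if_neg hk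
        rw [h0, Submodule.mem_comap, LinearMap.zero_apply]; exact Submodule.zero_mem _)
    (fun i k _ hz => vf_mem_relSub i k hz)

theorem highest_T_mk (h : DualWeightLattice I) (z : C.Fock) :
    (highest ν hΛ hν).T h (Submodule.Quotient.mk z) = Submodule.Quotient.mk (C.vT Λ h z) := rfl

theorem highest_f_mk (i : I) (l : ℕ) (z : C.Fock) :
    (highest ν hΛ hν).f i l (Submodule.Quotient.mk z) = Submodule.Quotient.mk (C.vf i l z) := rfl

theorem highest_e_mk {i : I} {l : ℕ} (hl : l = 0 ∨ C.IsIndex i l) (z : C.Fock) :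
    (highest ν hΛ hν).e i l (Submodule.Quotient.mk z) = Submodule.Quotient.mk (C.vE ν Λ i l z) := by
  rw [← verma_e hl]; rfl

/-- `f_i` is locally nilpotent modulo the relations: on `v` by the choice of `singVec`, and on longer words by
the Serre relations. -/
theorem exists_vf_pow_single_mem (i : I) (hi : C.IsReal i) (w : List C.Index) :
    ∃ p : ℕ, (C.vf i 1 ^ p) (Finsupp.single w 1) ∈ relSub (C.singVec Λ) := by
  have hf := fun z (hz : z ∈ relSub (C.singVec Λ)) => vf_mem_relSub i 1 hz
  induction w with
  | nil => exact ⟨_, RelVec.mem (.base _ ⟨i, hi, rfl⟩)⟩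
  | cons x w ih =>
    obtain ⟨p, hp⟩ := ih
    by_cases hx : x.i = i
    · have hx1 : x.l = 1 := by
        rcases x.isIndex with h | h
        · exact h.2
        · have := hi; rw [IsReal, ← hx] at this; omega
      refine ⟨p, ?_⟩
      rw [← vf_index, hx, hx1, ← Module.End.mul_apply, ← pow_succ, pow_succ']
      exact hf _ hp
    · obtain ⟨N, hN⟩ := Int.eq_ofNat_of_zero_le (neg_nonneg.2 (mul_nonpos_of_nonneg_of_nonpos
        (Int.natCast_nonneg x.l) (C.offdiag i x.i (Ne.symm hx))))
      refine ⟨p * (N + 1), ?_⟩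
      rw [← vf_index]
      refine pow_apply_mem_of_serre (generic_qi (C := C) i) hf (fun z hz => vf_mem_relSub x.i x.l hz) (fun z => ?_) p _ hp
      rw [← hN]
      exact serre_mem_relSub hi (Or.inr x.isIndex) (Ne.symm hx) z

theorem exists_vE_pow_single_eq_zero (Λ : WeightLattice I) (i : I) (hi : C.IsReal i) (hνi : ν i 1 ≠ 0)
    (w : List C.Index) : ∃ p : ℕ, (C.vE ν Λ i 1 ^ p) (Finsupp.single w 1) = 0 := by
  have hc0 : (ν i 1 * ((C.qi i)⁻¹ - C.qi i))⁻¹ ≠ 0 := inv_ne_zero (mul_ne_zero hνi (qi_inv_sub_ne_zero i))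
  induction w with
  | nil => exact ⟨1, by rw [pow_one, vE_nil one_ne_zero]⟩
  | cons x w ih =>
    obtain ⟨p, hp⟩ := ih
    by_cases hx : x.i = i
    · have hx1 : x.l = 1 := by
        rcases x.isIndex with h | h
        · exact h.2
        · have := hi; rw [IsReal, ← hx] at this; omega
      have hsl := (C.verma ν Λ).sl2Weight hi hνi
      rw [verma_e (Or.inr hi.isIndex)] at hsl
      have h1 := hsl.pow_E_B_eq_zero p ((C.verma ν Λ).wtSpace_le_kWt i _ (single_mem_wtSpace Λ w)) hp
      rw [PreRep.opB, LinearMap.smul_apply, map_smul, smul_eq_zero_iff_right hc0] at h1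
      refine ⟨p + 1, ?_⟩
      rw [← vf_index, hx, hx1]
      exact h1
    · refine ⟨p, ?_⟩
      have hc : Commute (C.vE ν Λ i 1 ^ p) (C.vf x.i x.l) := (commute_vE_vf Λ (Ne.symm hx) 1 x.l).pow_left _
      rw [← vf_index, ← Module.End.mul_apply, hc.eq, Module.End.mul_apply, hp, map_zero]

theorem nilpotent_quot {A : Module.End Qq C.Fock} {N : Submodule Qq C.Fock} (hA : ∀ z ∈ N, A z ∈ N)
    (h : ∀ w, ∃ p : ℕ, (A ^ p) (Finsupp.single w 1) ∈ N) (z : C.Fock) : ∃ p : ℕ, (A ^ p) z ∈ N := by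
  induction z using Finsupp.induction_linear with
  | zero => exact ⟨0, by simp⟩
  | add x y hx hy =>
    obtain ⟨p, hp⟩ := hx
    obtain ⟨p', hp'⟩ := hy
    refine ⟨max p p', ?_⟩
    rw [map_add]
    exact add_mem (pow_apply_mem_of_le hA (le_max_left _ _) hp) (pow_apply_mem_of_le hA (le_max_right _ _) hp')
  | single w c =>
    obtain ⟨p, hp⟩ := h w
    refine ⟨p, ?_⟩
    rw [← mul_one c, ← smul_eq_mul, ← Finsupp.smul_single, map_smul]
    exact N.smul_mem _ hp

theorem highest_integrable : (highest ν hΛ hν).Integrable where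
  comm_e i j k l hk hl hij := by
    refine LinearMap.ext fun z => ?_
    obtain ⟨z, rfl⟩ := Submodule.Quotient.mk_surjective _ z
    rw [Module.End.mul_apply, Module.End.mul_apply, highest_e_mk hΛ hν (Or.inr hk), highest_e_mk hΛ hν (Or.inr hl),
      highest_e_mk hΛ hν (Or.inr hk), highest_e_mk hΛ hν (Or.inr hl)]
    exact congrArg _ (LinearMap.congr_fun (commute_vE_vE Λ hij k l) z)
  comm_f i j k l hk hl hij := by
    refine LinearMap.ext fun z => ?_
    obtain ⟨z, rfl⟩ := Submodule.Quotient.mk_surjective _ z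
    rw [Module.End.mul_apply, Module.End.mul_apply, highest_f_mk, highest_f_mk, highest_f_mk, highest_f_mk,
      Submodule.Quotient.eq]
    exact comm_mem_relSub (Or.inr hk) (Or.inr hl) hij z
  nil_e i hi z := by
    obtain ⟨z, rfl⟩ := Submodule.Quotient.mk_surjective _ z
    obtain ⟨p, hp⟩ := nilpotent_quot (A := C.vE ν Λ i 1) (N := ⊥) (fun z hz => by
      rw [Submodule.mem_bot] at hz ⊢; rw [hz, map_zero])
      (fun w => by simpa only [Submodule.mem_bot] using exists_vE_pow_single_eq_zero Λ i hi (hν i hi) w) z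
    have key : ∀ (p : ℕ) (z : C.Fock), ((highest ν hΛ hν).e i 1 ^ p) (Submodule.Quotient.mk z) =
        Submodule.Quotient.mk ((C.vE ν Λ i 1 ^ p) z) := by
      intro p
      induction p with
      | zero => intro z; rfl
      | succ p ih =>
        intro z
        rw [pow_succ, Module.End.mul_apply, highest_e_mk hΛ hν (Or.inr hi.isIndex), ih, pow_succ,
          Module.End.mul_apply, Nat.cast_one]
    refine ⟨p, ?_⟩
    rw [Submodule.mem_bot] at hp
    rw [key, hp, Submodule.Quotient.mk_zero]
  nil_f i hi z := by
    obtain ⟨z, rfl⟩ := Submodule.Quotient.mk_surjective _ z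
    obtain ⟨p, hp⟩ := nilpotent_quot (A := C.vf i 1) (fun z hz => vf_mem_relSub i 1 hz)
      (exists_vf_pow_single_mem (Λ := Λ) i hi) z
    have key : ∀ (p : ℕ) (z : C.Fock), ((highest ν hΛ hν).f i 1 ^ p) (Submodule.Quotient.mk z) =
        Submodule.Quotient.mk ((C.vf i 1 ^ p) z) := by
      intro p
      induction p with
      | zero => intro z; rfl
      | succ p ih =>
        intro z
        rw [pow_succ, Module.End.mul_apply, highest_f_mk, ih, pow_succ, Module.End.mul_apply]
    refine ⟨p, ?_⟩
    rw [key, Submodule.Quotient.mk_eq_zero]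
    exact hp

end

end BorcherdsCartanMatrix

namespace BorcherdsCartanMatrix

open QuantumSl2

variable {I : Type u} {C : BorcherdsCartanMatrix I} {ν : I → ℕ → Qq}

/-! ### Tensor products -/

section Combinatorics

variable {X : Type*} [AddCommMonoid X]

/-- Both sides run over the `(j, m, n, s, t)` with `j + m + n = k` and `j + s + t = l`; on the right `j` is
absorbed into `m` and `s`. -/
theorem sum_antidiagonal_shift (Φ : ℕ → ℕ → ℕ → ℕ → ℕ → X) (k l : ℕ) :
    ∑ j ∈ Finset.range (min k l + 1), ∑ p ∈ Finset.HasAntidiagonal.antidiagonal (k - j),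
      ∑ r ∈ Finset.HasAntidiagonal.antidiagonal (l - j), Φ j p.1 p.2 r.1 r.2 =
    ∑ p ∈ Finset.HasAntidiagonal.antidiagonal k, ∑ r ∈ Finset.HasAntidiagonal.antidiagonal l,
      ∑ j ∈ Finset.range (min p.1 r.1 + 1), Φ j (p.1 - j) p.2 (r.1 - j) r.2 := by
  simp only [Finset.sum_sigma']
  refine Finset.sum_bij'
    (fun t _ => ⟨(t.2.1.1 + t.1, t.2.1.2), ⟨(t.2.2.1 + t.1, t.2.2.2), t.1⟩⟩)
    (fun t _ => ⟨t.2.2, ⟨(t.1.1 - t.2.2, t.1.2), (t.2.1.1 - t.2.2, t.2.1.2)⟩⟩) ?_ ?_ ?_ ?_ ?_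
  · rintro ⟨j, ⟨m, n⟩, s, t⟩ h
    simp only [Finset.mem_sigma, Finset.mem_range, Finset.HasAntidiagonal.mem_antidiagonal] at h ⊢
    omega
  · rintro ⟨⟨m, n⟩, ⟨s, t⟩, j⟩ h
    simp only [Finset.mem_sigma, Finset.mem_range, Finset.HasAntidiagonal.mem_antidiagonal] at h ⊢
    omega
  · rintro ⟨j, ⟨m, n⟩, s, t⟩ h
    simp
  · rintro ⟨⟨m, n⟩, ⟨s, t⟩, j⟩ h
    simp only [Finset.mem_sigma, Finset.mem_range, Finset.HasAntidiagonal.mem_antidiagonal] at h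
    have h1 : m - j + j = m := by omega
    have h2 : s - j + j = s := by omega
    simp only [h1, h2]
  · rintro ⟨j, ⟨m, n⟩, s, t⟩ h
    simp

/-- The analogue of `sum_antidiagonal_shift` in which `j` is absorbed into `n` and `t`. -/
theorem sum_antidiagonal_shift' (Φ : ℕ → ℕ → ℕ → ℕ → ℕ → X) (k l : ℕ) :
    ∑ j ∈ Finset.range (min k l + 1), ∑ p ∈ Finset.HasAntidiagonal.antidiagonal (k - j),
      ∑ r ∈ Finset.HasAntidiagonal.antidiagonal (l - j), Φ j p.1 p.2 r.1 r.2 =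
    ∑ p ∈ Finset.HasAntidiagonal.antidiagonal k, ∑ r ∈ Finset.HasAntidiagonal.antidiagonal l,
      ∑ j ∈ Finset.range (min p.2 r.2 + 1), Φ j p.1 (p.2 - j) r.1 (r.2 - j) := by
  have h := sum_antidiagonal_shift (fun j m n s t => Φ j n m t s) k l
  refine Eq.trans (Finset.sum_congr rfl fun j _ => ?_) (h.trans ?_)
  · rw [← Finset.Nat.sum_antidiagonal_swap]
    refine Finset.sum_congr rfl fun p _ => ?_
    rw [← Finset.Nat.sum_antidiagonal_swap]
    rfl
  · rw [← Finset.Nat.sum_antidiagonal_swap]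
    refine Finset.sum_congr rfl fun p _ => ?_
    rw [← Finset.Nat.sum_antidiagonal_swap]
    rfl

end Combinatorics

/-- `q_i ^ μ(h_i)`, the eigenvalue of `K_i` on the vectors of weight `μ`. -/
noncomputable def kval (C : BorcherdsCartanMatrix I) (i : I) (μ : WeightLattice I) : Qq :=
  qq ^ (C.s i * μ (coroot i))

theorem kval_add_of_eq_zero {i j : I} (h : C.a i j = 0) (μ : WeightLattice I) (l : ℕ) :
    C.kval i (μ + l • C.root j) = C.kval i μ := by
  rw [kval, kval, LinearMap.add_apply, LinearMap.smul_apply, root_coroot, h, smul_zero, add_zero]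

theorem kval_add (i : I) (μ : WeightLattice I) (l : ℕ) :
    C.kval i (μ + l • C.root i) = C.kval i μ * C.qpar i ^ (2 * (l : ℤ)) := by
  rw [kval, kval, two_mul, zpow_add₀ (qpar_ne_zero i), ← qpar_zpow_two_mul, ← zpow_add₀ qq_ne_zero,
    LinearMap.add_apply, LinearMap.smul_apply, root_coroot, nsmul_eq_mul]
  congr 1; ring

theorem kval_add_neg (i : I) (μ : WeightLattice I) (l : ℕ) :
    C.kval i (μ + -(l • C.root i)) = C.kval i μ * C.qpar i ^ (-(2 * (l : ℤ))) := by
  have h := kval_add (C := C) i (μ + -(l • C.root i)) l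
  rw [neg_add_cancel_right] at h
  rw [h, mul_assoc, ← zpow_add₀ (qpar_ne_zero i), add_neg_cancel, zpow_zero, mul_one]

theorem cpar_eq_kval (i : I) (μ : WeightLattice I) (d : ℤ) :
    C.cpar i μ d = C.qpar i ^ d * (C.kval i μ)⁻¹ := by
  rw [cpar, kval, zpow_neg]

namespace PreRep

variable {V : Type*} [AddCommGroup V] [Module Qq V] {V' : Type*} [AddCommGroup V'] [Module Qq V']
  (R : C.PreRep ν V) (R' : C.PreRep ν V')

/-- The action of `e_{ik}` on the tensor product, by the coproduct
`e_{ik} ↦ ∑_{m+n=k} q_(i)^{mn} e_{im} K_i^n ⊗ e_{in}`. -/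
noncomputable def tensE (i : I) (k : ℕ) : Module.End Qq (V ⊗[Qq] V') :=
  ∑ p ∈ Finset.HasAntidiagonal.antidiagonal k, C.qpar i ^ (p.1 * p.2) •
    TensorProduct.map (R.e i p.1 * R.T ((p.2 * C.s i) • coroot i)) (R'.e i p.2)

/-- The action of `f_{il}` on the tensor product, by the coproduct
`f_{il} ↦ ∑_{s+t=l} q_(i)^{st} f_{is} ⊗ f_{it} K_i^{-s}`. -/
noncomputable def tensF (i : I) (l : ℕ) : Module.End Qq (V ⊗[Qq] V') :=
  ∑ p ∈ Finset.HasAntidiagonal.antidiagonal l, C.qpar i ^ (p.1 * p.2) •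
    TensorProduct.map (R.f i p.1) (R'.f i p.2 * R'.T (-((p.1 * C.s i) • coroot i)))

/-- The action of `q^h` on the tensor product. -/
noncomputable def tensT (h : DualWeightLattice I) : Module.End Qq (V ⊗[Qq] V') :=
  TensorProduct.map (R.T h) (R'.T h)

variable {R R'} {μ μ' : WeightLattice I} {x : V} {y : V'}

theorem T_smul_coroot (R : C.PreRep ν V) (hx : x ∈ wtSpace R.T μ) (i : I) (n : ℕ) :
    R.T ((n * C.s i) • coroot i) x = C.kval i μ ^ n • x := by
  rw [mem_wtSpace.1 hx, kval, ← zpow_natCast, ← zpow_mul, coroot_eq_of_smul]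
  congr 2; ring

theorem T_neg_smul_coroot (R : C.PreRep ν V) (hx : x ∈ wtSpace R.T μ) (i : I) (n : ℕ) :
    R.T (-((n * C.s i) • coroot i)) x = (C.kval i μ)⁻¹ ^ n • x := by
  rw [mem_wtSpace.1 hx, kval, ← zpow_natCast, ← zpow_neg, ← zpow_mul, map_neg, coroot_eq_of_smul]
  congr 2; ring

theorem tensE_tmul (hx : x ∈ wtSpace R.T μ) (i : I) (k : ℕ) (y : V') :
    tensE R R' i k (x ⊗ₜ y) = ∑ p ∈ Finset.HasAntidiagonal.antidiagonal k,
      (C.qpar i ^ (p.1 * p.2) * C.kval i μ ^ p.2) • (R.e i p.1 x ⊗ₜ[Qq] R'.e i p.2 y) := by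
  rw [tensE, LinearMap.sum_apply]
  refine Finset.sum_congr rfl fun p _ => ?_
  rw [LinearMap.smul_apply, TensorProduct.map_tmul, Module.End.mul_apply, T_smul_coroot R hx, map_smul,
    ← TensorProduct.smul_tmul', smul_smul]

theorem tensF_tmul (hy : y ∈ wtSpace R'.T μ') (i : I) (l : ℕ) (x : V) :
    tensF R R' i l (x ⊗ₜ y) = ∑ p ∈ Finset.HasAntidiagonal.antidiagonal l,
      (C.qpar i ^ (p.1 * p.2) * (C.kval i μ')⁻¹ ^ p.1) • (R.f i p.1 x ⊗ₜ[Qq] R'.f i p.2 y) := by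
  rw [tensF, LinearMap.sum_apply]
  refine Finset.sum_congr rfl fun p _ => ?_
  rw [LinearMap.smul_apply, TensorProduct.map_tmul, Module.End.mul_apply, T_neg_smul_coroot R' hy, map_smul,
    TensorProduct.tmul_smul, smul_smul]

theorem tmul_mem_wtSpace (hx : x ∈ wtSpace R.T μ) (hy : y ∈ wtSpace R'.T μ') :
    x ⊗ₜ[Qq] y ∈ wtSpace (tensT R R') (μ + μ') := by
  rw [mem_wtSpace]
  intro h
  rw [tensT, TensorProduct.map_tmul, mem_wtSpace.1 hx, mem_wtSpace.1 hy, TensorProduct.smul_tmul_smul,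
    ← zpow_add₀ qq_ne_zero, LinearMap.add_apply]

theorem tensor_ext (R : C.PreRep ν V) (R' : C.PreRep ν V') {X : Type*} [AddCommGroup X] [Module Qq X]
    {A B : V ⊗[Qq] V' →ₗ[Qq] X}
    (h : ∀ μ μ', ∀ x ∈ wtSpace R.T μ, ∀ y ∈ wtSpace R'.T μ', A (x ⊗ₜ y) = B (x ⊗ₜ y)) : A = B := by
  refine TensorProduct.ext ?_
  refine ext_of_wtSpace R.iSup_wt fun μ x hx => ?_
  exact ext_of_wtSpace R'.iSup_wt fun μ' y hy => h μ μ' x hx y hy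

theorem iSup_wtSpace_tensT (R : C.PreRep ν V) (R' : C.PreRep ν V') :
    ⨆ μ, wtSpace (tensT R R') μ = ⊤ := by
  have h : (⨆ μ, wtSpace (tensT R R') μ).mkQ = 0 := by
    refine tensor_ext R R' fun μ μ' x hx y hy => ?_
    rw [LinearMap.zero_apply, Submodule.mkQ_apply, Submodule.Quotient.mk_eq_zero]
    exact Submodule.mem_iSup_of_mem _ (tmul_mem_wtSpace hx hy)
  rw [← Submodule.ker_mkQ (⨆ μ, wtSpace (tensT R R') μ), h, LinearMap.ker_zero]

theorem mem_degSpace_tensT {α : WeightLattice I} {A : Module.End Qq (V ⊗[Qq] V')}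
    (h : ∀ μ μ', ∀ x ∈ wtSpace R.T μ, ∀ y ∈ wtSpace R'.T μ', A (x ⊗ₜ y) ∈ wtSpace (tensT R R') (μ + μ' + α)) :
    A ∈ degSpace (tensT R R') α := by
  intro h'
  refine tensor_ext R R' fun μ μ' x hx y hy => ?_
  rw [LinearMap.smul_apply, Module.End.mul_apply, Module.End.mul_apply, mem_wtSpace.1 (h μ μ' x hx y hy),
    mem_wtSpace.1 (tmul_mem_wtSpace hx hy), map_smul, smul_smul, ← zpow_add₀ qq_ne_zero, LinearMap.add_apply _ α,
    add_comm]

theorem IsIndex.antidiagonal {i : I} {k : ℕ} (hk : k = 0 ∨ C.IsIndex i k) {p : ℕ × ℕ}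
    (hp : p ∈ Finset.HasAntidiagonal.antidiagonal k) :
    (p.1 = 0 ∨ C.IsIndex i p.1) ∧ (p.2 = 0 ∨ C.IsIndex i p.2) := by
  rw [Finset.HasAntidiagonal.mem_antidiagonal] at hp
  rcases hk with rfl | hk
  · exact ⟨Or.inl (by omega), Or.inl (by omega)⟩
  · exact ⟨hk.of_le (by omega), hk.of_le (by omega)⟩

theorem tensE_mem (R : C.PreRep ν V) (R' : C.PreRep ν V') {i : I} {k : ℕ} (hk : k = 0 ∨ C.IsIndex i k) :
    tensE R R' i k ∈ degSpace (tensT R R') (k • C.root i) := by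
  refine mem_degSpace_tensT fun μ μ' x hx y hy => ?_
  rw [tensE_tmul hx]
  refine Submodule.sum_mem _ fun p hp => Submodule.smul_mem _ _ ?_
  obtain ⟨h1, h2⟩ := IsIndex.antidiagonal hk hp
  have := tmul_mem_wtSpace (apply_mem_wtSpace (R.e_mem' h1) hx) (apply_mem_wtSpace (R'.e_mem' h2) hy)
  rw [Finset.HasAntidiagonal.mem_antidiagonal] at hp
  rwa [add_add_add_comm, ← add_smul, hp] at this

theorem tensF_mem (R : C.PreRep ν V) (R' : C.PreRep ν V') {i : I} {k : ℕ} (hk : k = 0 ∨ C.IsIndex i k) :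
    tensF R R' i k ∈ degSpace (tensT R R') (-(k • C.root i)) := by
  refine mem_degSpace_tensT fun μ μ' x hx y hy => ?_
  rw [tensF_tmul hy]
  refine Submodule.sum_mem _ fun p hp => Submodule.smul_mem _ _ ?_
  obtain ⟨h1, h2⟩ := IsIndex.antidiagonal hk hp
  have := tmul_mem_wtSpace (apply_mem_wtSpace (R.f_mem' h1) hx) (apply_mem_wtSpace (R'.f_mem' h2) hy)
  rw [Finset.HasAntidiagonal.mem_antidiagonal] at hp
  rwa [add_add_add_comm, ← neg_add, ← add_smul, hp] at this

/-- The coefficient of `f_{is} e_{im} ⊗ f_{it} e_{in}` in the action of `f_{i,s+t} e_{i,m+n}`, which is also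
that of `e_{im} f_{is} ⊗ e_{in} f_{it}` in the action of `e_{i,m+n} f_{i,s+t}`. -/
noncomputable def tensCoef (C : BorcherdsCartanMatrix I) (i : I) (μ μ' : WeightLattice I) (m n s t : ℕ) : Qq :=
  C.qpar i ^ ((m : ℤ) * n + s * t - 2 * n * s) * C.kval i μ ^ n * (C.kval i μ')⁻¹ ^ s

theorem tensCoef_add_left (i : I) (μ μ' : WeightLattice I) (m n s t j : ℕ) :
    tensCoef C i μ μ' (m + j) n (s + j) t = tensCoef C i μ μ' m n s t * C.cpar i μ' (t - n) ^ j := by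
  rw [tensCoef, tensCoef, cpar_eq_kval, mul_pow, pow_add _ s j, ← zpow_natCast (C.qpar i ^ _), ← zpow_mul]
  push_cast
  rw [show ((m : ℤ) + j) * n + (s + j) * t - 2 * n * (s + j) = (m * n + s * t - 2 * n * s) + (t - n) * j by ring,
    zpow_add₀ (qpar_ne_zero i)]
  ring

theorem tensCoef_add_right (i : I) (μ μ' : WeightLattice I) (m n s t j : ℕ) :
    tensCoef C i μ μ' m (n + j) s (t + j) = tensCoef C i μ μ' m n s t * (C.cpar i μ (s - m))⁻¹ ^ j := by
  rw [tensCoef, tensCoef, cpar_eq_kval, mul_inv, inv_inv, mul_pow, pow_add _ n j, ← zpow_neg,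
    ← zpow_natCast (C.qpar i ^ _), ← zpow_mul]
  push_cast
  rw [show (m : ℤ) * (n + j) + s * (t + j) - 2 * (n + j) * s = (m * n + s * t - 2 * n * s) + -(s - m) * j by ring,
    zpow_add₀ (qpar_ne_zero i)]
  ring

theorem tensF_tensE_tmul (hx : x ∈ wtSpace R.T μ) (hy : y ∈ wtSpace R'.T μ') {i : I} {k : ℕ}
    (hk : k = 0 ∨ C.IsIndex i k) (l : ℕ) :
    tensF R R' i l (tensE R R' i k (x ⊗ₜ y)) = ∑ p ∈ Finset.HasAntidiagonal.antidiagonal k,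
      ∑ r ∈ Finset.HasAntidiagonal.antidiagonal l, tensCoef C i μ μ' p.1 p.2 r.1 r.2 •
        (R.f i r.1 (R.e i p.1 x) ⊗ₜ[Qq] R'.f i r.2 (R'.e i p.2 y)) := by
  rw [tensE_tmul hx, map_sum]
  refine Finset.sum_congr rfl fun p hp => ?_
  rw [map_smul, tensF_tmul (apply_mem_wtSpace (R'.e_mem' (IsIndex.antidiagonal hk hp).2) hy), Finset.smul_sum]
  refine Finset.sum_congr rfl fun r _ => ?_
  rw [smul_smul, kval_add, mul_inv, mul_pow, ← zpow_neg, ← zpow_natCast (C.qpar i ^ _), ← zpow_mul, tensCoef,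
    show (p.1 : ℤ) * p.2 + r.1 * r.2 - 2 * p.2 * r.1 =
      (p.1 * p.2 : ℕ) + (r.1 * r.2 : ℕ) + -(2 * p.2) * r.1 by push_cast; ring, zpow_add₀ (qpar_ne_zero i),
    zpow_add₀ (qpar_ne_zero i), zpow_natCast, zpow_natCast]
  congr 1; ring

theorem tensE_tensF_tmul (hx : x ∈ wtSpace R.T μ) (hy : y ∈ wtSpace R'.T μ') {i : I} {l : ℕ} (k : ℕ)
    (hl : l = 0 ∨ C.IsIndex i l) :
    tensE R R' i k (tensF R R' i l (x ⊗ₜ y)) = ∑ p ∈ Finset.HasAntidiagonal.antidiagonal k,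
      ∑ r ∈ Finset.HasAntidiagonal.antidiagonal l, tensCoef C i μ μ' p.1 p.2 r.1 r.2 •
        (R.e i p.1 (R.f i r.1 x) ⊗ₜ[Qq] R'.e i p.2 (R'.f i r.2 y)) := by
  rw [tensF_tmul hy, map_sum, Finset.sum_comm]
  refine Finset.sum_congr rfl fun r hr => ?_
  rw [map_smul, tensE_tmul (apply_mem_wtSpace (R.f_mem' (IsIndex.antidiagonal hl hr).1) hx), Finset.smul_sum]
  refine Finset.sum_congr rfl fun p _ => ?_
  rw [smul_smul, kval_add_neg, mul_pow, ← zpow_natCast (C.qpar i ^ _), ← zpow_mul, tensCoef,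
    show (p.1 : ℤ) * p.2 + r.1 * r.2 - 2 * p.2 * r.1 =
      (p.1 * p.2 : ℕ) + (r.1 * r.2 : ℕ) + -(2 * r.1) * p.2 by push_cast; ring, zpow_add₀ (qpar_ne_zero i),
    zpow_add₀ (qpar_ne_zero i), zpow_natCast, zpow_natCast]
  congr 1; ring

theorem cpar_add_add (i : I) (μ μ' : WeightLattice I) (d d' : ℤ) :
    C.cpar i (μ + μ') (d + d') = C.cpar i μ d * C.cpar i μ' d' := by
  rw [cpar, cpar, cpar, zpow_add₀ (qpar_ne_zero i), LinearMap.add_apply, mul_add, neg_add, zpow_add₀ qq_ne_zero]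
  ring

/-- Both sides of the relation are equal to
`∑ ν_{ij} c₁^{-j} c₂^j w e_{im} f_{is} ⊗ f_{it} e_{in}`, the sum over `j`, `m + n = k - j`, `s + t = l - j`,
with `w = tensCoef`. The relation in the first factor leads there from the left-hand side, the relation in the second
factor from the right-hand side. -/
theorem tens_ef (hx : x ∈ wtSpace R.T μ) (hy : y ∈ wtSpace R'.T μ') {i : I} {k l : ℕ} (hk : C.IsIndex i k)
    (hl : C.IsIndex i l) :
    ∑ j ∈ Finset.range (min k l + 1), (nu0 ν i j * C.cpar i (μ + μ') (l - k) ^ j) •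
      tensF R R' i (l - j) (tensE R R' i (k - j) (x ⊗ₜ y)) =
    ∑ j ∈ Finset.range (min k l + 1), (nu0 ν i j * (C.cpar i (μ + μ') (l - k))⁻¹ ^ j) •
      tensE R R' i (k - j) (tensF R R' i (l - j) (x ⊗ₜ y)) := by
  have hC : ∀ {m n s t : ℕ}, m + n = k → s + t = l →
      C.cpar i (μ + μ') (l - k) = C.cpar i μ (s - m) * C.cpar i μ' (t - n) := by
    rintro m n s t rfl rfl
    rw [← cpar_add_add]; congr 1; push_cast; ring
  trans ∑ j ∈ Finset.range (min k l + 1), ∑ p ∈ Finset.HasAntidiagonal.antidiagonal (k - j),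
    ∑ r ∈ Finset.HasAntidiagonal.antidiagonal (l - j),
      (nu0 ν i j * (C.cpar i μ (r.1 - p.1))⁻¹ ^ j * C.cpar i μ' (r.2 - p.2) ^ j *
        tensCoef C i μ μ' p.1 p.2 r.1 r.2) •
      (R.e i p.1 (R.f i r.1 x) ⊗ₜ[Qq] R'.f i r.2 (R'.e i p.2 y))
  · rw [sum_antidiagonal_shift (fun j m n s t => (nu0 ν i j * (C.cpar i μ (s - m))⁻¹ ^ j *
      C.cpar i μ' (t - n) ^ j * tensCoef C i μ μ' m n s t) •
      (R.e i m (R.f i s x) ⊗ₜ[Qq] R'.f i t (R'.e i n y)))]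
    have h1 : ∀ j ∈ Finset.range (min k l + 1), (nu0 ν i j * C.cpar i (μ + μ') (l - k) ^ j) •
        tensF R R' i (l - j) (tensE R R' i (k - j) (x ⊗ₜ y)) =
        ∑ p ∈ Finset.HasAntidiagonal.antidiagonal (k - j), ∑ r ∈ Finset.HasAntidiagonal.antidiagonal (l - j),
          (nu0 ν i j * C.cpar i (μ + μ') (l - k) ^ j * tensCoef C i μ μ' p.1 p.2 r.1 r.2) •
          (R.f i r.1 (R.e i p.1 x) ⊗ₜ[Qq] R'.f i r.2 (R'.e i p.2 y)) := by
      intro j _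
      rw [tensF_tensE_tmul hx hy (hk.sub_left j), Finset.smul_sum]
      refine Finset.sum_congr rfl fun p _ => ?_
      rw [Finset.smul_sum]
      exact Finset.sum_congr rfl fun r _ => smul_smul _ _ _
    rw [Finset.sum_congr rfl h1, sum_antidiagonal_shift (fun j m n s t =>
      (nu0 ν i j * C.cpar i (μ + μ') (l - k) ^ j * tensCoef C i μ μ' m n s t) •
      (R.f i s (R.e i m x) ⊗ₜ[Qq] R'.f i t (R'.e i n y)))]
    refine Finset.sum_congr rfl fun p hp => Finset.sum_congr rfl fun r hr => ?_
    have h2 := congrArg (fun v => tensCoef C i μ μ' p.1 p.2 r.1 r.2 • (v ⊗ₜ[Qq] R'.f i r.2 (R'.e i p.2 y)))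
      (R.ef' (IsIndex.antidiagonal (Or.inr hk) hp).1 (IsIndex.antidiagonal (Or.inr hl) hr).1 hx)
    simp only [TensorProduct.sum_tmul, ← TensorProduct.smul_tmul', Finset.smul_sum, smul_smul] at h2
    rw [Finset.HasAntidiagonal.mem_antidiagonal] at hp hr
    refine Eq.trans (Finset.sum_congr rfl fun j hj => ?_) (h2.trans (Finset.sum_congr rfl fun j hj => ?_))
    · rw [Finset.mem_range] at hj
      congr 1
      have h3 := tensCoef_add_left (C := C) i μ μ' (p.1 - j) p.2 (r.1 - j) r.2 j
      rw [Nat.sub_add_cancel (by omega), Nat.sub_add_cancel (by omega)] at h3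
      rw [h3, hC hp hr, mul_pow]
      ring
    · rw [Finset.mem_range] at hj
      congr 1
      have h3 := tensCoef_add_left (C := C) i μ μ' (p.1 - j) p.2 (r.1 - j) r.2 j
      rw [Nat.sub_add_cancel (by omega), Nat.sub_add_cancel (by omega)] at h3
      rw [h3, show (((r.1 - j : ℕ) : ℤ) - ((p.1 - j : ℕ) : ℤ)) = (r.1 : ℤ) - p.1 by omega]
      ring
  · symm
    rw [sum_antidiagonal_shift' (fun j m n s t => (nu0 ν i j * (C.cpar i μ (s - m))⁻¹ ^ j *
      C.cpar i μ' (t - n) ^ j * tensCoef C i μ μ' m n s t) •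
      (R.e i m (R.f i s x) ⊗ₜ[Qq] R'.f i t (R'.e i n y)))]
    have h1 : ∀ j ∈ Finset.range (min k l + 1), (nu0 ν i j * (C.cpar i (μ + μ') (l - k))⁻¹ ^ j) •
        tensE R R' i (k - j) (tensF R R' i (l - j) (x ⊗ₜ y)) =
        ∑ p ∈ Finset.HasAntidiagonal.antidiagonal (k - j), ∑ r ∈ Finset.HasAntidiagonal.antidiagonal (l - j),
          (nu0 ν i j * (C.cpar i (μ + μ') (l - k))⁻¹ ^ j * tensCoef C i μ μ' p.1 p.2 r.1 r.2) •
          (R.e i p.1 (R.f i r.1 x) ⊗ₜ[Qq] R'.e i p.2 (R'.f i r.2 y)) := by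
      intro j _
      rw [tensE_tensF_tmul hx hy _ (hl.sub_left j), Finset.smul_sum]
      refine Finset.sum_congr rfl fun p _ => ?_
      rw [Finset.smul_sum]
      exact Finset.sum_congr rfl fun r _ => smul_smul _ _ _
    rw [Finset.sum_congr rfl h1, sum_antidiagonal_shift' (fun j m n s t =>
      (nu0 ν i j * (C.cpar i (μ + μ') (l - k))⁻¹ ^ j * tensCoef C i μ μ' m n s t) •
      (R.e i m (R.f i s x) ⊗ₜ[Qq] R'.e i n (R'.f i t y)))]
    refine Finset.sum_congr rfl fun p hp => Finset.sum_congr rfl fun r hr => ?_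
    have h2 := congrArg (fun v => tensCoef C i μ μ' p.1 p.2 r.1 r.2 • (R.e i p.1 (R.f i r.1 x) ⊗ₜ[Qq] v))
      (R'.ef' (IsIndex.antidiagonal (Or.inr hk) hp).2 (IsIndex.antidiagonal (Or.inr hl) hr).2 hy).symm
    simp only [TensorProduct.tmul_sum, TensorProduct.tmul_smul, Finset.smul_sum, smul_smul] at h2
    rw [Finset.HasAntidiagonal.mem_antidiagonal] at hp hr
    have hc0 := cpar_ne_zero (C := C) i μ (r.1 - p.1)
    have hinv : ∀ j : ℕ, (C.cpar i μ (r.1 - p.1))⁻¹ ^ j * C.cpar i μ (r.1 - p.1) ^ j = 1 := by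
      intro j
      rw [← mul_pow, inv_mul_cancel₀ hc0, one_pow]
    refine Eq.trans (Finset.sum_congr rfl fun j hj => ?_) (h2.trans (Finset.sum_congr rfl fun j hj => ?_))
    · rw [Finset.mem_range] at hj
      congr 1
      have h3 := tensCoef_add_right (C := C) i μ μ' p.1 (p.2 - j) r.1 (r.2 - j) j
      rw [Nat.sub_add_cancel (by omega), Nat.sub_add_cancel (by omega)] at h3
      rw [h3, hC hp hr, mul_inv, mul_pow]
      ring
    · rw [Finset.mem_range] at hj
      congr 1
      have h3 := tensCoef_add_right (C := C) i μ μ' p.1 (p.2 - j) r.1 (r.2 - j) j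
      rw [Nat.sub_add_cancel (by omega), Nat.sub_add_cancel (by omega)] at h3
      rw [h3, show (((r.2 - j : ℕ) : ℤ) - ((p.2 - j : ℕ) : ℤ)) = (r.2 : ℤ) - p.2 by omega]
      ring

end PreRep

end BorcherdsCartanMatrix

namespace BorcherdsCartanMatrix

open QuantumSl2

variable {I : Type u} {C : BorcherdsCartanMatrix I} {ν : I → ℕ → Qq}

theorem kval_add_smul (i j : I) (μ : WeightLattice I) (l : ℕ) :
    C.kval i (μ + l • C.root j) = C.kval i μ * qq ^ (C.s i * C.a i j * l) := by
  rw [kval, kval, ← zpow_add₀ qq_ne_zero, LinearMap.add_apply, LinearMap.smul_apply, root_coroot, nsmul_eq_mul]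
  congr 1; ring

theorem kval_add_neg_smul (i j : I) (μ : WeightLattice I) (l : ℕ) :
    C.kval i (μ + -(l • C.root j)) = C.kval i μ * qq ^ (-(C.s i * C.a i j * l)) := by
  rw [kval, kval, ← zpow_add₀ qq_ne_zero, LinearMap.add_apply, LinearMap.neg_apply, LinearMap.smul_apply, root_coroot,
    nsmul_eq_mul]
  congr 1; ring

theorem a_eq_zero_symm {i j : I} (h : C.a i j = 0) : C.a j i = 0 := by
  have := C.symm i j
  rw [h, mul_zero, zero_eq_mul] at this
  exact this.resolve_left (C.s_pos j).ne'

namespace PreRep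

variable {V : Type*} [AddCommGroup V] [Module Qq V] {V' : Type*} [AddCommGroup V'] [Module Qq V']
  {R : C.PreRep ν V} {R' : C.PreRep ν V'} {μ μ' : WeightLattice I} {x : V} {y : V'}

theorem commute_tensE_tensF {i j : I} {k l : ℕ} (hk : C.IsIndex i k) (hl : C.IsIndex j l) (hij : i ≠ j) :
    Commute (tensE R R' i k) (tensF R R' j l) := by
  refine tensor_ext R R' fun μ μ' x hx y hy => ?_
  rw [Module.End.mul_apply, Module.End.mul_apply, tensF_tmul hy, tensE_tmul hx, map_sum, map_sum]
  have h1 : ∀ r ∈ Finset.HasAntidiagonal.antidiagonal l,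
      tensE R R' i k ((C.qpar j ^ (r.1 * r.2) * (C.kval j μ')⁻¹ ^ r.1) • (R.f j r.1 x ⊗ₜ[Qq] R'.f j r.2 y)) =
      ∑ p ∈ Finset.HasAntidiagonal.antidiagonal k,
        ((C.qpar j ^ (r.1 * r.2) * (C.kval j μ')⁻¹ ^ r.1) * (C.qpar i ^ (p.1 * p.2) *
          C.kval i (μ + -(r.1 • C.root j)) ^ p.2)) • (R.e i p.1 (R.f j r.1 x) ⊗ₜ[Qq] R'.e i p.2 (R'.f j r.2 y)) := by
    intro r hr
    rw [map_smul, tensE_tmul (apply_mem_wtSpace (R.f_mem' (IsIndex.antidiagonal (Or.inr hl) hr).1) hx),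
      Finset.smul_sum]
    exact Finset.sum_congr rfl fun p _ => smul_smul _ _ _
  have h2 : ∀ p ∈ Finset.HasAntidiagonal.antidiagonal k,
      tensF R R' j l ((C.qpar i ^ (p.1 * p.2) * C.kval i μ ^ p.2) • (R.e i p.1 x ⊗ₜ[Qq] R'.e i p.2 y)) =
      ∑ r ∈ Finset.HasAntidiagonal.antidiagonal l,
        ((C.qpar i ^ (p.1 * p.2) * C.kval i μ ^ p.2) * (C.qpar j ^ (r.1 * r.2) *
          (C.kval j (μ' + p.2 • C.root i))⁻¹ ^ r.1)) • (R.f j r.1 (R.e i p.1 x) ⊗ₜ[Qq] R'.f j r.2 (R'.e i p.2 y)) := by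
    intro p hp
    rw [map_smul, tensF_tmul (apply_mem_wtSpace (R'.e_mem' (IsIndex.antidiagonal (Or.inr hk) hp).2) hy),
      Finset.smul_sum]
    exact Finset.sum_congr rfl fun r _ => smul_smul _ _ _
  rw [Finset.sum_congr rfl h1, Finset.sum_congr rfl h2, Finset.sum_comm]
  refine Finset.sum_congr rfl fun p hp => Finset.sum_congr rfl fun r hr => ?_
  have hp' := IsIndex.antidiagonal (Or.inr hk) hp
  have hr' := IsIndex.antidiagonal (Or.inr hl) hr
  rw [← Module.End.mul_apply, (R.comm_ef' hp'.1 hr'.1 hij).eq, ← Module.End.mul_apply (R'.e i p.2),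
    (R'.comm_ef' hp'.2 hr'.2 hij).eq, Module.End.mul_apply, Module.End.mul_apply]
  congr 1
  rw [kval_add_neg_smul, kval_add_smul, mul_inv, mul_pow, mul_pow, ← zpow_neg, ← zpow_natCast (qq ^ _),
    ← zpow_natCast (qq ^ _), ← zpow_mul, ← zpow_mul, C.symm i j,
    show -(C.s j * C.a j i * (r.1 : ℤ)) * p.2 = -(C.s j * C.a j i * p.2) * r.1 by ring]
  ring

theorem comm_zero_or {W : Type*} [AddCommGroup W] [Module Qq W] {g : I → ℕ → Module.End Qq W}
    (h0 : ∀ i, g i 0 = 1) {i j : I} (h : ∀ k l, C.IsIndex i k → C.IsIndex j l → Commute (g i k) (g j l)) {k l : ℕ}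
    (hk : k = 0 ∨ C.IsIndex i k) (hl : l = 0 ∨ C.IsIndex j l) (z : W) : g i k (g j l z) = g j l (g i k z) := by
  rcases hk with rfl | hk
  · rw [h0]; rfl
  rcases hl with rfl | hl
  · rw [h0]; rfl
  exact LinearMap.congr_fun (h k l hk hl) z

theorem commute_tensE_tensE {i j : I} {k l : ℕ} (hk : C.IsIndex i k) (hl : C.IsIndex j l) (hij : C.a i j = 0)
    (h : ∀ k l, C.IsIndex i k → C.IsIndex j l → Commute (R.e i k) (R.e j l))
    (h' : ∀ k l, C.IsIndex i k → C.IsIndex j l → Commute (R'.e i k) (R'.e j l)) :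
    Commute (tensE R R' i k) (tensE R R' j l) := by
  refine tensor_ext R R' fun μ μ' x hx y hy => ?_
  rw [Module.End.mul_apply, Module.End.mul_apply, tensE_tmul hx, tensE_tmul hx, map_sum, map_sum]
  have h1 : ∀ {i j : I} {l : ℕ} (k : ℕ) (hl : C.IsIndex j l) (hij : C.a i j = 0),
      ∀ r ∈ Finset.HasAntidiagonal.antidiagonal l,
      tensE R R' i k ((C.qpar j ^ (r.1 * r.2) * (C.kval j μ) ^ r.2) • (R.e j r.1 x ⊗ₜ[Qq] R'.e j r.2 y)) =
      ∑ p ∈ Finset.HasAntidiagonal.antidiagonal k,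
        ((C.qpar j ^ (r.1 * r.2) * (C.kval j μ) ^ r.2) * (C.qpar i ^ (p.1 * p.2) *
          C.kval i μ ^ p.2)) • (R.e i p.1 (R.e j r.1 x) ⊗ₜ[Qq] R'.e i p.2 (R'.e j r.2 y)) := by
    intro i j l k hl hij r hr
    rw [map_smul, tensE_tmul (apply_mem_wtSpace (R.e_mem' (IsIndex.antidiagonal (Or.inr hl) hr).1) hx),
      Finset.smul_sum, kval_add_of_eq_zero hij]
    exact Finset.sum_congr rfl fun p _ => smul_smul _ _ _
  rw [Finset.sum_congr rfl (h1 k hl hij), Finset.sum_congr rfl (h1 l hk (a_eq_zero_symm hij)), Finset.sum_comm]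
  refine Finset.sum_congr rfl fun p hp => Finset.sum_congr rfl fun r hr => ?_
  have hp' := IsIndex.antidiagonal (Or.inr hk) hp
  have hr' := IsIndex.antidiagonal (Or.inr hl) hr
  rw [comm_zero_or R.e_zero h hp'.1 hr'.1, comm_zero_or R'.e_zero h' hp'.2 hr'.2]
  congr 1
  ring

theorem commute_tensF_tensF {i j : I} {k l : ℕ} (hk : C.IsIndex i k) (hl : C.IsIndex j l) (hij : C.a i j = 0)
    (h : ∀ k l, C.IsIndex i k → C.IsIndex j l → Commute (R.f i k) (R.f j l))
    (h' : ∀ k l, C.IsIndex i k → C.IsIndex j l → Commute (R'.f i k) (R'.f j l)) :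
    Commute (tensF R R' i k) (tensF R R' j l) := by
  refine tensor_ext R R' fun μ μ' x hx y hy => ?_
  rw [Module.End.mul_apply, Module.End.mul_apply, tensF_tmul hy, tensF_tmul hy, map_sum, map_sum]
  have h1 : ∀ {i j : I} {l : ℕ} (k : ℕ) (hl : C.IsIndex j l) (hij : C.a i j = 0),
      ∀ r ∈ Finset.HasAntidiagonal.antidiagonal l,
      tensF R R' i k ((C.qpar j ^ (r.1 * r.2) * (C.kval j μ')⁻¹ ^ r.1) • (R.f j r.1 x ⊗ₜ[Qq] R'.f j r.2 y)) =
      ∑ p ∈ Finset.HasAntidiagonal.antidiagonal k,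
        ((C.qpar j ^ (r.1 * r.2) * (C.kval j μ')⁻¹ ^ r.1) * (C.qpar i ^ (p.1 * p.2) *
          (C.kval i μ')⁻¹ ^ p.1)) • (R.f i p.1 (R.f j r.1 x) ⊗ₜ[Qq] R'.f i p.2 (R'.f j r.2 y)) := by
    intro i j l k hl hij r hr
    rw [map_smul, tensF_tmul (apply_mem_wtSpace (R'.f_mem' (IsIndex.antidiagonal (Or.inr hl) hr).2) hy),
      Finset.smul_sum, kval_add_neg_smul, hij, mul_zero, zero_mul, neg_zero, zpow_zero, mul_one]
    exact Finset.sum_congr rfl fun p _ => smul_smul _ _ _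
  rw [Finset.sum_congr rfl (h1 k hl hij), Finset.sum_congr rfl (h1 l hk (a_eq_zero_symm hij)), Finset.sum_comm]
  refine Finset.sum_congr rfl fun p hp => Finset.sum_congr rfl fun r hr => ?_
  have hp' := IsIndex.antidiagonal (Or.inr hk) hp
  have hr' := IsIndex.antidiagonal (Or.inr hl) hr
  rw [comm_zero_or R.f_zero h hp'.1 hr'.1, comm_zero_or R'.f_zero h' hp'.2 hr'.2]
  congr 1
  ring

variable (R R') in
/-- The tensor product of two representations. -/
noncomputable def tensor : C.PreRep ν (V ⊗[Qq] V') where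
  T := tensT R R'
  e := tensE R R'
  f := tensF R R'
  e_zero i := tensor_ext R R' fun μ μ' x hx y hy => by
    rw [tensE_tmul hx, Finset.Nat.antidiagonal_zero, Finset.sum_singleton, R.e_zero, R'.e_zero]
    simp
  f_zero i := tensor_ext R R' fun μ μ' x hx y hy => by
    rw [tensF_tmul hy, Finset.Nat.antidiagonal_zero, Finset.sum_singleton, R.f_zero, R'.f_zero]
    simp
  iSup_wt := iSup_wtSpace_tensT R R'
  e_mem i l hl := tensE_mem R R' (Or.inr hl)
  f_mem i l hl := tensF_mem R R' (Or.inr hl)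
  comm_ef i j k l hk hl hij := commute_tensE_tensF hk hl hij
  ef i k l hk hl μ z hz := by
    refine (ef_apply_iff (T := tensT R R') (e := tensE R R' i) (f := tensF R R' i)
      (fun l hl => tensE_mem R R' hl) (fun l hl => tensF_mem R R' hl) hk hl hz).1 ?_
    refine LinearMap.congr_fun (tensor_ext R R' fun μ μ' x hx y hy => ?_) z
    exact (ef_apply_iff (T := tensT R R') (e := tensE R R' i) (f := tensF R R' i)
      (fun l hl => tensE_mem R R' hl) (fun l hl => tensF_mem R R' hl) hk hl (tmul_mem_wtSpace hx hy)).2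
      (tens_ef hx hy hk hl)

theorem mem_of_tmul_mem (R : C.PreRep ν V) (R' : C.PreRep ν V') {J : Submodule Qq (V ⊗[Qq] V')}
    (h : ∀ μ μ', ∀ x ∈ wtSpace R.T μ, ∀ y ∈ wtSpace R'.T μ', x ⊗ₜ[Qq] y ∈ J) (z : V ⊗[Qq] V') : z ∈ J := by
  have h0 : J.mkQ = 0 := by
    refine tensor_ext R R' fun μ μ' x hx y hy => ?_
    rw [LinearMap.zero_apply, Submodule.mkQ_apply, Submodule.Quotient.mk_eq_zero]
    exact h μ μ' x hx y hy
  rw [← Submodule.Quotient.mk_eq_zero, ← Submodule.mkQ_apply, h0, LinearMap.zero_apply]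

/-- An operator of the form `c a ⊗ 1 + c' 1 ⊗ b`, with scalars that depend on the weights, is locally nilpotent
if `a` and `b` are. -/
theorem tensor_nilpotent (R : C.PreRep ν V) (R' : C.PreRep ν V') {A : Module.End Qq (V ⊗[Qq] V')}
    {a : Module.End Qq V} {b : Module.End Qq V'} {α β : WeightLattice I} (ha : a ∈ degSpace R.T α)
    (hb : b ∈ degSpace R'.T β)
    (hA : ∀ μ μ', ∀ x ∈ wtSpace R.T μ, ∀ y ∈ wtSpace R'.T μ',
      ∃ c c' : Qq, A (x ⊗ₜ y) = c • (a x ⊗ₜ y) + c' • (x ⊗ₜ b y))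
    (hna : ∀ x, ∃ N : ℕ, (a ^ N) x = 0) (hnb : ∀ y, ∃ N : ℕ, (b ^ N) y = 0) (z : V ⊗[Qq] V') :
    ∃ N : ℕ, (A ^ N) z = 0 := by
  have hmem : ∀ z, z ∈ A.maxGenEigenspace 0 ↔ ∃ N : ℕ, (A ^ N) z = 0 := by
    intro z
    rw [Module.End.mem_maxGenEigenspace, zero_smul, sub_zero]
  -- Induction on the sum of the nilpotency orders of `a` on `x` and of `b` on `y`.
  have key : ∀ n p r : ℕ, p + r = n → ∀ μ μ', ∀ x ∈ wtSpace R.T μ, ∀ y ∈ wtSpace R'.T μ',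
      (a ^ p) x = 0 → (b ^ r) y = 0 → x ⊗ₜ[Qq] y ∈ A.maxGenEigenspace 0 := by
    intro n
    induction n with
    | zero =>
      intro p r hpr μ μ' x _ y _ hp _
      obtain rfl : p = 0 := by omega
      rw [pow_zero, Module.End.one_apply] at hp
      rw [hp, TensorProduct.zero_tmul]
      exact zero_mem _
    | succ n ih =>
      intro p r hpr μ μ' x hx y hy hp hr
      rcases p with _ | p
      · rw [pow_zero, Module.End.one_apply] at hp
        rw [hp, TensorProduct.zero_tmul]
        exact zero_mem _
      rcases r with _ | r
      · rw [pow_zero, Module.End.one_apply] at hr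
        rw [hr, TensorProduct.tmul_zero]
        exact zero_mem _
      obtain ⟨c, c', hc⟩ := hA μ μ' x hx y hy
      have h1 : A (x ⊗ₜ y) ∈ A.maxGenEigenspace 0 := by
        rw [hc]
        refine add_mem (Submodule.smul_mem _ _ ?_) (Submodule.smul_mem _ _ ?_)
        · exact ih p (r + 1) (by omega) _ _ _ (apply_mem_wtSpace ha hx) _ hy
            (by rw [← Module.End.mul_apply, ← pow_succ]; exact hp) hr
        · exact ih (p + 1) r (by omega) _ _ _ hx _ (apply_mem_wtSpace hb hy) hp
            (by rw [← Module.End.mul_apply, ← pow_succ]; exact hr)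
      rw [hmem] at h1 ⊢
      obtain ⟨N, hN⟩ := h1
      exact ⟨N + 1, by rw [pow_succ]; exact hN⟩
  refine (hmem z).1 (mem_of_tmul_mem R R' (fun μ μ' x hx y hy => ?_) z)
  obtain ⟨p, hp⟩ := hna x
  obtain ⟨r, hr⟩ := hnb y
  exact key _ p r rfl μ μ' x hx y hy hp hr

theorem tensor_integrable (hR : R.Integrable) (hR' : R'.Integrable) : (tensor R R').Integrable where
  comm_e i j k l hk hl hij := commute_tensE_tensE hk hl hij (fun k l hk hl => hR.comm_e i j k l hk hl hij)
    (fun k l hk hl => hR'.comm_e i j k l hk hl hij)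
  comm_f i j k l hk hl hij := commute_tensF_tensF hk hl hij (fun k l hk hl => hR.comm_f i j k l hk hl hij)
    (fun k l hk hl => hR'.comm_f i j k l hk hl hij)
  nil_e i hi := tensor_nilpotent R R' (R.e_mem i 1 hi.isIndex) (R'.e_mem i 1 hi.isIndex)
    (fun μ μ' x hx y hy => by
      refine ⟨1, C.kval i μ, ?_⟩
      rw [show (tensor R R').e = tensE R R' from rfl, tensE_tmul hx, Finset.Nat.antidiagonal_succ]
      simp [R.e_zero, R'.e_zero, add_comm]) (hR.nil_e i hi) (hR'.nil_e i hi)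
  nil_f i hi := tensor_nilpotent R R' (R.f_mem i 1 hi.isIndex) (R'.f_mem i 1 hi.isIndex)
    (fun μ μ' x hx y hy => by
      refine ⟨(C.kval i μ')⁻¹, 1, ?_⟩
      rw [show (tensor R R').f = tensF R R' from rfl, tensF_tmul hy, Finset.Nat.antidiagonal_succ]
      simp [R.f_zero, R'.f_zero, add_comm]) (hR.nil_f i hi) (hR'.nil_f i hi)

end PreRep

end BorcherdsCartanMatrix

namespace QuantumSl2

theorem map_dp_apply_of_intertwine {k : Type*} [Field k] {V A : Type*} [AddCommGroup V] [Module k V] [Ring A] [Algebra k A]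
    {q : k} (g : V →ₗ[k] A) {E : Module.End k V} {a : A} (hE : ∀ z, g (E z) = a * g z) (n : ℤ) (z : V) :
    g (dp q E n z) = dp q a n * g z := by
  have hpow : ∀ (n : ℕ) (z : V), g ((E ^ n) z) = a ^ n * g z := by
    intro n
    induction n with
    | zero => intro z; simp
    | succ n ih => intro z; rw [pow_succ, Module.End.mul_apply, ih, hE, pow_succ, mul_assoc]
  rw [dp, dp]
  split_ifs
  · rw [LinearMap.smul_apply, map_smul, hpow, smul_mul_assoc]
  · rw [LinearMap.zero_apply, map_zero, zero_mul]

theorem map_serreSum_apply_of_intertwine {k : Type*} [Field k] {V A : Type*} [AddCommGroup V] [Module k V] [Ring A]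
    [Algebra k A] {q : k} (g : V →ₗ[k] A) {E x : Module.End k V} {a b : A} (hE : ∀ z, g (E z) = a * g z)
    (hx : ∀ z, g (x z) = b * g z) (m s : ℤ) (z : V) :
    g (serreSum q E x m s z) = serreSum q a b m s * g z := by
  rw [serreSum, serreSum, LinearMap.sum_apply, map_sum, Finset.sum_mul]
  refine Finset.sum_congr rfl fun r _ => ?_
  rw [LinearMap.smul_apply, map_smul, Module.End.mul_apply, Module.End.mul_apply, map_dp_apply_of_intertwine g hE, hx,
    map_dp_apply_of_intertwine g hE, smul_mul_assoc, mul_assoc, mul_assoc]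

end QuantumSl2

namespace BorcherdsCartanMatrix

open QuantumSl2

variable {I : Type u} {C : BorcherdsCartanMatrix I} {ν : I → ℕ → Qq}

/-! ### The triangular decomposition -/

section WordMap

variable {A : Type*} [Ring A] [Algebra Qq A] {g : I → ℕ → A}

variable (C) in
/-- The linear map that sends a word in the symbols `(i, l)` to the corresponding product of the `g i l`. -/
noncomputable def wordMap (g : I → ℕ → A) : C.Fock →ₗ[Qq] A :=
  Finsupp.linearCombination Qq fun w => (w.map fun x => g x.i x.l).prod

theorem wordMap_single (w : List C.Index) :
    C.wordMap g (Finsupp.single w 1) = (w.map fun x => g x.i x.l).prod := by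
  rw [wordMap, Finsupp.linearCombination_single, one_smul]

theorem wordMap_nil : C.wordMap g (Finsupp.single [] 1) = 1 := by
  rw [wordMap_single, List.map_nil, List.prod_nil]

theorem wordMap_cons (x : C.Index) (w : List C.Index) :
    C.wordMap g (Finsupp.single (x :: w) 1) = g x.i x.l * C.wordMap g (Finsupp.single w 1) := by
  rw [wordMap_single, wordMap_single, List.map_cons, List.prod_cons]

theorem wordMap_vf {i : I} {l : ℕ} (h0 : g i 0 = 1) (hl : l = 0 ∨ C.IsIndex i l) (z : C.Fock) :
    C.wordMap g (C.vf i l z) = g i l * C.wordMap g z := by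
  rcases hl with rfl | hl
  · rw [vf_zero, h0, one_mul]; rfl
  · have : C.wordMap g ∘ₗ C.vf i l = LinearMap.mulLeft Qq (g i l) ∘ₗ C.wordMap g := by
      refine fock_ext fun w => ?_
      rw [LinearMap.comp_apply, LinearMap.comp_apply, vf_single hl, wordMap_cons, LinearMap.mulLeft_apply]
    exact LinearMap.congr_fun this z

theorem wordMap_eq_zero (h0 : ∀ i, g i 0 = 1)
    (hs : ∀ i j l, C.IsReal i → C.IsIndex j l → i ≠ j →
      serreSum (C.qi i) (g i 1) (g j l) (-(l * C.a i j) + 1) 0 = 0)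
    (hc : ∀ i j k l, C.IsIndex i k → C.IsIndex j l → C.a i j = 0 → Commute (g i k) (g j l))
    {z : C.Fock} (hz : z ∈ relSub (∅ : Set C.Fock)) : C.wordMap g z = 0 := by
  refine relSub_induction (p := fun z => C.wordMap g z = 0) (map_zero _)
    (fun x y hx hy => by rw [map_add, hx, hy, add_zero]) (fun c x hx => by rw [map_smul, hx, smul_zero])
    (fun z hz => ?_) hz
  induction hz with
  | base z hz => exact hz.elim
  | serre i j l hi hj hij w =>
    rw [map_serreSum_apply_of_intertwine _ (wordMap_vf (h0 i) (Or.inr hi.isIndex)) (wordMap_vf (h0 j) (Or.inr hj)),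
      hs i j l hi hj hij, zero_mul]
  | comm i j k l hi hj hij w =>
    rw [map_sub, wordMap_vf (h0 i) (Or.inr hi), wordMap_vf (h0 j) (Or.inr hj), wordMap_vf (h0 j) (Or.inr hj),
      wordMap_vf (h0 i) (Or.inr hi), ← mul_assoc, ← mul_assoc, (hc i j k l hi hj hij).eq, sub_self]
  | cons x z _ ih => rw [wordMap_vf (h0 _) (Or.inr x.isIndex), ih, mul_zero]

end WordMap

theorem uf_wordMap_eq_zero {z : C.Fock} (hz : z ∈ relSub (∅ : Set C.Fock)) : C.wordMap (C.uf ν) z = 0 := by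
  refine wordMap_eq_zero uf_zero (fun i j l hi hj hij => ?_) (fun i j k l hi hj hij => ?_) hz
  · rw [← serre_relator_eq l hij]
    have := toU_rel (ν := ν) (.serre_f i j l hi hj hij)
    simpa only [map_sum, map_smul, map_mul, map_divPow, map_zero, toU_ge, toU_gf] using this
  · have := toU_rel (ν := ν) (.comm_f i j k l hi hj hij)
    rwa [map_mul, map_mul] at this

theorem ue_wordMap_eq_zero {z : C.Fock} (hz : z ∈ relSub (∅ : Set C.Fock)) : C.wordMap (C.ue ν) z = 0 := by
  refine wordMap_eq_zero ue_zero (fun i j l hi hj hij => ?_) (fun i j k l hi hj hij => ?_) hz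
  · rw [← serre_relator_eq l hij]
    have := toU_rel (ν := ν) (.serre_e i j l hi hj hij)
    simpa only [map_sum, map_smul, map_mul, map_divPow, map_zero, toU_ge, toU_gf] using this
  · have := toU_rel (ν := ν) (.comm_e i j k l hi hj hij)
    rwa [map_mul, map_mul] at this

/-- A subalgebra of `U` that contains the generators is everything. -/
theorem subalgebra_eq_top {P : Subalgebra Qq (C.QAlg ν)} (hq : ∀ h, C.qh ν h ∈ P)
    (he : ∀ i l, C.IsIndex i l → C.ue ν i l ∈ P) (hf : ∀ i l, C.IsIndex i l → C.uf ν i l ∈ P) : P = ⊤ := by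
  have h1 : P.comap (C.toU ν) = ⊤ := by
    rw [eq_top_iff, ← FreeAlgebra.adjoin_range_ι, Algebra.adjoin_le_iff]
    rintro _ ⟨x, rfl⟩
    rcases x with h | x | x
    · exact hq h
    · have hx : x.l ≠ 0 := by rcases x.isIndex with h | h <;> omega
      have := he x.i x.l x.isIndex
      rwa [ue, ge, if_neg hx, dif_pos x.isIndex] at this
    · have hx : x.l ≠ 0 := by rcases x.isIndex with h | h <;> omega
      have := hf x.i x.l x.isIndex
      rwa [uf, gf, if_neg hx, dif_pos x.isIndex] at this
  rw [eq_top_iff]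
  rintro u -
  obtain ⟨y, rfl⟩ := RingQuot.mkAlgHom_surjective Qq (C.Rel ν) u
  have : y ∈ P.comap (C.toU ν) := by rw [h1]; trivial
  exact this

/-- The map `y ⊗ x ↦ y x` from the tensor product of the algebras of words in the `f_{il}` and in the
`e_{il}` to `U`. -/
noncomputable def mulFE (ν : I → ℕ → Qq) : C.Fock ⊗[Qq] C.Fock →ₗ[Qq] C.QAlg ν :=
  LinearMap.mul' Qq (C.QAlg ν) ∘ₗ TensorProduct.map (C.wordMap (C.uf ν)) (C.wordMap (C.ue ν))

theorem mulFE_tmul (y x : C.Fock) : mulFE ν (y ⊗ₜ x) = C.wordMap (C.uf ν) y * C.wordMap (C.ue ν) x := by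
  rw [mulFE, LinearMap.comp_apply, TensorProduct.map_tmul, LinearMap.mul'_apply]

/-- `∑_h (y ⊗ x)_h ↦ ∑_h y x q^h`. -/
noncomputable def triang (ν : I → ℕ → Qq) : (DualWeightLattice I →₀ C.Fock ⊗[Qq] C.Fock) →ₗ[Qq] C.QAlg ν :=
  Finsupp.lsum Qq fun h => LinearMap.mulRight Qq (C.qh ν h) ∘ₗ mulFE ν

theorem triang_single (h : DualWeightLattice I) (t : C.Fock ⊗[Qq] C.Fock) :
    triang ν (Finsupp.single h t) = mulFE ν t * C.qh ν h := by
  rw [triang, Finsupp.lsum_single]; rfl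

theorem triang_induction {P : C.QAlg ν → Prop} (h0 : P 0) (ha : ∀ x y, P x → P y → P (x + y))
    (hs : ∀ (c : Qq) x, P x → P (c • x))
    (h : ∀ w w' h, P (C.wordMap (C.uf ν) (Finsupp.single w 1) * C.wordMap (C.ue ν) (Finsupp.single w' 1) * C.qh ν h))
    {u : C.QAlg ν} (hu : u ∈ LinearMap.range (triang ν)) : P u := by
  let N : Submodule Qq (C.QAlg ν) := { carrier := {u | P u}, add_mem' := ha _ _, zero_mem' := h0, smul_mem' := hs }
  have h1 : N.mkQ ∘ₗ triang ν = 0 := by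
    refine Finsupp.lhom_ext' fun h' => ?_
    refine TensorProduct.ext ?_
    refine fock_ext fun w => fock_ext fun w' => ?_
    have h2 : N.mkQ (triang ν (Finsupp.single h' (Finsupp.single w 1 ⊗ₜ Finsupp.single w' 1))) = 0 := by
      rw [triang_single, mulFE_tmul, Submodule.mkQ_apply, Submodule.Quotient.mk_eq_zero]
      exact h w w' h'
    exact h2
  obtain ⟨t, rfl⟩ := hu
  have h2 := LinearMap.congr_fun h1 t
  rw [LinearMap.comp_apply, LinearMap.zero_apply, Submodule.mkQ_apply, Submodule.Quotient.mk_eq_zero] at h2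
  exact h2

theorem mem_range_triang (y x : C.Fock) (h : DualWeightLattice I) :
    C.wordMap (C.uf ν) y * C.wordMap (C.ue ν) x * C.qh ν h ∈ LinearMap.range (triang ν) :=
  ⟨Finsupp.single h (y ⊗ₜ x), by rw [triang_single, mulFE_tmul]⟩

theorem uf_mul_mem_range_triang {i : I} {l : ℕ} (hl : l = 0 ∨ C.IsIndex i l) {u : C.QAlg ν}
    (hu : u ∈ LinearMap.range (triang ν)) : C.uf ν i l * u ∈ LinearMap.range (triang ν) := by
  refine triang_induction (P := fun u => C.uf ν i l * u ∈ LinearMap.range (triang ν)) (by simp)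
    (fun x y hx hy => by rw [mul_add]; exact add_mem hx hy)
    (fun c x hx => by rw [mul_smul_comm]; exact Submodule.smul_mem _ _ hx) (fun w w' h => ?_) hu
  rw [← mul_assoc, ← mul_assoc, ← wordMap_vf (uf_zero i) hl]
  exact mem_range_triang _ _ _

theorem wordMap_uf_mem_rootSpace (w : List C.Index) :
    ∃ α, C.wordMap (C.uf ν) (Finsupp.single w 1) ∈ C.rootSpace ν α := by
  induction w with
  | nil => exact ⟨0, by rw [wordMap_nil]; exact one_mem_rootSpace⟩
  | cons x w ih =>
    obtain ⟨α, hα⟩ := ih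
    exact ⟨_, by rw [wordMap_cons]; exact mul_mem_rootSpace (uf_mem_rootSpace x.isIndex) hα⟩

theorem wordMap_ue_mem_rootSpace (w : List C.Index) :
    ∃ α, C.wordMap (C.ue ν) (Finsupp.single w 1) ∈ C.rootSpace ν α := by
  induction w with
  | nil => exact ⟨0, by rw [wordMap_nil]; exact one_mem_rootSpace⟩
  | cons x w ih =>
    obtain ⟨α, hα⟩ := ih
    exact ⟨_, by rw [wordMap_cons]; exact mul_mem_rootSpace (ue_mem_rootSpace x.isIndex) hα⟩

theorem qh_mul_mem_range_triang (h : DualWeightLattice I) {u : C.QAlg ν}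
    (hu : u ∈ LinearMap.range (triang ν)) : C.qh ν h * u ∈ LinearMap.range (triang ν) := by
  refine triang_induction (P := fun u => C.qh ν h * u ∈ LinearMap.range (triang ν)) (by simp)
    (fun x y hx hy => by rw [mul_add]; exact add_mem hx hy)
    (fun c x hx => by rw [mul_smul_comm]; exact Submodule.smul_mem _ _ hx) (fun w w' h' => ?_) hu
  obtain ⟨α, hα⟩ := wordMap_uf_mem_rootSpace (ν := ν) w
  obtain ⟨β, hβ⟩ := wordMap_ue_mem_rootSpace (ν := ν) w'
  rw [← mul_assoc, qh_mul_of_mem (mul_mem_rootSpace hα hβ), smul_mul_assoc, mul_assoc, ← qh_add]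
  exact Submodule.smul_mem _ _ (mem_range_triang _ _ _)

/-- The relation of `e_{ik}` and `f_{il}` moves `e_{ik}` to the right, by induction on `k` and on the word. -/
theorem ue_mul_wordMap_mem_range_triang {j : I} (k : ℕ) (hk : k = 0 ∨ C.IsIndex j k) (y x : C.Fock)
    (h : DualWeightLattice I) :
    C.ue ν j k * (C.wordMap (C.uf ν) y * C.wordMap (C.ue ν) x * C.qh ν h) ∈ LinearMap.range (triang ν) := by
  induction k using Nat.strong_induction_on generalizing y with
  | _ k ih =>
  let A : C.Fock →ₗ[Qq] C.QAlg ν := LinearMap.mulLeft Qq (C.ue ν j k) ∘ₗ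
    LinearMap.mulRight Qq (C.wordMap (C.ue ν) x * C.qh ν h) ∘ₗ C.wordMap (C.uf ν)
  have hA : ∀ y, A y = C.ue ν j k * (C.wordMap (C.uf ν) y * C.wordMap (C.ue ν) x * C.qh ν h) := by
    intro y; rw [mul_assoc (C.wordMap (C.uf ν) y)]; rfl
  rw [← hA]
  refine apply_mem_of_single (fun w => ?_) y
  induction w with
  | nil =>
    rw [hA, wordMap_nil, one_mul, ← mul_assoc, ← wordMap_vf (ue_zero j) hk, ← one_mul (C.wordMap (C.ue ν) _),
      ← wordMap_nil (C := C) (g := C.uf ν)]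
    exact mem_range_triang _ _ _
  | cons z w ihw =>
    rw [hA] at ihw ⊢
    rw [wordMap_cons]
    rcases hk with rfl | hk
    · rw [ue_zero, one_mul, ← wordMap_cons]; exact mem_range_triang _ _ _
    by_cases hij : j = z.i
    · obtain ⟨i, l, hl⟩ := z
      obtain rfl : j = i := hij
      have hW : ∀ n, C.ue ν j (k - n) * (C.wordMap (C.uf ν) (Finsupp.single w 1) * C.wordMap (C.ue ν) x * C.qh ν h) ∈
          LinearMap.range (triang ν) := by
        intro n
        rcases Nat.eq_zero_or_pos n with rfl | hn
        · exact ihw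
        · have hk0 : 0 < k := by rcases hk with h | h <;> omega
          exact ih (k - n) (by omega) (hk.sub_left n) _
      have hR : ∀ n, C.ue ν j (k - (n + 1)) * (C.uf ν j (l - (n + 1)) * (C.wordMap (C.uf ν) (Finsupp.single w 1) *
          C.wordMap (C.ue ν) x * C.qh ν h)) ∈ LinearMap.range (triang ν) := by
        intro n
        have hk0 : 0 < k := by rcases hk with h | h <;> omega
        rw [← mul_assoc (C.uf ν j _), ← mul_assoc (C.uf ν j _), ← wordMap_vf (uf_zero j) (hl.sub_left (n + 1))]
        exact ih _ (by omega) (hk.sub_left _) _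
      have h0 : C.Kpow ν j 0 = 1 := by rw [Kpow_eq, zero_mul, zero_smul, qh_zero]
      have h1 := ue_uf_relation (ν := ν) hk hl
      conv_rhs at h1 => rw [Finset.sum_range_succ']
      have hs : C.uf ν j l * C.wordMap (C.uf ν) (Finsupp.single w 1) * C.wordMap (C.ue ν) x * C.qh ν h =
        C.uf ν j l * (C.wordMap (C.uf ν) (Finsupp.single w 1) * C.wordMap (C.ue ν) x * C.qh ν h) := by
        simp only [mul_assoc]
      rw [hs]
      generalize C.wordMap (C.uf ν) (Finsupp.single w 1) * C.wordMap (C.ue ν) x * C.qh ν h = v at hW hR ⊢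
      have h2 := congrArg (· * v) h1
      simp only [Finset.sum_mul, add_mul, smul_mul_assoc, mul_assoc, Nat.cast_zero, zero_mul, zpow_zero, nu0, if_true,
        mul_one, one_smul, h0, one_mul, Nat.sub_zero] at h2
      -- The term `n = 0` of the relation is solved for `e_{jk} f_{jl}`; all other terms involve `e_{j,k-n}`
      -- with `n ≥ 1`, or `e_{jk}` applied to the shorter word.
      rw [eq_sub_of_add_eq' h2.symm]
      refine sub_mem (Submodule.sum_mem _ fun n _ => Submodule.smul_mem _ _ ?_)
        (Submodule.sum_mem _ fun n _ => Submodule.smul_mem _ _ ?_)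
      · exact qh_mul_mem_range_triang _ (uf_mul_mem_range_triang (hl.sub_left n) (hW n))
      · exact qh_mul_mem_range_triang _ (hR n)
    · rw [mul_assoc, mul_assoc, ← mul_assoc, (commute_ue_uf hk z.isIndex hij).eq, mul_assoc]
      refine uf_mul_mem_range_triang (Or.inr z.isIndex) ?_
      rwa [mul_assoc] at ihw

/-- The products `y x q^h` span `U`: their span is a left ideal that contains `1`. -/
theorem range_triang : LinearMap.range (triang ν) = (⊤ : Submodule Qq (C.QAlg ν)) := by
  let P : Subalgebra Qq (C.QAlg ν) :=
    { carrier := {u | ∀ v ∈ LinearMap.range (triang ν), u * v ∈ LinearMap.range (triang ν)}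
      mul_mem' := fun {a b} ha hb v hv => by rw [mul_assoc]; exact ha _ (hb _ hv)
      add_mem' := fun {a b} ha hb v hv => by rw [add_mul]; exact add_mem (ha _ hv) (hb _ hv)
      algebraMap_mem' := fun c v hv => by rw [← Algebra.smul_def]; exact Submodule.smul_mem _ _ hv }
  have hP : P = ⊤ := by
    refine subalgebra_eq_top (fun h v hv => qh_mul_mem_range_triang h hv) (fun j k hk v hv => ?_)
      (fun j k hk v hv => uf_mul_mem_range_triang (Or.inr hk) hv)
    refine triang_induction (P := fun u => C.ue ν j k * u ∈ LinearMap.range (triang ν)) (by simp)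
      (fun x y hx hy => by rw [mul_add]; exact add_mem hx hy)
      (fun c x hx => by rw [mul_smul_comm]; exact Submodule.smul_mem _ _ hx) (fun w w' h => ?_) hv
    exact ue_mul_wordMap_mem_range_triang k (Or.inr hk) _ _ _
  rw [eq_top_iff]
  rintro u -
  have hu : u ∈ P := by rw [hP]; trivial
  have h1 := mem_range_triang (ν := ν) (Finsupp.single [] 1 : C.Fock) (Finsupp.single [] 1) 0
  rw [wordMap_nil, wordMap_nil, qh_zero, one_mul, one_mul] at h1
  have := hu _ h1
  rwa [mul_one] at this

end BorcherdsCartanMatrix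

namespace BorcherdsCartanMatrix

open QuantumSl2

variable {I : Type u} {C : BorcherdsCartanMatrix I} {ν : I → ℕ → Qq}

/-! ### The height of words -/

/-- The height of a word: the sum of the numbers `l` over its letters `(i, l)`. -/
def wordHt (w : List C.Index) : ℕ := (w.map fun x => x.l).sum

theorem wordHt_cons (x : C.Index) (w : List C.Index) : wordHt (x :: w) = x.l + wordHt w := by
  rw [wordHt, List.map_cons, List.sum_cons, wordHt]

theorem root_single (i j : I) : C.root i (0, Finsupp.single j 1) = Finsupp.single j 1 i := by
  simp [root]

/-- The height of a word is determined by its weight, the simple roots being linearly independent on the `d_i`.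
-/
theorem wordHt_eq_of_wordWt {Λ : WeightLattice I} {w w' : List C.Index} (h : C.wordWt Λ w = C.wordWt Λ w') :
    wordHt w = wordHt w' := by
  classical
  let c : List C.Index → I →₀ ℕ := fun w => (w.map fun x => Finsupp.single x.i x.l).sum
  have h1 : ∀ w j, C.wordWt Λ w (0, Finsupp.single j 1) = Λ (0, Finsupp.single j 1) - c w j := by
    intro w j
    induction w with
    | nil => simp [wordWt_nil, c]
    | cons x w ih =>
      have hc : c (x :: w) = Finsupp.single x.i x.l + c w := by simp [c]
      rw [wordWt_cons, LinearMap.add_apply, ih, LinearMap.neg_apply, LinearMap.smul_apply, root_single, hc,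
        Finsupp.add_apply, Finsupp.single_apply, Finsupp.single_apply]
      by_cases hx : x.i = j
      · simp [hx]; ring
      · simp [hx, Ne.symm hx]
  have h2 : ∀ w : List C.Index, wordHt w = (c w).degree := by
    intro w
    induction w with
    | nil => simp [wordHt, c]
    | cons x w ih =>
      have hc : c (x :: w) = Finsupp.single x.i x.l + c w := by simp [c]
      rw [wordHt_cons, hc, map_add, ih, Finsupp.degree_single]
  rw [h2, h2]
  congr 1
  ext j
  have h3 := h1 w j
  rw [h, h1] at h3
  omega

open Classical in
/-- The projection onto the span of the words whose height satisfies `P`. -/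
noncomputable def cut (P : ℕ → Prop) : Module.End Qq C.Fock := wordDiag fun w => if P (wordHt w) then 1 else 0

variable {P : ℕ → Prop}

theorem cut_single_of_pos {w : List C.Index} (h : P (wordHt w)) : cut P (Finsupp.single w 1) = Finsupp.single w 1 := by
  rw [cut, wordDiag_single, if_pos h, one_smul]

theorem cut_single_of_neg {w : List C.Index} (h : ¬ P (wordHt w)) : cut P (Finsupp.single w 1) = 0 := by
  rw [cut, wordDiag_single, if_neg h, zero_smul]

/-- The relations are spanned by weight vectors, which are homogeneous for the height. -/
theorem cut_mem_relSub_empty {z : C.Fock} (hz : z ∈ relSub (∅ : Set C.Fock)) : cut P z ∈ relSub (∅ : Set C.Fock) := by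
  classical
  refine relSub_induction (p := fun z => cut P z ∈ relSub (∅ : Set C.Fock)) (by simp)
      (fun a b ha hb => by rw [map_add]; exact add_mem ha hb)
      (fun c a ha => by rw [map_smul]; exact Submodule.smul_mem _ _ ha) (fun g hg => ?_) hz
  obtain ⟨μ, hμ⟩ := hg.mem_wtSpace (Λ := 0) (fun g hg => hg.elim)
  have : ∃ c : Qq, cut P g = c • g := by
    by_cases h0 : g = 0
    · exact ⟨0, by rw [h0, map_zero, smul_zero]⟩
    obtain ⟨w, hw⟩ := Finsupp.ne_iff.1 h0
    refine ⟨if P (wordHt w) then 1 else 0, ?_⟩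
    ext w'
    rw [cut, wordDiag_apply, Finsupp.smul_apply, smul_eq_mul]
    by_cases hw' : g w' = 0
    · rw [hw', mul_zero, mul_zero]
    · rw [wordHt_eq_of_wordWt ((wordWt_of_mem hμ hw).trans (wordWt_of_mem hμ hw').symm)]
  obtain ⟨c, hc⟩ := this
  rw [hc]
  exact Submodule.smul_mem _ _ hg.mem

theorem vf_index_apply_ne_zero {x : C.Index} {g : C.Fock} {w : List C.Index} (h : C.vf x.i x.l g w ≠ 0) :
    ∃ w', w = x :: w' ∧ g w' ≠ 0 := by
  classical
  have : x.l ≠ 0 := by rcases x.isIndex with h | h <;> omega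
  rw [vf, if_neg this, dif_pos x.isIndex, Finsupp.lmapDomain_apply, ← Finsupp.mem_support_iff] at h
  obtain ⟨w', hw', rfl⟩ := Finset.mem_image.1 (Finsupp.mapDomain_support h)
  exact ⟨w', rfl, Finsupp.mem_support_iff.1 hw'⟩

/-- In heights at most `D`, the highest weight module agrees with the algebra of words modulo the relations if
the highest weight takes values at least `D` on the real simple coroots. -/
theorem cut_mem_relSub_of_singVec {Λ : WeightLattice I} {D : ℕ} (hΛ : ∀ i, C.IsReal i → (D : ℤ) ≤ Λ (coroot i))
    (hP : ∀ n, P n → n ≤ D) {z : C.Fock} (hz : z ∈ relSub (C.singVec Λ)) : cut P z ∈ relSub (∅ : Set C.Fock) := by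
  classical
  refine relSub_induction (p := fun z => cut P z ∈ relSub (∅ : Set C.Fock)) (by simp)
      (fun a b ha hb => by rw [map_add]; exact add_mem ha hb)
      (fun c a ha => by rw [map_smul]; exact Submodule.smul_mem _ _ ha) (fun g hg => ?_) hz
  -- The additional relations live in heights greater than `D`.
  have key : g ∈ relSub (∅ : Set C.Fock) ∨ ∀ w, g w ≠ 0 → D < wordHt w := by
    clear hz
    induction hg with
    | base g hg =>
      obtain ⟨i, hi, rfl⟩ := hg
      right
      have h1 := hΛ i hi
      have h2 : ∀ n w, ((C.vf i 1 ^ n) (Finsupp.single [] 1) : C.Fock) w ≠ 0 → wordHt w = n := by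
        intro n
        induction n with
        | zero =>
          intro w hw
          rw [pow_zero, Module.End.one_apply, Finsupp.single_apply] at hw
          by_cases h0 : [] = w
          · rw [← h0]; rfl
          · exact absurd (if_neg h0) hw
        | succ n ih =>
          intro w hw
          rw [pow_succ', Module.End.mul_apply] at hw
          obtain ⟨w', rfl, hw'⟩ := vf_index_apply_ne_zero (x := ⟨i, 1, hi.isIndex⟩) hw
          rw [wordHt_cons, ih w' hw', add_comm]
      intro w hw
      have := h2 _ w hw
      omega
    | serre i j l hi hj hij w => exact Or.inl (RelVec.mem (.serre i j l hi hj hij w))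
    | comm i j k l hi hj hij w => exact Or.inl (RelVec.mem (.comm i j k l hi hj hij w))
    | cons x g _ ih =>
      rcases ih with ih | ih
      · exact Or.inl (vf_mem_relSub _ _ ih)
      · right
        intro w hw
        obtain ⟨w', rfl, hw'⟩ := vf_index_apply_ne_zero hw
        have := ih w' hw'
        rw [wordHt_cons]; omega
  rcases key with h | h
  · exact cut_mem_relSub_empty h
  · have : cut P g = 0 := by
      ext w
      rw [cut, wordDiag_apply, Finsupp.zero_apply]
      by_cases hw : g w = 0
      · rw [hw, mul_zero]
      · rw [if_neg, zero_mul]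
        intro h1
        have := hP _ h1
        have := h w hw
        omega
    rw [this]
    exact zero_mem _

/-- The map induced by `cut P` from a highest weight module to the algebra of words modulo the relations. -/
noncomputable def cutQ {Λ : WeightLattice I} {D : ℕ} (hΛ : ∀ i, C.IsReal i → (D : ℤ) ≤ Λ (coroot i))
    (hP : ∀ n, P n → n ≤ D) : C.Fock ⧸ relSub (C.singVec Λ) →ₗ[Qq] C.Fock ⧸ relSub (∅ : Set C.Fock) :=
  Submodule.mapQ _ _ (cut P) fun _ hz => cut_mem_relSub_of_singVec hΛ hP hz

theorem cutQ_mk {Λ : WeightLattice I} {D : ℕ} (hΛ : ∀ i, C.IsReal i → (D : ℤ) ≤ Λ (coroot i))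
    (hP : ∀ n, P n → n ≤ D) (z : C.Fock) : cutQ hΛ hP (Submodule.Quotient.mk z) = Submodule.Quotient.mk (cut P z) := rfl

theorem exists_cut_eq (z : C.Fock) : ∃ D : ℕ, ∀ D' ≥ D, cut (· < D') z = z := by
  refine ⟨z.support.sup wordHt + 1, fun D' hD => ?_⟩
  ext w
  rw [cut, wordDiag_apply]
  by_cases hw : z w = 0
  · rw [hw, mul_zero]
  · have := Finset.le_sup (f := wordHt) (Finsupp.mem_support_iff.2 hw)
    rw [if_pos (by omega), one_mul]

theorem exists_map_cut_eq (t : C.Fock ⊗[Qq] C.Fock) : ∃ D : ℕ, ∀ D' ≥ D,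
    TensorProduct.map (cut (· < D')) LinearMap.id t = t ∧ TensorProduct.map LinearMap.id (cut (· < D')) t = t := by
  induction t with
  | zero => exact ⟨0, fun _ _ => ⟨map_zero _, map_zero _⟩⟩
  | add x y hx hy =>
    obtain ⟨D, hD⟩ := hx
    obtain ⟨E, hE⟩ := hy
    refine ⟨max D E, fun D' h => ?_⟩
    have h1 := hD D' (le_of_max_le_left h)
    have h2 := hE D' (le_of_max_le_right h)
    rw [map_add, map_add, h1.1, h2.1, h1.2, h2.2]
    exact ⟨rfl, rfl⟩
  | tmul x y =>
    obtain ⟨D, hD⟩ := exists_cut_eq x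
    obtain ⟨E, hE⟩ := exists_cut_eq y
    refine ⟨max D E, fun D' h => ?_⟩
    rw [TensorProduct.map_tmul, TensorProduct.map_tmul, hD D' (le_of_max_le_left h), hE D' (le_of_max_le_right h)]
    exact ⟨rfl, rfl⟩

/-! ### Tensor products of lowest and highest weight modules -/

section Pair

variable {Λ : WeightLattice I} (hΛ : ∀ i, C.IsReal i → 0 ≤ Λ (coroot i)) (hν : ∀ i, C.IsReal i → ν i 1 ≠ 0)

theorem highest_mem_wtSpace (w : List C.Index) :
    Submodule.Quotient.mk (Finsupp.single w 1) ∈ wtSpace (highest ν hΛ hν).T (C.wordWt Λ w) := by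
  rw [mem_wtSpace]
  intro h
  rw [highest_T_mk, vT_single]
  rfl

variable {V : Type*} [AddCommGroup V] [Module Qq V] (R : C.PreRep ν V)

/-- As `e_{in}` kills `η` for `n ≥ 1`, the `e_{ik}` act on `x ⊗ η` through the first factor. -/
theorem tensE_tmul_highest {i : I} {k : ℕ} (hk : k = 0 ∨ C.IsIndex i k) {μ : WeightLattice I} {x : V}
    (hx : x ∈ wtSpace R.T μ) :
    PreRep.tensE R (highest ν hΛ hν) i k (x ⊗ₜ Submodule.Quotient.mk (Finsupp.single [] 1)) =
      R.e i k x ⊗ₜ Submodule.Quotient.mk (Finsupp.single [] 1) := by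
  rw [PreRep.tensE_tmul hx, Finset.sum_eq_single (k, 0)]
  · rw [mul_zero, pow_zero, pow_zero, mul_one, one_smul, (highest ν hΛ hν).e_zero]; rfl
  · rintro ⟨a, b⟩ hp hne
    have hb := (PreRep.IsIndex.antidiagonal hk hp).2
    have hb0 : b ≠ 0 := by
      rintro rfl
      rw [Finset.HasAntidiagonal.mem_antidiagonal] at hp
      exact hne (by rw [← hp]; rfl)
    rw [highest_e_mk hΛ hν hb, vE_nil (by exact_mod_cast hb0), Submodule.Quotient.mk_zero, TensorProduct.tmul_zero,
      smul_zero]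
  · intro h
    exact absurd (Finset.HasAntidiagonal.mem_antidiagonal.2 (add_zero k)) h

/-- The span of the vectors `a ⊗ b`, for the images `b` of the words of height less than `n`. -/
noncomputable def lowSpan (V : Type*) [AddCommGroup V] [Module Qq V] (Λ : WeightLattice I) (n : ℕ) :
    Submodule Qq (V ⊗[Qq] (C.Fock ⧸ relSub (C.singVec Λ))) :=
  Submodule.span Qq {z | ∃ (a : V) (w : List C.Index), wordHt w < n ∧
    z = a ⊗ₜ Submodule.Quotient.mk (Finsupp.single w 1)}

/-- The term of `f_{il}` with full height in the second factor is `1 ⊗ f_{il}`. -/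
theorem tensF_tmul_sub_mem (x : C.Index) (a : V) (w : List C.Index) :
    PreRep.tensF R (highest ν hΛ hν) x.i x.l (a ⊗ₜ Submodule.Quotient.mk (Finsupp.single w 1)) -
      a ⊗ₜ Submodule.Quotient.mk (Finsupp.single (x :: w) 1) ∈ lowSpan (C := C) V Λ (wordHt (x :: w)) := by
  rw [PreRep.tensF_tmul (highest_mem_wtSpace hΛ hν w),
    ← Finset.add_sum_erase _ _ (Finset.HasAntidiagonal.mem_antidiagonal.2 (zero_add x.l) : (0, x.l) ∈ _)]
  rw [zero_mul, pow_zero, pow_zero, mul_one, one_smul, R.f_zero, highest_f_mk, vf_index, Module.End.one_apply,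
    add_sub_cancel_left]
  refine Submodule.sum_mem _ fun p hp => Submodule.smul_mem _ _ ?_
  rw [Finset.mem_erase, Finset.HasAntidiagonal.mem_antidiagonal] at hp
  obtain ⟨hne, hp⟩ := hp
  have hlt : p.2 < x.l := by
    rcases Nat.lt_or_ge p.2 x.l with h | h
    · exact h
    · exact absurd (Prod.ext (by simp; omega) (by simp; omega)) hne
  rw [highest_f_mk]
  rcases x.isIndex.of_le hlt.le with h0 | h
  · rw [h0, vf_zero]
    refine Submodule.subset_span ⟨_, w, ?_, rfl⟩
    rw [wordHt_cons]; omega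
  · rw [vf_single h]
    refine Submodule.subset_span ⟨_, _, ?_, rfl⟩
    rw [wordHt_cons, wordHt_cons]
    exact Nat.add_lt_add_right hlt _

theorem lowSpan_mono {n n' : ℕ} (h : n ≤ n') : lowSpan (C := C) V Λ n ≤ lowSpan V Λ n' :=
  Submodule.span_mono fun _ ⟨a, w, hw, hz⟩ => ⟨a, w, hw.trans_le h, hz⟩

theorem tensF_mem_lowSpan (x : C.Index) {n : ℕ} {z : V ⊗[Qq] (C.Fock ⧸ relSub (C.singVec Λ))}
    (hz : z ∈ lowSpan V Λ n) : PreRep.tensF R (highest ν hΛ hν) x.i x.l z ∈ lowSpan V Λ (x.l + n) := by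
  induction hz using Submodule.span_induction with
  | mem z hz =>
    obtain ⟨a, w, hw, rfl⟩ := hz
    rw [← sub_add_cancel (PreRep.tensF R (highest ν hΛ hν) x.i x.l _)
      (a ⊗ₜ Submodule.Quotient.mk (Finsupp.single (x :: w) 1))]
    refine add_mem (lowSpan_mono ?_ (tensF_tmul_sub_mem hΛ hν R x a w)) (Submodule.subset_span ⟨a, _, ?_, rfl⟩)
    · rw [wordHt_cons]; omega
    · rw [wordHt_cons]; omega
  | zero => rw [map_zero]; exact zero_mem _
  | add y z _ _ hy hz => rw [map_add]; exact add_mem hy hz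
  | smul c z _ hz => rw [map_smul]; exact Submodule.smul_mem _ _ hz

/-- `y (a ⊗ η) = a ⊗ y η` up to terms of smaller height in the second factor, for a word `y` in the `f_{il}`. -/
theorem toEnd_wordMap_uf_sub_mem {R : C.PreRep ν V} (hR : R.Integrable) (a : V) (w : List C.Index) :
    (PreRep.tensor_integrable hR (highest_integrable hΛ hν)).toEnd hν (C.wordMap (C.uf ν) (Finsupp.single w 1))
      (a ⊗ₜ Submodule.Quotient.mk (Finsupp.single [] 1)) - a ⊗ₜ Submodule.Quotient.mk (Finsupp.single w 1) ∈
      lowSpan (C := C) V Λ (wordHt w) := by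
  induction w with
  | nil => rw [wordMap_nil, map_one, Module.End.one_apply, sub_self]; exact zero_mem _
  | cons x w ih =>
    rw [wordMap_cons, map_mul, Module.End.mul_apply, PreRep.Integrable.toEnd_uf _ hν x.isIndex]
    have h1 := tensF_mem_lowSpan hΛ hν R x ih
    rw [map_sub] at h1
    have h2 := add_mem h1 (by simpa only [wordHt_cons] using tensF_tmul_sub_mem hΛ hν R x a w)
    rw [sub_add_sub_cancel] at h2
    rw [wordHt_cons]
    exact h2

variable {Λ' : WeightLattice I} (hΛ' : ∀ i, C.IsReal i → 0 ≤ Λ' (coroot i))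

theorem swap_highest_mem_wtSpace (w : List C.Index) :
    Submodule.Quotient.mk (Finsupp.single w 1) ∈ wtSpace (highest ν hΛ' hν).swap.T (-C.wordWt Λ' w) := by
  have h : wtSpace (highest ν hΛ' hν).swap.T (-C.wordWt Λ' w) = wtSpace (highest ν hΛ' hν).T (- -C.wordWt Λ' w) :=
    wtSpace_neg _
  rw [h, neg_neg]
  exact highest_mem_wtSpace hΛ' hν w

/-- The action of `U` on the tensor product of the lowest weight module of lowest weight `-Λ'` and the highest
weight module of highest weight `Λ`. -/
noncomputable def pairEnd : C.QAlg ν →ₐ[Qq] Module.End Qq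
    ((C.Fock ⧸ relSub (C.singVec Λ')) ⊗[Qq] (C.Fock ⧸ relSub (C.singVec Λ))) :=
  (PreRep.tensor_integrable (highest_integrable hΛ' hν).swap (highest_integrable hΛ hν)).toEnd hν

/-- `x (ξ ⊗ η) = x ξ ⊗ η` for a word `x` in the `e_{il}`, where `ξ` and `η` are the generating vectors. -/
theorem pairEnd_ue (w : List C.Index) : pairEnd hΛ hν hΛ' (C.wordMap (C.ue ν) (Finsupp.single w 1))
      (Submodule.Quotient.mk (Finsupp.single [] 1) ⊗ₜ Submodule.Quotient.mk (Finsupp.single [] 1)) =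
    Submodule.Quotient.mk (Finsupp.single w 1) ⊗ₜ Submodule.Quotient.mk (Finsupp.single [] 1) := by
  induction w with
  | nil => rw [wordMap_nil, map_one, Module.End.one_apply]
  | cons x w ih =>
    rw [wordMap_cons, map_mul, Module.End.mul_apply, ih, pairEnd, PreRep.Integrable.toEnd_ue _ hν x.isIndex]
    refine (tensE_tmul_highest hΛ hν _ (Or.inr x.isIndex) (swap_highest_mem_wtSpace hν hΛ' w)).trans ?_
    rw [← vf_index]
    rfl

theorem pairEnd_qh (h : DualWeightLattice I) : pairEnd hΛ hν hΛ' (C.qh ν h)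
      (Submodule.Quotient.mk (Finsupp.single [] 1) ⊗ₜ Submodule.Quotient.mk (Finsupp.single [] 1)) =
    qq ^ (Λ - Λ') h •
      (Submodule.Quotient.mk (Finsupp.single [] 1) ⊗ₜ Submodule.Quotient.mk (Finsupp.single [] 1)) := by
  rw [pairEnd, PreRep.Integrable.toEnd_qh]
  refine (mem_wtSpace.1 (PreRep.tmul_mem_wtSpace (swap_highest_mem_wtSpace hν hΛ' [])
    (highest_mem_wtSpace hΛ hν [])) h).trans ?_
  rw [wordWt_nil, wordWt_nil, neg_add_eq_sub]

end Pair

end BorcherdsCartanMatrix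

namespace BorcherdsCartanMatrix

open QuantumSl2

variable {I : Type u} {C : BorcherdsCartanMatrix I} {ν : I → ℕ → Qq}

/-! ### Faithfulness of `𝓞` -/

/-- The characters `μ ↦ q^{μ(h)}` of the weight lattice are linearly independent. -/
theorem eq_zero_of_forall_sum_weight_eq_zero {X : Type*} [AddCommGroup X] [Module Qq X] (s : Finset (DualWeightLattice I))
    (τ : DualWeightLattice I → X) (h : ∀ μ : WeightLattice I, ∑ h ∈ s, qq ^ μ h • τ h = 0) : ∀ h ∈ s, τ h = 0 := by
  let χ : DualWeightLattice I → (Multiplicative (WeightLattice I) →* Qq) := fun h =>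
    { toFun := fun μ => qq ^ (Multiplicative.toAdd μ) h
      map_one' := by simp
      map_mul' := fun μ μ' => by rw [toAdd_mul, LinearMap.add_apply, zpow_add₀ qq_ne_zero] }
  have hχ : Function.Injective χ := by
    intro h h' hh
    have h1 : ∀ μ : WeightLattice I, μ h = μ h' := fun μ =>
      qq_zpow_injective (DFunLike.congr_fun hh (Multiplicative.ofAdd μ))
    refine Prod.ext (Finsupp.ext fun i => ?_) (Finsupp.ext fun i => ?_)
    · exact h1 ((Finsupp.lapply i).comp (LinearMap.fst ℤ _ _))
    · exact h1 ((Finsupp.lapply i).comp (LinearMap.snd ℤ _ _))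
  have hli := (linearIndependent_monoidHom (Multiplicative (WeightLattice I)) Qq).comp χ hχ
  intro h0 hh0
  rw [← Module.forall_dual_apply_eq_zero_iff Qq]
  intro φ
  refine linearIndependent_iff'.1 hli s (fun h => φ (τ h)) ?_ h0 hh0
  ext μ
  have h1 := congrArg φ (h (Multiplicative.toAdd μ))
  rw [map_sum, map_zero] at h1
  rw [Finset.sum_apply, Pi.zero_apply, ← h1]
  refine Finset.sum_congr rfl fun h' _ => ?_
  rw [map_smul, smul_eq_mul, mul_comm]
  rfl

/-- Multiplication factors through the words modulo the relations. -/
theorem mulFE_eq_zero {t : C.Fock ⊗[Qq] C.Fock}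
    (ht : TensorProduct.map (relSub (∅ : Set C.Fock)).mkQ (relSub (∅ : Set C.Fock)).mkQ t = 0) : mulFE ν t = 0 := by
  have h : mulFE ν = LinearMap.mul' Qq (C.QAlg ν) ∘ₗ TensorProduct.map
      ((relSub (∅ : Set C.Fock)).liftQ (C.wordMap (C.uf ν)) fun _ hz => LinearMap.mem_ker.2 (uf_wordMap_eq_zero hz))
      ((relSub (∅ : Set C.Fock)).liftQ (C.wordMap (C.ue ν)) fun _ hz => LinearMap.mem_ker.2 (ue_wordMap_eq_zero hz)) ∘ₗ
      TensorProduct.map (relSub (∅ : Set C.Fock)).mkQ (relSub (∅ : Set C.Fock)).mkQ := by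
    rw [← TensorProduct.map_comp, Submodule.liftQ_mkQ, Submodule.liftQ_mkQ, mulFE]
  rw [h, LinearMap.comp_apply, LinearMap.comp_apply, ht, map_zero, map_zero]

/-- In the tensor product of a lowest and a highest weight module, the part of highest degree in the second
factor of `y x (ξ ⊗ η)` is `x ξ ⊗ y η`. -/
theorem cutQ_pairEnd {Λ Λ' : WeightLattice I} {D H : ℕ} (hHD : H ≤ D) (hν : ∀ i, C.IsReal i → ν i 1 ≠ 0)
    (h0 : ∀ i, C.IsReal i → 0 ≤ Λ (coroot i)) (h0' : ∀ i, C.IsReal i → 0 ≤ Λ' (coroot i))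
    (hΛ : ∀ i, C.IsReal i → (D : ℤ) ≤ Λ (coroot i)) (hΛ' : ∀ i, C.IsReal i → (D : ℤ) ≤ Λ' (coroot i))
    (t : C.Fock ⊗[Qq] C.Fock) :
    TensorProduct.map (cutQ (P := (· < D)) hΛ' fun _ h => h.le) (cutQ (P := (· = H)) hΛ fun _ h => h.trans_le hHD)
      (pairEnd h0 hν h0' (mulFE ν (TensorProduct.map (cut (· < H + 1)) LinearMap.id t))
        (Submodule.Quotient.mk (Finsupp.single [] 1) ⊗ₜ Submodule.Quotient.mk (Finsupp.single [] 1))) =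
    TensorProduct.comm Qq _ _ (TensorProduct.map (relSub (∅ : Set C.Fock)).mkQ (relSub (∅ : Set C.Fock)).mkQ
      (TensorProduct.map (cut (· = H)) (cut (· < D)) t)) := by
  let A : C.Fock ⊗[Qq] C.Fock →ₗ[Qq] (C.Fock ⧸ relSub (∅ : Set C.Fock)) ⊗[Qq] (C.Fock ⧸ relSub (∅ : Set C.Fock)) :=
    TensorProduct.map (cutQ (P := (· < D)) hΛ' fun _ h => h.le) (cutQ (P := (· = H)) hΛ fun _ h => h.trans_le hHD) ∘ₗ
    LinearMap.applyₗ (Submodule.Quotient.mk (Finsupp.single [] 1) ⊗ₜ Submodule.Quotient.mk (Finsupp.single [] 1)) ∘ₗ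
    (pairEnd h0 hν h0').toLinearMap ∘ₗ mulFE ν ∘ₗ TensorProduct.map (cut (· < H + 1)) LinearMap.id
  let B : C.Fock ⊗[Qq] C.Fock →ₗ[Qq] (C.Fock ⧸ relSub (∅ : Set C.Fock)) ⊗[Qq] (C.Fock ⧸ relSub (∅ : Set C.Fock)) :=
    (TensorProduct.comm Qq _ _).toLinearMap ∘ₗ
      TensorProduct.map (relSub (∅ : Set C.Fock)).mkQ (relSub (∅ : Set C.Fock)).mkQ ∘ₗ
      TensorProduct.map (cut (· = H)) (cut (· < D))
  have hAB : A = B := by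
    refine TensorProduct.ext (fock_ext fun w => fock_ext fun w' => ?_)
    change TensorProduct.map _ _ (pairEnd h0 hν h0' (mulFE ν (TensorProduct.map _ _ (_ ⊗ₜ _))) _) =
      TensorProduct.comm Qq _ _ (TensorProduct.map _ _ (TensorProduct.map _ _ (_ ⊗ₜ _)))
    rw [TensorProduct.map_tmul, TensorProduct.map_tmul, TensorProduct.map_tmul, TensorProduct.comm_tmul, mulFE_tmul,
      map_mul, Module.End.mul_apply, LinearMap.id_apply, pairEnd_ue]
    by_cases hw : wordHt w < H + 1
    · rw [cut_single_of_pos hw]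
      have h1 := toEnd_wordMap_uf_sub_mem h0 hν (highest_integrable h0' hν).swap
        (Submodule.Quotient.mk (Finsupp.single w' 1)) w
      have h2 : lowSpan (C.Fock ⧸ relSub (C.singVec Λ')) Λ (wordHt w) ≤ LinearMap.ker (TensorProduct.map
          (cutQ (P := (· < D)) hΛ' fun _ h => h.le) (cutQ (P := (· = H)) hΛ fun _ h => h.trans_le hHD)) := by
        refine Submodule.span_le.2 ?_
        rintro _ ⟨a, b, hb, rfl⟩
        rw [SetLike.mem_coe, LinearMap.mem_ker, TensorProduct.map_tmul, cutQ_mk, cut_single_of_neg (by omega),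
          Submodule.Quotient.mk_zero, TensorProduct.tmul_zero]
      have h3 := h2 h1
      rw [LinearMap.mem_ker, map_sub, sub_eq_zero, TensorProduct.map_tmul, cutQ_mk, cutQ_mk] at h3
      exact h3
    · rw [cut_single_of_neg hw, cut_single_of_neg (P := (· = H)) (by omega), map_zero, map_zero, map_zero, TensorProduct.tmul_zero,
        LinearMap.zero_apply, map_zero]
  exact LinearMap.congr_fun hAB t

theorem triang_mapRange (A : Module.End Qq (C.Fock ⊗[Qq] C.Fock)) (t : DualWeightLattice I →₀ C.Fock ⊗[Qq] C.Fock) :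
    triang ν (Finsupp.mapRange.linearMap A t) = ∑ h ∈ t.support, mulFE ν (A (t h)) * C.qh ν h := by
  rw [triang, Finsupp.lsum_apply, Finsupp.mapRange.linearMap_apply,
    Finsupp.sum_of_support_subset _ Finsupp.support_mapRange _ fun h _ => map_zero _]
  rfl

/-- If an element of `U`, written as `∑ y x q^h` with all `y` of height at most `H`, kills all objects of `𝓞`,
then its part with `y` of height `H` is zero. -/
theorem top_part_eq_zero (hν : ∀ i, C.IsReal i → ν i 1 ≠ 0) (H : ℕ) (t : DualWeightLattice I →₀ C.Fock ⊗[Qq] C.Fock)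
    (ht : ∀ (M : Type u) [AddCommGroup M] [Module Qq M] [Module (C.QAlg ν) M]
      [IsScalarTower Qq (C.QAlg ν) M] (_ : C.IsCategoryO ν M) (z : M),
      triang ν (Finsupp.mapRange.linearMap (TensorProduct.map (cut (· < H + 1)) LinearMap.id) t) • z = 0)
    (h : DualWeightLattice I) : mulFE ν (TensorProduct.map (cut (· = H)) LinearMap.id (t h)) = 0 := by
  by_cases hh : h ∈ t.support
  swap
  · rw [Finsupp.notMem_support_iff.1 hh, map_zero, map_zero]
  choose D' hD' using fun h => exists_map_cut_eq (t h)
  let D := max H (t.support.sup D')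
  have hD : ∀ h ∈ t.support, TensorProduct.map LinearMap.id (cut (· < D)) (t h) = t h := fun h hh =>
    (hD' h D ((Finset.le_sup (f := D') hh).trans (le_max_right _ _))).2
  refine mulFE_eq_zero ?_
  have hcut : ∀ h ∈ t.support, TensorProduct.map (cut (· = H)) (cut (· < D)) (t h) =
      TensorProduct.map (cut (· = H)) LinearMap.id (t h) := by
    intro h hh
    conv_rhs => rw [← hD h hh, ← LinearMap.comp_apply, ← TensorProduct.map_comp]
    rfl
  refine (LinearEquiv.map_eq_zero_iff (TensorProduct.comm Qq _ _)).1 ?_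
  rw [← hcut h hh]
  refine eq_zero_of_forall_sum_weight_eq_zero t.support (fun h => TensorProduct.comm Qq _ _
    (TensorProduct.map (relSub (∅ : Set C.Fock)).mkQ (relSub (∅ : Set C.Fock)).mkQ
      (TensorProduct.map (cut (· = H)) (cut (· < D)) (t h)))) (fun μ => ?_) h hh
  -- dominant weights `Λ`, `Λ'` with difference `μ`, large on all simple coroots
  let Λ' : WeightLattice I := (Finsupp.linearCombination ℤ fun i => (D : ℤ) + |μ (coroot i)|).comp
    (LinearMap.fst ℤ (I →₀ ℤ) (I →₀ ℤ))
  have hΛ'c : ∀ i, Λ' (coroot i) = D + |μ (coroot i)| := by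
    intro i
    simp [Λ', coroot]
  have hΛ' : ∀ i, C.IsReal i → (D : ℤ) ≤ Λ' (coroot i) := fun i _ => by
    rw [hΛ'c]; have := abs_nonneg (μ (coroot i)); omega
  have hΛ : ∀ i, C.IsReal i → (D : ℤ) ≤ (μ + Λ') (coroot i) := fun i _ => by
    rw [LinearMap.add_apply, hΛ'c]; have := neg_abs_le (μ (coroot i)); omega
  have h0 : ∀ i, C.IsReal i → 0 ≤ (μ + Λ') (coroot i) := fun i hi => (Int.natCast_nonneg D).trans (hΛ i hi)
  have h0' : ∀ i, C.IsReal i → 0 ≤ Λ' (coroot i) := fun i hi => (Int.natCast_nonneg D).trans (hΛ' i hi)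
  have h1 : pairEnd h0 hν h0' (triang ν (Finsupp.mapRange.linearMap
      (TensorProduct.map (cut (· < H + 1)) LinearMap.id) t)) = 0 :=
    PreRep.Integrable.toEnd_eq_zero _ hν ht
  have h2 := LinearMap.congr_fun h1
    (Submodule.Quotient.mk (Finsupp.single [] 1) ⊗ₜ Submodule.Quotient.mk (Finsupp.single [] 1))
  have h3 := congrArg (TensorProduct.map (cutQ (P := (· < D)) hΛ' fun _ h => h.le)
    (cutQ (P := (· = H)) hΛ fun _ h => h.trans_le (le_max_left _ _))) h2
  rw [LinearMap.zero_apply, map_zero] at h3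
  rw [← h3]
  rw [triang_mapRange, map_sum, LinearMap.sum_apply, map_sum]
  refine Finset.sum_congr rfl fun h _ => ?_
  rw [map_mul, Module.End.mul_apply, pairEnd_qh, add_sub_cancel_right, map_smul, map_smul,
    cutQ_pairEnd (le_max_left _ _) hν h0 h0' hΛ hΛ']

/-- An element of `U` that acts by zero on all objects of `𝓞` is zero. -/
theorem eq_zero_of_forall_smul_eq_zero (hν : ∀ i, C.IsReal i → ν i 1 ≠ 0) {x : C.QAlg ν}
    (hx : ∀ (M : Type u) [AddCommGroup M] [Module Qq M] [Module (C.QAlg ν) M]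
      [IsScalarTower Qq (C.QAlg ν) M] (_ : C.IsCategoryO ν M) (z : M), x • z = 0) : x = 0 := by
  -- Induction on a bound for the heights of the words `y` in the `f_{il}`.
  have key : ∀ (H : ℕ) (t : DualWeightLattice I →₀ C.Fock ⊗[Qq] C.Fock),
      (∀ (M : Type u) [AddCommGroup M] [Module Qq M] [Module (C.QAlg ν) M]
        [IsScalarTower Qq (C.QAlg ν) M] (_ : C.IsCategoryO ν M) (z : M),
        triang ν (Finsupp.mapRange.linearMap (TensorProduct.map (cut (· < H)) LinearMap.id) t) • z = 0) →
      triang ν (Finsupp.mapRange.linearMap (TensorProduct.map (cut (· < H)) LinearMap.id) t) = 0 := by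
    intro H t
    induction H with
    | zero =>
      intro _
      have : (cut (· < 0) : Module.End Qq C.Fock) = 0 := fock_ext fun w => by
        rw [cut_single_of_neg (by omega)]; rfl
      rw [this, TensorProduct.map_zero_left, triang_mapRange]
      exact Finset.sum_eq_zero fun h _ => by rw [LinearMap.zero_apply, map_zero, zero_mul]
    | succ H ih =>
      intro ht
      have h1 := top_part_eq_zero hν H t ht
      have h2 : (cut (· < H + 1) : Module.End Qq C.Fock) = cut (· < H) + cut (· = H) := fock_ext fun w => by
        rw [LinearMap.add_apply]
        rcases lt_trichotomy (wordHt w) H with h | h | h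
        · rw [cut_single_of_pos (by omega), cut_single_of_pos h, cut_single_of_neg (by omega), add_zero]
        · rw [cut_single_of_pos (by omega), cut_single_of_neg (by omega), cut_single_of_pos h, zero_add]
        · rw [cut_single_of_neg (by omega), cut_single_of_neg (by omega), cut_single_of_neg (by omega), add_zero]
      have h3 : triang ν (Finsupp.mapRange.linearMap (TensorProduct.map (cut (· < H + 1)) LinearMap.id) t) =
          triang ν (Finsupp.mapRange.linearMap (TensorProduct.map (cut (· < H)) LinearMap.id) t) := by
        rw [triang_mapRange, triang_mapRange]
        refine Finset.sum_congr rfl fun h _ => ?_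
        rw [h2, TensorProduct.map_add_left, LinearMap.add_apply, map_add, h1, add_zero]
      rw [h3] at ht ⊢
      exact ih ht
  have hx' : x ∈ LinearMap.range (triang ν) := by rw [range_triang]; trivial
  obtain ⟨t, rfl⟩ := hx'
  choose D' hD' using fun h => exists_map_cut_eq (t h)
  have hD : Finsupp.mapRange.linearMap (TensorProduct.map (cut (· < t.support.sup D')) LinearMap.id) t = t := by
    refine Finsupp.ext fun h => ?_
    rw [Finsupp.mapRange.linearMap_apply, Finsupp.mapRange_apply]
    by_cases hh : h ∈ t.support
    · exact (hD' h _ (Finset.le_sup (f := D') hh)).1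
    · rw [Finsupp.notMem_support_iff.1 hh, map_zero]
  rw [← hD] at hx ⊢
  exact key _ t hx

end BorcherdsCartanMatrix

namespace BorcherdsCartanMatrix

open QuantumSl2

variable {I : Type u} {C : BorcherdsCartanMatrix I} {ν : I → ℕ → Qq}

/-! ### The symmetries of the algebra -/

theorem reflCo_reflCo {i : I} (hi : C.IsReal i) (h : DualWeightLattice I) : C.reflCo i (C.reflCo i h) = h := by
  rw [reflCo, reflCo, map_sub, map_smul, root_coroot, show C.a i i = 2 from hi]
  module

theorem refl_refl {i : I} (hi : C.IsReal i) (μ : WeightLattice I) : C.refl i (C.refl i μ) = μ := by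
  refine LinearMap.ext fun h => ?_
  rw [refl_apply, refl_apply, reflCo_reflCo hi]

theorem reflCo_smul_coroot {i : I} (hi : C.IsReal i) (n : ℤ) : C.reflCo i (n • coroot i) = -n • coroot i := by
  rw [reflCo, map_smul, root_coroot, show C.a i i = 2 from hi]
  module

theorem Kpow_mul_Kpow (i : I) (m n : ℤ) : C.Kpow ν i m * C.Kpow ν i n = C.Kpow ν i (m + n) := by
  rw [Kpow_eq, Kpow_eq, Kpow_eq, ← qh_add, ← add_smul, add_mul]

theorem Kpow_mul_Kpow_neg (i : I) (m : ℤ) : C.Kpow ν i m * C.Kpow ν i (-m) = 1 := by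
  rw [Kpow_mul_Kpow, add_neg_cancel, Kpow_eq, zero_mul, zero_smul, qh_zero]

theorem Kpow_neg_mul_Kpow (i : I) (m : ℤ) : C.Kpow ν i (-m) * C.Kpow ν i m = 1 := by
  rw [Kpow_mul_Kpow, neg_add_cancel, Kpow_eq, zero_mul, zero_smul, qh_zero]

theorem uf_eq_smul_B {i : I} (hi : C.IsReal i) (hν : ν i 1 ≠ 0) :
    C.uf ν i 1 = (ν i 1 * ((C.qi i)⁻¹ - C.qi i)) • C.B ν i := by
  rw [B, smul_inv_smul₀ (mul_ne_zero hν (qi_inv_sub_ne_zero i)), pb_real hi]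

theorem IsReal.eq_one {i : I} (hi : C.IsReal i) {l : ℕ} (h : C.IsIndex i l) : l = 1 := by
  rcases h with h | h
  · exact h.2
  · have := hi; rw [IsReal] at this; omega

/-- The pairs `(u, u')` of elements of `U` such that `L'_{i,e} (u z) = u' L'_{i,e} (z)` in all objects of `𝓞`
with underlying type in `Type v`. -/
noncomputable def braidGraph (ν : I → ℕ → Qq) {i : I} (hi : C.IsReal i) (e : ℤ) : Subalgebra Qq (C.QAlg ν × C.QAlg ν) where
  carrier := {p | ∀ (M : Type v) [AddCommGroup M] [Module Qq M] [Module (C.QAlg ν) M]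
    [IsScalarTower Qq (C.QAlg ν) M] (hM : C.IsCategoryO ν M) (z : M),
    C.modL' hM i hi e (p.1 • z) = p.2 • C.modL' hM i hi e z}
  mul_mem' := fun {a b} ha hb M _ _ _ _ hM z => by
    rw [Prod.fst_mul, Prod.snd_mul, mul_smul, ha M hM, hb M hM, mul_smul]
  add_mem' := fun {a b} ha hb M _ _ _ _ hM z => by
    rw [Prod.fst_add, Prod.snd_add, add_smul, map_add, ha M hM, hb M hM, add_smul]
  algebraMap_mem' := fun c M _ _ _ _ hM z => by
    rw [Prod.algebraMap_apply, algebraMap_smul, algebraMap_smul, map_smul]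

section Graph

variable {i : I} (hi : C.IsReal i) (hν : ν i 1 ≠ 0) {e : ℤ} (he : e = 1 ∨ e = -1)

theorem mem_braidGraph {u u' : C.QAlg ν} : (u, u') ∈ braidGraph.{u, v} ν hi e ↔
    ∀ (M : Type v) [AddCommGroup M] [Module Qq M] [Module (C.QAlg ν) M]
    [IsScalarTower Qq (C.QAlg ν) M] (hM : C.IsCategoryO ν M) (z : M),
    C.modL' hM i hi e (u • z) = u' • C.modL' hM i hi e z := Iff.rfl

include hν he

/-- Compatibility with `L''`, the inverse of `L'`, read backwards. -/
theorem mem_braidGraph_of_modL'' {u u' : C.QAlg ν}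
    (h : ∀ (M : Type v) [AddCommGroup M] [Module Qq M] [Module (C.QAlg ν) M]
      [IsScalarTower Qq (C.QAlg ν) M] (hM : C.IsCategoryO ν M) (z : M),
      C.modL'' hM i hi (-e) (u' • z) = u • C.modL'' hM i hi (-e) z) : (u, u') ∈ braidGraph.{u, v} ν hi e := by
  rw [mem_braidGraph]
  intro M _ _ _ _ hM z
  have h1 := h M hM (C.modL' hM i hi e z)
  rw [modL''_modL' hM hi hν he] at h1
  rw [← h1, modL'_modL'' hM hi hν he]

theorem qh_mem_braidGraph (h : DualWeightLattice I) :
    (C.qh ν h, C.qh ν (C.reflCo i h)) ∈ braidGraph.{u, v} ν hi e :=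
  fun _ _ _ _ _ hM z => modL'_qh hM hi hν he h z

theorem pa_mem_braidGraph : (C.pa ν i 1, -(C.Kpow ν i e * C.B ν i)) ∈ braidGraph.{u, v} ν hi e :=
  fun _ _ _ _ _ hM z => modL'_pa hM hi hν he z

theorem B_mem_braidGraph : (C.B ν i, -(C.pa ν i 1 * C.Kpow ν i (-e))) ∈ braidGraph.{u, v} ν hi e :=
  fun _ _ _ _ _ hM z => modL'_B hM hi hν he z

theorem mem_braidGraph_of_commute_B {α : WeightLattice I} {x : C.QAlg ν} (hx : x ∈ C.rootSpace ν α)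
    (hxB : Commute x (C.B ν i)) {N : ℤ} (hα : α (coroot i) = -N) (hN : 0 ≤ N) :
    (x, serreSum (C.qi i ^ e) (C.pa ν i 1) x N 1) ∈ braidGraph.{u, v} ν hi e :=
  fun _ _ _ _ _ hM z => modL'_of_commute_B hM hi hν he hx hxB hα hN z

theorem mem_braidGraph_of_commute_pa {α : WeightLattice I} {y : C.QAlg ν} (hy : y ∈ C.rootSpace ν α)
    (hyE : Commute y (C.pa ν i 1)) {N : ℤ} (hα : α (coroot i) = N) (hN : 0 ≤ N) :
    (y, ((-1) ^ N * (C.qi i ^ e) ^ N)⁻¹ • serreSum (C.qi i ^ e) (C.B ν i) y N 1) ∈ braidGraph.{u, v} ν hi e :=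
  fun _ _ _ _ _ hM z => modL'_of_commute_pa hM hi hν he hy hyE hα hN z

theorem mem_braidGraph_of_commute_B' {α : WeightLattice I} {x : C.QAlg ν} (hx : x ∈ C.rootSpace ν α)
    (hxB : Commute x (C.B ν i)) {N : ℤ} (hα : α (coroot i) = -N) (hN : 0 ≤ N) :
    (((-1) ^ N * (C.qi i ^ (-e)) ^ N)⁻¹ • serreSum (C.qi i ^ (-e)) (C.pa ν i 1) x N 1, x) ∈ braidGraph.{u, v} ν hi e :=
  mem_braidGraph_of_modL'' hi hν he fun _ _ _ _ _ hM z => modL''_of_commute_B hM hi hν he hx hxB hα hN z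

theorem mem_braidGraph_of_commute_pa' {α : WeightLattice I} {y : C.QAlg ν} (hy : y ∈ C.rootSpace ν α)
    (hyE : Commute y (C.pa ν i 1)) {N : ℤ} (hα : α (coroot i) = N) (hN : 0 ≤ N) :
    (serreSum (C.qi i ^ (-e)) (C.B ν i) y N 1, y) ∈ braidGraph.{u, v} ν hi e :=
  mem_braidGraph_of_modL'' hi hν he fun _ _ _ _ _ hM z => modL''_of_commute_pa hM hi hν he hy hyE hα hN z

/-- Every element of `U` is the first component of a compatible pair: this holds for the generators. -/
theorem map_fst_braidGraph : (braidGraph.{u, u} ν hi e ⊓ braidGraph.{u, v} ν hi e).map (AlgHom.fst Qq _ _) = ⊤ := by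
  refine subalgebra_eq_top (fun h => ?_) (fun j l hj => ?_) (fun j l hj => ?_)
  · exact ⟨_, ⟨qh_mem_braidGraph hi hν he h, qh_mem_braidGraph hi hν he h⟩, rfl⟩
  · by_cases hij : j = i
    · subst hij
      rw [hi.eq_one hj, ← pa_real hi]
      exact ⟨_, ⟨pa_mem_braidGraph hi hν he, pa_mem_braidGraph hi hν he⟩, rfl⟩
    · have hc : Commute (C.ue ν j l) (C.B ν i) := by
        rw [B, pb_real hi]; exact (commute_ue_uf hj hi.isIndex hij).smul_right _
      exact ⟨_, ⟨mem_braidGraph_of_commute_B hi hν he (ue_mem_rootSpace hj) hc (root_nsmul_coroot i j l)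
        (offdiag_mul_nonneg hij l), mem_braidGraph_of_commute_B hi hν he (ue_mem_rootSpace hj) hc
        (root_nsmul_coroot i j l) (offdiag_mul_nonneg hij l)⟩, rfl⟩
  · by_cases hij : j = i
    · subst hij
      rw [hi.eq_one hj, uf_eq_smul_B hi hν]
      have h1 : C.B ν j ∈ (braidGraph.{u, u} ν hi e ⊓ braidGraph.{u, v} ν hi e).map (AlgHom.fst Qq _ _) :=
        ⟨_, ⟨B_mem_braidGraph hi hν he, B_mem_braidGraph hi hν he⟩, rfl⟩
      exact Subalgebra.smul_mem _ h1 _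
    · have hc : Commute (C.uf ν j l) (C.pa ν i 1) := by
        rw [pa_real hi]; exact (commute_ue_uf hi.isIndex hj (Ne.symm hij)).symm
      have hr : (-(l • C.root j)) (coroot i) = -C.a i j * l := by
        rw [LinearMap.neg_apply, root_nsmul_coroot, neg_neg]
      exact ⟨_, ⟨mem_braidGraph_of_commute_pa hi hν he (uf_mem_rootSpace hj) hc hr
        (offdiag_mul_nonneg hij l), mem_braidGraph_of_commute_pa hi hν he (uf_mem_rootSpace hj) hc hr
        (offdiag_mul_nonneg hij l)⟩, rfl⟩

/-- Every element of `U` is the second component of a compatible pair: this holds for the generators. -/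
theorem map_snd_braidGraph : (braidGraph.{u, u} ν hi e ⊓ braidGraph.{u, v} ν hi e).map (AlgHom.snd Qq _ _) = ⊤ := by
  set P := (braidGraph.{u, u} ν hi e ⊓ braidGraph.{u, v} ν hi e).map (AlgHom.snd Qq _ _) with hP
  have hq : ∀ h, C.qh ν h ∈ P := fun h => by
    have h1 := qh_mem_braidGraph.{u, u} hi hν he (C.reflCo i h)
    have h2 := qh_mem_braidGraph.{u, v} hi hν he (C.reflCo i h)
    rw [reflCo_reflCo hi] at h1 h2
    exact ⟨_, ⟨h1, h2⟩, rfl⟩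
  refine subalgebra_eq_top hq (fun j l hj => ?_) (fun j l hj => ?_)
  · by_cases hij : j = i
    · subst hij
      have h1 : -(C.pa ν j 1 * C.Kpow ν j (-e)) ∈ P :=
        ⟨_, ⟨B_mem_braidGraph hi hν he, B_mem_braidGraph hi hν he⟩, rfl⟩
      have h2 := mul_mem (neg_mem h1) (hq ((e * C.s j) • coroot j))
      rw [neg_neg, mul_assoc, ← Kpow_eq, Kpow_neg_mul_Kpow, mul_one, pa_real hi] at h2
      rwa [hi.eq_one hj]
    · have hc : Commute (C.ue ν j l) (C.B ν i) := by
        rw [B, pb_real hi]; exact (commute_ue_uf hj hi.isIndex hij).smul_right _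
      exact ⟨_, ⟨mem_braidGraph_of_commute_B' hi hν he (ue_mem_rootSpace hj) hc (root_nsmul_coroot i j l)
        (offdiag_mul_nonneg hij l), mem_braidGraph_of_commute_B' hi hν he (ue_mem_rootSpace hj) hc
        (root_nsmul_coroot i j l) (offdiag_mul_nonneg hij l)⟩, rfl⟩
  · by_cases hij : j = i
    · subst hij
      have h1 : -(C.Kpow ν j e * C.B ν j) ∈ P :=
        ⟨_, ⟨pa_mem_braidGraph hi hν he, pa_mem_braidGraph hi hν he⟩, rfl⟩
      have h2 := mul_mem (hq ((-e * C.s j) • coroot j)) (neg_mem h1)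
      rw [neg_neg, ← mul_assoc, ← Kpow_eq, Kpow_neg_mul_Kpow, one_mul] at h2
      rw [hi.eq_one hj, uf_eq_smul_B hi hν]
      exact Subalgebra.smul_mem _ h2 _
    · have hc : Commute (C.uf ν j l) (C.pa ν i 1) := by
        rw [pa_real hi]; exact (commute_ue_uf hi.isIndex hj (Ne.symm hij)).symm
      have hr : (-(l • C.root j)) (coroot i) = -C.a i j * l := by
        rw [LinearMap.neg_apply, root_nsmul_coroot, neg_neg]
      exact ⟨_, ⟨mem_braidGraph_of_commute_pa' hi hν he (uf_mem_rootSpace hj) hc hr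
        (offdiag_mul_nonneg hij l), mem_braidGraph_of_commute_pa' hi hν he (uf_mem_rootSpace hj) hc hr
        (offdiag_mul_nonneg hij l)⟩, rfl⟩

/-- `L'_{i,e}` on the algebra: the graph is that of an automorphism, as `𝓞` is faithful. The modules that prove
faithfulness live in `Type u`, while compatibility is wanted in `Type v`; hence the intersection of two graphs. -/
theorem exists_algEquiv (hν' : ∀ i, C.IsReal i → ν i 1 ≠ 0) : ∃ L : C.QAlg ν ≃ₐ[Qq] C.QAlg ν,
    ∀ u u', L u = u' ↔ (u, u') ∈ braidGraph.{u, u} ν hi e ⊓ braidGraph.{u, v} ν hi e := by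
  let G := braidGraph.{u, u} ν hi e ⊓ braidGraph.{u, v} ν hi e
  have h1 : Function.Bijective ((AlgHom.fst Qq (C.QAlg ν) (C.QAlg ν)).comp G.val) := by
    constructor
    · rw [injective_iff_map_eq_zero]
      rintro ⟨⟨u, u'⟩, hu, _⟩ (rfl : u = 0)
      refine Subtype.ext (Prod.ext rfl (eq_zero_of_forall_smul_eq_zero hν' fun M _ _ _ _ hM z => ?_))
      have h2 := hu M hM (C.modL'' hM i hi (-e) z)
      rw [modL'_modL'' hM hi hν he, zero_smul, map_zero] at h2
      exact h2.symm
    · intro u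
      have : u ∈ G.map (AlgHom.fst Qq (C.QAlg ν) (C.QAlg ν)) := by rw [map_fst_braidGraph hi hν he]; trivial
      obtain ⟨p, hp, rfl⟩ := this
      exact ⟨⟨p, hp⟩, rfl⟩
  have h2 : Function.Bijective ((AlgHom.snd Qq (C.QAlg ν) (C.QAlg ν)).comp G.val) := by
    constructor
    · rw [injective_iff_map_eq_zero]
      rintro ⟨⟨u, u'⟩, hu, _⟩ (rfl : u' = 0)
      refine Subtype.ext (Prod.ext (eq_zero_of_forall_smul_eq_zero hν' fun M _ _ _ _ hM z => ?_) rfl)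
      have h2 := congrArg (C.modL'' hM i hi (-e)) (hu M hM z)
      rw [modL''_modL' hM hi hν he, zero_smul, map_zero] at h2
      exact h2
    · intro u
      have : u ∈ G.map (AlgHom.snd Qq (C.QAlg ν) (C.QAlg ν)) := by rw [map_snd_braidGraph hi hν he]; trivial
      obtain ⟨p, hp, rfl⟩ := this
      exact ⟨⟨p, hp⟩, rfl⟩
  refine ⟨(AlgEquiv.ofBijective _ h1).symm.trans (AlgEquiv.ofBijective _ h2), fun u u' => ?_⟩
  rw [AlgEquiv.trans_apply]
  constructor
  · rintro rfl
    have h3 : ((AlgEquiv.ofBijective _ h1).symm u : C.QAlg ν × C.QAlg ν).1 = u :=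
      (AlgEquiv.ofBijective _ h1).apply_symm_apply u
    have h4 := ((AlgEquiv.ofBijective _ h1).symm u).2
    have h5 : ((AlgEquiv.ofBijective _ h1).symm u : C.QAlg ν × C.QAlg ν) =
        (u, (AlgEquiv.ofBijective _ h2) ((AlgEquiv.ofBijective _ h1).symm u)) := Prod.ext h3 rfl
    rw [h5] at h4
    exact h4
  · intro h
    have h3 : (AlgEquiv.ofBijective _ h1).symm u = ⟨(u, u'), h⟩ := by
      rw [AlgEquiv.symm_apply_eq]; rfl
    rw [h3]
    rfl

end Graph

end BorcherdsCartanMatrix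

namespace BorcherdsCartanMatrix

open QuantumSl2

variable {I : Type u} {C : BorcherdsCartanMatrix I} {ν : I → ℕ → Qq}

/-! ### The elements `𝓕` and `𝓕'` of the algebra -/

/-- Two elements of `U` with the same action on all vectors `z` with `K_i z = q_i^n z` are equal. -/
theorem eq_of_forall_kSpace (hν : ∀ i, C.IsReal i → ν i 1 ≠ 0) (i : I) {x y : C.QAlg ν}
    (h : ∀ (M : Type u) [AddCommGroup M] [Module Qq M] [Module (C.QAlg ν) M]
      [IsScalarTower Qq (C.QAlg ν) M] (_ : C.IsCategoryO ν M) (n : ℤ), ∀ z ∈ C.kSpace ν M i n, x • z = y • z) :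
    x = y := by
  classical
  rw [← sub_eq_zero]
  refine eq_zero_of_forall_smul_eq_zero hν fun M _ _ _ _ hM z => ?_
  have hz : z ∈ ⨆ n, C.kSpace ν M i n := by
    rw [(hM.kSpace_isInternal i).submodule_iSup_eq_top]; trivial
  rw [sub_smul, sub_eq_zero]
  refine Submodule.iSup_induction _ (motive := fun z => x • z = y • z) hz (h M hM) (by simp) fun a b ha hb => ?_
  rw [smul_add, smul_add, ha, hb]

variable {i j : I} {e : ℤ}

/-- The higher Serre relations in `U`; they hold in all objects of `𝓞`, which is faithful. -/
theorem serreSum_paS_eq_zero (hν : ∀ i, C.IsReal i → ν i 1 ≠ 0) (hi : C.IsReal i) (he : e = 1 ∨ e = -1)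
    (hj : j ≠ i) (n : ℕ) {m : ℤ} (hm : -C.a i j * n < m) :
    serreSum (C.qi i ^ e) (C.pa ν i 1) (C.paS ν j n) m (-C.a i j * n - m + 1) = 0 := by
  refine eq_zero_of_forall_smul_eq_zero hν fun M _ _ _ _ hM z => ?_
  have h1 := (sl2Module hM hi (hν i hi) he).serreSum_eq_zero_of_lt (x := act M (C.paS ν j n))
    ((commute_paS_B hi hj n).map (act M)) (N := -C.a i j * n)
    (fun k z hz => by
      have := smul_mem_kSpace (paS_mem_rootSpace j n) i hz
      rwa [root_nsmul_coroot, ← sub_eq_add_neg] at this) (offdiag_mul_nonneg hj n) hm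
  rw [← map_serreSum] at h1
  exact LinearMap.congr_fun h1 z

theorem serF_eq_zero (hν : ∀ i, C.IsReal i → ν i 1 ≠ 0) (hi : C.IsReal i) (he : e = 1 ∨ e = -1)
    (hj : j ≠ i) (n : ℕ) {m : ℤ}
    (hm : -C.a i j * n < m) : C.serF ν i j n m e = 0 := by
  rw [serF_eq i j he, serreSum_paS_eq_zero hν hi he hj n hm]

theorem serF'_eq_zero (hν : ∀ i, C.IsReal i → ν i 1 ≠ 0) (hi : C.IsReal i) (he : e = 1 ∨ e = -1)
    (hj : j ≠ i) (n : ℕ) {m : ℤ}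
    (hm : -C.a i j * n < m) : C.serF' ν i j n m e = 0 := by
  rw [serF'_eq i j he, ← serreSum_inv, ← zpow_neg, serreSum_paS_eq_zero hν hi (neg_sign he) hj n hm, smul_zero]

theorem serF_mem_rootSpace (hi : C.IsReal i) (he : e = 1 ∨ e = -1) (j : I) (n : ℕ) (m : ℤ) :
    C.serF ν i j n m e ∈ C.rootSpace ν (m • C.root i + n • C.root j) := by
  rw [serF_eq i j he, serreSum]
  refine Submodule.sum_mem _ fun r _ => Submodule.smul_mem _ _ ?_
  have := mul_mem_rootSpace (mul_mem_rootSpace (dp_mem_rootSpace (pa_real_mem_rootSpace (ν := ν) hi) (C.qi i ^ e) r)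
    (paS_mem_rootSpace (ν := ν) j n)) (dp_mem_rootSpace (pa_real_mem_rootSpace (ν := ν) hi) (C.qi i ^ e) (m - r))
  rwa [add_right_comm, ← add_smul, add_sub_cancel] at this

theorem zsmul_root_add_nsmul_root_coroot (hi : C.IsReal i) (j : I) (n : ℕ) (m : ℤ) :
    (m • C.root i + n • C.root j) (coroot i) = 2 * m - -C.a i j * n := by
  rw [LinearMap.add_apply, root_nsmul_coroot, LinearMap.smul_apply, root_coroot, show C.a i i = 2 from hi, smul_eq_mul]
  ring

/-- The commutator of `𝓕_{n,m,e}` with `B_i`. -/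
theorem serF_B_sub (hν : ∀ i, C.IsReal i → ν i 1 ≠ 0) (hi : C.IsReal i) (he : e = 1 ∨ e = -1)
    (hj : j ≠ i) (n : ℕ) (m : ℤ) :
    C.serF ν i j n m e * C.B ν i - C.B ν i * C.serF ν i j n m e =
    qint (C.qi i ^ e) (-C.a i j * n - m + 1) • (C.Kpow ν i (-e) * C.serF ν i j n (m - 1) e) := by
  refine eq_of_forall_kSpace hν i fun M _ _ _ _ hM k z hz => ?_
  have h1 := (sl2Module hM hi (hν i hi) he).serreSum_B (x := act M (C.paS ν j n))
    ((commute_paS_B hi hj n).map (act M)) (N := -C.a i j * n)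
    (fun k z hz => by
      have := smul_mem_kSpace (paS_mem_rootSpace j n) i hz
      rwa [root_nsmul_coroot, ← sub_eq_add_neg] at this) hz m
  rw [← map_serreSum, ← map_serreSum, ← serF_eq i j he, ← serF_eq i j he] at h1
  have h2 := smul_mem_kSpace (serF_mem_rootSpace hi he j n (m - 1)) i hz
  rw [zsmul_root_add_nsmul_root_coroot hi] at h2
  simp only [sub_smul, mul_smul, smul_assoc]
  rw [Kpow_smul h2, smul_smul (qint _ _)]
  refine h1.trans ?_
  rw [← zpow_mul]
  congr 3
  ring

/-- `𝓕'_{n,m+1,e}` as a `q`-commutator of `𝚊_i` and `𝓕'_{n,m,e}`. -/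
theorem qint_smul_serF' (i j : I) (he : e = 1 ∨ e = -1) (n : ℕ) (m : ℤ) :
    qint (C.qi i ^ e) (m + 1) • C.serF' ν i j n (m + 1) e =
    C.pa ν i 1 * C.serF' ν i j n m e -
      (C.qi i ^ e) ^ (-C.a i j * n - 2 * m) • (C.serF' ν i j n m e * C.pa ν i 1) := by
  rw [serF'_eq i j he, serF'_eq i j he]
  set N := -C.a i j * (n : ℤ) with hN
  set q := C.qi i ^ e with hq
  have hgen : Generic q := generic_zpow i he
  have h1 := serreSum_recursion_add hgen (C.pa ν i 1) (C.paS ν j n) m (-(N - m + 1))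
  rw [show -(N - m + 1) + 1 = -(N - (m + 1) + 1) by ring, show -(N - m + 1) + m + 1 = -(N - 2 * m) by ring] at h1
  rw [smul_comm, ← h1, mul_smul_comm, smul_mul_assoc, smul_sub, smul_smul, smul_smul]
  have h2 : (-1 : Qq) ^ (m + 1) * q ^ ((N - (m + 1) + 1) * (m + 1)) =
      -(q ^ (N - 2 * m) * ((-1) ^ m * q ^ ((N - m + 1) * m))) := by
    rw [zpow_add₀ (neg_ne_zero.2 one_ne_zero), zpow_one, mul_left_comm, ← zpow_add₀ hgen.ne_zero,
      show N - 2 * m + (N - m + 1) * m = (N - (m + 1) + 1) * (m + 1) by ring]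
    ring
  rw [h2, neg_mul, mul_right_comm, ← zpow_add₀ hgen.ne_zero, add_neg_cancel, zpow_zero, one_mul, neg_smul, neg_smul,
    sub_neg_eq_add, neg_add_eq_sub]

end BorcherdsCartanMatrix

namespace BorcherdsCartanMatrix

open QuantumSl2

variable {I : Type u} {C : BorcherdsCartanMatrix I} {ν : I → ℕ → Qq} {i : I} {e : ℤ}

theorem map_rootSpace_le {L : C.QAlg ν →ₐ[Qq] C.QAlg ν} (hi : C.IsReal i)
    (hL : ∀ h, L (C.qh ν h) = C.qh ν (C.reflCo i h)) {α : WeightLattice I} {x : C.QAlg ν} (hx : x ∈ C.rootSpace ν α) :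
    L x ∈ C.rootSpace ν (C.refl i α) := by
  rw [mem_rootSpace_iff] at hx ⊢
  intro h
  have h1 := congrArg L (hx (C.reflCo i h))
  have h2 : C.reflCo i (-h) = -C.reflCo i h := by rw [reflCo, reflCo, map_neg]; module
  rw [map_mul, map_mul, ← h2, hL, hL, reflCo_reflCo hi, reflCo_reflCo hi, map_smul] at h1
  rw [h1, refl_apply]

/-- A compatible automorphism reflects the root spaces, because it reflects the `q^h`. -/
theorem image_rootSpace {L : C.QAlg ν ≃ₐ[Qq] C.QAlg ν} (hi : C.IsReal i)
    (hL : ∀ h, L (C.qh ν h) = C.qh ν (C.reflCo i h)) (α : WeightLattice I) :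
    L '' (C.rootSpace ν α : Set (C.QAlg ν)) = C.rootSpace ν (C.refl i α) := by
  have hL' : ∀ h, L.symm (C.qh ν h) = C.qh ν (C.reflCo i h) := fun h => by
    rw [AlgEquiv.symm_apply_eq, hL, reflCo_reflCo hi]
  refine Set.Subset.antisymm ?_ fun x hx => ⟨L.symm x, ?_, L.apply_symm_apply x⟩
  · rintro _ ⟨x, hx, rfl⟩
    exact map_rootSpace_le (L := L.toAlgHom) hi hL hx
  · have := map_rootSpace_le (L := L.symm.toAlgHom) hi hL' hx
    rwa [refl_refl hi] at this

/-- The effect of `L'_{i,e}` on the elements `𝓕'_{n,m,e}`, from its values on `𝚊_i` and on `𝚊_{jn} = 𝓕'_{n,0,e}`. -/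
theorem apply_serF' {L : C.QAlg ν →ₐ[Qq] C.QAlg ν} (hν : ∀ i, C.IsReal i → ν i 1 ≠ 0) (hi : C.IsReal i)
    (he : e = 1 ∨ e = -1) {j : I} (hj : j ≠ i) (n : ℕ)
    (ha : L (C.pa ν i 1) = -(C.Kpow ν i e * C.B ν i))
    (hp : L (C.paS ν j n) = C.serF ν i j n (-C.a i j * n) e) (m : ℤ) :
    L (C.serF' ν i j n m e) = C.serF ν i j n (-C.a i j * n - m) e := by
  rcases lt_or_ge m 0 with hm | hm
  · rw [serF_eq_zero hν hi he hj n (by omega), serF'_eq i j he, serreSum_of_neg _ _ _ hm, smul_zero, map_zero]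
  rcases lt_or_ge (-C.a i j * n) m with hm' | hm'
  · rw [serF'_eq_zero hν hi he hj n hm', serF_eq i j he (m := -C.a i j * n - m),
      serreSum_of_neg _ _ _ (by omega), map_zero]
  obtain ⟨m, rfl⟩ := Int.eq_ofNat_of_zero_le hm
  clear hm
  induction m with
  | zero =>
    rw [Nat.cast_zero, sub_zero, serF'_eq i j he, serreSum_zero, mul_zero, zpow_zero, zpow_zero, one_mul, one_smul, hp]
  | succ m ih =>
    have ih := ih (by push_cast at hm'; omega)
    have hgen : Generic (C.qi i ^ e) := generic_zpow i he
    have hq : qint (C.qi i ^ e) ((m : ℤ) + 1) ≠ 0 := hgen.qint_ne_zero (by omega)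
    have h1 := congrArg L (qint_smul_serF' (ν := ν) i j he n (m : ℤ))
    rw [map_smul, map_sub, map_smul, map_mul, map_mul, ih, ha] at h1
    have h2 := serF_B_sub hν hi he hj n (-C.a i j * n - m)
    have h3 := qh_mul_of_mem (serF_mem_rootSpace (ν := ν) hi he j n (-C.a i j * n - m)) ((e * C.s i) • coroot i)
    rw [← Kpow_eq, map_smul, zsmul_root_add_nsmul_root_coroot hi, smul_eq_mul,
      show e * C.s i * (2 * (-C.a i j * n - m) - -C.a i j * n) = C.s i * (e * (-C.a i j * n - 2 * m)) by ring,
      zpow_mul, ← qi, zpow_mul] at h3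
    rw [show -C.a i j * n - (-C.a i j * n - m) + 1 = (m : ℤ) + 1 by ring] at h2
    have h4 : qint (C.qi i ^ e) ((m : ℤ) + 1) • L (C.serF' ν i j n (m + 1) e) =
        qint (C.qi i ^ e) ((m : ℤ) + 1) • C.serF ν i j n (-C.a i j * n - (m + 1)) e := by
      rw [h1, mul_neg, smul_neg, ← mul_assoc (C.serF ν i j n _ e), ← smul_mul_assoc, ← h3, sub_neg_eq_add, neg_mul,
        neg_add_eq_sub, mul_assoc, mul_assoc, ← mul_sub, h2, mul_smul_comm, ← mul_assoc, Kpow_mul_Kpow_neg, one_mul,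
        sub_sub]
    -- `L` turns the recursion for `𝓕'` into the commutator of `𝓕` with `B_i`; the scalar `[m + 1]` is the
    -- same.
    rw [smul_right_inj hq] at h4
    push_cast
    exact h4

end BorcherdsCartanMatrix

open BorcherdsCartanMatrix QuantumSl2

theorem neg_one_zpow_inv (n : ℤ) : ((-1 : Qq) ^ n)⁻¹ = (-1) ^ n := by
  rw [← inv_zpow, inv_neg, inv_one]

theorem proposition2 {I : Type u} [Countable I] (C : BorcherdsCartanMatrix I) (ν : I → ℕ → Qq)
    (hν : ∀ i l, C.IsIndex i l → HasPositiveExpansion (ν i l))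
    (i : I) (hi : C.IsReal i) (e : ℤ) (he : e = 1 ∨ e = -1) :
    (∀ (M : Type v) [AddCommGroup M] [Module Qq M] [Module (C.QAlg ν) M]
      [IsScalarTower Qq (C.QAlg ν) M] (hM : C.IsCategoryO ν M) (j : I) (_ : j ≠ i) (n : ℕ) (z : M),
      C.modL'' hM i hi (-e) (C.serF ν i j n (-C.a i j * n) e • z) =
          C.paS ν j n • C.modL'' hM i hi (-e) z ∧
      C.modL' hM i hi e (C.serF' ν i j n (-C.a i j * n) e • z) =
          C.paS ν j n • C.modL' hM i hi e z ∧
      C.modL'' hM i hi (-e) (C.serG ν i j n (-C.a i j * n) e • z) =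
          C.pbS ν j n • C.modL'' hM i hi (-e) z ∧
      C.modL' hM i hi e (C.serG' ν i j n (-C.a i j * n) e • z) =
          C.pbS ν j n • C.modL' hM i hi e z) ∧
    ∃ L' L'' : C.QAlg ν ≃ₐ[Qq] C.QAlg ν,
      C.ExtendsL' ν i e L' ∧ C.ExtendsL''neg ν i e L'' ∧
      (∀ u, L'' (L' u) = u) ∧ (∀ u, L' (L'' u) = u) ∧
      (∀ α : WeightLattice I,
        L' '' (C.rootSpace ν α : Set (C.QAlg ν)) = C.rootSpace ν (C.refl i α) ∧
        L'' '' (C.rootSpace ν α : Set (C.QAlg ν)) = C.rootSpace ν (C.refl i α)) ∧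
      (∀ (M : Type v) [AddCommGroup M] [Module Qq M] [Module (C.QAlg ν) M]
        [IsScalarTower Qq (C.QAlg ν) M] (hM : C.IsCategoryO ν M) (u : C.QAlg ν) (z : M),
        C.modL' hM i hi e (u • z) = L' u • C.modL' hM i hi e z ∧
        C.modL'' hM i hi (-e) (u • z) = L'' u • C.modL'' hM i hi (-e) z) ∧
      (∀ φ : C.QAlg ν → C.QAlg ν,
        (∀ (M : Type u) [AddCommGroup M] [Module Qq M] [Module (C.QAlg ν) M]
          [IsScalarTower Qq (C.QAlg ν) M] (hM : C.IsCategoryO ν M) (u : C.QAlg ν) (z : M),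
          C.modL' hM i hi e (u • z) = φ u • C.modL' hM i hi e z) → ∀ u, φ u = L' u) ∧
      (∀ φ : C.QAlg ν → C.QAlg ν,
        (∀ (M : Type u) [AddCommGroup M] [Module Qq M] [Module (C.QAlg ν) M]
          [IsScalarTower Qq (C.QAlg ν) M] (hM : C.IsCategoryO ν M) (u : C.QAlg ν) (z : M),
          C.modL'' hM i hi (-e) (u • z) = φ u • C.modL'' hM i hi (-e) z) → ∀ u, φ u = L'' u) ∧
      (∀ (j : I) (_ : j ≠ i) (n : ℕ) (m : ℤ),
        L' (C.serF' ν i j n m e) = C.serF ν i j n (-C.a i j * n - m) e ∧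
        L'' (C.serF ν i j n m e) = C.serF' ν i j n (-C.a i j * n - m) e) := by
  have hν' : ∀ i, C.IsReal i → ν i 1 ≠ 0 := fun i hi => (hν i 1 hi.isIndex).ne_zero
  obtain ⟨L, hL⟩ := exists_algEquiv.{u, v} hi (hν' i hi) he hν'
  have hLu : ∀ u, (u, L u) ∈ braidGraph.{u, u} ν hi e := fun u => ((hL u (L u)).1 rfl).1
  have hLv : ∀ u, (u, L u) ∈ braidGraph.{u, v} ν hi e := fun u => ((hL u (L u)).1 rfl).2
  have hSymm : ∀ u u', (u, u') ∈ braidGraph.{u, u} ν hi e → (u, u') ∈ braidGraph.{u, v} ν hi e → L.symm u' = u :=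
    fun u u' h h' => by rw [AlgEquiv.symm_apply_eq, (hL u u').2 ⟨h, h'⟩]
  have hmul : ∀ (j : I) (l : ℕ), (-(l * C.a i j) : ℤ) = -C.a i j * l := fun j l => by ring
  have hqh : ∀ h, L (C.qh ν h) = C.qh ν (C.reflCo i h) := fun h =>
    (hL _ _).2 ⟨qh_mem_braidGraph hi (hν' i hi) he h, qh_mem_braidGraph hi (hν' i hi) he h⟩
  have hqh' : ∀ h, L.symm (C.qh ν h) = C.qh ν (C.reflCo i h) := fun h => by
    rw [AlgEquiv.symm_apply_eq, hqh, reflCo_reflCo hi]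
  have hK : ∀ n, L (C.Kpow ν i n) = C.Kpow ν i (-n) := fun n => by
    rw [Kpow_eq, hqh, reflCo_smul_coroot hi, Kpow_eq, neg_mul]
  have ha : L (C.pa ν i 1) = -(C.Kpow ν i e * C.B ν i) :=
    (hL _ _).2 ⟨pa_mem_braidGraph hi (hν' i hi) he, pa_mem_braidGraph hi (hν' i hi) he⟩
  have hB : L (C.B ν i) = -(C.pa ν i 1 * C.Kpow ν i (-e)) :=
    (hL _ _).2 ⟨B_mem_braidGraph hi (hν' i hi) he, B_mem_braidGraph hi (hν' i hi) he⟩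
  have hpaS : ∀ (j : I) (_ : j ≠ i) (n : ℕ), L (C.paS ν j n) = C.serF ν i j n (-C.a i j * n) e := fun j hj n =>
    (hL _ _).2 ⟨fun _ _ _ _ _ hM z => modL'_paS hM hi (hν' i hi) he hj n z,
      fun _ _ _ _ _ hM z => modL'_paS hM hi (hν' i hi) he hj n z⟩
  have hserF : ∀ (j : I) (_ : j ≠ i) (n : ℕ) (m : ℤ),
      L (C.serF' ν i j n m e) = C.serF ν i j n (-C.a i j * n - m) e := fun j hj n m =>
    apply_serF' (L := L.toAlgHom) hν' hi he hj n ha (hpaS j hj n) m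
  refine ⟨fun M _ _ _ _ hM j hj n z => ?_, L, L.symm, ⟨ha, hB, fun j l hl hj => ?_, fun j l hl hj => ?_, hqh⟩,
    ⟨?_, ?_, fun j l hl hj => ?_, fun j l hl hj => ?_, hqh'⟩, L.symm_apply_apply, L.apply_symm_apply,
    fun α => ⟨image_rootSpace hi hqh α, image_rootSpace hi hqh' α⟩, fun M _ _ _ _ hM u z => ⟨hLv u M hM z, ?_⟩,
    fun φ hφ u => ?_, fun φ hφ u => ?_, fun j hj n m => ⟨hserF j hj n m, ?_⟩⟩
  · have h1 := modL'_modL'' hM hi (hν' i hi) he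
    have h2 := modL''_modL' hM hi (hν' i hi) he
    refine ⟨?_, ?_, ?_, ?_⟩
    · rw [← h1 z, ← modL'_paS hM hi (hν' i hi) he hj, h2, h2]
    · rw [← h2 z, ← modL''_paS hM hi (hν' i hi) he hj, h1, h1]
    · rw [← h1 z, ← modL'_pbS hM hi (hν' i hi) he hj, h2, h2]
    · rw [← h2 z, ← modL''_pbS hM hi (hν' i hi) he hj, h1, h1]
  · have h1 := sum_pairs_eq_serreSum (C := C) i he (C.pa ν i 1) (C.pa ν j l) (-(l * C.a i j)) 1
    simp only [mul_one] at h1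
    rw [h1, hmul]
    have h2 := commute_pa_B (ν := ν) hi hl hj
    exact (hL _ _).2 ⟨mem_braidGraph_of_commute_B hi (hν' i hi) he (pa_mem_rootSpace hl) h2 (root_nsmul_coroot i j l)
      (offdiag_mul_nonneg hj l), mem_braidGraph_of_commute_B hi (hν' i hi) he (pa_mem_rootSpace hl) h2
      (root_nsmul_coroot i j l) (offdiag_mul_nonneg hj l)⟩
  · have h1 := sum_pairs_swap_eq_serreSum (C := C) i (neg_sign he) (C.B ν i) (C.pb ν j l) (-(l * C.a i j)) 1
    simp only [mul_one, neg_mul] at h1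
    rw [h1, hmul, zpow_neg, serreSum_inv, neg_neg, one_mul, inv_zpow, ← neg_one_zpow_inv, ← mul_inv]
    have h2 := commute_pb_pa (ν := ν) hi hl hj
    have h3 : (-(l • C.root j)) (coroot i) = -C.a i j * l := by rw [LinearMap.neg_apply, root_nsmul_coroot, neg_neg]
    exact (hL _ _).2 ⟨mem_braidGraph_of_commute_pa hi (hν' i hi) he (pb_mem_rootSpace hl) h2 h3
      (offdiag_mul_nonneg hj l), mem_braidGraph_of_commute_pa hi (hν' i hi) he (pb_mem_rootSpace hl) h2 h3
      (offdiag_mul_nonneg hj l)⟩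
  · rw [AlgEquiv.symm_apply_eq, map_neg, map_mul, hB, hK, neg_neg, neg_mul, neg_neg, mul_assoc, Kpow_neg_mul_Kpow,
      mul_one]
  · rw [AlgEquiv.symm_apply_eq, map_neg, map_mul, ha, hK, mul_neg, neg_neg, ← mul_assoc, Kpow_neg_mul_Kpow, one_mul]
  · have h1 := sum_pairs_swap_eq_serreSum (C := C) i he (C.pa ν i 1) (C.pa ν j l) (-(l * C.a i j)) 1
    simp only [mul_one] at h1
    have hc : (-1) ^ (-C.a i j * (l : ℤ)) * (C.qi i ^ e) ^ (-C.a i j * (l : ℤ)) =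
        ((-1) ^ (-C.a i j * (l : ℤ)) * (C.qi i ^ (-e)) ^ (-C.a i j * (l : ℤ)))⁻¹ := by
      rw [mul_inv, neg_one_zpow_inv, zpow_neg, inv_zpow, inv_inv]
    rw [h1, hmul, ← serreSum_inv, ← zpow_neg, one_mul, hc]
    have h2 := commute_pa_B (ν := ν) hi hl hj
    exact hSymm _ _ (mem_braidGraph_of_commute_B' hi (hν' i hi) he (pa_mem_rootSpace hl) h2 (root_nsmul_coroot i j l)
      (offdiag_mul_nonneg hj l)) (mem_braidGraph_of_commute_B' hi (hν' i hi) he (pa_mem_rootSpace hl) h2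
      (root_nsmul_coroot i j l) (offdiag_mul_nonneg hj l))
  · have h1 := sum_pairs_eq_serreSum (C := C) i (neg_sign he) (C.B ν i) (C.pb ν j l) (-(l * C.a i j)) 1
    simp only [mul_one, neg_mul] at h1
    rw [h1, hmul]
    have h2 := commute_pb_pa (ν := ν) hi hl hj
    have h3 : (-(l • C.root j)) (coroot i) = -C.a i j * l := by rw [LinearMap.neg_apply, root_nsmul_coroot, neg_neg]
    exact hSymm _ _ (mem_braidGraph_of_commute_pa' hi (hν' i hi) he (pb_mem_rootSpace hl) h2 h3
      (offdiag_mul_nonneg hj l)) (mem_braidGraph_of_commute_pa' hi (hν' i hi) he (pb_mem_rootSpace hl) h2 h3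
      (offdiag_mul_nonneg hj l))
  · have h1 := hLv (L.symm u) M hM (C.modL'' hM i hi (-e) z)
    rw [L.apply_symm_apply, modL'_modL'' hM hi (hν' i hi) he] at h1
    rw [← h1, modL''_modL' hM hi (hν' i hi) he]
  · rw [← sub_eq_zero]
    refine eq_zero_of_forall_smul_eq_zero hν' fun M _ _ _ _ hM z => ?_
    have h1 := hφ M hM u (C.modL'' hM i hi (-e) z)
    rw [hLu u M hM, modL'_modL'' hM hi (hν' i hi) he] at h1
    rw [sub_smul, h1, sub_self]
  · rw [← sub_eq_zero]
    refine eq_zero_of_forall_smul_eq_zero hν' fun M _ _ _ _ hM z => ?_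
    have h1 := hφ M hM u (C.modL' hM i hi e z)
    have h2 : C.modL' hM i hi e (L.symm u • z) = L (L.symm u) • C.modL' hM i hi e z := hLu (L.symm u) M hM z
    rw [L.apply_symm_apply] at h2
    rw [modL''_modL' hM hi (hν' i hi) he, ← h2, modL''_modL' hM hi (hν' i hi) he] at h1
    rw [sub_smul, h1, sub_self]
  · rw [AlgEquiv.symm_apply_eq, hserF j hj, sub_sub_cancel]
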